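/- **Setting.** Let $\mathcal H$ be a complex Hilbert space with inner product $(\cdot,\cdot)$ (linear in the first entry), $H$ a self-adjoint operator on $\mathcal H$ with spectral measure $E(\cdot)$, $K$ a bounded operator on $\mathcal H$, and $\tau>0$. Let $X$ be a quasi-complete barrelled Hausdorff locally convex space over $\mathbb C$, continuously and densely included in $\mathcal H$; let $X'$ be the space of continuous anti-linear functionals on $X$ with the strong dual topology and $\kappa:X\to X'$, $\langle\kappa(u)|\varphi\rangle=(u,\varphi)$. Let $I\subset\mathbb R$ be an open interval, $\mathbb C_+=\{\operatorname{Im}\zeta>0\}$ and $\Omega=\{\lambda\in\mathbb C:\operatorname{Re}\lambda\ne0\text{ or }\operatorname{Im}\lambda\in I\}$. Assume: * the spectral measure is absolutely continuous and lives on $I$: $(E(B)\psi,\varphi)=\int_{B\cap I}E[\psi,\varphi](\omega)\,d\omega$ for all Borel $B$ and $\psi,\varphi\in X$, with $E[\psi,\varphi]\in L^1(I)$; the density $E[\psi,\varphi]$ is analytic on $I$ with an analytic continuation to $\mathbb C_+$; and for each $\zeta\in\mathbb C_+\cup I$ the form $E[\cdot,\cdot](\zeta)$ is separately continuous on $X\times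 X$; * $Y\subset X$ is a dense subspace with $Y\subset\operatorname{Dom}(H)$, $HY\subset X$ and $K^*Y\subset X$. For $\lambda\in\Omega$ define $A(\lambda):\kappa X\to X'$ by $\langle A(\lambda)\kappa(\psi)|\varphi\rangle=\int_I\frac{E[\psi,\varphi](\omega)}{\lambda-i\omega}d\omega$ if $\operatorname{Re}\lambda>0$, by the limit of this integral from $\operatorname{Re}\lambda>0$ if $\lambda\in iI$, and by $\int_I\frac{E[\psi,\varphi](\omega)}{\lambda-i\omega}d\omega+2\pi E[\psi,\varphi](\lambda/i)$ if $\operatorname{Re}\lambda<0$. Let $K^\times$ be the dual of $K^*|_Y$, that is $\langle K^\times F|\varphi\rangle=\langle F|K^*\varphi\rangle$ for $\varphi\in Y$. Assume that $K^\times A(\lambda)\kappa X\subset\kappa X$ for all $\lambda\in\Omega$, and put $C(\lambda)=\kappa^{-1}K^\times A(\lambda)\kappa:X\to X$. Assume finally that $C(\lambda)$ is compact, uniformly in $\lambda$: for every compact $D\subset\Omega$ there is a neighbourhood $V$ of $0$ in $X$ such that $\bigcup_{\lambda\in D}C(\lambda)V$ is relatively compact in $X$. A *generalized eigenvalue* is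 a $\lambda\in\Omega$ for which $(\mathrm{id}-e^{-\lambda\tau}A(\lambda)K^\times)\xi=0$ for some nonzero $\xi\in\operatorname{Ran}A(\lambda)$; $\hat\sigma_p$ is the set of these. The *generalized retarded resolvent* is $\mathcal R_\tau(\lambda)=A(\lambda)(\mathrm{id}-e^{-\lambda\tau}K^\times A(\lambda))^{-1}$ on $\kappa X$. **Corollary.** 1. For $\lambda\in\Omega\setminus\hat\sigma_p$ the operator $\mathrm{id}-e^{-\lambda\tau}C(\lambda)$ is a bijection of $X$, and $\langle\mathcal R_\tau(\lambda)\kappa(y)|\varphi\rangle$ is holomorphic there for all $y,\varphi\in X$. The set $\hat\sigma_p$ has finitely many points in each compact subset of $\Omega$, and its real parts are bounded above. Near each $\lambda_k\in\hat\sigma_p$ there is a Laurent expansion $\mathcal R_\tau(\lambda)\kappa(y)=\sum_{j\in\mathbb Z}(\lambda_k-\lambda)^{-j}E^k_j\kappa(y)$ for all $y\in X$, convergent in $X'$, with linear $E^k_j$. 2. There is $a_0$ such that the following holds for all $a>\max(a_0,0)$. Let $x\in X$ and $f\in L^2([-\tau,0];\mathcal H)$ with $Kf(s)\in X$ for almost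 all $s$, and assume that the weak (Pettis) integrals $\int_{-\tau}^0e^{-\lambda(\tau+s)}Kf(s)\,ds$ exist in $X$ for all $\lambda\in\mathbb C$ (as they do if $s\mapsto Kf(s)\in X$ is continuous). Let $u$ be the mild solution of $u'(t)=iHu(t)+Ku(t-\tau)$ with these data: $u$ is continuous on $[0,\infty)$, $u(0)=x$, $u=f$ on $[-\tau,0)$, and for all $t\ge0$ one has $\int_0^tu\in\operatorname{Dom}(H)$ and $u(t)=x+iH\int_0^tu(s)ds+\int_0^tKu(s-\tau)ds$. Write $\hat Kh=Kh(-\tau)$ and $((\lambda-A_L)^{-1}h)(s)=-\int_0^se^{\lambda(s-m)}h(m)dm$. Then $\hat K(\lambda-A_L)^{-m-1}f\in X$ for all $\lambda\in\mathbb C$, $m\ge0$. Let $t>0$, $\psi\in X$, $\Phi_x(\lambda)=e^{\lambda t}\langle\mathcal R_\tau(\lambda)\kappa(x)|\psi\rangle$ and $\Phi(\lambda)=e^{\lambda t}\langle\mathcal R_\tau(\lambda)\kappa(x+\hat K(\lambda-A_L)^{-1}f)|\psi\rangle$. The series $$\rho^f_k=\sum_{j=0}^\infty\sum_{m=0}^j\frac{(-t)^{j-m}}{(j-m)!}e^{\lambda_kt}\langle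 E^k_{j+1}\kappa(\hat K(\lambda_k-A_L)^{-m-1}f)|\psi\rangle,\qquad \rho^x_k=\sum_{j=0}^\infty\frac{(-t)^j}{j!}e^{\lambda_kt}\langle E^k_{j+1}\kappa(x)|\psi\rangle$$ converge absolutely in $j$, and $(u(t),\psi)=\lim_{b\to\infty}\frac1{2\pi i}\int_{a-ib}^{a+ib}\Phi(\lambda)\,d\lambda$. 3. In the situation of 2, let $\Gamma'$ be a curve in the open left half-plane, parametrized by $\mathbb R$. For $n\in\mathbb N$ let $\Gamma'_n$ be its part over $[p_n,q_n]$, where $p_n\to-\infty$, $q_n\to+\infty$, $p_n<q_n$, and let $0<b_n\to\infty$; let $\alpha_n$ be an arc from $a-ib_n$ to the initial point of $\Gamma'_n$ and $\beta_n$ an arc from the end point of $\Gamma'_n$ to $a+ib_n$, all piecewise $C^1$ in $\Omega\setminus\hat\sigma_p$. Suppose that the closed curve formed by the segment from $a-ib_n$ to $a+ib_n$ and the reverse of $\alpha_n\Gamma'_n\beta_n$ has winding number $0$ or $1$ about each generalized eigenvalue, and let $\Lambda_n$ be the set of those with winding number $1$. Then $\Lambda_n$ is finite and, for every $n$, $$\frac1{2\pi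 i}\int_{a-ib_n}^{a+ib_n}\Phi\,d\lambda=\frac1{2\pi i}\int_{\alpha_n\Gamma'_n\beta_n}\Phi\,d\lambda-\sum_{\lambda_k\in\Lambda_n}\rho^f_k-\sum_{\lambda_k\in\Lambda_n}\rho^x_k .$$ If the contribution $\int_{\alpha_n}\Phi\,d\lambda+\int_{\beta_n}\Phi\,d\lambda$ of the connecting arcs tends to $0$ and $\int_{\Gamma'}\Phi\,d\lambda:=\lim_n\int_{\Gamma'_n}\Phi\,d\lambda$ exists, then $(u(t),\psi)=\frac1{2\pi i}\int_{\Gamma'}\Phi\,d\lambda-\sum_k(\rho^f_k+\rho^x_k)$; if the same two conditions also hold for $\Phi_x$, then $$(u(t),\psi)=\frac1{2\pi i}\int_{\Gamma'}e^{\lambda t}\langle\mathcal R_\tau(\lambda)\kappa(x+\hat K(\lambda-A_L)^{-1}f)|\psi\rangle\,d\lambda-\sum_k\rho^f_k-\sum_k\rho^x_k .$$ Here $\sum_k$ is the limit (which exists) of the finite sums over $\lambda_k\in\Lambda_n$ as $n\to\infty$. -/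

import Mathlib

open Set Filter Topology MeasureTheory

noncomputable section

/-- `P` is the spectral measure of the (unbounded) operator `H`: a projection-valued measure on `ℝ`
with `H = ∫ ω dP(ω)`, on the domain of all `x` with `∫ ω² d‖P x‖² < ∞`. The scalar measure
`μ = ‖P(·) x‖²` is `(P(·) x, x)`, and an operator on a complex space is determined by its domain
and its quadratic form there. -/
structure IsSpectralMeasure {𝓗 : Type*} [NormedAddCommGroup 𝓗] [InnerProductSpace ℂ 𝓗]
    [CompleteSpace 𝓗] (H : 𝓗 →ₗ.[ℂ] 𝓗) (P : Set ℝ → 𝓗 →L[ℂ] 𝓗) : Prop where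
  proj : ∀ B, MeasurableSet B → IsStarProjection (P B)
  inter : ∀ B B', MeasurableSet B → MeasurableSet B' → P (B ∩ B') = P B * P B'
  total : P univ = 1
  scalar : ∀ x : 𝓗, ∃ μ : Measure ℝ,
    (∀ B, MeasurableSet B → μ B = ENNReal.ofReal (‖P B x‖ ^ 2)) ∧
    (x ∈ H.domain ↔ ∫⁻ ω, ENNReal.ofReal (ω ^ 2) ∂μ < ⊤) ∧
    ∀ hx : x ∈ H.domain, inner ℂ x (H ⟨x, hx⟩) = ((∫ ω, ω ∂μ : ℝ) : ℂ)

/-- The space `X'` of continuous anti-linear functionals. Mathlib's topology on it is the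
topology of uniform convergence on bounded subsets of `X`, the strong dual topology. -/
abbrev AntiDual (X : Type*) [AddCommGroup X] [Module ℂ X] [TopologicalSpace X] : Type _ :=
  X →L⋆[ℂ] ℂ

/-- The data of the delay equation `u'(t) = iH u(t) + K u(t - τ)` on the Hilbert space `𝓗`,
together with a Gelfand triple `X ⊆ 𝓗 ⊆ X'`. The laws are in `DelaySystem.Standing`. -/
structure DelaySystem (𝓗 X : Type*) [NormedAddCommGroup 𝓗] [InnerProductSpace ℂ 𝓗]
    [AddCommGroup X] [Module ℂ X] [TopologicalSpace X] where
  /-- the unperturbed operator -/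
  H : 𝓗 →ₗ.[ℂ] 𝓗
  /-- the delayed perturbation -/
  K : 𝓗 →L[ℂ] 𝓗
  /-- the delay -/
  τ : ℝ
  /-- the inclusion of `X` into `𝓗` -/
  ι : X →L[ℂ] 𝓗
  /-- the spectral measure of `H` -/
  P : Set ℝ → 𝓗 →L[ℂ] 𝓗
  /-- the interval on which the spectrum of `H` lives -/
  I : Set ℝ
  /-- the spectral density `E[ψ, φ](ω)` on `I` and its continuation to the upper half-plane -/
  dens : X → X → ℂ → ℂ
  /-- the dense subspace of `X` on which duals of operators are tested -/
  Y : Submodule ℂ X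

namespace DelaySystem

section Resolvent

variable {𝓗 X : Type*} [NormedAddCommGroup 𝓗] [InnerProductSpace ℂ 𝓗] [CompleteSpace 𝓗]
  [AddCommGroup X] [Module ℂ X] [TopologicalSpace X] (S : DelaySystem 𝓗 X)

/-- The `λ`-domain (Riemann sheet): both open half-planes, glued along `iI`. -/
def dom : Set ℂ := {z | z.re ≠ 0 ∨ z.im ∈ S.I}

/-- The Cauchy integral `∫ (λ - iω)⁻¹ E[ψ, φ](ω) dω`. -/
def cauchy (z : ℂ) (ψ φ : X) : ℂ :=
  ∫ ω in S.I, (z - Complex.I * (ω : ℂ))⁻¹ * S.dens ψ φ (ω : ℂ)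

open Classical in
/-- `⟨A(λ) κ ψ | φ⟩`, the continuation of `((λ - iH)⁻¹ ψ, φ)` through `iI` to the left
half-plane. -/
def A (z : ℂ) (ψ φ : X) : ℂ :=
  if 0 < z.re then S.cauchy z ψ φ
  else if z.re = 0 then limUnder (𝓝[{w : ℂ | 0 < w.re}] z) (fun w => S.cauchy w ψ φ)
  else S.cauchy z ψ φ + 2 * (Real.pi : ℂ) * S.dens ψ φ (z / Complex.I)

/-- `g = K^× F`, where `K^×` is the dual on `X'` of the operator `K^*` restricted to `Y`:
`⟨g | φ⟩ = ⟨F | K^* φ⟩` for `φ ∈ Y`, and `g = κ y` belongs to `κ X`. -/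
def IsKdual (F : X → ℂ) (y : X) : Prop :=
  ∀ φ ∈ S.Y, ∀ η : X, S.ι η = ContinuousLinearMap.adjoint S.K (S.ι φ) →
    inner ℂ (S.ι φ) (S.ι y) = F η

/-- `C(λ) = κ⁻¹ K^× A(λ) κ : X → X`. -/
def C (z : ℂ) (ψ : X) : X := Classical.epsilon (fun y => S.IsKdual (S.A z ψ) y)

/-- The operator `id - e^{-λτ} κ⁻¹ K^× A(λ) κ` on `X`. -/
def oneSub (z : ℂ) (y : X) : X := y - Complex.exp (-z * S.τ) • S.C z y

/-- `⟨R_τ(λ) κ ψ | φ⟩`, with the generalized retarded resolvent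
`R_τ(λ) = A(λ) ∘ (id - e^{-λτ} K^× A(λ))⁻¹`. -/
def R (z : ℂ) (ψ φ : X) : ℂ := S.A z (Function.invFun (S.oneSub z) ψ) φ

/-- The generalized eigenvalues: some nonzero `A(λ) κ ψ` in the range of `A(λ)` is fixed by
`e^{-λτ} A(λ) K^×`. -/
def poles : Set ℂ :=
  {z | z ∈ S.dom ∧ ∃ ψ : X, S.A z ψ ≠ 0 ∧
    S.A z ψ = fun φ => Complex.exp (-z * S.τ) * S.A z (S.C z ψ) φ}

/-- The standing hypotheses on the triple, on `H` and on `K`. (That `X` is a quasi-complete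
barrelled Hausdorff locally convex space is expressed by type classes.) -/
structure Standing : Prop where
  tau_pos : 0 < S.τ
  self_adjoint : IsSelfAdjoint S.H
  inj : Function.Injective S.ι
  dense : DenseRange S.ι
  spectral : IsSpectralMeasure S.H S.P
  I_open : IsOpen S.I
  I_conn : S.I.OrdConnected
  -- the spectral measure lives on `I` and is absolutely continuous there
  dens_int : ∀ ψ φ, IntegrableOn (fun ω : ℝ => S.dens ψ φ (ω : ℂ)) S.I
  dens_eq : ∀ ψ φ B, MeasurableSet B →
    inner ℂ (S.ι φ) (S.P B (S.ι ψ)) = ∫ ω in B ∩ S.I, S.dens ψ φ (ω : ℂ)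
  dens_analytic : ∀ ψ φ,
    AnalyticOnNhd ℂ (S.dens ψ φ) ({z : ℂ | 0 < z.im} ∪ (fun ω : ℝ => (ω : ℂ)) '' S.I)
  dens_cont_left : ∀ z ∈ {z : ℂ | 0 < z.im} ∪ (fun ω : ℝ => (ω : ℂ)) '' S.I, ∀ φ,
    Continuous (fun ψ => S.dens ψ φ z)
  dens_cont_right : ∀ z ∈ {z : ℂ | 0 < z.im} ∪ (fun ω : ℝ => (ω : ℂ)) '' S.I, ∀ ψ,
    Continuous (fun φ => S.dens ψ φ z)
  Y_dense : Dense (S.Y : Set X)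
  Y_H : ∀ φ ∈ S.Y, ∃ h : S.ι φ ∈ S.H.domain, ∃ η : X, S.ι η = S.H ⟨S.ι φ, h⟩
  Y_K : ∀ φ ∈ S.Y, ∃ η : X, S.ι η = ContinuousLinearMap.adjoint S.K (S.ι φ)
  K_dual : ∀ z ∈ S.dom, ∀ ψ, ∃ y, S.IsKdual (S.A z ψ) y

/-- `C(λ) = κ⁻¹ K^× A(λ) κ` is compact, uniformly in `λ`: for `λ` in any compact set `D`, all
`C(λ)` map one and the same neighbourhood of `0` into one relatively compact set. -/
def UniformlyCompact : Prop :=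
  ∀ D : Set ℂ, IsCompact D → D ⊆ S.dom → ∃ V ∈ 𝓝 (0 : X),
    IsCompact (closure (⋃ z ∈ D, S.C z '' V))

/-- `E j`, `j ∈ ℤ`, are the Laurent coefficients of `λ ↦ R_τ(λ) κ` at the point `z`, in powers
of `z - λ`, with convergence in the strong dual topology. -/
def IsLaurent (z : ℂ) (E : ℤ → X →ₗ[ℂ] AntiDual X) : Prop :=
  ∃ r > 0, ∀ w : ℂ, w ≠ z → ‖w - z‖ < r → w ∈ S.dom \ S.poles ∧
    ∀ y : X, ∃ F : AntiDual X, (∀ φ, F φ = S.R w y φ) ∧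
      HasSum (fun j : ℤ => ((z - w) ^ (-j)) • E j y) F

end Resolvent

section Solutions

variable {𝓗 X : Type*} [NormedAddCommGroup 𝓗] [InnerProductSpace ℂ 𝓗] [CompleteSpace 𝓗]
  [AddCommGroup X] [Module ℂ X] [TopologicalSpace X] (S : DelaySystem 𝓗 X)

/-- `u` is the mild (weak) solution of `u'(t) = iH u(t) + K u(t - τ)` with value `x` at `0` and
history `f` on `[-τ, 0)`. -/
structure IsMildSolution (x : 𝓗) (f u : ℝ → 𝓗) : Prop where
  cont : ContinuousOn u (Ici 0)
  init : u 0 = x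
  hist : ∀ s ∈ Ico (-S.τ) 0, u s = f s
  eqn : ∀ t, 0 ≤ t → ∃ h : (∫ s in (0 : ℝ)..t, u s) ∈ S.H.domain,
    u t = x + Complex.I • S.H ⟨∫ s in (0 : ℝ)..t, u s, h⟩ + ∫ s in (0 : ℝ)..t, S.K (u (s - S.τ))

/-- `y` is the weak (Pettis) integral of `g : ℝ → X` over `[-τ, 0]`. -/
def HasWeakIntegral (g : ℝ → X) (y : X) : Prop :=
  ∀ l : X →L[ℂ] ℂ, IntegrableOn (fun s => l (g s)) (Icc (-S.τ) 0) ∧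
    l y = ∫ s in Icc (-S.τ) 0, l (g s)

/-- The histories considered: `f ∈ L²([-τ, 0]; 𝓗)`, with `K f(s) ∈ X`, and such that the
integrals `∫ e^{-λ(τ+s)} K f(s) ds` exist in `X`. -/
structure IsHistory (f : ℝ → 𝓗) : Prop where
  memLp : MemLp f 2 (volume.restrict (Icc (-S.τ) 0))
  values : ∃ k : ℝ → X, (∀ᵐ s ∂(volume.restrict (Icc (-S.τ) 0)), S.ι (k s) = S.K (f s)) ∧
    ∀ z : ℂ, ∃ y : X, S.HasWeakIntegral (fun s => Complex.exp (-z * (S.τ + s)) • k s) y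

/-- `(λ - A_L)⁻¹ f`, the resolvent of the generator `A_L = d/ds` of the nilpotent left shift on
`L²([-τ, 0]; 𝓗)`. -/
def shiftRes (z : ℂ) (f : ℝ → 𝓗) : ℝ → 𝓗 :=
  fun s => -∫ m in (0 : ℝ)..s, Complex.exp (z * ((s : ℂ) - m)) • f m

/-- `K̂ (λ - A_L)^{-n} f`, where `K̂ h = K h(-τ)`. -/
def delayRes (z : ℂ) (n : ℕ) (f : ℝ → 𝓗) : 𝓗 := S.K (((shiftRes z)^[n] f) (-S.τ))

end Solutions

/-- The `j`-th term of the residue contribution of the value `x` at the eigenvalue `z`. -/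
def termX {X : Type*} [AddCommGroup X] [Module ℂ X] [TopologicalSpace X]
    (E : ℂ → ℤ → X →ₗ[ℂ] AntiDual X) (x ψ : X) (t : ℝ) (z : ℂ) (j : ℕ) : ℂ :=
  (-(t : ℂ)) ^ j / (j.factorial : ℂ) * Complex.exp (z * t) * E z (j + 1) x ψ

/-- The `j`-th term of the residue contribution of the history at the eigenvalue `z`;
`g z m` stands for `K̂ (z - A_L)^{-m-1} f`. -/
def termF {X : Type*} [AddCommGroup X] [Module ℂ X] [TopologicalSpace X]
    (E : ℂ → ℤ → X →ₗ[ℂ] AntiDual X) (g : ℂ → ℕ → X) (ψ : X) (t : ℝ) (z : ℂ) (j : ℕ) : ℂ :=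
  ∑ m ∈ Finset.range (j + 1), (-(t : ℂ)) ^ (j - m) / ((j - m).factorial : ℂ) *
    Complex.exp (z * t) * E z (j + 1) (g z m) ψ

end DelaySystem

/-- `γ` is continuous and piecewise continuously differentiable on `[c, d]`. -/
def PiecewiseC1 (γ : ℝ → ℂ) (c d : ℝ) : Prop :=
  ContinuousOn γ (Icc c d) ∧ ∃ s : Finset ℝ, ∀ u v, c ≤ u → u < v → v ≤ d →
    Disjoint (Ioo u v) (s : Set ℝ) → ContDiffOn ℝ 1 γ (Icc u v)

/-- The integral of `F` along `γ` restricted to `[c, d]`. -/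
def lineInt (F : ℂ → ℂ) (γ : ℝ → ℂ) (c d : ℝ) : ℂ := ∫ s in c..d, F (γ s) * deriv γ s

/-- The vertical line `Re λ = a`, directed upwards. -/
def vline (a : ℝ) (s : ℝ) : ℂ := a + s * Complex.I

/-- A curve `Γ'`, with, for each `n`, a truncation of it to `[p n, q n]`, and two arcs, joining
`a - i b n` to `Γ' (p n)` and `Γ' (q n)` to `a + i b n`. -/
structure Contour where
  Γ' : ℝ → ℂ
  p : ℕ → ℝ
  q : ℕ → ℝ
  b : ℕ → ℝ
  lower : ℕ → ℝ → ℂ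
  upper : ℕ → ℝ → ℂ

namespace Contour

/-- The integral over both connecting arcs. -/
def arcInt (c : Contour) (F : ℂ → ℂ) (n : ℕ) : ℂ :=
  lineInt F (c.lower n) 0 1 + lineInt F (c.upper n) 0 1

/-- The integral over the truncation of `Γ'`. -/
def mainInt (c : Contour) (F : ℂ → ℂ) (n : ℕ) : ℂ := lineInt F c.Γ' (c.p n) (c.q n)

/-- The winding number about `z` of the closed curve formed by the segment from `a - i b n` to
`a + i b n` followed by the reversed deformed path. -/
def winding (c : Contour) (a : ℝ) (n : ℕ) (z : ℂ) : ℂ :=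
  (2 * Real.pi * Complex.I)⁻¹ *
    (lineInt (fun w => (w - z)⁻¹) (vline a) (-c.b n) (c.b n)
      - (c.mainInt (fun w => (w - z)⁻¹) n + c.arcInt (fun w => (w - z)⁻¹) n))

/-- The points of `Q` lying between the line `Re λ = a` and the `n`-th deformed path. -/
def enclosed (c : Contour) (a : ℝ) (Q : Set ℂ) (n : ℕ) : Set ℂ := {z ∈ Q | c.winding a n z = 1}

/-- The line `Re λ = a` is deformed to `Γ'`: the curve `Γ'` lies in the open left half-plane; all
curves are piecewise `C¹`, run inside `U` and avoid `Q`; and the closed curves that arise run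
at most once, counterclockwise, around each point of `Q`. -/
structure IsDeformation (c : Contour) (a : ℝ) (U Q : Set ℂ) : Prop where
  left : ∀ s, (c.Γ' s).re < 0
  main_smooth : ∀ s s', s < s' → PiecewiseC1 c.Γ' s s'
  main_mem : ∀ s, c.Γ' s ∈ U \ Q
  b_pos : ∀ n, 0 < c.b n
  p_lt_q : ∀ n, c.p n < c.q n
  b_lim : Tendsto c.b atTop atTop
  p_lim : Tendsto c.p atTop atBot
  q_lim : Tendsto c.q atTop atTop
  lower_smooth : ∀ n, PiecewiseC1 (c.lower n) 0 1
  lower_mem : ∀ n, ∀ s ∈ Icc (0 : ℝ) 1, c.lower n s ∈ U \ Q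
  lower_start : ∀ n, c.lower n 0 = vline a (-c.b n)
  lower_end : ∀ n, c.lower n 1 = c.Γ' (c.p n)
  upper_smooth : ∀ n, PiecewiseC1 (c.upper n) 0 1
  upper_mem : ∀ n, ∀ s ∈ Icc (0 : ℝ) 1, c.upper n s ∈ U \ Q
  upper_start : ∀ n, c.upper n 0 = c.Γ' (c.q n)
  upper_end : ∀ n, c.upper n 1 = vline a (c.b n)
  once : ∀ n, ∀ z ∈ Q, c.winding a n z = 0 ∨ c.winding a n z = 1

end Contour

end

set_option linter.unusedSectionVars false

/-! The proof has a spectral half and a dynamical half, joined by a contour deformation.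

Continuation. For Re λ ≠ 0 the Cauchy integral of the density is the matrix element of (λ - iH)⁻¹;
this is shown with Riemann sums over small spectral cells (`inner_skewResolvent_eq_integral`). Near
iI the analytic density lets a segment of integration be pushed onto a semicircle, and the jump
across it is 2π times the density (`exists_cauchy_continuation`). So the form A is holomorphic on
all of Ω, and identities that are clear for Re λ > 0, such as sesquilinearity, spread over Ω by the
identity theorem. On the cut, continuity of the form follows from barrelledness.

Fredholm theory. Over a compact D, uniform compactness makes all C(λ) factor through one Banach
space whose unit ball is a compact disk of X (`exists_compactModel`). There e^{-λτ} C(λ) becomes a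
family T(λ) of compact operators, holomorphic in operator norm on the interior of D because its
matrix elements against a norming family are. Failure of injectivity of 1 - T(λ) is locally the zero
set of a finite determinant (`exists_analyticAt_eq_zero_iff_not_injective`). No eigenvalue has Re λ
> ‖K‖, and Ω is connected if I is nonempty, so the eigenvalues are discrete; off them the retarded
resolvent is holomorphic (`differentiableAt_R`). Its Laurent coefficients are circle integrals,
dominated by one continuous seminorm thanks to barrelledness, which gives convergence in the strong
dual.

Dynamics. An energy estimate and Grönwall's inequality bound the mild solution by a multiple of
e^{‖K‖t} (`exists_growth`). Its Laplace transform solves a fixed-point equation whose solution is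
unique for Re λ > ‖K‖, and this identifies the transform, tested against ψ, with the retarded
resolvent applied to x plus the history transform (`inner_laplace_eq_R`). To invert it, the free
part, the Cauchy integral of the density of (x, ψ), is split off. That part is only conditionally
integrable along a vertical line and is treated by one integration by parts. The rest is an inner
product of two functions that are square integrable on the line, one by a Poisson kernel estimate
and one by Plancherel, so Fourier inversion applies (`tendsto_lineInt`).

Deformation. Ω is star-shaped about every point of iI, so a residue theorem for abstract cycles in
star-shaped domains suffices (`IsCycleIntegral.residue_theorem`). Each residue is computed by
integrating, term by term over a circle, the product of the exponential series, the Taylor series of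
the history transform and the resolvent (`summable_and_residue`). The expansion is in powers of λ_k
- λ rather than λ - λ_k, hence the minus signs in front of the sums. The integral with the initial
value alone also converges on the vertical line (`exists_tendsto_lineInt`), and this is what lets
the two residue sums converge separately. -/

noncomputable section

/-! ### Uniform difference quotients, weak and separate holomorphy -/

section ComplexAnalysis
open Metric

variable {F : Type*} [NormedAddCommGroup F] [NormedSpace ℂ F]

/-- Maximum principle for the divided difference on a ball of radius `s`, chosen beyond both `w` and
r/2: on its boundary circle the numerator is at most 2M and the denominator is at least r/2. -/
theorem norm_dslope_le_of_forall_norm_le [CompleteSpace F] {f : ℂ → F} {z₀ : ℂ} {r M : ℝ}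
    (hd : DifferentiableOn ℂ f (ball z₀ r)) (hM : ∀ z ∈ ball z₀ r, ‖f z‖ ≤ M)
    {w : ℂ} (hw : w ∈ ball z₀ r) : ‖dslope f z₀ w‖ ≤ 4 * M / r := by
  have hr : 0 < r := pos_of_mem_ball hw
  have hM0 : 0 ≤ M := (norm_nonneg _).trans (hM z₀ (mem_ball_self hr))
  obtain ⟨s, hs, hsr⟩ := exists_between (max_lt (mem_ball.1 hw) (half_lt_self hr))
  have hs0 : 0 < s := (half_pos hr).trans ((le_max_right _ _).trans_lt hs)
  have hg : DifferentiableOn ℂ (dslope f z₀) (ball z₀ r) :=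
    (Complex.differentiableOn_dslope (ball_mem_nhds z₀ hr)).2 hd
  have hcl : closedBall z₀ s ⊆ ball z₀ r := closedBall_subset_ball hsr
  have hDC : DiffContOnCl ℂ (dslope f z₀) (ball z₀ s) := by
    refine ⟨hg.mono (ball_subset_ball hsr.le), ?_⟩
    exact hg.continuousOn.mono ((closure_ball_subset_closedBall).trans hcl)
  refine Complex.norm_le_of_forall_mem_frontier_norm_le isBounded_ball hDC ?_
    (subset_closure (mem_ball.2 ((le_max_left _ _).trans_lt hs)))
  intro z hz
  rw [frontier_ball z₀ hs0.ne'] at hz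
  have hne : z ≠ z₀ := by
    rintro rfl
    simp at hz
    exact hs0.ne hz
  rw [dslope_of_ne _ hne, slope_def_module, norm_smul, norm_inv, ← dist_eq_norm, mem_sphere.1 hz]
  have h1 : ‖f z - f z₀‖ ≤ 2 * M := by
    refine (norm_sub_le _ _).trans ?_
    have := hM z (hcl (sphere_subset_closedBall hz))
    have := hM z₀ (mem_ball_self hr)
    linarith
  have h2 : r / 2 ≤ s := ((le_max_right _ _).trans_lt hs).le
  calc s⁻¹ * ‖f z - f z₀‖ ≤ (r / 2)⁻¹ * (2 * M) := by gcongr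
    _ = 4 * M / r := by field_simp; ring

/-- Cauchy's estimate on discs of radius r/4 bounds the derivative of the divided difference, and
the mean value inequality does the rest. The constant depends on `f` only through `M`, so the bound
is uniform over families of functionals applied to one function. -/
theorem norm_dslope_sub_dslope_le [CompleteSpace F] {f : ℂ → F} {z₀ : ℂ} {r M : ℝ}
    (hd : DifferentiableOn ℂ f (ball z₀ r)) (hM : ∀ z ∈ ball z₀ r, ‖f z‖ ≤ M)
    {w v : ℂ} (hw : w ∈ ball z₀ (r / 2)) (hv : v ∈ ball z₀ (r / 2)) :
    ‖dslope f z₀ w - dslope f z₀ v‖ ≤ 16 * M / r ^ 2 * ‖w - v‖ := by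
  have hr : 0 < r := by have := pos_of_mem_ball hw; linarith
  have hg : DifferentiableOn ℂ (dslope f z₀) (ball z₀ r) :=
    (Complex.differentiableOn_dslope (ball_mem_nhds z₀ hr)).2 hd
  have hsub : ball z₀ (r / 2) ⊆ ball z₀ r := ball_subset_ball (by linarith)
  refine (convex_ball z₀ (r / 2)).norm_image_sub_le_of_norm_deriv_le
    (fun x hx => hg.differentiableAt (isOpen_ball.mem_nhds (hsub hx))) ?_ hv hw
  intro x hx
  have hcl : closedBall x (r / 4) ⊆ ball z₀ r := by
    refine closedBall_subset_ball' ?_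
    have := mem_ball.1 hx
    linarith
  have := Complex.norm_deriv_le_of_forall_mem_sphere_norm_le (f := dslope f z₀) (c := x)
    (R := r / 4) (C := 4 * M / r) (by linarith)
    ⟨hg.mono (ball_subset_closedBall.trans hcl),
      hg.continuousOn.mono (closure_ball_subset_closedBall.trans hcl)⟩
    (fun z hz => norm_dslope_le_of_forall_norm_le hd hM (hcl (sphere_subset_closedBall hz)))
  refine this.trans (le_of_eq ?_)
  field_simp
  ring

/-- A locally bounded vector-valued function that is holomorphic when tested against a norming
family of functionals is holomorphic. -/
theorem differentiableAt_of_norming [CompleteSpace F] {f : ℂ → F} {z₀ : ℂ} {r M : ℝ} (hr : 0 < r)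
    (𝓛 : Set (F →L[ℂ] ℂ)) (h1 : ∀ L ∈ 𝓛, ∀ z, ‖L z‖ ≤ ‖z‖)
    (h2 : ∀ z c, 0 ≤ c → (∀ L ∈ 𝓛, ‖L z‖ ≤ c) → ‖z‖ ≤ c)
    (hM : ∀ z ∈ ball z₀ r, ‖f z‖ ≤ M)
    (hd : ∀ L ∈ 𝓛, DifferentiableOn ℂ (fun z => L (f z)) (ball z₀ r)) :
    DifferentiableAt ℂ f z₀ := by
  have hM0 : 0 ≤ M := (norm_nonneg _).trans (hM z₀ (mem_ball_self hr))
  -- The Lipschitz bound for the scalar quotients is the same for every functional, so the norming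
  -- property passes it to the vector quotients. These are then Cauchy at z₀ and completeness yields
  -- the derivative.
  have key : ∀ w ∈ ball z₀ (r / 2) \ {z₀}, ∀ v ∈ ball z₀ (r / 2) \ {z₀},
      ‖slope f z₀ w - slope f z₀ v‖ ≤ 16 * M / r ^ 2 * ‖w - v‖ := by
    intro w hw v hv
    refine h2 _ _ (by positivity) fun L hL => ?_
    have := norm_dslope_sub_dslope_le (hd L hL) (fun z hz => (h1 L hL _).trans (hM z hz)) hw.1 hv.1
    rw [dslope_of_ne _ hw.2, dslope_of_ne _ hv.2] at this
    simpa [slope_def_module, map_sub, map_smul] using this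
  have hu : UniformContinuousOn (slope f z₀) (ball z₀ (r / 2) \ {z₀}) := by
    have : LipschitzOnWith (16 * M / r ^ 2).toNNReal (slope f z₀) (ball z₀ (r / 2) \ {z₀}) := by
      refine LipschitzOnWith.of_dist_le_mul fun w hw v hv => ?_
      rw [dist_eq_norm, dist_eq_norm, Real.coe_toNNReal _ (by positivity)]
      exact key w hw v hv
    exact this.uniformContinuousOn
  have hc : Cauchy (map (slope f z₀) (𝓝[≠] z₀)) := by
    refine (cauchy_nhds.mono nhdsWithin_le_nhds).map_of_le hu ?_
    rw [le_principal_iff]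
    exact sdiff_mem_nhdsWithin_compl (ball_mem_nhds z₀ (half_pos hr)) _
  obtain ⟨d, hd⟩ := CompleteSpace.complete hc
  exact (hasDerivAt_iff_tendsto_slope.2 hd).differentiableAt

/-- A separately holomorphic, locally bounded function of two variables is holomorphic on the
diagonal. -/
theorem differentiableAt_diag {G : ℂ → ℂ → ℂ} {z₀ : ℂ} {r M : ℝ} (hr : 0 < r)
    (h1 : ∀ v ∈ ball z₀ r, DifferentiableOn ℂ (fun w => G w v) (ball z₀ r))
    (h2 : ∀ w ∈ ball z₀ r, DifferentiableOn ℂ (G w) (ball z₀ r))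
    (hM : ∀ w ∈ ball z₀ r, ∀ v ∈ ball z₀ r, ‖G w v‖ ≤ M) :
    DifferentiableAt ℂ (fun z => G z z) z₀ := by
  have h0 : z₀ ∈ ball z₀ r := mem_ball_self hr
  have h0' : z₀ ∈ ball z₀ (r / 2) := mem_ball_self (half_pos hr)
  set D : ℂ → ℂ := fun z => dslope (fun w => G w z) z₀ z with hD
  -- In `D` the second variable moves along with the first. Since the factor z - z₀ vanishes at z₀,
  -- mere continuity of `D` there is enough.
  have hsplit : (fun z => G z z) = fun z => G z₀ z + (z - z₀) * D z := by
    funext z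
    have := sub_smul_dslope (fun w => G w z) z₀ z
    simp only [smul_eq_mul] at this
    rw [hD, this]
    ring
  have hDc : ContinuousAt D z₀ := by
    have hb : ∀ z ∈ ball z₀ (r / 2), ‖D z - D z₀‖ ≤ (16 * M / r ^ 2 + 8 * M / r ^ 2) * ‖z - z₀‖ := by
      intro z hz
      have hz' : z ∈ ball z₀ r := ball_subset_ball (by linarith) hz
      have e1 := norm_dslope_sub_dslope_le (h1 z hz') (fun w hw => hM w hw z hz') hz h0'
      -- Cauchy's estimate for w ↦ G w z - G w z₀, which is at most (4M/r)‖z - z₀‖ by the divided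
      -- difference bound in the second variable.
      have e2 : ‖dslope (fun w => G w z) z₀ z₀ - dslope (fun w => G w z₀) z₀ z₀‖
          ≤ 8 * M / r ^ 2 * ‖z - z₀‖ := by
        have hdz := (h1 z hz').differentiableAt (isOpen_ball.mem_nhds h0)
        have hdz0 := (h1 z₀ h0).differentiableAt (isOpen_ball.mem_nhds h0)
        rw [dslope_same, dslope_same, ← deriv_fun_sub hdz hdz0]
        have hcl : closedBall z₀ (r / 2) ⊆ ball z₀ r := closedBall_subset_ball (by linarith)
        have hsub := (h1 z hz').sub (h1 z₀ h0)
        refine (Complex.norm_deriv_le_of_forall_mem_sphere_norm_le (R := r / 2)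
          (C := 4 * M / r * ‖z - z₀‖) (by linarith)
          ⟨hsub.mono (ball_subset_closedBall.trans hcl),
            hsub.continuousOn.mono (closure_ball_subset_closedBall.trans hcl)⟩ ?_).trans ?_
        · intro w hw
          have hw' := hcl (sphere_subset_closedBall hw)
          have := norm_dslope_le_of_forall_norm_le (h2 w hw') (hM w hw') hz'
          have e := sub_smul_dslope (G w) z₀ z
          simp only [Pi.sub_apply]
          rw [← e, norm_smul, mul_comm]
          gcongr
        · refine le_of_eq ?_
          field_simp
          ring
      calc ‖D z - D z₀‖ ≤ ‖dslope (fun w => G w z) z₀ z - dslope (fun w => G w z) z₀ z₀‖ +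
            ‖dslope (fun w => G w z) z₀ z₀ - dslope (fun w => G w z₀) z₀ z₀‖ :=
            norm_sub_le_norm_sub_add_norm_sub _ _ _
        _ ≤ _ := by rw [add_mul]; gcongr
    rw [ContinuousAt, tendsto_iff_norm_sub_tendsto_zero]
    refine squeeze_zero' (Eventually.of_forall fun _ => norm_nonneg _)
      (eventually_of_mem (ball_mem_nhds z₀ (half_pos hr)) hb) ?_
    have : ContinuousAt (fun z : ℂ => (16 * M / r ^ 2 + 8 * M / r ^ 2) * ‖z - z₀‖) z₀ := by fun_prop
    simpa [ContinuousAt] using this.tendsto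
  rw [hsplit]
  refine ((h2 z₀ h0).differentiableAt (isOpen_ball.mem_nhds h0)).add ?_
  refine (hasDerivAt_iff_tendsto_slope (f' := D z₀).2 ?_).differentiableAt
  refine (hDc.tendsto.mono_left nhdsWithin_le_nhds).congr' ?_
  filter_upwards [self_mem_nhdsWithin] with z hz
  have : z - z₀ ≠ 0 := sub_ne_zero.2 hz
  simp [slope_def_field, this]

end ComplexAnalysis

/-! ### Laurent expansions and principal parts -/

section Laurent
open Metric

/-- The coefficient of `(z₀ - w)⁻ʲ` in the Laurent expansion of `f` at `z₀`, computed on the circle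
of radius `ρ`. -/
def laurentCoeff (f : ℂ → ℂ) (z₀ : ℂ) (ρ : ℝ) (j : ℤ) : ℂ :=
  -((2 * Real.pi * Complex.I)⁻¹ * ∮ ζ in C(z₀, ρ), (z₀ - ζ) ^ (j - 1) * f ζ)

theorem norm_laurentCoeff_le {f : ℂ → ℂ} {z₀ : ℂ} {ρ M : ℝ} (hρ : 0 < ρ)
    (hM : ∀ ζ ∈ sphere z₀ ρ, ‖f ζ‖ ≤ M) (j : ℤ) : ‖laurentCoeff f z₀ ρ j‖ ≤ ρ ^ j * M := by
  rw [laurentCoeff, norm_neg, ← smul_eq_mul]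
  refine (circleIntegral.norm_two_pi_i_inv_smul_integral_le_of_norm_le_const (C := ρ ^ (j - 1) * M)
    hρ.le ?_).trans (le_of_eq ?_)
  · intro ζ hζ
    have h1 : ‖z₀ - ζ‖ = ρ := by rw [← dist_eq_norm, dist_comm]; exact hζ
    rw [norm_mul, norm_zpow, h1]
    gcongr
    exact hM ζ hζ
  · rw [← mul_assoc, ← zpow_one_add₀ hρ.ne']
    congr 2
    ring

variable {f : ℂ → ℂ} {z₀ : ℂ} {R : ℝ}

theorem continuousOn_sub_zpow_mul (hf : DifferentiableOn ℂ f (ball z₀ R \ {z₀})) (j : ℤ) :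
    ContinuousOn (fun ζ => (z₀ - ζ) ^ j * f ζ) (ball z₀ R \ {z₀}) := by
  refine ContinuousOn.mul (ContinuousOn.zpow₀ (by fun_prop) _ fun ζ hζ => Or.inl ?_) hf.continuousOn
  exact sub_ne_zero.2 (Ne.symm hζ.2)

theorem isOpen_punctured_ball (z₀ : ℂ) (R : ℝ) : IsOpen (ball z₀ R \ {z₀}) :=
  isOpen_ball.sdiff isClosed_singleton

theorem closedBall_diff_ball_subset {r s : ℝ} (hr : 0 < r) (hs : s < R) :
    closedBall z₀ s \ ball z₀ r ⊆ ball z₀ R \ {z₀} := by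
  rintro x ⟨h1, h2⟩
  refine ⟨closedBall_subset_ball hs h1, ?_⟩
  rintro rfl
  exact h2 (mem_ball_self hr)

theorem sphere_subset_punctured_ball {r : ℝ} (hr : 0 < r) (hs : r < R) :
    sphere z₀ r ⊆ ball z₀ R \ {z₀} := fun x hx =>
  closedBall_diff_ball_subset hr hs ⟨sphere_subset_closedBall hx, by
    rw [mem_ball, mem_sphere.1 hx]; exact lt_irrefl _⟩

theorem laurentCoeff_eq_of_le (hf : DifferentiableOn ℂ f (ball z₀ R \ {z₀})) {r s : ℝ} (hr : 0 < r)
    (hrs : r ≤ s) (hs : s < R) (j : ℤ) : laurentCoeff f z₀ r j = laurentCoeff f z₀ s j := by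
  have hsub := closedBall_diff_ball_subset (z₀ := z₀) hr hs
  rw [laurentCoeff, laurentCoeff, Complex.circleIntegral_eq_of_differentiable_on_annulus_off_countable
    hr hrs countable_empty ((continuousOn_sub_zpow_mul hf _).mono hsub)]
  intro z hz
  have hz' : z ∈ ball z₀ R \ {z₀} := hsub ⟨ball_subset_closedBall hz.1.1,
    fun h => hz.1.2 (ball_subset_closedBall h)⟩
  refine DifferentiableAt.mul (DifferentiableAt.zpow (by fun_prop) (Or.inl ?_))
    (hf.differentiableAt ((isOpen_punctured_ball _ _).mem_nhds hz'))
  exact sub_ne_zero.2 (Ne.symm hz'.2)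

theorem laurentCoeff_eq (hf : DifferentiableOn ℂ f (ball z₀ R \ {z₀})) {r s : ℝ} (hr : 0 < r)
    (hrR : r < R) (hs : 0 < s) (hsR : s < R) (j : ℤ) :
    laurentCoeff f z₀ r j = laurentCoeff f z₀ s j := by
  rcases le_total r s with h | h
  · exact laurentCoeff_eq_of_le hf hr h hsR j
  · exact (laurentCoeff_eq_of_le hf hs h hrR j).symm

/-- Geometric series in (z - c)/w, whose ratio on the circle is r/‖w‖ < 1. Here `w` is the
displacement of the outer point from the centre; this supplies the negative powers of a Laurent
expansion. -/
theorem hasSum_circleIntegral_inner {f : ℂ → ℂ} {c w : ℂ} {r : ℝ} (hr : 0 ≤ r)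
    (hf : ContinuousOn f (sphere c r)) (hw : r < ‖w‖) :
    HasSum (fun n : ℕ => ∮ z in C(c, r), ((z - c) / w) ^ n * (w⁻¹ * f z))
      (∮ z in C(c, r), (w - (z - c))⁻¹ * f z) := by
  have hwpos : 0 < ‖w‖ := hr.trans_lt hw
  have hw0 : w ≠ 0 := norm_pos_iff.1 hwpos
  obtain ⟨M, hM⟩ := (isCompact_sphere c r).exists_bound_of_continuousOn hf
  have hcm : ∀ t : ℝ, circleMap c r t ∈ sphere c r := circleMap_mem_sphere c hr
  have hM0 : 0 ≤ M := (norm_nonneg _).trans (hM _ (hcm 0))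
  have hq : r / ‖w‖ < 1 := (div_lt_one hwpos).2 hw
  have hfc : Continuous fun t : ℝ => f (circleMap c r t) :=
    hf.comp_continuous (continuous_circleMap c r) hcm
  simp only [circleIntegral, deriv_circleMap, smul_eq_mul]
  refine intervalIntegral.hasSum_integral_of_dominated_convergence
    (fun n _ => r * ((r / ‖w‖) ^ n * (‖w‖⁻¹ * M))) (fun n => ?_) (fun n => ?_) ?_ ?_ ?_
  · have hz : ∀ t : ℝ, circleMap c r t - c = circleMap 0 r t := by simp [circleMap]
    simp only [hz]
    refine Continuous.aestronglyMeasurable ?_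
    have h := continuous_circleMap 0 r
    exact (h.mul continuous_const).mul (((h.div_const w).pow n).mul (continuous_const.mul hfc))
  · refine Eventually.of_forall fun t _ => ?_
    have h1 : ‖circleMap c r t - c‖ = r := by rw [← dist_eq_norm]; exact hcm t
    have h2 : ‖circleMap 0 r t * Complex.I‖ = r := by simp [abs_of_nonneg hr]
    rw [norm_mul, h2, norm_mul, norm_pow, norm_div, h1, norm_mul, norm_inv]
    gcongr
    exact hM _ (hcm t)
  · refine Eventually.of_forall fun t _ => ?_
    exact ((summable_geometric_of_lt_one (by positivity) hq).mul_right _).mul_left _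
  · simp
  · refine Eventually.of_forall fun t _ => ?_
    have h1 : ‖circleMap c r t - c‖ = r := by rw [← dist_eq_norm]; exact hcm t
    have h3 : ‖(circleMap c r t - c) / w‖ < 1 := by rw [norm_div, h1]; exact hq
    have h4 := ((hasSum_geometric_of_norm_lt_one h3).mul_right
      (w⁻¹ * f (circleMap c r t))).mul_left (circleMap 0 r t * Complex.I)
    convert! h4 using 2
    rw [← mul_assoc, ← mul_inv]
    congr 2
    field_simp

/-- The divided difference of `f` at `w` is holomorphic on the punctured ball, so its integrals over
both circles agree. What remains is f w times the integral of (ζ - w)⁻¹, which is 2πi over the outer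
circle and 0 over the inner one. -/
theorem cauchy_annulus (hf : DifferentiableOn ℂ f (ball z₀ R \ {z₀})) {w : ℂ} {r s : ℝ}
    (hr : 0 < r) (hrw : r < ‖w - z₀‖) (hws : ‖w - z₀‖ < s) (hs : s < R) :
    (∮ ζ in C(z₀, s), (ζ - w)⁻¹ * f ζ) - (∮ ζ in C(z₀, r), (ζ - w)⁻¹ * f ζ)
      = 2 * Real.pi * Complex.I * f w := by
  have hsub := closedBall_diff_ball_subset (z₀ := z₀) hr hs
  have hs0 : 0 < s := (norm_nonneg _).trans_lt hws
  have hwm : w ∈ ball z₀ R \ {z₀} := hsub ⟨by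
    rw [mem_closedBall, dist_eq_norm]; exact hws.le, by
    rw [mem_ball, dist_eq_norm]; exact not_lt.2 hrw.le⟩
  have hdw : DifferentiableAt ℂ f w :=
    hf.differentiableAt ((isOpen_punctured_ball _ _).mem_nhds hwm)
  have hD : DifferentiableOn ℂ (dslope f w) (ball z₀ R \ {z₀}) :=
    (Complex.differentiableOn_dslope ((isOpen_punctured_ball _ _).mem_nhds hwm)).2 hf
  have heq := Complex.circleIntegral_eq_of_differentiable_on_annulus_off_countable
    hr (hrw.trans hws).le countable_empty (hD.continuousOn.mono hsub) (by
      intro z hz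
      refine hD.differentiableAt ((isOpen_punctured_ball _ _).mem_nhds (hsub ?_))
      exact ⟨ball_subset_closedBall hz.1.1, fun h => hz.1.2 (ball_subset_closedBall h)⟩)
  have expand : ∀ ρ : ℝ, 0 < ρ → ρ < R → ‖w - z₀‖ ≠ ρ →
      (∮ ζ in C(z₀, ρ), dslope f w ζ) =
        (∮ ζ in C(z₀, ρ), (ζ - w)⁻¹ * f ζ) - (∮ ζ in C(z₀, ρ), (ζ - w)⁻¹) * f w := by
    intro ρ h0 hR hne
    have hnw : ∀ ζ ∈ sphere z₀ ρ, ζ - w ≠ 0 := by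
      intro ζ hζ h
      rw [sub_eq_zero.1 h, mem_sphere, dist_eq_norm] at hζ
      exact hne hζ
    have c1 : ContinuousOn (fun ζ : ℂ => (ζ - w)⁻¹) (sphere z₀ ρ) :=
      ContinuousOn.inv₀ (by fun_prop) hnw
    have c2 : ContinuousOn f (sphere z₀ ρ) :=
      hf.continuousOn.mono (sphere_subset_punctured_ball h0 hR)
    rw [mul_comm, ← circleIntegral.integral_const_mul,
      ← circleIntegral.integral_sub (f := fun ζ => (ζ - w)⁻¹ * f ζ) (g := fun ζ => f w * (ζ - w)⁻¹)
      ((c1.mul c2).circleIntegrable h0.le) ((continuousOn_const.mul c1).circleIntegrable h0.le)]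
    refine circleIntegral.integral_congr h0.le fun ζ hζ => ?_
    have : ζ ≠ w := sub_ne_zero.1 (hnw ζ hζ)
    simp only [dslope_of_ne _ this, slope_def_field]
    field_simp [hnw ζ hζ]
  rw [expand s hs0 hs hws.ne, expand r hr (hrw.trans (hws.trans hs)) hrw.ne'] at heq
  rw [circleIntegral.integral_sub_inv_of_mem_ball (by rwa [mem_ball, dist_eq_norm])] at heq
  have h0 : (∮ ζ in C(z₀, r), (ζ - w)⁻¹) = 0 := by
    have hne : ∀ z ∈ closedBall z₀ r, z - w ≠ 0 := by
      intro z hz h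
      rw [sub_eq_zero.1 h, mem_closedBall, dist_eq_norm] at hz
      exact absurd hz (not_le.2 hrw)
    refine Complex.circleIntegral_eq_zero_of_differentiable_on_off_countable hr.le countable_empty
      (ContinuousOn.inv₀ (by fun_prop) hne) fun z hz => ?_
    exact DifferentiableAt.inv (by fun_prop) (hne z (ball_subset_closedBall hz.1))
  rw [h0] at heq
  linear_combination heq

theorem hasSum_laurent_nonpos (hf : DifferentiableOn ℂ f (ball z₀ R \ {z₀})) {w : ℂ} {s : ℝ}
    (hws : ‖w - z₀‖ < s) (hs : s < R) :
    HasSum (fun n : ℕ => (z₀ - w) ^ n * laurentCoeff f z₀ s (-n))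
      ((2 * Real.pi * Complex.I)⁻¹ * ∮ ζ in C(z₀, s), (ζ - w)⁻¹ * f ζ) := by
  have hs0 : 0 < s := (norm_nonneg _).trans_lt hws
  have c2 : ContinuousOn f (sphere z₀ s) :=
    hf.continuousOn.mono (sphere_subset_punctured_ball hs0 hs)
  have h := (hasSum_two_pi_I_cauchyPowerSeries_integral (c2.circleIntegrable hs0.le) hws).mul_left
    (2 * Real.pi * Complex.I : ℂ)⁻¹
  simp only [add_sub_cancel, smul_eq_mul] at h
  convert! h using 2 with n
  rw [laurentCoeff, mul_neg, mul_left_comm, ← mul_neg]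
  congr 1
  rw [← neg_one_mul, ← mul_assoc, ← circleIntegral.integral_const_mul]
  refine circleIntegral.integral_congr hs0.le fun ζ hζ => ?_
  have hne : z₀ - ζ ≠ 0 := by
    rw [sub_ne_zero]
    rintro rfl
    simp at hζ
    exact hs0.ne hζ
  have hne' : ζ - z₀ ≠ 0 := by rw [← neg_sub]; exact neg_ne_zero.2 hne
  have e : (w - z₀) / (ζ - z₀) = (z₀ - w) / (z₀ - ζ) := by
    rw [← neg_sub z₀ w, ← neg_sub z₀ ζ, neg_div_neg_eq]
  rw [e, zpow_sub₀ hne, zpow_neg, zpow_natCast, zpow_one, div_pow, ← neg_sub z₀ ζ, inv_neg]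
  field_simp

theorem hasSum_laurent_pos (hf : DifferentiableOn ℂ f (ball z₀ R \ {z₀})) {w : ℂ} {r : ℝ}
    (hr : 0 < r) (hrw : r < ‖w - z₀‖) (hrR : r < R) :
    HasSum (fun n : ℕ => (z₀ - w) ^ (-((n : ℤ) + 1)) * laurentCoeff f z₀ r (n + 1))
      (-((2 * Real.pi * Complex.I)⁻¹ * ∮ ζ in C(z₀, r), (ζ - w)⁻¹ * f ζ)) := by
  have c2 : ContinuousOn f (sphere z₀ r) :=
    hf.continuousOn.mono (sphere_subset_punctured_ball hr hrR)
  have h := (hasSum_circleIntegral_inner hr.le c2 hrw).mul_left (2 * Real.pi * Complex.I : ℂ)⁻¹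
  have hw0 : w - z₀ ≠ 0 := norm_pos_iff.1 (hr.trans hrw)
  convert! h using 1
  · funext n
    rw [laurentCoeff, mul_neg, mul_left_comm, ← mul_neg]
    congr 1
    rw [← neg_one_mul, ← mul_assoc, ← circleIntegral.integral_const_mul]
    refine circleIntegral.integral_congr hr.le fun ζ _ => ?_
    have e : (ζ - z₀) / (w - z₀) = (z₀ - ζ) / (z₀ - w) := by
      rw [← neg_sub z₀ w, ← neg_sub z₀ ζ, neg_div_neg_eq]
    have hne : z₀ - w ≠ 0 := by rw [← neg_sub]; exact neg_ne_zero.2 hw0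
    rw [e, add_sub_cancel_right, zpow_natCast, zpow_neg, div_pow, ← neg_sub z₀ w, inv_neg,
      zpow_add_one₀ hne, zpow_natCast]
    field_simp
  · rw [← mul_neg, ← neg_one_mul, ← circleIntegral.integral_const_mul]
    congr 1
    refine circleIntegral.integral_congr hr.le fun ζ _ => ?_
    have : w - z₀ - (ζ - z₀) = -(ζ - w) := by ring
    simp only [this, inv_neg]
    ring

/-- Cauchy's formula in an annulus around `w`: its outer circle produces the nonnegative powers of
z₀ - w, its inner circle the negative ones. The coefficients do not depend on the radius, so both
halves can be referred to `ρ`. -/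
theorem hasSum_laurent (hf : DifferentiableOn ℂ f (ball z₀ R \ {z₀})) {w : ℂ}
    (hw : w ∈ ball z₀ R \ {z₀}) {ρ : ℝ} (hρ : 0 < ρ) (hρR : ρ < R) :
    HasSum (fun j : ℤ => (z₀ - w) ^ (-j) * laurentCoeff f z₀ ρ j) (f w) := by
  have hw1 : ‖w - z₀‖ < R := by rw [← dist_eq_norm]; exact hw.1
  have hw0 : 0 < ‖w - z₀‖ := norm_pos_iff.2 (sub_ne_zero.2 hw.2)
  obtain ⟨s, hws, hsR⟩ := exists_between hw1
  obtain ⟨r, hr, hrw⟩ := exists_between hw0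
  have hs0 := hw0.trans hws
  have hrR := hrw.trans hw1
  have h1 := hasSum_laurent_nonpos hf hws hsR
  have h2 := hasSum_laurent_pos hf hr hrw hrR
  have h3 := HasSum.of_nat_of_neg_add_one
    (f := fun j : ℤ => (z₀ - w) ^ j * laurentCoeff f z₀ ρ (-j))
    (by convert! h1 using 2 with n; rw [zpow_natCast, laurentCoeff_eq hf hρ hρR hs0 hsR])
    (by convert! h2 using 2 with n; rw [neg_neg, laurentCoeff_eq hf hρ hρR hr hrR])
  have h4 := (Equiv.neg ℤ).hasSum_iff.2 h3
  convert! h4 using 1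
  · funext j; simp
  · rw [← sub_eq_add_neg, ← mul_sub, cauchy_annulus hf hr hrw hws hsR, ← mul_assoc,
      inv_mul_cancel₀ Complex.two_pi_I_ne_zero, one_mul]

/-- Splitting of a function with an isolated singularity into a holomorphic part, a simple pole, and
a part that has a primitive. -/
theorem exists_principal_part (hf : DifferentiableOn ℂ f (ball z₀ R \ {z₀})) {ρ : ℝ} (hρ : 0 < ρ)
    (hρR : ρ < R) : ∃ e k : ℂ → ℂ, Differentiable ℂ e ∧ DifferentiableOn ℂ k (ball z₀ R) ∧
      ∀ w ∈ ball z₀ R \ {z₀}, f w = k w +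
        (((2 * Real.pi * Complex.I)⁻¹ * ∮ ζ in C(z₀, ρ), f ζ) * (w - z₀)⁻¹ +
          ((w - z₀)⁻¹) ^ 2 * e ((w - z₀)⁻¹)) := by
  have hcomp : ∀ r, 0 < r → r < R → ∃ M, 0 ≤ M ∧ ∀ j : ℤ, ‖laurentCoeff f z₀ ρ j‖ ≤ r ^ j * M := by
    intro r hr hrR
    obtain ⟨M, hM⟩ := (isCompact_sphere z₀ r).exists_bound_of_continuousOn
      (hf.continuousOn.mono (sphere_subset_punctured_ball hr hrR))
    refine ⟨max M 0, le_max_right _ _, fun j => ?_⟩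
    rw [laurentCoeff_eq hf hρ hρR hr hrR]
    exact norm_laurentCoeff_le hr (fun ζ hζ => (hM ζ hζ).trans (le_max_left _ _)) j
  -- `e` collects the powers from (w - z₀)⁻² downwards, as a series in s = (w - z₀)⁻¹ with s²
  -- factored out. It is entire because the coefficients can be estimated on arbitrarily small
  -- circles, and with an entire `e` the term s² e(s) has a primitive in w.
  refine ⟨fun s => ∑' n : ℕ, (-s) ^ n * laurentCoeff f z₀ ρ (n + 2),
    fun w => ∑' n : ℕ, (z₀ - w) ^ n * laurentCoeff f z₀ ρ (-n), ?_, ?_, ?_⟩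
  · intro s
    obtain ⟨r, hr, hr2⟩ : ∃ r, 0 < r ∧ r < min R (‖s‖ + 1)⁻¹ :=
      exists_between (lt_min (hρ.trans hρR) (by positivity))
    have hrR := hr2.trans_le (min_le_left _ _)
    have hr3 := hr2.trans_le (min_le_right _ _)
    obtain ⟨M, hM0, hM⟩ := hcomp r hr hrR
    have hlt : (‖s‖ + 1) * r < 1 := by
      rw [mul_comm]
      have := (lt_inv_comm₀ hr (by positivity)).1 hr3
      calc r * (‖s‖ + 1) < r * r⁻¹ := by gcongr
        _ = 1 := mul_inv_cancel₀ hr.ne'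
    refine (Complex.differentiableOn_tsum_of_summable_norm (U := ball 0 (‖s‖ + 1))
      (u := fun n : ℕ => ((‖s‖ + 1) * r) ^ n * (r ^ 2 * M)) ?_ (fun n => by fun_prop) isOpen_ball
      ?_).differentiableAt (isOpen_ball.mem_nhds (by simp))
    · exact (summable_geometric_of_lt_one (by positivity) hlt).mul_right _
    · intro n x hx
      rw [mem_ball_zero_iff] at hx
      rw [norm_mul, norm_pow, norm_neg]
      calc ‖x‖ ^ n * ‖laurentCoeff f z₀ ρ (n + 2)‖ ≤ (‖s‖ + 1) ^ n * (r ^ ((n : ℤ) + 2) * M) := by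
            gcongr; exact hM _
        _ = _ := by
          rw [zpow_add₀ hr.ne', zpow_natCast, mul_pow, zpow_ofNat]; ring
  · intro w hw
    refine DifferentiableAt.differentiableWithinAt ?_
    have hw1 : ‖w - z₀‖ < R := by rw [← dist_eq_norm]; exact hw
    obtain ⟨s, hws, hsR⟩ := exists_between hw1
    obtain ⟨q, hsq, hqR⟩ := exists_between hsR
    have hs0 := (norm_nonneg _).trans_lt hws
    have hq0 := hs0.trans hsq
    obtain ⟨M, hM0, hM⟩ := hcomp q hq0 hqR
    refine (Complex.differentiableOn_tsum_of_summable_norm (U := ball z₀ s)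
      (u := fun n : ℕ => (s / q) ^ n * M) ?_ (fun n => by fun_prop) isOpen_ball
      ?_).differentiableAt (isOpen_ball.mem_nhds (by rwa [mem_ball, dist_eq_norm]))
    · exact (summable_geometric_of_lt_one (by positivity) ((div_lt_one hq0).2 hsq)).mul_right _
    · intro n x hx
      rw [mem_ball, dist_comm, dist_eq_norm] at hx
      rw [norm_mul, norm_pow]
      calc ‖z₀ - x‖ ^ n * ‖laurentCoeff f z₀ ρ (-n)‖ ≤ s ^ n * (q ^ (-(n : ℤ)) * M) := by
            gcongr; exact hM _
        _ = _ := by rw [zpow_neg, zpow_natCast, div_pow]; ring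
  · intro w hw
    have hw1 : ‖w - z₀‖ < R := by rw [← dist_eq_norm]; exact hw.1
    have hw0 : 0 < ‖w - z₀‖ := norm_pos_iff.2 (sub_ne_zero.2 hw.2)
    have hwne : w - z₀ ≠ 0 := sub_ne_zero.2 hw.2
    have hwne' : z₀ - w ≠ 0 := sub_ne_zero.2 (Ne.symm hw.2)
    obtain ⟨s, hws, hsR⟩ := exists_between hw1
    obtain ⟨r, hr, hrw⟩ := exists_between hw0
    have hs0 := hw0.trans hws
    have hrR := hrw.trans hw1
    have h1 := hasSum_laurent_nonpos hf hws hsR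
    have h2 := hasSum_laurent_pos hf hr hrw hrR
    simp only [laurentCoeff_eq hf hs0 hsR hρ hρR] at h1
    simp only [laurentCoeff_eq hf hr hrR hρ hρR] at h2
    have h3 := (hasSum_nat_add_iff' 1).2 h2
    have h4 : HasSum (fun n : ℕ => (-(w - z₀)⁻¹) ^ n * laurentCoeff f z₀ ρ (n + 2))
        ((z₀ - w) ^ 2 * (-((2 * Real.pi * Complex.I)⁻¹ * ∮ ζ in C(z₀, r), (ζ - w)⁻¹ * f ζ) -
          ∑ i ∈ Finset.range 1,
            (z₀ - w) ^ (-((i : ℤ) + 1)) * laurentCoeff f z₀ ρ (i + 1))) := by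
      convert! h3.mul_left ((z₀ - w) ^ 2) using 2 with n
      have e : -(w - z₀)⁻¹ = (z₀ - w)⁻¹ := by rw [← inv_neg, neg_sub]
      have e2 : ((n + 1 : ℕ) : ℤ) + 1 = n + 2 := by push_cast; ring
      rw [e, e2, zpow_neg, zpow_add₀ hwne', zpow_natCast, zpow_ofNat, inv_pow]
      field_simp
    have hann := cauchy_annulus hf hr hrw hws hsR
    have hfw : f w = (2 * Real.pi * Complex.I)⁻¹ * (2 * Real.pi * Complex.I * f w) := by
      rw [← mul_assoc, inv_mul_cancel₀ Complex.two_pi_I_ne_zero, one_mul]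
    simp only [h4.tsum_eq, h1.tsum_eq]
    rw [hfw, ← hann, Finset.sum_range_one]
    have e1 : laurentCoeff f z₀ ρ ((0 : ℕ) + 1) = -((2 * Real.pi * Complex.I)⁻¹ * ∮ ζ in C(z₀, ρ), f ζ) := by
      simp [laurentCoeff]
    have e3 : (z₀ - w) ^ (-(((0 : ℕ) : ℤ) + 1)) = -(w - z₀)⁻¹ := by
      rw [← inv_neg, neg_sub]; simp
    rw [e1, e3]
    have e4 : ((w - z₀)⁻¹) ^ 2 * (z₀ - w) ^ 2 = 1 := by field_simp; ring
    linear_combination -(-(2 * Real.pi * Complex.I)⁻¹ * (∮ ζ in C(z₀, r), (ζ - w)⁻¹ * f ζ) - (w - z₀)⁻¹ * ((2 * Real.pi * Complex.I)⁻¹ * ∮ ζ in C(z₀, ρ), f ζ)) * e4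

end Laurent

/-! ### Primitives and the fundamental theorem along piecewise smooth curves -/

section Primitives
open Metric

/-- A holomorphic function on an open set that is star-shaped about `c` has a primitive. -/
theorem exists_primitive_of_starShaped {U : Set ℂ} {c : ℂ} {f : ℂ → ℂ} (hU : IsOpen U)
    (hc : ∀ w ∈ U, ∀ t ∈ Icc (0 : ℝ) 1, c + t * (w - c) ∈ U) (hf : DifferentiableOn ℂ f U) :
    ∃ G : ℂ → ℂ, ∀ w ∈ U, HasDerivAt G (f w) w := by
  refine ⟨fun z => ∫ t in (0 : ℝ)..1, f (c + t * (z - c)) * (z - c), fun w hw => ?_⟩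
  obtain ⟨ε, hε, hεU⟩ := nhds_basis_closedBall.mem_iff.1 (hU.mem_nhds hw)
  have hf' : DifferentiableOn ℂ (deriv f) U := hf.deriv hU
  have hmap : Continuous fun p : ℝ × ℂ => c + p.1 * (p.2 - c) := by fun_prop
  have hmem : ∀ t ∈ Icc (0 : ℝ) 1, ∀ z ∈ closedBall w ε, c + t * (z - c) ∈ U :=
    fun t ht z hz => hc z (hεU hz) t ht
  set g : ℝ × ℂ → ℂ := fun p =>
    p.1 * deriv f (c + p.1 * (p.2 - c)) * (p.2 - c) + f (c + p.1 * (p.2 - c)) with hg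
  have hgc : ContinuousOn g (Icc (0 : ℝ) 1 ×ˢ closedBall w ε) := by
    have h1 : ContinuousOn (fun p : ℝ × ℂ => f (c + p.1 * (p.2 - c)))
        (Icc (0 : ℝ) 1 ×ˢ closedBall w ε) :=
      hf.continuousOn.comp hmap.continuousOn fun p hp => hmem p.1 hp.1 p.2 hp.2
    have h2 : ContinuousOn (fun p : ℝ × ℂ => deriv f (c + p.1 * (p.2 - c)))
        (Icc (0 : ℝ) 1 ×ˢ closedBall w ε) :=
      hf'.continuousOn.comp hmap.continuousOn fun p hp => hmem p.1 hp.1 p.2 hp.2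
    exact ((ContinuousOn.mul (by fun_prop) h2).mul (by fun_prop)).add h1
  obtain ⟨M, hM⟩ := (isCompact_Icc.prod (isCompact_closedBall w ε)).exists_bound_of_continuousOn hgc
  have huI : uIoc (0 : ℝ) 1 ⊆ Icc 0 1 := by
    rw [uIoc_of_le zero_le_one]; exact Ioc_subset_Icc_self
  have huI' : uIcc (0 : ℝ) 1 = Icc 0 1 := uIcc_of_le zero_le_one
  have hcont : ∀ z ∈ closedBall w ε,
      ContinuousOn (fun t : ℝ => f (c + t * (z - c)) * (z - c)) (uIcc 0 1) := by
    intro z hz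
    rw [huI']
    refine ContinuousOn.mul ?_ continuousOn_const
    exact hf.continuousOn.comp (by fun_prop) fun t ht => hmem t ht z hz
  have hwε : w ∈ closedBall w ε := mem_closedBall_self hε.le
  have hcont' : ContinuousOn (fun t : ℝ => g (t, w)) (uIcc 0 1) := by
    rw [huI']
    exact hgc.comp (by fun_prop) fun t ht => ⟨ht, hwε⟩
  have hder := (intervalIntegral.hasDerivAt_integral_of_dominated_loc_of_deriv_le
    (μ := volume) (a := 0) (b := 1) (F := fun z t => f (c + (t : ℝ) * (z - c)) * (z - c))
    (F' := fun z t => g (t, z)) (x₀ := w) (s := ball w ε) (bound := fun _ => M)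
    (ball_mem_nhds w hε) ?_ ?_ ?_ ?_ ?_ ?_).2
  · convert! hder using 1
    -- The differentiated integrand g (t, w) is d/dt of t f(c + t(w - c)), so its integral over [0,
    -- 1] is f w.
    have hFTC := intervalIntegral.integral_eq_sub_of_hasDerivAt
      (f := fun t : ℝ => (t : ℂ) * f (c + t * (w - c))) (f' := fun t => g (t, w)) (a := 0) (b := 1)
      (fun t ht => ?_) hcont'.intervalIntegrable
    · rw [hFTC]; simp
    · rw [huI'] at ht
      have hdf : HasDerivAt f (deriv f (c + t * (w - c))) (c + t * (w - c)) :=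
        (hf.differentiableAt (hU.mem_nhds (hmem t ht w hwε))).hasDerivAt
      have hin : HasDerivAt (fun s : ℝ => c + (s : ℂ) * (w - c)) (w - c) t := by
        simpa using ((Complex.ofRealCLM.hasDerivAt (x := t)).mul_const (w - c)).const_add c
      have h2 := (Complex.ofRealCLM.hasDerivAt (x := t)).mul (hdf.comp_of_eq t hin rfl)
      convert! h2 using 1
      simp [hg]
      ring
  · filter_upwards [ball_mem_nhds w hε] with z hz
    exact ((hcont z (ball_subset_closedBall hz)).intervalIntegrable).aestronglyMeasurable_restrict_uIoc
  · exact (hcont w hwε).intervalIntegrable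
  · exact hcont'.intervalIntegrable.aestronglyMeasurable_restrict_uIoc
  · exact Eventually.of_forall fun t ht z hz => hM (t, z) ⟨huI ht, ball_subset_closedBall hz⟩
  · exact intervalIntegrable_const
  · refine Eventually.of_forall fun t ht z hz => ?_
    have hdf : HasDerivAt f (deriv f (c + t * (z - c))) (c + t * (z - c)) :=
      (hf.differentiableAt (hU.mem_nhds
        (hmem t (huI ht) z (ball_subset_closedBall hz)))).hasDerivAt
    have hin : HasDerivAt (fun s : ℂ => c + (t : ℂ) * (s - c)) (t : ℂ) z := by
      simpa using (((hasDerivAt_id z).sub_const c).const_mul (t : ℂ)).const_add c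
    have h2 := (hdf.comp_of_eq z hin rfl).mul ((hasDerivAt_id z).sub_const c)
    convert! h2 using 1
    simp only [hg, id, Function.comp_apply]
    ring

/-- Induction on the number of break points inside the open interval. With none, `deriv` agrees
there with the continuous `derivWithin`; otherwise split at a break point, which lies in neither of
the two open pieces, so both counts drop. -/
theorem continuousOn_Icc_of_piecewise {γ : ℝ → ℂ} (S : Finset ℝ) (g : ℝ → ℂ) (n : ℕ) :
    ∀ c d : ℝ, c ≤ d → (S.filter (· ∈ Ioo c d)).card = n → ContinuousOn g (Icc c d) →
    (∀ u v, c ≤ u → u < v → v ≤ d → Disjoint (Ioo u v) (S : Set ℝ) →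
      ContDiffOn ℝ 1 γ (Icc u v)) →
    IntervalIntegrable (fun s => g s * deriv γ s) volume c d := by
  induction n using Nat.strong_induction_on with
  | _ n ih =>
    intro c d hcd hn hg hS
    rcases hcd.eq_or_lt with rfl | hlt
    · exact IntervalIntegrable.refl
    by_cases hdis : Disjoint (Ioo c d) (S : Set ℝ)
    · have h1 := hS c d le_rfl hlt le_rfl hdis
      have h2 : ContinuousOn (fun s => g s * derivWithin γ (Icc c d) s) (Icc c d) :=
        hg.mul (h1.continuousOn_derivWithin (uniqueDiffOn_Icc hlt) le_rfl)
      have h3 : IntegrableOn (fun s => g s * derivWithin γ (Icc c d) s) (Ioo c d) :=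
        (h2.integrableOn_compact isCompact_Icc).mono_set Ioo_subset_Icc_self
      rw [intervalIntegrable_iff_integrableOn_Ioo_of_le hcd]
      refine h3.congr_fun (fun s hs => ?_) measurableSet_Ioo
      simp only
      rw [derivWithin_of_mem_nhds (Icc_mem_nhds hs.1 hs.2)]
    · obtain ⟨p, hp, hpS⟩ := Set.not_disjoint_iff.1 hdis
      have hpm : p ∈ S.filter (· ∈ Ioo c d) := by simpa using ⟨hpS, hp⟩
      have hcard : ∀ u v, c ≤ u → v ≤ d → p ∉ Ioo u v →
          (S.filter (· ∈ Ioo u v)).card < n := by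
        intro u v hu hv hpn
        rw [← hn]
        refine Finset.card_lt_card ⟨fun x hx => ?_, fun h => ?_⟩
        · simp only [Finset.mem_filter] at hx ⊢
          exact ⟨hx.1, hu.trans_lt hx.2.1, hx.2.2.trans_le hv⟩
        · exact hpn (Finset.mem_filter.1 (h hpm)).2
      refine IntervalIntegrable.trans (b := p) ?_ ?_
      · exact ih _ (hcard c p le_rfl hp.2.le fun h => lt_irrefl _ h.2) c p hp.1.le rfl
          (hg.mono (Icc_subset_Icc_right hp.2.le))
          fun u v hu huv hv => hS u v hu huv (hv.trans hp.2.le)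
      · exact ih _ (hcard p d hp.1.le le_rfl fun h => lt_irrefl _ h.1) p d hp.2.le rfl
          (hg.mono (Icc_subset_Icc_left hp.1.le))
          fun u v hu huv hv => hS u v (hp.1.le.trans hu) huv hv

theorem PiecewiseC1.intervalIntegrable {γ : ℝ → ℂ} {c d : ℝ} (hγ : PiecewiseC1 γ c d) (hcd : c ≤ d)
    {F : ℂ → ℂ} (hF : ContinuousOn F (γ '' Icc c d)) :
    IntervalIntegrable (fun s => F (γ s) * deriv γ s) volume c d := by
  obtain ⟨hc, S, hS⟩ := hγ
  exact continuousOn_Icc_of_piecewise S (fun s => F (γ s)) _ c d hcd rfl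
    (hF.comp hc (mapsTo_image _ _)) hS

/-- Off the finite break set the curve is differentiable, so the fundamental theorem with a
countable exceptional set applies to G ∘ γ. -/
theorem PiecewiseC1.lineInt_eq_sub {γ : ℝ → ℂ} {c d : ℝ} (hγ : PiecewiseC1 γ c d) (hcd : c ≤ d)
    {F G : ℂ → ℂ} (hF : ContinuousOn F (γ '' Icc c d))
    (hG : ∀ w ∈ γ '' Icc c d, HasDerivAt G (F w) w) :
    lineInt F γ c d = G (γ d) - G (γ c) := by
  have hint := hγ.intervalIntegrable hcd hF
  obtain ⟨hc, S, hS⟩ := hγ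
  refine MeasureTheory.integral_eq_of_hasDerivAt_off_countable_of_le (fun s => G (γ s)) _ hcd
    S.countable_toSet ?_ ?_ hint
  · refine ContinuousOn.comp (t := γ '' Icc c d) ?_ hc (mapsTo_image _ _)
    exact fun w hw => (hG w hw).continuousAt.continuousWithinAt
  · rintro s ⟨hs, hsS⟩
    have hopen : Ioo c d ∩ (S : Set ℝ)ᶜ ∈ 𝓝 s :=
      (isOpen_Ioo.inter S.finite_toSet.isClosed.isOpen_compl).mem_nhds ⟨hs, hsS⟩
    obtain ⟨ε, hε, hεs⟩ := nhds_basis_closedBall.mem_iff.1 hopen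
    rw [Real.closedBall_eq_Icc] at hεs
    have hlt : s - ε < s + ε := by linarith
    have hl := hεs (left_mem_Icc.2 hlt.le)
    have hr := hεs (right_mem_Icc.2 hlt.le)
    have h1 := hS (s - ε) (s + ε) hl.1.1.le hlt hr.1.2.le
      (Set.disjoint_left.2 fun x hx => (hεs (Ioo_subset_Icc_self hx)).2)
    have hd : DifferentiableAt ℝ γ s := ((h1.differentiableOn one_ne_zero) s
      ⟨by linarith, by linarith⟩).differentiableAt (Icc_mem_nhds (by linarith) (by linarith))
    exact (hG (γ s) ⟨s, Ioo_subset_Icc_self hs, rfl⟩).comp s hd.hasDerivAt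

end Primitives

/-! ### The residue theorem for cycles in star-shaped domains -/

section Residues
open Metric

/-- `L` is integration over a cycle with trace in the compact set `K`. -/
structure IsCycleIntegral (K : Set ℂ) (L : (ℂ → ℂ) → ℂ) : Prop where
  isCompact : IsCompact K
  add : ∀ f g, ContinuousOn f K → ContinuousOn g K → L (fun w => f w + g w) = L f + L g
  const_mul : ∀ (a : ℂ) f, L (fun w => a * f w) = a * L f
  congr : ∀ f g, EqOn f g K → L f = L g
  prim : ∀ G g : ℂ → ℂ, ContinuousOn g K → (∀ w ∈ K, HasDerivAt G (g w) w) → L g = 0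

namespace IsCycleIntegral

variable {K : Set ℂ} {L : (ℂ → ℂ) → ℂ}

theorem sum (h : IsCycleIntegral K L) {ι : Type*} (s : Finset ι) (f : ι → ℂ → ℂ)
    (hf : ∀ i ∈ s, ContinuousOn (f i) K) :
    L (fun w => ∑ i ∈ s, f i w) = ∑ i ∈ s, L (f i) := by
  classical
  induction s using Finset.induction_on with
  | empty =>
    have := h.const_mul 0 (fun _ => 0)
    simpa using this
  | insert i s hi ih =>
    have hs : ∀ j ∈ s, ContinuousOn (f j) K := fun j hj => hf j (Finset.mem_insert_of_mem hj)
    simp only [Finset.sum_insert hi]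
    rw [h.add _ _ (hf i (Finset.mem_insert_self i s)) (continuousOn_finsetSum s hs), ih hs]

/-- The cone over `K` with vertex `c`. -/
def cone (K : Set ℂ) (c : ℂ) : Set ℂ :=
  (fun p : ℝ × ℂ => c + p.1 * (p.2 - c)) '' (Icc (0 : ℝ) 1 ×ˢ K)

theorem isCompact_cone (hK : IsCompact K) (c : ℂ) : IsCompact (cone K c) :=
  (isCompact_Icc.prod hK).image (by fun_prop)

theorem subset_cone (K : Set ℂ) (c : ℂ) : K ⊆ cone K c := fun w hw =>
  ⟨(1, w), ⟨by simp, hw⟩, by simp⟩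

theorem cone_starShaped {c w : ℂ} (hw : w ∈ cone K c) {t : ℝ} (ht : t ∈ Icc (0 : ℝ) 1) :
    c + t * (w - c) ∈ cone K c := by
  obtain ⟨⟨s, v⟩, ⟨hs, hv⟩, rfl⟩ := hw
  refine ⟨(t * s, v), ⟨⟨mul_nonneg ht.1 hs.1, mul_le_one₀ ht.2 hs.1 hs.2⟩, hv⟩, ?_⟩
  push_cast
  ring

/-- A cycle does not wind around the points outside a cone over its trace. -/
theorem inv_sub_eq_zero (h : IsCycleIntegral K L) {c z : ℂ} (hz : z ∉ cone K c) :
    L (fun w => (w - z)⁻¹) = 0 := by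
  have hne : ∀ w ∈ K, w - z ≠ 0 := by
    rintro w hw h0
    exact hz (sub_eq_zero.1 h0 ▸ subset_cone K c hw)
  by_cases hcz : c = z
  · subst hcz
    have hKe : K = ∅ := by
      by_contra hK
      obtain ⟨w, hw⟩ := Set.nonempty_iff_ne_empty.2 hK
      exact hz ⟨(0, w), ⟨by simp, hw⟩, by simp⟩
    exact h.prim (fun _ => 0) _ (by simp [hKe]) (by simp [hKe])
  have hcz' : c - z ≠ 0 := sub_ne_zero.2 hcz
  -- The principal logarithm is available: if (w - z)/(c - z) were real and nonpositive, z would lie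
  -- on the segment from c to w, hence in the cone.
  refine h.prim (fun w => Complex.log ((w - z) / (c - z))) _
    (ContinuousOn.inv₀ (by fun_prop) hne) fun w hw => ?_
  have hslit : (w - z) / (c - z) ∈ Complex.slitPlane := by
    rw [Complex.mem_slitPlane_iff_not_le_zero]
    intro hle
    obtain ⟨hre, him⟩ := Complex.nonpos_iff.1 hle
    set q := (w - z) / (c - z) with hq
    have hqr : q = (q.re : ℂ) := Complex.ext (by simp) (by simp [him])
    have hwz : w - z = q.re * (c - z) := by
      rw [← hqr, hq, div_mul_cancel₀ _ hcz']
    refine hz ⟨((1 - q.re)⁻¹, w), ⟨⟨by rw [inv_nonneg]; linarith, inv_le_one_of_one_le₀ (by linarith)⟩, hw⟩, ?_⟩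
    have h1 : ((1 - q.re : ℝ) : ℂ) ≠ 0 := by
      rw [Complex.ofReal_ne_zero]; linarith
    have h2 : w - c = (1 - q.re : ℝ) * (z - c) := by
      push_cast
      linear_combination hwz
    simp only
    rw [h2, ← mul_assoc, Complex.ofReal_inv, inv_mul_cancel₀ h1]
    ring
  have h1 : HasDerivAt (fun w => (w - z) / (c - z)) (1 / (c - z)) w := by
    simpa using ((hasDerivAt_id w).sub_const z).div_const (c - z)
  convert! h1.clog hslit using 1
  have := hne w hw
  field_simp

/-- The residue theorem in a star-shaped domain. -/
theorem residue_theorem (h : IsCycleIntegral K L) {U Q : Set ℂ} {c : ℂ} (hU : IsOpen U)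
    (hc : ∀ w ∈ U, ∀ t ∈ Icc (0 : ℝ) 1, c + t * (w - c) ∈ U) (hKU : K ⊆ U \ Q)
    (hQ : ∀ D, IsCompact D → D ⊆ U → (D ∩ Q).Finite) :
    ∃ T : Finset ℂ, (T : Set ℂ) ⊆ Q ∧ (∀ z ∈ Q, z ∉ T → L (fun w => (w - z)⁻¹) = 0) ∧
      ∀ (f res : ℂ → ℂ), DifferentiableOn ℂ f (U \ Q) →
        (∀ z ∈ Q, ∃ ρ R : ℝ, 0 < ρ ∧ ρ < R ∧ ball z R \ {z} ⊆ U \ Q ∧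
          res z = (2 * Real.pi * Complex.I)⁻¹ * ∮ ζ in C(z, ρ), f ζ) →
        L f = ∑ z ∈ T, res z * L (fun w => (w - z)⁻¹) := by
  have hconeU : cone K c ⊆ U := by
    rintro _ ⟨⟨t, w⟩, ⟨ht, hw⟩, rfl⟩
    exact hc w (hKU hw).1 t ht
  have hfin := hQ _ (isCompact_cone h.isCompact c) hconeU
  refine ⟨hfin.toFinset, by simp, ?_, ?_⟩
  · intro z hz hzT
    refine h.inv_sub_eq_zero (c := c) fun hz' => hzT ?_
    simpa using ⟨hz', hz⟩
  intro f res hf hres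
  set T := hfin.toFinset with hT
  have hTm : ∀ z, z ∈ T ↔ z ∈ cone K c ∧ z ∈ Q := by simp [hT]
  have hO : IsOpen (U \ (Q \ (T : Set ℂ))) := by
    rw [isOpen_iff_mem_nhds]
    rintro w ⟨hwU, hw⟩
    obtain ⟨ε, hε, hεU⟩ := nhds_basis_closedBall.mem_iff.1 (hU.mem_nhds hwU)
    have hfin' : (closedBall w ε ∩ (Q \ (T : Set ℂ))).Finite :=
      (hQ _ (isCompact_closedBall w ε) hεU).subset (inter_subset_inter_right _ sdiff_subset)
    filter_upwards [closedBall_mem_nhds w hε,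
      hfin'.isClosed.isOpen_compl.mem_nhds (fun h => hw h.2)] with x hx hx'
    exact ⟨hεU hx, fun hxQ => hx' ⟨hx, hxQ⟩⟩
  have hconeO : cone K c ⊆ U \ (Q \ (T : Set ℂ)) := fun w hw =>
    ⟨hconeU hw, fun hq => hq.2 ((hTm w).2 ⟨hw, hq.1⟩)⟩
  -- A small thickening of the cone is open, is still star-shaped about `c`, and meets `Q` only in
  -- the finite set `T`. All holomorphy is used on this set.
  obtain ⟨δ, hδ, hδO⟩ := (isCompact_cone h.isCompact c).exists_thickening_subset_open hO hconeO
  set W := thickening δ (cone K c) with hW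
  have hWopen : IsOpen W := isOpen_thickening
  have hWstar : ∀ w ∈ W, ∀ t ∈ Icc (0 : ℝ) 1, c + t * (w - c) ∈ W := by
    intro w hw t ht
    obtain ⟨v, hv, hd⟩ := mem_thickening_iff.1 hw
    refine mem_thickening_iff.2 ⟨c + t * (v - c), cone_starShaped hv ht, ?_⟩
    rw [dist_eq_norm] at hd ⊢
    have : c + t * (w - c) - (c + t * (v - c)) = t * (w - v) := by ring
    rw [this, norm_mul, Complex.norm_real, Real.norm_of_nonneg ht.1]
    exact (mul_le_of_le_one_left (norm_nonneg _) ht.2).trans_lt hd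
  have hWf : ∀ w ∈ W, w ∉ T → w ∈ U \ Q := fun w hw hwT =>
    ⟨(hδO hw).1, fun hq => (hδO hw).2 ⟨hq, hwT⟩⟩
  have hKW : K ⊆ W := (subset_cone K c).trans (self_subset_thickening hδ _)
  have hUQ : IsOpen (U \ Q) := by
    rw [isOpen_iff_mem_nhds]
    rintro w ⟨hwU, hw⟩
    obtain ⟨ε, hε, hεU⟩ := nhds_basis_closedBall.mem_iff.1 (hU.mem_nhds hwU)
    filter_upwards [closedBall_mem_nhds w hε,
      (hQ _ (isCompact_closedBall w ε) hεU).isClosed.isOpen_compl.mem_nhds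
        (fun h => hw h.2)] with x hx hx'
    exact ⟨hεU hx, fun hxQ => hx' ⟨hx, hxQ⟩⟩
  choose! ρ R hρ hρR hball hresz using hres
  have hpp : ∀ z ∈ Q, ∃ e k : ℂ → ℂ, Differentiable ℂ e ∧ DifferentiableOn ℂ k (ball z (R z)) ∧
      ∀ w ∈ ball z (R z) \ {z}, f w = k w + (res z * (w - z)⁻¹ +
          ((w - z)⁻¹) ^ 2 * e ((w - z)⁻¹)) := by
    intro z hz
    rw [hresz z hz]
    exact exists_principal_part (hf.mono (hball z hz)) (hρ z hz) (hρR z hz)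
  choose! e k he hk hfk using hpp
  set P : ℂ → ℂ → ℂ := fun z w => res z * (w - z)⁻¹ + ((w - z)⁻¹) ^ 2 * e z ((w - z)⁻¹) with hP
  have hPd : ∀ z ∈ Q, ∀ w, w ≠ z → DifferentiableAt ℂ (P z) w := by
    intro z hz w hw
    have h0 : w - z ≠ 0 := sub_ne_zero.2 hw
    have h1 : DifferentiableAt ℂ (fun w => (w - z)⁻¹) w := DifferentiableAt.inv (by fun_prop) h0
    exact (h1.const_mul _).add ((h1.pow 2).mul ((he z hz _).comp w h1))
  classical
  -- `f` with the principal parts at `T` removed; at a point of `T` itself the value is that of the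
  -- local regular part, which makes the function holomorphic there.
  set F : ℂ → ℂ := fun w => if w ∈ T then k w w - ∑ z ∈ T.erase w, P z w
    else f w - ∑ z ∈ T, P z w with hF
  have hTQ : ∀ z ∈ T, z ∈ Q := fun z hz => ((hTm z).1 hz).2
  have hFd : DifferentiableOn ℂ F W := by
    intro w hw
    refine DifferentiableAt.differentiableWithinAt ?_
    by_cases hwT : w ∈ T
    · have hwQ := hTQ w hwT
      have hd : DifferentiableAt ℂ (fun v => k w v - ∑ z ∈ T.erase w, P z v) w := by
        refine DifferentiableAt.sub ((hk w hwQ).differentiableAt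
          (ball_mem_nhds w ((hρ w hwQ).trans (hρR w hwQ)))) ?_
        refine DifferentiableAt.fun_sum fun z hz => ?_
        exact hPd z (hTQ z (Finset.mem_of_mem_erase hz)) w (Finset.ne_of_mem_erase hz).symm
      refine hd.congr_of_eventuallyEq ?_
      filter_upwards [ball_mem_nhds w ((hρ w hwQ).trans (hρR w hwQ))] with v hv
      by_cases hvw : v = w
      · subst hvw; simp [hF, hwT]
      · have hvQ := hball w hwQ ⟨hv, hvw⟩
        have hvT : v ∉ T := fun h => hvQ.2 (hTQ v h)
        simp only [hF, hvT, if_false]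
        rw [hfk w hwQ v ⟨hv, hvw⟩, ← Finset.add_sum_erase T (fun z => P z v) hwT]
        simp only [hP]
        ring
    · have hd : DifferentiableAt ℂ (fun v => f v - ∑ z ∈ T, P z v) w := by
        refine DifferentiableAt.sub (hf.differentiableAt (hUQ.mem_nhds (hWf w hw hwT))) ?_
        refine DifferentiableAt.fun_sum fun z hz => hPd z (hTQ z hz) w ?_
        rintro rfl
        exact hwT hz
      refine hd.congr_of_eventuallyEq ?_
      filter_upwards [T.finite_toSet.isClosed.isOpen_compl.mem_nhds hwT] with v hv
      have hv' : v ∉ T := hv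
      simp [hF, hv']
  obtain ⟨G, hG⟩ := exists_primitive_of_starShaped hWopen hWstar hFd
  have hL0 : L F = 0 := h.prim G F (hFd.continuousOn.mono hKW) fun w hw => hG w (hKW hw)
  have hKne : ∀ w ∈ K, ∀ z ∈ Q, w ≠ z := by
    rintro w hw z hz rfl
    exact (hKU hw).2 hz
  have hPc : ∀ z ∈ T, ContinuousOn (P z) K := fun z hz w hw =>
    (hPd z (hTQ z hz) w (hKne w hw z (hTQ z hz))).continuousAt.continuousWithinAt
  have hLf : L f = L (fun w => F w + ∑ z ∈ T, P z w) := by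
    refine h.congr _ _ fun w hw => ?_
    have : w ∉ T := fun hT' => (hKU hw).2 (hTQ w hT')
    simp [hF, this]
  rw [hLf, h.add _ _ (hFd.continuousOn.mono hKW) (continuousOn_finsetSum T hPc), hL0, zero_add,
    h.sum T P hPc]
  refine Finset.sum_congr rfl fun z hz => ?_
  have hzQ := hTQ z hz
  have hinv : ContinuousOn (fun w => (w - z)⁻¹) K :=
    ContinuousOn.inv₀ (by fun_prop) fun w hw => sub_ne_zero.2 (hKne w hw z hzQ)
  have hsec : ContinuousOn (fun w => ((w - z)⁻¹) ^ 2 * e z ((w - z)⁻¹)) K :=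
    (hinv.pow 2).mul ((he z hzQ).continuous.comp_continuousOn hinv)
  rw [show P z = fun w => res z * (w - z)⁻¹ + ((w - z)⁻¹) ^ 2 * e z ((w - z)⁻¹) from rfl,
    h.add (fun w => res z * (w - z)⁻¹) _ (continuousOn_const.mul hinv) hsec, h.const_mul]
  -- If E' = e z, then -E((w - z)⁻¹) is a primitive of the higher order part of the principal part,
  -- so only the simple pole contributes to the cycle.
  obtain ⟨E, hE⟩ : ∃ E : ℂ → ℂ, ∀ s, HasDerivAt E (e z s) s := by
    obtain ⟨E, hE⟩ := (he z hzQ).isExactOn_univ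
    exact ⟨E, fun s => (hE s (mem_univ s))⟩
  rw [h.prim (fun w => -E ((w - z)⁻¹)) _ hsec fun w hw => ?_, add_zero]
  have h0 : w - z ≠ 0 := sub_ne_zero.2 (hKne w hw z hzQ)
  have h1 : HasDerivAt (fun w => (w - z)⁻¹) (-1 / (w - z) ^ 2) w := by
    simpa using ((hasDerivAt_id w).sub_const z).fun_inv h0
  convert! ((hE ((w - z)⁻¹)).comp w h1).neg using 1
  field_simp

end IsCycleIntegral
end Residues

/-! ### Line integrals and the closed curves of a contour deformation -/

section LineIntegrals

theorem lineInt_add {F G : ℂ → ℂ} {γ : ℝ → ℂ} {c d : ℝ} (hγ : PiecewiseC1 γ c d) (hcd : c ≤ d)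
    (hF : ContinuousOn F (γ '' Icc c d)) (hG : ContinuousOn G (γ '' Icc c d)) :
    lineInt (fun w => F w + G w) γ c d = lineInt F γ c d + lineInt G γ c d := by
  rw [lineInt, lineInt, lineInt, ← intervalIntegral.integral_add (hγ.intervalIntegrable hcd hF)
    (hγ.intervalIntegrable hcd hG)]
  simp only [add_mul]

theorem lineInt_const_mul (a : ℂ) (F : ℂ → ℂ) (γ : ℝ → ℂ) (c d : ℝ) :
    lineInt (fun w => a * F w) γ c d = a * lineInt F γ c d := by
  rw [lineInt, lineInt, ← intervalIntegral.integral_const_mul]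
  simp only [mul_assoc]

theorem lineInt_congr {F G : ℂ → ℂ} {γ : ℝ → ℂ} {c d : ℝ} (hcd : c ≤ d)
    (h : EqOn F G (γ '' Icc c d)) : lineInt F γ c d = lineInt G γ c d := by
  refine intervalIntegral.integral_congr fun s hs => ?_
  rw [uIcc_of_le hcd] at hs
  simp only [h (mem_image_of_mem γ hs)]

theorem contDiff_vline (a : ℝ) : ContDiff ℝ 1 (vline a) :=
  contDiff_const.add (Complex.ofRealCLM.contDiff.mul contDiff_const)

theorem hasDerivAt_vline (a s : ℝ) : HasDerivAt (vline a) Complex.I s := by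
  have h : HasDerivAt (fun s : ℝ => (a : ℂ) + s * Complex.I) (1 * Complex.I) s :=
    ((Complex.ofRealCLM.hasDerivAt (x := s)).mul_const Complex.I).const_add (a : ℂ)
  rwa [one_mul] at h

theorem lineInt_vline (F : ℂ → ℂ) (a c d : ℝ) :
    lineInt F (vline a) c d = Complex.I * ∫ s in c..d, F (vline a s) := by
  rw [lineInt, ← intervalIntegral.integral_const_mul]
  simp only [(hasDerivAt_vline a _).deriv, mul_comm]

theorem piecewiseC1_vline (a c d : ℝ) : PiecewiseC1 (vline a) c d :=
  ⟨(contDiff_vline a).continuous.continuousOn, ∅, fun _ _ _ _ _ _ => (contDiff_vline a).contDiffOn⟩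

end LineIntegrals

namespace Contour

/-- The integral over the `n`-th closed curve. -/
def cycleInt (c : Contour) (a : ℝ) (n : ℕ) (F : ℂ → ℂ) : ℂ :=
  lineInt F (vline a) (-c.b n) (c.b n) - (c.mainInt F n + c.arcInt F n)

/-- The trace of the `n`-th closed curve. -/
def trace (c : Contour) (a : ℝ) (n : ℕ) : Set ℂ :=
  vline a '' Icc (-c.b n) (c.b n) ∪ c.Γ' '' Icc (c.p n) (c.q n) ∪
    (c.lower n '' Icc 0 1 ∪ c.upper n '' Icc 0 1)

variable {c : Contour} {a : ℝ} {U Q : Set ℂ}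

/-- The four pieces are matched at their end points, so the boundary values of a primitive cancel in
pairs. -/
theorem IsDeformation.isCycleIntegral (h : c.IsDeformation a U Q) (n : ℕ) :
    IsCycleIntegral (c.trace a n) (c.cycleInt a n) := by
  have hb : -c.b n ≤ c.b n := by linarith [h.b_pos n]
  have hpq := (h.p_lt_q n).le
  have hm := h.main_smooth _ _ (h.p_lt_q n)
  have hl := h.lower_smooth n
  have hu := h.upper_smooth n
  have hv := piecewiseC1_vline a (-c.b n) (c.b n)
  have s1 : vline a '' Icc (-c.b n) (c.b n) ⊆ c.trace a n := fun x hx => Or.inl (Or.inl hx)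
  have s2 : c.Γ' '' Icc (c.p n) (c.q n) ⊆ c.trace a n := fun x hx => Or.inl (Or.inr hx)
  have s3 : c.lower n '' Icc 0 1 ⊆ c.trace a n := fun x hx => Or.inr (Or.inl hx)
  have s4 : c.upper n '' Icc 0 1 ⊆ c.trace a n := fun x hx => Or.inr (Or.inr hx)
  refine ⟨?_, ?_, ?_, ?_, ?_⟩
  · exact ((isCompact_Icc.image_of_continuousOn hv.1).union
      (isCompact_Icc.image_of_continuousOn hm.1)).union
      ((isCompact_Icc.image_of_continuousOn hl.1).union
      (isCompact_Icc.image_of_continuousOn hu.1))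
  · intro F G hF hG
    simp only [cycleInt, mainInt, arcInt]
    rw [lineInt_add hv hb (hF.mono s1) (hG.mono s1), lineInt_add hm hpq (hF.mono s2) (hG.mono s2),
      lineInt_add hl zero_le_one (hF.mono s3) (hG.mono s3),
      lineInt_add hu zero_le_one (hF.mono s4) (hG.mono s4)]
    ring
  · intro k F
    simp only [cycleInt, mainInt, arcInt, lineInt_const_mul]
    ring
  · intro F G hFG
    simp only [cycleInt, mainInt, arcInt]
    rw [lineInt_congr hb (hFG.mono s1), lineInt_congr hpq (hFG.mono s2),
      lineInt_congr zero_le_one (hFG.mono s3), lineInt_congr zero_le_one (hFG.mono s4)]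
  · intro G g hg hG
    simp only [cycleInt, mainInt, arcInt]
    rw [hv.lineInt_eq_sub hb (hg.mono s1) fun w hw => hG w (s1 hw),
      hm.lineInt_eq_sub hpq (hg.mono s2) fun w hw => hG w (s2 hw),
      hl.lineInt_eq_sub zero_le_one (hg.mono s3) fun w hw => hG w (s3 hw),
      hu.lineInt_eq_sub zero_le_one (hg.mono s4) fun w hw => hG w (s4 hw),
      h.lower_start, h.lower_end, h.upper_start, h.upper_end]
    ring

/-- The general theorem yields a finite set `T` outside of which all winding numbers vanish. Points
of `T` may have winding number 0 as well; keeping those with winding number 1 gives exactly the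
enclosed points, and changes no sum because `once` leaves no third value. -/
theorem IsDeformation.residue_theorem (h : c.IsDeformation a U Q) (n : ℕ) {o : ℂ} (hU : IsOpen U)
    (hc : ∀ w ∈ U, ∀ t ∈ Icc (0 : ℝ) 1, o + t * (w - o) ∈ U) (hline : ∀ s, vline a s ∈ U \ Q)
    (hQ : ∀ D, IsCompact D → D ⊆ U → (D ∩ Q).Finite) :
    ∃ Λ : Finset ℂ, (Λ : Set ℂ) = c.enclosed a Q n ∧
      ∀ (f res : ℂ → ℂ), DifferentiableOn ℂ f (U \ Q) →
        (∀ z ∈ Q, ∃ ρ R : ℝ, 0 < ρ ∧ ρ < R ∧ Metric.ball z R \ {z} ⊆ U \ Q ∧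
          res z = (2 * Real.pi * Complex.I)⁻¹ * ∮ ζ in C(z, ρ), f ζ) →
        (2 * Real.pi * Complex.I)⁻¹ * lineInt f (vline a) (-c.b n) (c.b n) =
          (2 * Real.pi * Complex.I)⁻¹ * (c.mainInt f n + c.arcInt f n) + ∑ z ∈ Λ, res z := by
  classical
  have hsub : c.trace a n ⊆ U \ Q := by
    rintro x ((⟨s, -, rfl⟩ | ⟨s, -, rfl⟩) | (⟨s, hs, rfl⟩ | ⟨s, hs, rfl⟩))
    · exact hline s
    · exact h.main_mem s
    · exact h.lower_mem n s hs
    · exact h.upper_mem n s hs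
  obtain ⟨T, hTQ, hT0, hT⟩ := (h.isCycleIntegral n).residue_theorem hU hc hsub hQ
  have hw : ∀ z, c.winding a n z =
      (2 * Real.pi * Complex.I)⁻¹ * c.cycleInt a n (fun w => (w - z)⁻¹) := fun z => rfl
  refine ⟨T.filter fun z => c.winding a n z = 1, ?_, ?_⟩
  · ext z
    simp only [Finset.coe_filter, mem_ofPred_eq, enclosed]
    refine ⟨fun hz => ⟨hTQ hz.1, hz.2⟩, fun hz => ⟨?_, hz.2⟩⟩
    by_contra hzT
    have := hz.2
    rw [hw, hT0 z hz.1 hzT, mul_zero] at this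
    exact zero_ne_one this
  · intro f res hf hres
    have h1 := hT f res hf hres
    have h2 : ∑ z ∈ T with c.winding a n z = 1, res z = ∑ z ∈ T, res z * c.winding a n z := by
      rw [Finset.sum_filter]
      refine Finset.sum_congr rfl fun z hz => ?_
      rcases h.once n z (hTQ hz) with h0 | h0 <;> simp [h0]
    have h3 : c.cycleInt a n f =
        lineInt f (vline a) (-c.b n) (c.b n) - (c.mainInt f n + c.arcInt f n) := rfl
    rw [h2]
    simp only [hw]
    rw [h3] at h1
    have h4 : ∀ z, res z * ((2 * Real.pi * Complex.I)⁻¹ * c.cycleInt a n fun w => (w - z)⁻¹)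
        = (2 * Real.pi * Complex.I)⁻¹ * (res z * c.cycleInt a n fun w => (w - z)⁻¹) :=
      fun z => by ring
    simp only [h4]
    rw [← Finset.mul_sum, ← h1]
    ring

end Contour

/-! ### Compact perturbations of the identity on a Banach space -/

section Fredholm

variable {Z : Type*} [NormedAddCommGroup Z] [NormedSpace ℂ Z]

/-- The Fredholm alternative at the nonzero spectral value 1. -/
theorem IsCompactOperator.isUnit_one_sub_of_injective [CompleteSpace Z] {T : Z →L[ℂ] Z} (hT : IsCompactOperator T)
    (h : Function.Injective (1 - T : Z →L[ℂ] Z)) : IsUnit (1 - T) := by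
  rcases hT.hasEigenvalue_or_mem_resolventSet one_ne_zero with h1 | h1
  · exfalso
    obtain ⟨v, hv⟩ := h1.exists_hasEigenvector
    refine hv.2 (h ?_)
    have : T v = v := by simpa using hv.apply_eq_smul
    simp [this]
  · rw [spectrum.mem_resolventSet_iff] at h1
    simpa using h1

/-- `T` restricts to the identity of this kernel, so the identity of the kernel is compact. -/
theorem IsCompactOperator.finiteDimensional_ker_one_sub {T : Z →L[ℂ] Z}
    (hT : IsCompactOperator T) :
    FiniteDimensional ℂ (LinearMap.ker (1 - T : Z →L[ℂ] Z).toLinearMap) := by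
  set N := LinearMap.ker (1 - T : Z →L[ℂ] Z).toLinearMap
  have hmem : ∀ v ∈ N, T v = v := fun v hv => by
    have : v - T v = 0 := by simpa using LinearMap.mem_ker.1 hv
    exact (sub_eq_zero.1 this).symm
  have hN : ∀ v ∈ N, T.toLinearMap v ∈ N := fun v hv => by
    have : T.toLinearMap v = v := hmem v hv
    rwa [this]
  have hcl : IsClosed (N : Set Z) := ContinuousLinearMap.isClosed_ker (1 - T)
  have hc := IsCompactOperator.restrict (f := T.toLinearMap) hT hN hcl
  refine FiniteDimensional.of_isCompactOperator_id ?_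
  convert! hc using 1
  funext v
  exact Subtype.ext (hmem v v.2).symm

/-- A projection `P` onto the kernel N makes (1 - T, P) an isomorphism onto Z × N, which provides a
continuous right inverse `G` of 1 - T. Now G = 1 + TG is an injective compact perturbation of the
identity, hence bijective, and a bijective right inverse is two-sided. -/
theorem IsCompactOperator.injective_one_sub_of_surjective [CompleteSpace Z] {T : Z →L[ℂ] Z}
    (hT : IsCompactOperator T) (h : Function.Surjective (1 - T : Z →L[ℂ] Z)) :
    Function.Injective (1 - T : Z →L[ℂ] Z) := by
  have := hT.finiteDimensional_ker_one_sub
  set N := LinearMap.ker (1 - T : Z →L[ℂ] Z).toLinearMap with hN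
  obtain ⟨P, hP⟩ := Submodule.ClosedComplemented.of_finiteDimensional (𝕜 := ℂ) N
  set Φ : Z →L[ℂ] Z × N := (1 - T).prod P
  have hinj : LinearMap.ker Φ.toLinearMap = ⊥ := by
    rw [LinearMap.ker_eq_bot']
    intro x hx
    have h1 : (1 - T) x = 0 := congrArg Prod.fst hx
    have h2 : P x = 0 := congrArg Prod.snd hx
    have h3 := hP ⟨x, LinearMap.mem_ker.2 h1⟩
    rw [h2] at h3
    exact (congrArg Subtype.val h3).symm
  have hsurj : LinearMap.range Φ.toLinearMap = ⊤ := by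
    rw [LinearMap.range_eq_top]
    rintro ⟨y, k⟩
    obtain ⟨x, hx⟩ := h y
    refine ⟨x - P x + k, ?_⟩
    have h1 : ∀ v : N, (1 - T) (v : Z) = 0 := fun v => LinearMap.mem_ker.1 v.2
    refine Prod.ext ?_ ?_
    · change (1 - T) (x - P x + k) = y
      rw [map_add, map_sub, h1, h1, hx]; simp
    · change P (x - P x + k) = k
      rw [map_add, map_sub, hP, hP]; simp
  set e := ContinuousLinearEquiv.ofBijective Φ hinj hsurj
  set G : Z →L[ℂ] Z := (e.symm : Z × N →L[ℂ] Z).comp (ContinuousLinearMap.inl ℂ Z N)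
  have hG : ∀ y, (1 - T) (G y) = y := fun y => by
    have : Φ (e.symm (y, 0)) = (y, 0) := e.apply_symm_apply (y, 0)
    exact congrArg Prod.fst this
  have hG' : G = 1 - (-(T.comp G)) := by
    ext y
    have := hG y
    have h1 : (1 - T) (G y) = G y - T (G y) := rfl
    rw [h1] at this
    have h2 : (1 - (-(T.comp G)) : Z →L[ℂ] Z) y = y + T (G y) := by simp
    rw [h2]
    exact sub_eq_iff_eq_add.1 this
  have hc : IsCompactOperator (-(T.comp G) : Z →L[ℂ] Z) :=
    IsCompactOperator.neg (hT.comp_clm G)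
  have hGi : Function.Injective (1 - (-(T.comp G)) : Z →L[ℂ] Z) := by
    rw [← hG']
    exact Function.LeftInverse.injective hG
  have hGu := hc.isUnit_one_sub_of_injective hGi
  rw [← hG', ContinuousLinearMap.isUnit_iff_bijective] at hGu
  intro x x' hxx
  obtain ⟨y, rfl⟩ := hGu.2 x
  obtain ⟨y', rfl⟩ := hGu.2 x'
  rw [hG, hG] at hxx
  rw [hxx]

/-- A compact perturbation of the identity is invertible up to a finite rank perturbation. -/
theorem IsCompactOperator.exists_finiteRank_isUnit [CompleteSpace Z] {T : Z →L[ℂ] Z} (hT : IsCompactOperator T) :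
    ∃ (W : Submodule ℂ Z) (F : Z →L[ℂ] Z), FiniteDimensional ℂ W ∧ (∀ x, F x ∈ W) ∧
      IsUnit (1 - T + F) := by
  induction hn : Module.finrank ℂ (LinearMap.ker (1 - T : Z →L[ℂ] Z).toLinearMap)
    using Nat.strong_induction_on generalizing T with
  | _ n ih =>
    by_cases hinj : Function.Injective (1 - T : Z →L[ℂ] Z)
    · exact ⟨⊥, 0, inferInstance, by simp, by simpa using hT.isUnit_one_sub_of_injective hinj⟩
    have hns : ¬ Function.Surjective (1 - T : Z →L[ℂ] Z) := fun h =>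
      hinj (hT.injective_one_sub_of_surjective h)
    obtain ⟨v, hv⟩ : ∃ v, ∀ x, (1 - T) x ≠ v := by simpa [Function.Surjective] using hns
    obtain ⟨x₀, hx₀, hx₀'⟩ : ∃ x₀, (1 - T) x₀ = 0 ∧ x₀ ≠ 0 := by
      by_contra! hcon
      exact hinj ((injective_iff_map_eq_zero (1 - T : Z →L[ℂ] Z)).2 hcon)
    obtain ⟨l, hl⟩ := SeparatingDual.exists_ne_zero (R := ℂ) hx₀'
    -- A rank one correction with values outside the range of 1 - T and not vanishing on the kernel
    -- vector `x₀`. The corrected kernel is the old one intersected with ker l, so its dimension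
    -- drops strictly and the induction applies.
    set F' : Z →L[ℂ] Z := l.smulRight v with hF'
    have hF'c : IsCompactOperator F' := by
      have h1 : IsCompactOperator (ContinuousLinearMap.toSpanSingleton ℂ v : ℂ →L[ℂ] Z) :=
        isCompactOperator_of_locallyCompactSpace_rng _
      have h2 := h1.comp_clm l
      convert! h2 using 1
    have hT' : IsCompactOperator (T - F' : Z →L[ℂ] Z) := hT.sub hF'c
    have := hT.finiteDimensional_ker_one_sub
    have hlt : Module.finrank ℂ (LinearMap.ker (1 - (T - F') : Z →L[ℂ] Z).toLinearMap) < n := by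
      rw [← hn]
      refine Submodule.finrank_lt_finrank_of_lt (lt_of_le_of_ne ?_ ?_)
      · intro x hx
        have h1 : (1 - T) x + l x • v = 0 := by
          have : (1 - (T - F')) x = 0 := LinearMap.mem_ker.1 hx
          rw [← this]; simp [hF']; abel
        have h2 : l x = 0 := by
          by_contra hlx
          refine hv (-(l x)⁻¹ • x) ?_
          rw [map_smul, eq_neg_of_add_eq_zero_left h1, smul_neg, neg_smul, neg_neg, smul_smul,
            inv_mul_cancel₀ hlx, one_smul]
        rw [h2, zero_smul, add_zero] at h1
        exact LinearMap.mem_ker.2 h1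
      · intro heq
        have h1 : x₀ ∈ LinearMap.ker (1 - (T - F') : Z →L[ℂ] Z).toLinearMap := by
          rw [heq]; exact LinearMap.mem_ker.2 hx₀
        have h2 : (1 - T) x₀ + l x₀ • v = 0 := by
          have : (1 - (T - F')) x₀ = 0 := LinearMap.mem_ker.1 h1
          rw [← this]; simp [hF']; abel
        rw [hx₀, zero_add, smul_eq_zero] at h2
        rcases h2 with h2 | h2
        · exact hl h2
        · exact hv 0 (by rw [map_zero, h2])
    obtain ⟨W, F, hW, hF, hu⟩ := ih _ hlt hT' rfl
    refine ⟨W ⊔ ℂ ∙ v, F' + F, inferInstance, fun x => ?_, ?_⟩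
    · refine Submodule.add_mem _ (Submodule.mem_sup_right ?_) (Submodule.mem_sup_left (hF x))
      exact Submodule.smul_mem _ _ (Submodule.mem_span_singleton_self v)
    · convert! hu using 1
      abel

/-- With a finite rank `F` chosen at z₀, the operator A(z) = 1 - T(z) + F is invertible near z₀.
Then 1 - T(z) = A(z) - F has a kernel exactly when 1 - F A(z)⁻¹ has one on the finite-dimensional
range space `W`, and `d` is the determinant of the latter. -/
theorem exists_analyticAt_eq_zero_iff_not_injective [CompleteSpace Z] {T : ℂ → Z →L[ℂ] Z} {z₀ : ℂ}
    (hT : ∀ᶠ z in 𝓝 z₀, DifferentiableAt ℂ T z) (hc : IsCompactOperator (T z₀)) :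
    ∃ d : ℂ → ℂ, AnalyticAt ℂ d z₀ ∧
      ∀ᶠ z in 𝓝 z₀, d z = 0 ↔ ¬ Function.Injective (1 - T z : Z →L[ℂ] Z) := by
  obtain ⟨W, F, hW, hF, hu⟩ := hc.exists_finiteRank_isUnit
  set A : ℂ → Z →L[ℂ] Z := fun z => 1 - T z + F with hA
  have hAd : ∀ᶠ z in 𝓝 z₀, DifferentiableAt ℂ A z := hT.mono fun z hz =>
    ((differentiableAt_const _).sub hz).add (differentiableAt_const _)
  have hAu : ∀ᶠ z in 𝓝 z₀, IsUnit (A z) :=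
    hAd.self_of_nhds.continuousAt.eventually (Units.isOpen.mem_nhds hu)
  set FW : Z →L[ℂ] W := F.codRestrict W hF
  set G : ℂ → Z →L[ℂ] Z := fun z => Ring.inverse (A z) with hG
  have hGd : ∀ᶠ z in 𝓝 z₀, DifferentiableAt ℂ G z := by
    filter_upwards [hAd, hAu] with z h1 h2
    obtain ⟨u, hu⟩ := h2
    have : DifferentiableAt ℂ (Ring.inverse : (Z →L[ℂ] Z) → Z →L[ℂ] Z) (A z) := by
      rw [← hu]; exact differentiableAt_inverse u.isUnit
    exact this.comp z h1
  set M : ℂ → W →ₗ[ℂ] W := fun z => LinearMap.id - (FW.comp ((G z).comp W.subtypeL)).toLinearMap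
    with hM
  set b := Module.finBasis ℂ W
  refine ⟨fun z => LinearMap.det (M z), ?_, ?_⟩
  · rw [Complex.analyticAt_iff_eventually_differentiableAt]
    filter_upwards [hGd] with z hz
    have hdet : (fun z => LinearMap.det (M z)) = fun z => (LinearMap.toMatrix b b (M z)).det := by
      funext z; rw [LinearMap.det_toMatrix]
    rw [hdet]
    simp only [Matrix.det_apply]
    refine DifferentiableAt.fun_sum fun σ _ => DifferentiableAt.const_smul ?_ _
    refine DifferentiableAt.fun_finsetProd fun i _ => ?_
    simp only [LinearMap.toMatrix_apply]
    set l : W →L[ℂ] ℂ := LinearMap.toContinuousLinearMap (b.coord (σ i)) with hl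
    have : (fun z => (b.repr (M z (b i))) (σ i)) =
        fun z => l (b i) - l (FW (G z (b i : Z))) := by
      funext z
      simp [hl, hM]
    rw [this]
    have h1 : DifferentiableAt ℂ (fun z => G z (b i : Z)) z := by fun_prop
    fun_prop
  · filter_upwards [hAu] with z hz
    have hAG : ∀ x, A z (G z x) = x := fun x => by
      have := Ring.mul_inverse_cancel (A z) hz
      exact DFunLike.congr_fun this x
    have hGA : ∀ x, G z (A z x) = x := fun x => by
      have := Ring.inverse_mul_cancel (A z) hz
      exact DFunLike.congr_fun this x
    have hsub : ∀ x, (1 - T z) x = A z x - F x := fun x => by simp [hA]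
    have hMw : ∀ w : W, ((M z w : W) : Z) = w - F (G z w) := fun w => by
      simp [hM, FW]
    rw [LinearMap.det_eq_zero_iff_ker_ne_bot]
    refine not_congr ?_
    rw [LinearMap.ker_eq_bot', injective_iff_map_eq_zero]
    constructor
    · intro h x hx
      rw [hsub, sub_eq_zero] at hx
      have h1 : M z ⟨A z x, hx ▸ hF x⟩ = 0 := by
        refine Subtype.ext ?_
        rw [hMw]
        simp only [hGA]
        rw [hx, sub_self]; rfl
      have h2 : A z x = 0 := congrArg Subtype.val (h _ h1)
      rw [← hGA x, h2, map_zero]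
    · intro h w hw
      have h1 : (w : Z) - F (G z w) = 0 := by rw [← hMw, hw]; rfl
      have h2 := h (G z w) (by rw [hsub, hAG, h1])
      refine Subtype.ext ?_
      rw [← hAG w, h2, map_zero]; rfl

end Fredholm

/-! ### Discreteness of analytic zero sets -/

section Isolated

/-- If a subset of a connected open set is locally the zero set of an analytic function, then it is
discrete or everything. -/
theorem eventually_notMem_of_locally_zero_set {Ω N : Set ℂ} (hΩ : IsOpen Ω)
    (hΩc : IsPreconnected Ω)
    (h : ∀ z₀ ∈ Ω, ∃ d : ℂ → ℂ, AnalyticAt ℂ d z₀ ∧ ∀ᶠ z in 𝓝 z₀, d z = 0 ↔ z ∈ N) {z₁ : ℂ}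
    (h1 : z₁ ∈ Ω) (h1N : z₁ ∉ N) {z₀ : ℂ} (hz₀ : z₀ ∈ Ω) : ∀ᶠ z in 𝓝[≠] z₀, z ∉ N := by
  -- Isolated zeros give a dichotomy at every point. Points of either kind form open sets covering
  -- the connected Ω, and z₁ is of the second kind, so no point is of the first.
  have hdich : ∀ z₀ ∈ Ω, (∀ᶠ z in 𝓝 z₀, z ∈ N) ∨ ∀ᶠ z in 𝓝[≠] z₀, z ∉ N := by
    intro z hz
    obtain ⟨d, hd, hdN⟩ := h z hz
    rcases hd.eventually_eq_zero_or_eventually_ne_zero with h0 | h0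
    · left
      filter_upwards [h0, hdN] with w hw hw'
      exact hw'.1 hw
    · right
      filter_upwards [h0, hdN.filter_mono nhdsWithin_le_nhds] with w hw hw'
      exact fun hN => hw (hw'.2 hN)
  refine (hdich z₀ hz₀).resolve_left fun hz₀N => ?_
  have hA : IsOpen {z | ∀ᶠ w in 𝓝 z, w ∈ N} := isOpen_setOfPred_eventually_nhds
  have hB : IsOpen {z | z ∈ Ω ∧ ∀ᶠ w in 𝓝[≠] z, w ∉ N} := by
    rw [isOpen_iff_mem_nhds]
    rintro z ⟨hz, hzN⟩
    have h2 : ∀ᶠ w in 𝓝 z, ∀ᶠ v in 𝓝 w, v ≠ z → v ∉ N :=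
      eventually_eventually_nhds.2 (eventually_nhdsWithin_iff.1 hzN)
    filter_upwards [hΩ.mem_nhds hz, h2] with w hw hwN
    refine ⟨hw, ?_⟩
    by_cases hwz : w = z
    · rwa [hwz]
    · refine Filter.Eventually.filter_mono nhdsWithin_le_nhds ?_
      filter_upwards [hwN, isOpen_ne.mem_nhds hwz] with v hv hvz using hv hvz
  obtain ⟨z, -, hz1, -, hz2⟩ := hΩc _ _ hA hB
    (fun z hz => (hdich z hz).imp id fun h => ⟨hz, h⟩) ⟨z₀, hz₀, hz₀N⟩
    ⟨z₁, h1, h1, (hdich z₁ h1).resolve_left fun h => h1N h.self_of_nhds⟩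
  obtain ⟨w, hw1, hw2⟩ := ((hz1.filter_mono nhdsWithin_le_nhds).and hz2).exists
  exact hw2 hw1

theorem finite_inter_of_eventually_notMem {Ω N : Set ℂ}
    (h : ∀ z₀ ∈ Ω, ∀ᶠ z in 𝓝[≠] z₀, z ∉ N) {D : Set ℂ} (hD : IsCompact D) (hDΩ : D ⊆ Ω) :
    (D ∩ N).Finite := by
  choose! V hV hVo hzV using fun z hz => mem_nhds_iff.1 (eventually_nhdsWithin_iff.1 (h z hz))
  obtain ⟨t, htD, htc⟩ := hD.elim_nhds_subcover V fun z hz => (hVo z (hDΩ hz)).mem_nhds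
    (hzV z (hDΩ hz))
  refine t.finite_toSet.subset fun w hw => ?_
  obtain ⟨z, hz, hwz⟩ := mem_iUnion₂.1 (htc hw.1)
  by_contra hwt
  exact hV z (hDΩ (htD z hz)) hwz (fun h => hwt (h ▸ hz)) hw.2

end Isolated

/-! ### Banach spaces generated by compact disks -/

section LocallyConvex
open Bornology

universe u

variable {X : Type u} [AddCommGroup X] [Module ℂ X]

/-- The closed balls of `p` are the dilates of the compact set `B`. Boundedness of `B` makes `p` a
norm and `j` continuous. For completeness, a Cauchy sequence stays in a multiple of `B` and so has a
cluster point in X; closedness of (ε/2) • B turns this into convergence for `p`. -/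
theorem exists_banach_of_gauge [UniformSpace X] [IsUniformAddGroup X] [ContinuousSMul ℂ X]
    [T2Space X] {B : Set X} (hB : IsCompact B) {Z : Type u} [AddCommGroup Z] [Module ℂ Z]
    (p : Seminorm ℂ Z) (j : Z →ₗ[ℂ] X) (hj : Function.Injective j) (hrange : B ⊆ range j)
    (hball : ∀ (x : Z) (r : ℝ), 0 < r → (p x ≤ r ↔ ∃ b ∈ B, j x = (r : ℂ) • b)) :
    ∃ (Z : Type u) (_ : NormedAddCommGroup Z) (_ : NormedSpace ℂ Z) (_ : CompleteSpace Z)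
      (j : Z →L[ℂ] X), Function.Injective j ∧ j '' Metric.closedBall 0 1 = B := by
  have hp0 : ∀ x : Z, p x = 0 → x = 0 := by
    intro x hx
    have h1 : ∀ n : ℕ, ∃ b ∈ B, j x = ((1 / ((n : ℝ) + 1) : ℝ) : ℂ) • b := fun n =>
      (hball x _ (by positivity)).1 (by rw [hx]; positivity)
    choose b hb hxb using h1
    have hbdd : IsVonNBounded ℂ B :=
      (hB.totallyBounded).isVonNBounded ℂ
    have h2 : Tendsto (fun n : ℕ => ((1 / ((n : ℝ) + 1) : ℝ) : ℂ) • b n) atTop (𝓝 0) := by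
      refine hbdd.smul_tendsto_zero (Eventually.of_forall hb) ?_
      have := (Complex.continuous_ofReal.tendsto 0).comp
        tendsto_one_div_add_atTop_nhds_zero_nat
      simpa [Function.comp_def] using this
    have h3 : Tendsto (fun _ : ℕ => j x) atTop (𝓝 0) := by
      convert! h2 using 1
      funext n
      exact hxb n
    exact hj ((tendsto_nhds_unique tendsto_const_nhds h3).trans (map_zero j).symm)
  let _ : Norm Z := ⟨p⟩
  have hcore : NormedSpace.Core ℂ Z :=
    { norm_nonneg := fun x => apply_nonneg p x
      norm_smul := fun c x => map_smul_eq_mul p c x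
      norm_triangle := fun x y => map_add_le_add p x y
      norm_eq_zero_iff := fun x => ⟨hp0 x, fun h => by rw [h]; exact map_zero p⟩ }
  let nZ : NormedAddCommGroup Z := NormedAddCommGroup.ofCore hcore
  let sZ : NormedSpace ℂ Z := NormedSpace.ofCore hcore
  have hnorm : ∀ x : Z, ‖x‖ = p x := fun x => rfl
  have hcomplete : @CompleteSpace Z nZ.toUniformSpace := by
    refine Metric.complete_of_cauchySeq_tendsto fun v hv => ?_
    obtain ⟨M', hM'⟩ := hv.norm_bddAbove
    set M := max M' 1
    have hM0 : 0 < M := lt_max_of_lt_right one_pos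
    have hM : ∀ n, ‖v n‖ ≤ M := fun n => (hM' ⟨n, rfl⟩).trans (le_max_left _ _)
    have hMB : IsCompact ((fun b : X => (M : ℂ) • b) '' B) := hB.image (continuous_const_smul _)
    obtain ⟨x, ⟨b, hb, hbx⟩, hx⟩ := hMB.exists_mapClusterPt (u := fun n => j (v n)) (f := atTop) (by
      refine le_principal_iff.2 (mem_map.2 (Eventually.of_forall fun n => ?_))
      obtain ⟨b, hb, hbx⟩ := (hball (v n) M hM0).1 (hM n)
      exact ⟨b, hb, hbx.symm⟩)
    obtain ⟨b₀, hb₀⟩ := hrange hb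
    have hxZ : j ((M : ℂ) • b₀) = x := by rw [map_smul, hb₀]; exact hbx
    refine ⟨(M : ℂ) • b₀, ?_⟩
    rw [Metric.tendsto_atTop]
    intro ε hε
    obtain ⟨N, hN⟩ := Metric.cauchySeq_iff.1 hv (ε / 2) (half_pos hε)
    refine ⟨N, fun n hn => ?_⟩
    have hcl : IsClosed ((fun y : X => j (v n) - y) ⁻¹' ((fun b : X => ((ε / 2 : ℝ) : ℂ) • b) '' B)) :=
      (hB.image (continuous_const_smul _)).isClosed.preimage (by fun_prop)
    have hmem : x ∈ ((fun y : X => j (v n) - y) ⁻¹'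
        ((fun b : X => ((ε / 2 : ℝ) : ℂ) • b) '' B)) := by
      refine hcl.mem_of_frequently_of_tendsto (f := id) (b := 𝓝 x ⊓ map (fun n => j (v n)) atTop) ?_
        (tendsto_id'.2 inf_le_left) |> fun h => h
      have : NeBot (𝓝 x ⊓ map (fun n => j (v n)) atTop) := hx
      refine Eventually.frequently (Eventually.filter_mono inf_le_right ?_)
      rw [eventually_map]
      filter_upwards [eventually_ge_atTop N] with m hm
      have h1 : p (v n - v m) ≤ ε / 2 := by
        have := (hN n hn m hm).le
        rwa [dist_eq_norm, hnorm] at this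
      obtain ⟨b, hb, hbx⟩ := (hball _ _ (half_pos hε)).1 h1
      exact ⟨b, hb, hbx.symm.trans (map_sub j _ _)⟩
    obtain ⟨b', hb', hbx'⟩ := hmem
    have : p (v n - (M : ℂ) • b₀) ≤ ε / 2 := (hball _ _ (half_pos hε)).2
      ⟨b', hb', by rw [map_sub, hxZ]; exact hbx'.symm⟩
    rw [dist_eq_norm, hnorm]
    linarith
  have hunit : ∀ x : Z, x ∈ Metric.closedBall (0 : Z) 1 ↔ j x ∈ B := by
    intro x
    rw [mem_closedBall_zero_iff, hnorm, hball x 1 one_pos]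
    simp
  have hcont : @Continuous Z X nZ.toUniformSpace.toTopologicalSpace _ j := by
    have hbdd : IsVonNBounded ℂ B := (hB.totallyBounded).isVonNBounded ℂ
    refine continuous_of_continuousAt_zero j ?_
    rw [ContinuousAt, map_zero]
    intro V hV
    obtain ⟨r, hrV⟩ := absorbs_iff_norm.1 (hbdd hV)
    set q := max r 1
    have hq0 : 0 < q := lt_max_of_lt_right one_pos
    have hqc : (q : ℂ) ≠ 0 := Complex.ofReal_ne_zero.2 hq0.ne'
    refine mem_map.2 (mem_of_superset (Metric.ball_mem_nhds (0 : Z) (inv_pos.2 hq0)) fun y hy => ?_)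
    rw [mem_ball_zero_iff, hnorm] at hy
    obtain ⟨b, hb, hyb⟩ := (hball y _ (inv_pos.2 hq0)).1 hy.le
    obtain ⟨w, hw, hwb⟩ := hrV (q : ℂ) (by
      rw [Complex.norm_real, Real.norm_of_nonneg hq0.le]; exact le_max_left _ _) hb
    have hyw : j y = w := by
      rw [hyb, ← hwb]
      simp only [Complex.ofReal_inv]
      rw [smul_smul, inv_mul_cancel₀ hqc, one_smul]
    change j y ∈ V
    rwa [hyw]
  exact ⟨Z, nZ, sZ, hcomplete, ⟨j, hcont⟩, hj, by
    ext x
    constructor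
    · rintro ⟨y, hy, rfl⟩
      exact (hunit y).1 hy
    · intro hx
      obtain ⟨y, rfl⟩ := hrange hx
      exact ⟨y, (hunit _).2 hx, rfl⟩⟩

/-- The normed space generated by a bounded disk. -/
theorem exists_banach_disk [UniformSpace X] [IsUniformAddGroup X] [ContinuousSMul ℂ X]
    [T2Space X] {B : Set X} (hB : IsCompact B) (hconv : Convex ℝ B) (hbal : Balanced ℂ B)
    (hne : B.Nonempty) :
    ∃ (Z : Type u) (_ : NormedAddCommGroup Z) (_ : NormedSpace ℂ Z) (_ : CompleteSpace Z)
      (j : Z →L[ℂ] X), Function.Injective j ∧ j '' Metric.closedBall 0 1 = B := by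
  have h0 : (0 : X) ∈ B := hbal.zero_mem hne
  have hsm : ∀ {x : X} {r : ℂ}, x ∈ B → ‖r‖ ≤ 1 → r • x ∈ B := fun {x r} hx hr =>
    hbal r hr (smul_mem_smul_set hx)
  -- the span of `B`
  set E : Submodule ℂ X :=
    { carrier := {x | ∃ r : ℝ, 0 < r ∧ ∃ b ∈ B, x = (r : ℂ) • b}
      zero_mem' := ⟨1, one_pos, 0, h0, by simp⟩
      add_mem' := by
        rintro x y ⟨r, hr, b, hb, rfl⟩ ⟨s, hs, b', hb', rfl⟩
        refine ⟨r + s, by positivity, (r / (r + s)) • b + (s / (r + s)) • b', ?_, ?_⟩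
        · exact hconv hb hb' (by positivity) (by positivity) (by field_simp)
        · have e1 : ∀ (q : ℝ) (x : X), q • x = (q : ℂ) • x := fun q x => rfl
          rw [e1, e1, smul_add, smul_smul, smul_smul]
          have hrs : ((r : ℂ) + s) ≠ 0 := by
            rw [← Complex.ofReal_add, Complex.ofReal_ne_zero]; positivity
          congr 2
          · push_cast; field_simp
          · push_cast; field_simp
      smul_mem' := by
        rintro c x ⟨r, hr, b, hb, rfl⟩
        refine ⟨(‖c‖ + 1) * r, by positivity, (c / (‖c‖ + 1 : ℝ)) • b, hsm hb ?_, ?_⟩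
        · rw [norm_div, Complex.norm_real, Real.norm_of_nonneg (by positivity)]
          exact (div_le_one (by positivity)).2 (by linarith)
        · rw [smul_smul, smul_smul]
          congr 1
          have : ((‖c‖ + 1 : ℝ) : ℂ) ≠ 0 := Complex.ofReal_ne_zero.2 (by positivity)
          rw [Complex.ofReal_mul]
          field_simp }
    with hE
  have hBE : ∀ b ∈ B, b ∈ E := fun b hb => ⟨1, one_pos, b, hb, by simp⟩
  set s : Set E := {x | (x : X) ∈ B} with hs
  have hsb : Balanced ℂ s := by
    rintro a ha _ ⟨x, hx, rfl⟩
    exact hsm (x := (x : X)) hx ha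
  have hsc : Convex ℝ s := by
    intro x hx y hy a b ha hb hab
    exact hconv (x := (x : X)) hx (y := (y : X)) hy ha hb hab
  have habs : Absorbent ℝ s := by
    rw [absorbent_iff_forall_absorbs_singleton]
    rintro ⟨_, r, hr, b, hb, rfl⟩
    rw [absorbs_iff_norm]
    refine ⟨r, fun c hc => ?_⟩
    rw [singleton_subset_iff]
    have hc0 : c ≠ 0 := by rintro rfl; simp at hc; linarith
    rw [mem_smul_set_iff_inv_smul_mem₀ hc0]
    change c⁻¹ • ((r : ℂ) • b) ∈ B
    have e1 : ∀ (q : ℝ) (x : X), q • x = (q : ℂ) • x := fun q x => rfl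
    rw [e1, smul_smul]
    refine hsm hb ?_
    rw [← Complex.ofReal_mul, Complex.norm_real, norm_mul, norm_inv, Real.norm_of_nonneg hr.le]
    rw [inv_mul_le_iff₀ (norm_pos_iff.2 hc0)]
    linarith
  set p : Seminorm ℂ E := gaugeSeminorm hsb hsc habs with hp
  have hpg : ∀ x, p x = gauge s x := fun x => rfl
  have hclB : IsClosed B := hB.isClosed
  -- balls of `p`
  have hball : ∀ (x : E) (r : ℝ), 0 < r → (p x ≤ r ↔ ∃ b ∈ B, (x : X) = (r : ℂ) • b) := by
    intro x r hr
    constructor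
    · intro hx
      refine ⟨(r : ℂ)⁻¹ • (x : X), ?_, ?_⟩
      -- The gauge gives membership only for radii strictly above its value; as `B` is closed, the
      -- radii r + 1/(n + 1) may decrease to r.
      · have hseq : Tendsto (fun n : ℕ => ((r + 1 / ((n : ℝ) + 1) : ℝ) : ℂ)⁻¹ • (x : X)) atTop
            (𝓝 ((r : ℂ)⁻¹ • (x : X))) := by
          refine Tendsto.smul_const ?_ _
          refine Tendsto.inv₀ ?_ (Complex.ofReal_ne_zero.2 hr.ne')
          refine (Complex.continuous_ofReal.tendsto r).comp ?_
          simpa using tendsto_one_div_add_atTop_nhds_zero_nat.const_add r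
        refine hclB.mem_of_tendsto hseq (Eventually.of_forall fun n => ?_)
        have hlt : gauge s x < r + 1 / ((n : ℝ) + 1) := by
          rw [← hpg]
          have : 0 < 1 / ((n : ℝ) + 1) := by positivity
          linarith
        obtain ⟨b, hb0, hbr, y, hy, hyx⟩ := exists_lt_of_gauge_lt habs hlt
        have hxy : (x : X) = (b : ℂ) • (y : X) := by rw [← hyx]; rfl
        rw [hxy, smul_smul]
        refine hsm hy ?_
        rw [norm_mul, norm_inv, Complex.norm_real, Complex.norm_real,
          Real.norm_of_nonneg hb0.le, Real.norm_of_nonneg (hb0.trans hbr).le,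
          inv_mul_le_iff₀ (hb0.trans hbr)]
        linarith
      · rw [smul_smul, mul_inv_cancel₀ (Complex.ofReal_ne_zero.2 hr.ne'), one_smul]
    · rintro ⟨b, hb, hx⟩
      refine gauge_le_of_mem hr.le ⟨⟨b, hBE b hb⟩, hb, Subtype.ext hx.symm⟩
  exact exists_banach_of_gauge hB p E.subtype Subtype.val_injective
    (fun b hb => ⟨⟨b, hBE b hb⟩, rfl⟩) hball

end LocallyConvex

/-! ### Weak boundedness, weak derivatives and barrelledness -/

section LocallyConvex
open Bornology

universe u

theorem continuousSMul_real_of_complex {X : Type*} [AddCommGroup X] [Module ℂ X]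
    [TopologicalSpace X] [ContinuousSMul ℂ X] : ContinuousSMul ℝ X :=
  IsScalarTower.continuousSMul ℂ

-- The coefficients of a complex convex combination are nonnegative in the complex order, hence
-- real, so a basis of real convex neighbourhoods serves over ℂ too.
open scoped ComplexOrder in
theorem polynormableSpace_complex (X : Type*) [AddCommGroup X] [Module ℂ X] [TopologicalSpace X]
    [IsTopologicalAddGroup X] [ContinuousSMul ℂ X] [LocallyConvexSpace ℝ X] :
    PolynormableSpace ℂ X := by
  have : ContinuousSMul ℝ X := continuousSMul_real_of_complex
  have : LocallyConvexSpace ℂ X := by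
    rw [locallyConvexSpace_iff_exists_convex_subset_zero]
    intro U hU
    obtain ⟨V, hV, hVc, hVU⟩ :=
      (locallyConvexSpace_iff_exists_convex_subset_zero ℝ X).1 inferInstance U hU
    refine ⟨V, hV, ?_, hVU⟩
    intro x hx y hy a b ha hb hab
    obtain ⟨a', ha', rfl⟩ := RCLike.nonneg_iff_exists_ofReal.1 ha
    obtain ⟨b', hb', rfl⟩ := RCLike.nonneg_iff_exists_ofReal.1 hb
    exact hVc hx hy ha' hb' (by
      have := congrArg Complex.re hab
      simpa using this)
  infer_instance

/-- In a quasi-complete space a compact set lies in a compact disk. -/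
theorem IsCompact.exists_disk {X : Type*} [AddCommGroup X] [Module ℂ X] [UniformSpace X]
    [IsUniformAddGroup X] [ContinuousSMul ℂ X] [LocallyConvexSpace ℝ X]
    [QuasiCompleteSpace ℂ X] {s : Set X} (hs : IsCompact s) :
    ∃ B : Set X, IsCompact B ∧ Convex ℝ B ∧ Balanced ℂ B ∧ B.Nonempty ∧ s ⊆ B := by
  have : ContinuousSMul ℝ X := continuousSMul_real_of_complex
  -- The balanced hull first, as a compact image; its convex hull is totally bounded and
  -- quasi-completeness makes the closure compact. The point 0 is inserted so that the disk is
  -- nonempty even for empty `s`.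
  set s' : Set X := (fun p : ℂ × X => p.1 • p.2) '' (Metric.closedBall 0 1 ×ˢ insert 0 s)
  have hs' : IsCompact s' := ((isCompact_closedBall _ _).prod (hs.insert 0)).image continuous_smul
  have hbal : ∀ a : ℂ, ‖a‖ ≤ 1 → ∀ x ∈ s', a • x ∈ s' := by
    rintro a ha _ ⟨⟨c, x⟩, ⟨hc, hx⟩, rfl⟩
    refine ⟨⟨a * c, x⟩, ⟨?_, hx⟩, mul_smul _ _ _⟩
    rw [mem_closedBall_zero_iff] at hc ⊢
    rw [norm_mul]
    exact mul_le_one₀ ha (norm_nonneg _) hc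
  have hone : insert 0 s ⊆ s' := fun x hx => ⟨⟨1, x⟩, ⟨by simp, hx⟩, one_smul _ _⟩
  refine ⟨closure (convexHull ℝ s'), ?_, (convex_convexHull ℝ s').closure, ?_, ?_, ?_⟩
  · exact isCompact_closure_of_totallyBounded_quasiComplete (𝕜 := ℂ)
      hs'.totallyBounded.convexHull
  · refine Balanced.closure ?_
    rw [balanced_iff_smul_mem]
    intro a ha x hx
    have : convexHull ℝ s' ⊆ (fun x => a • x) ⁻¹' convexHull ℝ s' := by
      refine convexHull_min (fun x hx => subset_convexHull ℝ _ (hbal a ha x hx)) ?_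
      intro x hx y hy p q hp hq hpq
      change a • (p • x + q • y) ∈ convexHull ℝ s'
      rw [smul_add, smul_comm a, smul_comm a]
      exact convex_convexHull ℝ s' hx hy hp hq hpq
    exact this hx
  · exact ⟨(0 : X), subset_closure (subset_convexHull ℝ _ (hone (mem_insert _ _)))⟩
  · exact fun x hx => subset_closure (subset_convexHull ℝ _ (hone (mem_insert_of_mem _ hx)))

theorem Seminorm.exists_seminormed {X : Type u} [AddCommGroup X] [Module ℂ X]
    (p : Seminorm ℂ X) :
    ∃ (E : Type u) (_ : SeminormedAddCommGroup E) (_ : NormedSpace ℂ E) (e : X →ₗ[ℂ] E),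
      ∀ x, ‖e x‖ = p x :=
  let i : SeminormedAddCommGroup X := AddGroupSeminorm.toSeminormedAddCommGroup p.toAddGroupSeminorm
  ⟨X, i, { norm_smul_le := fun a b => (map_smul_eq_mul p a b).le }, LinearMap.id, fun _ => rfl⟩

/-- Uniform boundedness for the evaluations on the dual, which is complete whether or not `E` is;
Hahn–Banach recovers the norm of a vector from its evaluation. -/
theorem bounded_of_weakly_bounded {E : Type*} [SeminormedAddCommGroup E] [NormedSpace ℂ E]
    {ι : Type*} (v : ι → E) (h : ∀ l : E →L[ℂ] ℂ, ∃ M, ∀ i, ‖l (v i)‖ ≤ M) :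
    ∃ M, ∀ i, ‖v i‖ ≤ M := by
  obtain ⟨M, hM⟩ := banach_steinhaus (E := E →L[ℂ] ℂ) (F := ℂ)
    (g := fun i => ContinuousLinearMap.apply ℂ ℂ (v i)) h
  refine ⟨M, fun i => ?_⟩
  obtain ⟨l, hl, hli⟩ := exists_dual_vector'' ℂ (v i)
  have h1 := (ContinuousLinearMap.apply ℂ ℂ (v i)).le_opNorm l
  have h2 : ‖(ContinuousLinearMap.apply ℂ ℂ (v i)) l‖ = ‖v i‖ := by
    change ‖l (v i)‖ = _
    rw [hli]; simp
  rw [h2] at h1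
  refine h1.trans ((mul_le_of_le_one_right (norm_nonneg _) hl).trans (hM i))

/-- Weakly bounded families are bounded for each continuous seminorm. -/
theorem Seminorm.bounded_of_weakly_bounded {X : Type*} [AddCommGroup X] [Module ℂ X]
    [TopologicalSpace X] [IsTopologicalAddGroup X] {ι : Type*} (v : ι → X)
    (h : ∀ l : X →L[ℂ] ℂ, ∃ M, ∀ i, ‖l (v i)‖ ≤ M) (p : Seminorm ℂ X) (hp : Continuous p) :
    ∃ M, ∀ i, p (v i) ≤ M := by
  obtain ⟨E, _, _, e, he⟩ := p.exists_seminormed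
  have hcont : Continuous e := by
    refine continuous_of_continuousAt_zero e ?_
    rw [ContinuousAt, map_zero, tendsto_zero_iff_norm_tendsto_zero]
    simp only [he]
    have := hp.tendsto 0
    rwa [map_zero] at this
  obtain ⟨M, hM⟩ := _root_.bounded_of_weakly_bounded (fun i => e (v i)) fun l =>
    h (l.comp ⟨e, hcont⟩)
  exact ⟨M, fun i => he (v i) ▸ hM i⟩

/-- A weakly holomorphic map into a quasi-complete space is weakly differentiable with derivative in the space. -/
theorem exists_weak_deriv {X : Type*} [AddCommGroup X] [Module ℂ X] [UniformSpace X]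
    [IsUniformAddGroup X] [ContinuousSMul ℂ X] [LocallyConvexSpace ℝ X] [QuasiCompleteSpace ℂ X]
    [T2Space X] (y : ℂ → X) (h : ∀ l : X →L[ℂ] ℂ, Differentiable ℂ (fun z => l (y z))) :
    ∃ y' : ℂ → X, ∀ (l : X →L[ℂ] ℂ) z, HasDerivAt (fun z => l (y z)) (l (y' z)) z := by
  have := polynormableSpace_complex X
  have hw := PolynormableSpace.withSeminorms ℂ X
  suffices H : ∀ z, ∃ w : X, ∀ l : X →L[ℂ] ℂ, HasDerivAt (fun z => l (y z)) (l w) z by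
    choose y' hy' using H
    exact ⟨y', fun l z => hy' z l⟩
  intro z
  -- The shift by 2 keeps the increments below 1/2, the range in which the divided difference
  -- estimate for the unit ball is valid.
  set d : ℕ → ℂ := fun n => ((1 / ((n : ℝ) + 1 + 2) : ℝ) : ℂ)
  have hd0 : ∀ n, d n ≠ 0 := fun n => Complex.ofReal_ne_zero.2 (by positivity)
  have hd1 : ∀ n, ‖d n‖ < 1 / 2 := fun n => by
    rw [Complex.norm_real, Real.norm_of_nonneg (by positivity)]
    exact one_div_lt_one_div_of_lt (by norm_num) (by linarith [(Nat.cast_nonneg n : (0 : ℝ) ≤ n)])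
  have hd : Tendsto d atTop (𝓝 0) := by
    have := (tendsto_one_div_add_atTop_nhds_zero_nat (𝕜 := ℝ)).comp (tendsto_add_atTop_nat 2)
    have := (Complex.continuous_ofReal.tendsto 0).comp this
    refine (this.congr fun n => ?_).trans (by simp)
    simp only [Function.comp, d]
    push_cast
    ring_nf
  set q : ℕ → X := fun n => (d n)⁻¹ • (y (z + d n) - y z)
  have hlq : ∀ (l : X →L[ℂ] ℂ) n, l (q n) = dslope (fun z => l (y z)) z (z + d n) := by
    intro l n
    rw [dslope_of_ne _ (by simpa using hd0 n), slope_def_field]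
    simp only [q, map_smul, map_sub, smul_eq_mul, add_sub_cancel_left]
    rw [div_eq_inv_mul]
  -- the quotients are Lipschitz
  have hlip : ∀ p : Seminorm ℂ X, Continuous p → ∃ M, ∀ n m, p (q n - q m) ≤ M * ‖d n - d m‖ := by
    intro p hp
    -- The second divided differences are bounded after each functional, with a bound depending on
    -- the functional; this suffices for a bound in the seminorm `p`.
    obtain ⟨M, hM⟩ := p.bounded_of_weakly_bounded
      (fun nm : ℕ × ℕ => (d nm.1 - d nm.2)⁻¹ • (q nm.1 - q nm.2)) (by
        intro l
        have hc := (h l).continuous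
        obtain ⟨M, hM⟩ := ((isCompact_closedBall z 1).image hc).isBounded.exists_norm_le
        refine ⟨16 * M / 1 ^ 2, fun nm => ?_⟩
        have := norm_dslope_sub_dslope_le (r := 1) (h l).differentiableOn
          (fun w hw => hM _ ⟨w, Metric.ball_subset_closedBall hw, rfl⟩)
          (w := z + d nm.1) (v := z + d nm.2) (by simpa using hd1 nm.1) (by simpa using hd1 nm.2)
        rw [add_sub_add_left_eq_sub] at this
        rw [map_smul, map_sub, hlq, hlq, smul_eq_mul, norm_mul, norm_inv]
        rcases eq_or_ne (d nm.1) (d nm.2) with he | he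
        · simp only [he, sub_self, norm_zero, inv_zero, zero_mul]
          have : 0 ≤ M := (norm_nonneg _).trans (hM _ ⟨z, by simp, rfl⟩)
          positivity
        · rw [inv_mul_le_iff₀ (norm_pos_iff.2 (sub_ne_zero.2 he)), mul_comm]
          exact this) hp
    refine ⟨M, fun n m => ?_⟩
    rcases eq_or_ne (d n) (d m) with he | he
    · have : q n = q m := by simp only [q, he]
      rw [this, he]; simp
    · have h1 := hM (n, m)
      have h2 : 0 < ‖d n - d m‖ := norm_pos_iff.2 (sub_ne_zero.2 he)
      simp only [map_smul_eq_mul, norm_inv] at h1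
      rwa [inv_mul_le_iff₀ h2, mul_comm] at h1
  have hcau : CauchySeq q := by
    rw [CauchySeq, cauchy_map_iff]
    refine ⟨inferInstance, ?_⟩
    rw [uniformity_eq_comap_nhds_zero, tendsto_comap_iff, hw.tendsto_nhds]
    intro i ε hε
    obtain ⟨M, hM⟩ := hlip _ (hw.continuous_seminorm i)
    have hdd : Tendsto (fun x : ℕ × ℕ => M * ‖d x.2 - d x.1‖) (atTop ×ˢ atTop) (𝓝 0) := by
      have := ((hd.comp tendsto_snd).sub (hd.comp (tendsto_fst (f := atTop) (g := atTop)))).norm.const_mul M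
      simpa using this
    filter_upwards [hdd.eventually (gt_mem_nhds hε)] with x hx
    simp only [Function.comp, sub_zero]
    exact (hM _ _).trans_lt hx
  -- The range of a Cauchy sequence is totally bounded, so quasi-completeness is enough to provide
  -- the limit.
  have hcomp : IsComplete (closure (range q)) :=
    (isCompact_closure_of_totallyBounded_quasiComplete (𝕜 := ℂ)
      hcau.totallyBounded_range).isComplete
  obtain ⟨w, -, hw⟩ := cauchySeq_tendsto_of_isComplete hcomp
    (fun n => subset_closure (mem_range_self n)) hcau
  refine ⟨w, fun l => ?_⟩
  have h1 : HasDerivAt (fun z => l (y z)) (deriv (fun z => l (y z)) z) z := (h l z).hasDerivAt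
  have h2 : Tendsto (fun n => l (q n)) atTop (𝓝 (deriv (fun z => l (y z)) z)) := by
    simp only [hlq]
    have hc : ContinuousAt (dslope (fun z => l (y z)) z) z := continuousAt_dslope_same.2 (h l z)
    have := hc.tendsto.comp (f := fun n => z + d n) (x := atTop) (by simpa using hd.const_add z)
    rwa [dslope_same] at this
  rwa [tendsto_nhds_unique h2 ((l.continuous.tendsto w).comp hw)] at h1

/-- In a barrelled space a pointwise bounded family of continuous seminorms has a continuous
upper bound. -/
theorem exists_continuous_seminorm_bound {X : Type*} [AddCommGroup X] [Module ℂ X]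
    [TopologicalSpace X] [BarrelledSpace ℂ X] {ι : Type*} (p : ι → Seminorm ℂ X)
    (hp : ∀ i, Continuous (p i)) (h : ∀ x, ∃ M, ∀ i, p i x ≤ M) :
    ∃ q : Seminorm ℂ X, Continuous q ∧ ∀ i x, p i x ≤ q x := by
  have hb : BddAbove (range p) := by
    rw [Seminorm.bddAbove_range_iff]
    intro x
    obtain ⟨M, hM⟩ := h x
    exact ⟨M, by rintro _ ⟨i, rfl⟩; exact hM i⟩
  exact ⟨⨆ i, p i, by
    rw [Seminorm.coe_iSup_eq hb]; exact Seminorm.continuous_iSup p hp hb, fun i x => (le_ciSup hb i) x⟩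

/-- Pointwise summability with domination by a continuous seminorm gives summability in the
strong dual topology. -/
theorem hasSum_antiDual {X : Type*} [AddCommGroup X] [Module ℂ X] [TopologicalSpace X]
    {ι : Type*} {T : ι → AntiDual X} {F : AntiDual X} {q : Seminorm ℂ X} (hq : Continuous q)
    {v : ι → ℝ} (hv : Summable v) (hT : ∀ i φ, ‖T i φ‖ ≤ v i * q φ)
    (hF : ∀ φ, HasSum (fun i => T i φ) (F φ)) : HasSum T F := by
  classical
  unfold HasSum
  rw [← tendsto_sub_nhds_zero_iff,
    (ContinuousLinearMap.hasBasis_nhds_zero_of_basis Metric.nhds_basis_ball).tendsto_right_iff]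
  rintro ⟨B, ε⟩ ⟨hB, hε⟩
  simp only at hB hε
  obtain ⟨M, hM⟩ : ∃ M, ∀ φ ∈ B, q φ ≤ M := by
    have hV : q.ball 0 1 ∈ 𝓝 (0 : X) := by
      rw [Seminorm.ball_zero_eq]
      exact (isOpen_lt hq continuous_const).mem_nhds (by simp)
    obtain ⟨r, hr0, hr⟩ := (hB hV).exists_pos
    refine ⟨r, fun φ hφ => ?_⟩
    obtain ⟨w, hw, rfl⟩ := hr (r : ℂ) (by rw [Complex.norm_real, Real.norm_of_nonneg hr0.le]) hφ
    rw [Seminorm.mem_ball_zero] at hw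
    simp only [map_smul_eq_mul, Complex.norm_real, Real.norm_of_nonneg hr0.le]
    exact mul_le_of_le_one_right hr0.le hw.le
  have hM' : ∀ φ ∈ B, q φ ≤ |M| := fun φ hφ => (hM φ hφ).trans (le_abs_self M)
  have hlim : Tendsto (fun s : Finset ι => (∑' i, |v i| - ∑ i ∈ s, |v i|) * |M|) atTop (𝓝 0) := by
    have := ((hv.abs.hasSum.const_sub (∑' i, |v i|)) : Tendsto _ _ _).mul_const |M|
    simpa using this
  filter_upwards [hlim.eventually (gt_mem_nhds hε)] with s hs φ hφ
  simp only [mem_ball_zero_iff]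
  refine lt_of_le_of_lt ?_ hs
  have h1 : HasSum (fun i : {i // i ∉ s} => T i φ) (F φ - ∑ i ∈ s, T i φ) := by
    have := (s.hasSum_compl_iff (f := fun i => T i φ) (a := F φ - ∑ i ∈ s, T i φ)).2
      (by simpa using hF φ)
    exact this
  have h2 : HasSum (fun i : {i // i ∉ s} => |v i|) (∑' i, |v i| - ∑ i ∈ s, |v i|) := by
    have := (s.hasSum_compl_iff (f := fun i => |v i|) (a := ∑' i, |v i| - ∑ i ∈ s, |v i|)).2
      (by simpa using hv.abs.hasSum)
    exact this
  have h3 : (∑ i ∈ s, T i - F) φ = -(F φ - ∑ i ∈ s, T i φ) := by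
    simp
  change ‖(∑ i ∈ s, T i - F) φ‖ ≤ _
  rw [h3, norm_neg, ← h1.tsum_eq]
  refine tsum_of_norm_bounded (h2.mul_right |M|) fun i => ?_
  refine (hT i φ).trans ?_
  exact mul_le_mul (le_abs_self _) (hM' φ hφ) (apply_nonneg q φ) (abs_nonneg _)

end LocallyConvex

/-! ### The resolvent of iH from the graph of a self-adjoint operator -/

section SelfAdjoint

variable {𝓗 : Type*} [NormedAddCommGroup 𝓗] [InnerProductSpace ℂ 𝓗] [CompleteSpace 𝓗]
  {H : 𝓗 →ₗ.[ℂ] 𝓗}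

namespace IsSelfAdjoint

theorem inner_graph (hH : IsSelfAdjoint H) {v w v' w' : 𝓗} (h : (v, w) ∈ H.graph)
    (h' : (v', w') ∈ H.graph) : inner ℂ w v' = inner ℂ v w' := by
  rw [LinearPMap.mem_graph_iff] at h h'
  obtain ⟨x, rfl, rfl⟩ := h
  obtain ⟨y, rfl, rfl⟩ := h'
  have h1 := LinearPMap.adjoint_isFormalAdjoint hH.dense_domain
  rw [LinearPMap.isSelfAdjoint_def.1 hH] at h1
  exact h1 x y

theorem mem_graph_of_inner (hH : IsSelfAdjoint H) {v w : 𝓗}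
    (h : ∀ v' w', (v', w') ∈ H.graph → inner ℂ w v' = inner ℂ v w') : (v, w) ∈ H.graph := by
  have h1 : ∀ x : H.domain, inner ℂ w (x : 𝓗) = inner ℂ v (H x) := fun x => h _ _ (H.mem_graph x)
  have h2 := LinearPMap.mem_adjoint_domain_of_exists v ⟨w, h1⟩
  have h3 := LinearPMap.adjoint_apply_eq hH.dense_domain ⟨v, h2⟩ h1
  have h4 := (H.adjoint).mem_graph ⟨v, h2⟩
  rw [h3] at h4
  change (v, w) ∈ _ at h4
  rwa [LinearPMap.isSelfAdjoint_def.1 hH] at h4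

theorem re_inner_graph (hH : IsSelfAdjoint H) {v w : 𝓗} (h : (v, w) ∈ H.graph) :
    (inner ℂ v w).im = 0 := by
  have h1 := hH.inner_graph h h
  rw [← inner_conj_symm] at h1
  exact Complex.conj_eq_iff_im.1 h1

theorem re_inner_I_graph (hH : IsSelfAdjoint H) {v w : 𝓗} (h : (v, w) ∈ H.graph) :
    (inner ℂ v (Complex.I • w)).re = 0 := by
  rw [inner_smul_right]
  simp [hH.re_inner_graph h]

/-- The inner product of `v` with i H v is imaginary, so that of `v` with z v - i H v has real part
Re z ‖v‖²; then Cauchy–Schwarz. -/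
theorem norm_le_of_graph (hH : IsSelfAdjoint H) {v w : 𝓗} (h : (v, w) ∈ H.graph) (z : ℂ) :
    |z.re| * ‖v‖ ≤ ‖z • v - Complex.I • w‖ := by
  have h1 : (inner ℂ v (z • v - Complex.I • w)).re = z.re * ‖v‖ ^ 2 := by
    rw [inner_sub_right, Complex.sub_re, hH.re_inner_I_graph h, inner_smul_right,
      inner_self_eq_norm_sq_to_K, sub_zero]
    have e : (((‖v‖ : ℝ) : ℂ)) ^ 2 = ((‖v‖ ^ 2 : ℝ) : ℂ) := by push_cast; rfl
    exact (congrArg (fun c => (z * c).re) e).trans (by simp [-Complex.ofReal_pow])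
  have h2 := (Complex.abs_re_le_norm _).trans (norm_inner_le_norm (𝕜 := ℂ) v (z • v - Complex.I • w))
  rw [h1, abs_mul, abs_of_nonneg (by positivity : 0 ≤ ‖v‖ ^ 2)] at h2
  rcases (norm_nonneg v).eq_or_lt with hv | hv
  · rw [← hv]; simp
  · nlinarith

theorem isClosed_graph (hH : IsSelfAdjoint H) {u : ℕ → 𝓗 × 𝓗} {p : 𝓗 × 𝓗}
    (hu : ∀ n, u n ∈ H.graph) (h : Tendsto u atTop (𝓝 p)) : p ∈ H.graph := by
  refine hH.mem_graph_of_inner fun v' w' h' => ?_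
  have h1 : Tendsto (fun n => inner ℂ (u n).2 v') atTop (𝓝 (inner ℂ p.2 v')) :=
    ((continuous_snd.tendsto p).comp h).inner tendsto_const_nhds
  have h2 : Tendsto (fun n => inner ℂ (u n).1 w') atTop (𝓝 (inner ℂ p.1 w')) :=
    ((continuous_fst.tendsto p).comp h).inner tendsto_const_nhds
  exact tendsto_nhds_unique h1 (h2.congr fun n => (hH.inner_graph (hu n) h').symm)

/-- The range of z - iH is closed by the lower bound and closedness of the graph. A vector
orthogonal to it would be an eigenvector of H for i z̄, whose imaginary part Re z is nonzero. -/
theorem exists_graph_eq (hH : IsSelfAdjoint H) {z : ℂ} (hz : z.re ≠ 0) (y : 𝓗) :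
    ∃ v w, (v, w) ∈ H.graph ∧ z • v - Complex.I • w = y := by
  have hz' : 0 < |z.re| := abs_pos.2 hz
  let T : 𝓗 × 𝓗 →ₗ[ℂ] 𝓗 :=
    z • LinearMap.fst ℂ 𝓗 𝓗 - Complex.I • LinearMap.snd ℂ 𝓗 𝓗
  have hT : ∀ p, T p = z • p.1 - Complex.I • p.2 := fun p => rfl
  set G : Submodule ℂ 𝓗 := H.graph.map T with hG
  have hcl : IsClosed (G : Set 𝓗) := by
    rw [← isSeqClosed_iff_isClosed]
    intro y' p hy' hp
    choose q hq hqy using hy'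
    have hc : CauchySeq fun n => (q n).1 := by
      have hcy := hp.cauchySeq
      rw [Metric.cauchySeq_iff] at hcy ⊢
      intro ε hε
      obtain ⟨N, hN⟩ := hcy (|z.re| * ε) (by positivity)
      refine ⟨N, fun m hm n hn => ?_⟩
      have h1 := hN m hm n hn
      have h2 := hH.norm_le_of_graph (v := (q m - q n).1) (w := (q m - q n).2)
        (H.graph.sub_mem (hq m) (hq n)) z
      have h3 : z • (q m - q n).1 - Complex.I • (q m - q n).2 = y' m - y' n := by
        rw [← hT, map_sub, hqy, hqy]
      rw [h3, ← dist_eq_norm] at h2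
      rw [dist_eq_norm, ← Prod.fst_sub]
      exact lt_of_mul_lt_mul_left (h2.trans_lt h1) hz'.le
    obtain ⟨v, hv⟩ := cauchySeq_tendsto_of_complete hc
    have hw : Tendsto (fun n => (q n).2) atTop (𝓝 (-Complex.I • (z • v - p))) := by
      refine (((hv.const_smul z).sub hp).const_smul (-Complex.I)).congr fun n => ?_
      rw [← hqy n, hT, sub_sub_cancel, smul_smul]
      simp
    have := hH.isClosed_graph hq (hv.prodMk_nhds hw)
    refine ⟨_, this, ?_⟩
    rw [hT]
    simp [smul_smul]
  have hbot : Gᗮ = ⊥ := by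
    rw [Submodule.eq_bot_iff]
    intro w hw
    rw [Submodule.mem_orthogonal'] at hw
    have h1 : (w, Complex.I • (starRingEnd ℂ z) • w) ∈ H.graph := by
      refine hH.mem_graph_of_inner fun v' w' h' => ?_
      have := hw (T (v', w')) ⟨_, h', rfl⟩
      rw [hT, inner_sub_right, inner_smul_right, inner_smul_right] at this
      simp only at this
      rw [inner_smul_left, inner_smul_left, Complex.conj_conj, Complex.conj_I, sub_eq_zero.1 this,
        ← mul_assoc]
      simp
    have h2 := hH.re_inner_graph h1
    rw [inner_smul_right, inner_smul_right, inner_self_eq_norm_sq_to_K] at h2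
    have h3 : (Complex.I * ((starRingEnd ℂ) z * ((‖w‖ : ℂ)) ^ 2)).im = z.re * ‖w‖ ^ 2 := by
      have e : (((‖w‖ : ℝ) : ℂ)) ^ 2 = ((‖w‖ ^ 2 : ℝ) : ℂ) := by push_cast; rfl
      rw [e]
      simp [-Complex.ofReal_pow]
    have h4 : z.re * ‖w‖ ^ 2 = 0 := h3 ▸ h2
    have := (mul_eq_zero.1 h4).resolve_left hz
    exact norm_eq_zero.1 (pow_eq_zero_iff two_ne_zero |>.1 this)
  have htop : G = ⊤ := by
    have := G.topologicalClosure_eq_top_iff.2 hbot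
    rwa [hcl.submodule_topologicalClosure_eq] at this
  have hy : y ∈ G := htop ▸ Submodule.mem_top
  obtain ⟨p, hp, hpy⟩ := hy
  exact ⟨p.1, p.2, hp, hpy⟩

/-- The resolvent `(z - iH)⁻¹`, specified on the graph of `H`. -/
theorem exists_resolvent (hH : IsSelfAdjoint H) {z : ℂ} (hz : z.re ≠ 0) :
    ∃ R : 𝓗 →L[ℂ] 𝓗, (∀ y, ∃ w, (R y, w) ∈ H.graph ∧ z • R y - Complex.I • w = y) ∧
      (∀ v w, (v, w) ∈ H.graph → R (z • v - Complex.I • w) = v) ∧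
      ∀ y, ‖R y‖ ≤ |z.re|⁻¹ * ‖y‖ := by
  have hz' : 0 < |z.re| := abs_pos.2 hz
  choose r w hr hrw using hH.exists_graph_eq hz
  have huniq : ∀ v w, (v, w) ∈ H.graph → r (z • v - Complex.I • w) = v := by
    intro v w₁ h
    have h1 := hH.norm_le_of_graph (H.graph.sub_mem (hr (z • v - Complex.I • w₁)) h) z
    have h2 : z • (r (z • v - Complex.I • w₁) - v) - Complex.I • (w (z • v - Complex.I • w₁) - w₁)
        = 0 := by
      rw [smul_sub, smul_sub, sub_sub_sub_comm, hrw, sub_self]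
    rw [h2, norm_zero] at h1
    have : ‖r (z • v - Complex.I • w₁) - v‖ ≤ 0 := by
      by_contra hc
      push Not at hc
      nlinarith [mul_pos hz' hc]
    exact sub_eq_zero.1 (norm_le_zero_iff.1 this)
  have hbound : ∀ y, ‖r y‖ ≤ |z.re|⁻¹ * ‖y‖ := by
    intro y
    have := hH.norm_le_of_graph (hr y) z
    rw [hrw] at this
    rwa [le_inv_mul_iff₀ hz']
  let R₀ : 𝓗 →ₗ[ℂ] 𝓗 :=
    { toFun := r
      map_add' := fun a b => by
        have := huniq _ _ (H.graph.add_mem (hr a) (hr b))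
        rw [← this]
        congr 1
        simp only [smul_add]
        rw [add_sub_add_comm, hrw, hrw]
      map_smul' := fun c a => by
        have := huniq _ _ (H.graph.smul_mem c (hr a))
        simp only [RingHom.id_apply]
        rw [← this]
        congr 1
        rw [smul_comm z, smul_comm Complex.I, ← smul_sub, hrw] }
  exact ⟨R₀.mkContinuous _ hbound, fun y => ⟨w y, hr y, hrw y⟩, huniq, hbound⟩

end IsSelfAdjoint

open Classical in
/-- The resolvent `(z - iH)⁻¹` of a self-adjoint operator `H`, for `Re z ≠ 0`. -/
def LinearPMap.skewResolvent (H : 𝓗 →ₗ.[ℂ] 𝓗) (z : ℂ) : 𝓗 →L[ℂ] 𝓗 :=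
  if h : IsSelfAdjoint H ∧ z.re ≠ 0 then (h.1.exists_resolvent h.2).choose else 0

namespace IsSelfAdjoint

variable (hH : IsSelfAdjoint H) {z : ℂ} (hz : z.re ≠ 0)
include hH hz

theorem skewResolvent_graph (y : 𝓗) :
    ∃ w, (H.skewResolvent z y, w) ∈ H.graph ∧ z • H.skewResolvent z y - Complex.I • w = y := by
  rw [LinearPMap.skewResolvent, dif_pos ⟨hH, hz⟩]
  exact (hH.exists_resolvent hz).choose_spec.1 y

theorem skewResolvent_apply {v w : 𝓗} (h : (v, w) ∈ H.graph) :
    H.skewResolvent z (z • v - Complex.I • w) = v := by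
  rw [LinearPMap.skewResolvent, dif_pos ⟨hH, hz⟩]
  exact (hH.exists_resolvent hz).choose_spec.2.1 v w h

theorem norm_skewResolvent_apply_le (y : 𝓗) : ‖H.skewResolvent z y‖ ≤ |z.re|⁻¹ * ‖y‖ := by
  rw [LinearPMap.skewResolvent, dif_pos ⟨hH, hz⟩]
  exact (hH.exists_resolvent hz).choose_spec.2.2 y

theorem inner_skewResolvent (a b : 𝓗) :
    inner ℂ (H.skewResolvent z a) b
      = -inner ℂ a (H.skewResolvent (-(starRingEnd ℂ z)) b) := by
  have hz' : (-(starRingEnd ℂ z)).re ≠ 0 := by simpa using hz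
  obtain ⟨w, hw, hwa⟩ := hH.skewResolvent_graph hz a
  obtain ⟨w', hw', hwb⟩ := hH.skewResolvent_graph hz' b
  have h1 := hH.inner_graph hw hw'
  conv_lhs => rw [← hwb]
  conv_rhs => rw [← hwa]
  rw [inner_sub_right, inner_sub_left, inner_smul_right, inner_smul_right, inner_smul_left,
    inner_smul_left, h1, Complex.conj_I]
  ring

end IsSelfAdjoint

end SelfAdjoint

/-! ### From the spectral measure to the resolvent -/

section Spectral

variable {𝓗 : Type*} [NormedAddCommGroup 𝓗] [InnerProductSpace ℂ 𝓗] [CompleteSpace 𝓗]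
  {H : 𝓗 →ₗ.[ℂ] 𝓗} {P : Set ℝ → 𝓗 →L[ℂ] 𝓗}

namespace IsSpectralMeasure

variable (hP : IsSpectralMeasure H P)
include hP

theorem inner_apply {B : Set ℝ} (hB : MeasurableSet B) (x y : 𝓗) :
    inner ℂ (P B x) y = inner ℂ x (P B y) := by
  have h1 := (hP.proj B hB).isSelfAdjoint
  conv_lhs => rw [← ContinuousLinearMap.isSelfAdjoint_iff'.1 h1]
  exact ContinuousLinearMap.adjoint_inner_left _ _ _

theorem apply_apply {B B' : Set ℝ} (hB : MeasurableSet B) (hB' : MeasurableSet B') (x : 𝓗) :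
    P B (P B' x) = P (B ∩ B') x := by
  rw [hP.inter B B' hB hB']; rfl

theorem empty : P ∅ = 0 := by
  ext x
  obtain ⟨μ, hμ, -⟩ := hP.scalar x
  have := hμ ∅ MeasurableSet.empty
  rw [measure_empty, eq_comm, ENNReal.ofReal_eq_zero] at this
  have h2 : ‖P ∅ x‖ = 0 := by nlinarith [norm_nonneg (P ∅ x)]
  simpa using h2

theorem apply_of_disjoint {B B' : Set ℝ} (hB : MeasurableSet B) (hB' : MeasurableSet B')
    (h : Disjoint B B') (x : 𝓗) : P B (P B' x) = 0 := by
  rw [hP.apply_apply hB hB', h.inter_eq, hP.empty]; rfl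

theorem norm_sq_eq {B : Set ℝ} (hB : MeasurableSet B) (x : 𝓗) :
    ‖P B x‖ ^ 2 = (inner ℂ x (P B x)).re := by
  have h1 : inner ℂ x (P B x) = inner ℂ (P B x) (P B x) := by
    rw [hP.inner_apply hB, hP.apply_apply hB hB, inter_self]
  rw [h1, inner_self_eq_norm_sq_to_K]
  have e : (((‖P B x‖ : ℝ) : ℂ)) ^ 2 = ((‖P B x‖ ^ 2 : ℝ) : ℂ) := by push_cast; rfl
  exact ((congrArg Complex.re e).trans (Complex.ofReal_re _)).symm

theorem norm_apply_le {B : Set ℝ} (hB : MeasurableSet B) (x : 𝓗) : ‖P B x‖ ≤ ‖x‖ := by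
  have h1 := hP.norm_sq_eq hB x
  have h2 := (Complex.re_le_norm _).trans (norm_inner_le_norm (𝕜 := ℂ) x (P B x))
  rw [← h1] at h2
  rcases (norm_nonneg (P B x)).eq_or_lt with h | h
  · rw [← h]; positivity
  · nlinarith

/-- The first moments of the scalar measures. -/
theorem exists_measure (x : 𝓗) : ∃ μ : Measure ℝ, IsFiniteMeasure μ ∧
    (∀ B, MeasurableSet B → μ.real B = ‖P B x‖ ^ 2) ∧
    ∀ w, (x, w) ∈ H.graph → Integrable (fun ω : ℝ => ω) μ ∧
      (inner ℂ x w).re = ∫ ω, ω ∂μ := by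
  obtain ⟨μ, hμ, hd, hm⟩ := hP.scalar x
  have hfin : IsFiniteMeasure μ := ⟨by rw [hμ _ MeasurableSet.univ]; exact ENNReal.ofReal_lt_top⟩
  refine ⟨μ, hfin, fun B hB => ?_, fun w hw => ?_⟩
  · rw [measureReal_def, hμ B hB, ENNReal.toReal_ofReal (by positivity)]
  · rw [LinearPMap.mem_graph_iff] at hw
    obtain ⟨⟨_, hx⟩, rfl, rfl⟩ := hw
    have h1 := hm hx
    refine ⟨?_, by simpa using congrArg Complex.re h1⟩
    have h2 : MemLp (fun ω : ℝ => ω) 2 μ := by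
      refine ⟨measurable_id.aestronglyMeasurable, ?_⟩
      rw [eLpNorm_lt_top_iff_lintegral_rpow_enorm_lt_top (by norm_num) (by norm_num)]
      refine lt_of_eq_of_lt (lintegral_congr fun ω => ?_) (hd.1 hx)
      rw [← ofReal_norm, ENNReal.ofReal_rpow_of_nonneg (norm_nonneg _) (by norm_num)]
      congr 1
      simp
    exact h2.integrable (by norm_num)

/-- The scalar measure of `v` is finite and carried by the bounded set `B`, so its second moment is
finite. -/
theorem exists_graph_of_apply_eq {B : Set ℝ} (hB : MeasurableSet B) {ω₀ ε : ℝ}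
    (hBε : B ⊆ Icc (ω₀ - ε) (ω₀ + ε)) {v : 𝓗} (hv : P B v = v) : ∃ w, (v, w) ∈ H.graph := by
  obtain ⟨μ, hμ, hd, -⟩ := hP.scalar v
  suffices h : v ∈ H.domain from ⟨_, H.mem_graph ⟨v, h⟩⟩
  rw [hd]
  have h0 : μ Bᶜ = 0 := by
    rw [hμ _ hB.compl, ← hv, hP.apply_of_disjoint hB.compl hB disjoint_compl_left]
    simp
  have hfin : IsFiniteMeasure μ := ⟨by rw [hμ _ MeasurableSet.univ]; exact ENNReal.ofReal_lt_top⟩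
  have h1 : ∀ᵐ ω ∂μ, ω ∈ B := by
    rw [ae_iff]; exact h0
  have h2 : ∫⁻ ω, ENNReal.ofReal (ω ^ 2) ∂μ ≤ ∫⁻ _, ENNReal.ofReal ((|ω₀| + ε) ^ 2) ∂μ := by
    refine lintegral_mono_ae (h1.mono fun ω hω => ENNReal.ofReal_le_ofReal ?_)
    obtain ⟨ha, hb⟩ := hBε hω
    rw [← sq_abs]
    refine pow_le_pow_left₀ (abs_nonneg _) (abs_le.2 ⟨?_, ?_⟩) 2
    · linarith [neg_abs_le ω₀]
    · linarith [le_abs_self ω₀]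
  refine h2.trans_lt ?_
  rw [lintegral_const]
  exact ENNReal.mul_lt_top ENNReal.ofReal_lt_top (measure_lt_top _ _)

/-- On the range of `P B`, with `B` close to `ω₀`, the operator `H` is close to `ω₀`. -/
theorem norm_graph_sub_le (hH : IsSelfAdjoint H) {B : Set ℝ} (hB : MeasurableSet B) {ω₀ ε : ℝ}
    (hε : 0 ≤ ε) (hBε : B ⊆ Icc (ω₀ - ε) (ω₀ + ε)) {v w : 𝓗} (hv : P B v = v)
    (hw : (v, w) ∈ H.graph) : ‖w - (ω₀ : ℂ) • v‖ ≤ ε * ‖v‖ := by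
  set w' := w - (ω₀ : ℂ) • v with hw'
  have hQ : ∀ a h, (a, h) ∈ H.graph → ∃ μ : Measure ℝ, IsFiniteMeasure μ ∧
      (∀ A, MeasurableSet A → μ.real A = ‖P A a‖ ^ 2) ∧ Integrable (fun ω : ℝ => ω - ω₀) μ ∧
      (inner ℂ a (h - (ω₀ : ℂ) • a)).re = ∫ ω, (ω - ω₀) ∂μ := by
    intro a h ha
    obtain ⟨μ, hμ, hm, hi⟩ := hP.exists_measure a
    obtain ⟨h1, h2⟩ := hi h ha
    refine ⟨μ, hμ, hm, h1.sub (integrable_const _), ?_⟩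
    rw [integral_sub h1 (integrable_const _), ← h2, integral_const, hm _ MeasurableSet.univ,
      hP.total, inner_sub_right, inner_smul_right, inner_self_eq_norm_sq_to_K, Complex.sub_re]
    have e : (((‖a‖ : ℝ) : ℂ)) ^ 2 = ((‖a‖ ^ 2 : ℝ) : ℂ) := by push_cast; rfl
    have := (congrArg (fun c => ((ω₀ : ℂ) * c).re) e)
    refine (congrArg₂ _ rfl this).trans ?_
    simp [-Complex.ofReal_pow, mul_comm]
  -- Only quadratic forms of H are known, so polarise. The scalar measures of y + v and y - v agree
  -- off `B`, where `v` has no mass, and on `B` the integrand ω - ω₀ is at most ε; the parallelogram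
  -- law adds the two bounds.
  have key : ∀ y h, (y, h) ∈ H.graph → 2 * (inner ℂ y w').re ≤ ε * (‖y‖ ^ 2 + ‖v‖ ^ 2) := by
    intro y h hy
    obtain ⟨μ, hμ, hμm, hμi, hμe⟩ := hQ _ _ (H.graph.add_mem hy hw)
    obtain ⟨ν, hν, hνm, hνi, hνe⟩ := hQ _ _ (H.graph.sub_mem hy hw)
    simp only at hμm hμe hνm hνe
    have hres : μ.restrict Bᶜ = ν.restrict Bᶜ := by
      refine Measure.ext fun A hA => ?_
      rw [Measure.restrict_apply hA, Measure.restrict_apply hA]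
      have hA' := hA.inter hB.compl
      have h0 : P (A ∩ Bᶜ) v = 0 := by
        rw [← hv]
        exact hP.apply_of_disjoint hA' hB (disjoint_compl_left.mono_left inter_subset_right) _
      have := hμm _ hA'
      have h2 := hνm _ hA'
      rw [map_add, h0, add_zero] at this
      rw [map_sub, h0, sub_zero, ← this] at h2
      exact (measureReal_eq_measureReal_iff).1 h2.symm
    have hB1 : ∀ (κ : Measure ℝ) (a : 𝓗), IsFiniteMeasure κ → κ.real B = ‖P B a‖ ^ 2 →
        |∫ ω in B, (ω - ω₀) ∂κ| ≤ ε * ‖a‖ ^ 2 := by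
      intro κ a hκ hκB
      have := norm_setIntegral_le_of_norm_le_const (μ := κ) (f := fun ω => ω - ω₀) (s := B) (C := ε)
        (measure_lt_top _ _) (fun ω hω => by
          obtain ⟨h1, h2⟩ := hBε hω
          exact abs_le.2 ⟨by linarith, by linarith⟩)
      rw [hκB] at this
      exact this.trans (mul_le_mul_of_nonneg_left
        (pow_le_pow_left₀ (norm_nonneg _) (hP.norm_apply_le hB a) 2) hε)
    have h1 : (inner ℂ (y + v) (h + w - (ω₀ : ℂ) • (y + v))).re
        - (inner ℂ (y - v) (h - w - (ω₀ : ℂ) • (y - v))).re = 4 * (inner ℂ y w').re := by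
      have e1 : h + w - (ω₀ : ℂ) • (y + v) = (h - (ω₀ : ℂ) • y) + w' := by
        rw [hw', smul_add]; abel
      have e2 : h - w - (ω₀ : ℂ) • (y - v) = (h - (ω₀ : ℂ) • y) - w' := by
        rw [hw', smul_sub]; abel
      have e3 : inner ℂ v (h - (ω₀ : ℂ) • y) = starRingEnd ℂ (inner ℂ y w') := by
        rw [inner_conj_symm, hw', inner_sub_right, inner_sub_left, ← hH.inner_graph hw hy,
          inner_smul_right, inner_smul_left, Complex.conj_ofReal]
      rw [e1, e2]
      generalize h - (ω₀ : ℂ) • y = k at e3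
      clear_value w'
      rw [inner_add_left, inner_sub_left, inner_add_right, inner_add_right,
        inner_sub_right, inner_sub_right, e3]
      simp only [Complex.add_re, Complex.sub_re, Complex.conj_re]
      ring
    rw [hμe, hνe, ← integral_add_compl hB hμi, ← integral_add_compl hB hνi, hres] at h1
    have h2 := hB1 μ _ hμ (hμm B hB)
    have h3 := hB1 ν _ hν (hνm B hB)
    have h4 := parallelogram_law_with_norm ℂ y v
    have h5 := abs_le.1 h2
    have h6 := abs_le.1 h3
    nlinarith
  have key' : ∀ y : 𝓗, 2 * (inner ℂ y w').re ≤ ε * (‖y‖ ^ 2 + ‖v‖ ^ 2) := by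
    intro y
    have hcl : IsClosed {y : 𝓗 | 2 * (inner ℂ y w').re ≤ ε * (‖y‖ ^ 2 + ‖v‖ ^ 2)} := by
      refine isClosed_le ?_ ?_
      · exact continuous_const.mul (Complex.continuous_re.comp (continuous_id.inner continuous_const))
      · fun_prop
    have := hH.dense_domain.closure_eq ▸ mem_univ y
    exact hcl.closure_subset_iff.2 (fun y hy => key y _ (H.mem_graph ⟨y, hy⟩)) this
  rcases (norm_nonneg w').eq_or_lt with h0 | h0
  · rw [← h0]; positivity
  -- The multiple of `w'` with the norm of `v`, which balances the two squares on the right.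
  · have h1 := key' (((‖v‖ / ‖w'‖ : ℝ) : ℂ) • w')
    rw [inner_smul_left, Complex.conj_ofReal, inner_self_eq_norm_sq_to_K, norm_smul,
      Complex.norm_real, Real.norm_of_nonneg (by positivity), div_mul_cancel₀ _ h0.ne'] at h1
    have e : (((‖w'‖ : ℝ) : ℂ)) ^ 2 = ((‖w'‖ ^ 2 : ℝ) : ℂ) := by push_cast; rfl
    have e2 := (congrArg (fun c => (((‖v‖ / ‖w'‖ : ℝ) : ℂ) * c).re) e)
    have e3 : 2 * (‖v‖ * ‖w'‖) ≤ ε * (‖v‖ ^ 2 + ‖v‖ ^ 2) := by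
      refine le_trans (le_of_eq ?_) h1
      refine Eq.trans ?_ (congrArg (fun c => 2 * c) e2).symm
      simp only [← Complex.ofReal_mul, Complex.ofReal_re]
      field_simp
    rcases (norm_nonneg v).eq_or_lt with hv0 | hv0
    · have hv' : v = 0 := norm_eq_zero.1 hv0.symm
      have hw0 : w = 0 := by
        have := hH.mem_graph_of_inner (v := v) (w := 0) (by intro a b _; rw [hv']; simp)
        have h2 := H.graph.sub_mem hw this
        simp only [Prod.mk_sub_mk, sub_self, sub_zero] at h2
        exact H.graph_fst_eq_zero_snd h2 rfl
      simp [hw', hw0, hv']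
    · nlinarith

/-- Write z v - i H v as (z - iω₀) v minus the small term i (H v - ω₀ v), and apply the resolvent.
The two factors |Re z|⁻¹ bound the resolvent and |z - iω₀|⁻¹. -/
theorem norm_skewResolvent_sub_le (hH : IsSelfAdjoint H) {z : ℂ} (hz : z.re ≠ 0) {B : Set ℝ}
    (hB : MeasurableSet B) {ω₀ ε : ℝ} (hε : 0 ≤ ε) (hBε : B ⊆ Icc (ω₀ - ε) (ω₀ + ε)) {v : 𝓗}
    (hv : P B v = v) :
    ‖H.skewResolvent z v - (z - Complex.I * ω₀)⁻¹ • v‖ ≤ |z.re|⁻¹ ^ 2 * ε * ‖v‖ := by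
  obtain ⟨w, hw⟩ := hP.exists_graph_of_apply_eq hB hBε hv
  have h1 := hP.norm_graph_sub_le hH hB hε hBε hv hw
  have hre : |z.re| ≤ ‖z - Complex.I * ω₀‖ := by
    refine le_trans (le_of_eq ?_) (Complex.abs_re_le_norm _)
    simp
  have hne : z - Complex.I * ω₀ ≠ 0 := by
    intro h
    rw [h, norm_zero] at hre
    exact hz (abs_nonpos_iff.1 hre)
  have h2 := hH.skewResolvent_apply hz hw
  have h3 : z • v - Complex.I • w = (z - Complex.I * ω₀) • v - Complex.I • (w - (ω₀ : ℂ) • v) := by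
    rw [sub_smul, smul_sub, smul_smul]; abel
  rw [h3, map_sub, map_smul, map_smul] at h2
  have h4 : H.skewResolvent z v - (z - Complex.I * ω₀)⁻¹ • v
      = (z - Complex.I * ω₀)⁻¹ • Complex.I • H.skewResolvent z (w - (ω₀ : ℂ) • v) := by
    rw [eq_comm, ← sub_eq_zero]
    rw [show Complex.I • H.skewResolvent z (w - (ω₀ : ℂ) • v)
      = (z - Complex.I * ω₀) • H.skewResolvent z v - v by rw [eq_sub_iff_add_eq, ← sub_eq_iff_eq_add'.1 h2]]
    rw [smul_sub, smul_smul, inv_mul_cancel₀ hne, one_smul, sub_self]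
  rw [h4, norm_smul, norm_smul, norm_inv, Complex.norm_I, one_mul]
  have h5 := (hH.norm_skewResolvent_apply_le hz (w - (ω₀ : ℂ) • v))
  have hz' : 0 < |z.re| := abs_pos.2 hz
  calc ‖z - Complex.I * ω₀‖⁻¹ * ‖H.skewResolvent z (w - (ω₀ : ℂ) • v)‖
      ≤ |z.re|⁻¹ * (|z.re|⁻¹ * (ε * ‖v‖)) := by
        refine mul_le_mul (inv_anti₀ hz' hre) (h5.trans ?_) (norm_nonneg _) (by positivity)
        exact mul_le_mul_of_nonneg_left h1 (by positivity)
    _ = _ := by ring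

end IsSpectralMeasure

end Spectral

section Spectral

variable {𝓗 : Type*} [NormedAddCommGroup 𝓗] [InnerProductSpace ℂ 𝓗] [CompleteSpace 𝓗]
  {H : 𝓗 →ₗ.[ℂ] 𝓗} {P : Set ℝ → 𝓗 →L[ℂ] 𝓗}

theorem abs_re_le_norm_sub_I_mul (z : ℂ) (ω : ℝ) : |z.re| ≤ ‖z - Complex.I * ω‖ := by
  refine le_trans (le_of_eq ?_) (Complex.abs_re_le_norm _)
  simp

theorem sub_I_mul_ne_zero {z : ℂ} (hz : z.re ≠ 0) (ω : ℝ) : z - Complex.I * ω ≠ 0 := by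
  intro h
  have := abs_re_le_norm_sub_I_mul z ω
  rw [h, norm_zero] at this
  exact hz (abs_nonpos_iff.1 this)

theorem norm_inv_sub_I_mul_le {z : ℂ} (hz : z.re ≠ 0) (ω : ℝ) :
    ‖(z - Complex.I * ω)⁻¹‖ ≤ |z.re|⁻¹ := by
  rw [norm_inv]
  exact inv_anti₀ (abs_pos.2 hz) (abs_re_le_norm_sub_I_mul z ω)

namespace IsSpectralMeasure

variable (hP : IsSpectralMeasure H P)
include hP

theorem norm_sub_sum_sq {κ : Type*} (s : Finset κ) {B : κ → Set ℝ}
    (hB : ∀ k, MeasurableSet (B k)) (hdisj : Pairwise (Function.onFun Disjoint B)) (x : 𝓗) :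
    ‖x - ∑ k ∈ s, P (B k) x‖ ^ 2 = ‖x‖ ^ 2 - ∑ k ∈ s, ‖P (B k) x‖ ^ 2 := by
  classical
  induction s using Finset.induction_on with
  | empty => simp
  | insert a s ha ih =>
    rw [Finset.sum_insert ha, Finset.sum_insert ha]
    set y := x - ∑ k ∈ s, P (B k) x with hy
    have h1 : x - (P (B a) x + ∑ k ∈ s, P (B k) x) = y - P (B a) x := by rw [hy]; abel
    have h2 : P (B a) y = P (B a) x := by
      rw [hy, map_sub, map_sum, Finset.sum_eq_zero fun k hk => ?_, sub_zero]
      exact hP.apply_of_disjoint (hB a) (hB k) (hdisj (fun h => ha (h ▸ hk))) x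
    have h3 : ‖y - P (B a) y‖ ^ 2 = ‖y‖ ^ 2 - ‖P (B a) y‖ ^ 2 := by
      have := norm_sub_sq (𝕜 := ℂ) y (P (B a) y)
      have h4 := hP.norm_sq_eq (hB a) y
      rw [this]
      change _ - 2 * (inner ℂ y (P (B a) y)).re + _ = _
      rw [← h4]; ring
    rw [h1, ← h2, h3, ih, h2]
    ring

/-- The 2(m+1)³ cells of length (m+1)⁻² cover [-(m+1), m+1), and by Pythagoras the squared defect is
the mass of the complement. The mesh is finer than the covering needs: in a later Cauchy–Schwarz
estimate the mesh size has to beat the square root of the number of cells. -/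
theorem tendsto_sum_apply (x : 𝓗) :
    Tendsto (fun m : ℕ => ∑ k ∈ Finset.Ico (-(((m + 1) ^ 3 : ℕ) : ℤ)) ((m + 1) ^ 3 : ℕ),
      P {ω : ℝ | ⌊ω * ((m : ℝ) + 1) ^ 2⌋ = k} x) atTop (𝓝 x) := by
  obtain ⟨μ, hμ, hμB, -⟩ := hP.exists_measure x
  rw [tendsto_iff_norm_sub_tendsto_zero]
  have hmeas : ∀ (m : ℕ) (k : ℤ), MeasurableSet {ω : ℝ | ⌊ω * ((m : ℝ) + 1) ^ 2⌋ = k} := fun m k =>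
    (Int.measurable_floor.comp (measurable_id.mul_const _)) (measurableSet_singleton k)
  have hdisj : ∀ m : ℕ, Pairwise (Function.onFun Disjoint
      (fun k : ℤ => {ω : ℝ | ⌊ω * ((m : ℝ) + 1) ^ 2⌋ = k})) := by
    intro m k k' hkk'
    rw [Function.onFun, Set.disjoint_left]
    intro ω h1 h2
    exact hkk' (h1.symm.trans h2)
  have hsq : Tendsto (fun m : ℕ => ‖x‖ ^ 2 -
      ∑ k ∈ Finset.Ico (-(((m + 1) ^ 3 : ℕ) : ℤ)) ((m + 1) ^ 3 : ℕ),
        ‖P {ω : ℝ | ⌊ω * ((m : ℝ) + 1) ^ 2⌋ = k} x‖ ^ 2) atTop (𝓝 0) := by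
    have h1 : ∀ m : ℕ, ∑ k ∈ Finset.Ico (-(((m + 1) ^ 3 : ℕ) : ℤ)) ((m + 1) ^ 3 : ℕ),
        ‖P {ω : ℝ | ⌊ω * ((m : ℝ) + 1) ^ 2⌋ = k} x‖ ^ 2
        = μ.real (⋃ k ∈ Finset.Ico (-(((m + 1) ^ 3 : ℕ) : ℤ)) ((m + 1) ^ 3 : ℕ),
            {ω : ℝ | ⌊ω * ((m : ℝ) + 1) ^ 2⌋ = k}) := by
      intro m
      rw [measureReal_biUnion_finset (fun k _ k' _ h => hdisj m h) (fun k _ => hmeas m k)]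
      exact Finset.sum_congr rfl fun k _ => (hμB _ (hmeas m k)).symm
    have h2 : ‖x‖ ^ 2 = μ.real univ := by rw [hμB _ MeasurableSet.univ, hP.total]; rfl
    simp only [h1, h2]
    have h3 : Tendsto (fun m : ℕ => μ.real (Ioo (-((m : ℝ) + 1)) ((m : ℝ) + 1))) atTop
        (𝓝 (μ.real univ)) := by
      have hU : ⋃ m : ℕ, Ioo (-((m : ℝ) + 1)) ((m : ℝ) + 1) = univ := by
        refine eq_univ_of_forall fun ω => mem_iUnion.2 ?_
        obtain ⟨n, hn⟩ := exists_nat_gt |ω|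
        have := abs_lt.1 hn
        exact ⟨n, by linarith [this.1], by linarith [this.2]⟩
      have hmono : Monotone fun m : ℕ => Ioo (-((m : ℝ) + 1)) ((m : ℝ) + 1) := by
        intro m n hmn
        have : (m : ℝ) ≤ n := Nat.cast_le.2 hmn
        exact Ioo_subset_Ioo (by linarith) (by linarith)
      have := tendsto_measure_iUnion_atTop (μ := μ) hmono
      rw [hU] at this
      exact (ENNReal.tendsto_toReal (measure_ne_top _ _)).comp this
    have h4 := h3.const_sub (μ.real univ)
    rw [sub_self] at h4
    refine squeeze_zero (fun m => sub_nonneg.2 (measureReal_mono (subset_univ _))) (fun m => ?_) h4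
    refine sub_le_sub_left (measureReal_mono ?_ (measure_ne_top _ _)) _
    intro ω hω
    simp only [mem_iUnion, Finset.mem_Ico, mem_ofPred_eq]
    have hm0 : (0 : ℝ) < (m : ℝ) + 1 := by positivity
    refine ⟨_, ⟨?_, ?_⟩, rfl⟩
    · rw [Int.le_floor]; push_cast; nlinarith [hω.1, sq_nonneg ((m : ℝ) + 1), pow_pos hm0 2]
    · rw [Int.floor_lt]; push_cast; nlinarith [hω.2, pow_pos hm0 2]
  have h5 : ∀ m : ℕ, ‖∑ k ∈ Finset.Ico (-(((m + 1) ^ 3 : ℕ) : ℤ)) ((m + 1) ^ 3 : ℕ),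
      P {ω : ℝ | ⌊ω * ((m : ℝ) + 1) ^ 2⌋ = k} x - x‖ = √(‖x‖ ^ 2 -
      ∑ k ∈ Finset.Ico (-(((m + 1) ^ 3 : ℕ) : ℤ)) ((m + 1) ^ 3 : ℕ),
        ‖P {ω : ℝ | ⌊ω * ((m : ℝ) + 1) ^ 2⌋ = k} x‖ ^ 2) := by
    intro m
    rw [← hP.norm_sub_sum_sq _ (hmeas m) (hdisj m), Real.sqrt_sq (norm_nonneg _), norm_sub_rev]
  simp only [h5]
  have := (Real.continuous_sqrt.tendsto 0).comp hsq
  rwa [Real.sqrt_zero] at this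

/-- The resolvent of `H` is given by the Cauchy integrals of the spectral density. -/
theorem inner_skewResolvent_eq_integral (hH : IsSelfAdjoint H) {z : ℂ} (hz : z.re ≠ 0)
    {I : Set ℝ} (hI : MeasurableSet I) {d : ℝ → ℂ} (hd : IntegrableOn d I) {x y : 𝓗}
    (h : ∀ B, MeasurableSet B → inner ℂ y (P B x) = ∫ ω in B ∩ I, d ω) :
    inner ℂ y (H.skewResolvent z x) = ∫ ω in I, (z - Complex.I * (ω : ℂ))⁻¹ * d ω := by
  have hz' : 0 < |z.re| := abs_pos.2 hz
  set B : ℕ → ℤ → Set ℝ := fun m k => {ω : ℝ | ⌊ω * ((m : ℝ) + 1) ^ 2⌋ = k} with hBdef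
  set s : ℕ → Finset ℤ := fun m => Finset.Ico (-(((m + 1) ^ 3 : ℕ) : ℤ)) ((m + 1) ^ 3 : ℕ)
    with hs
  set c : ℕ → ℤ → ℝ := fun m k => k / ((m : ℝ) + 1) ^ 2 with hc
  have hmeas : ∀ (m : ℕ) (k : ℤ), MeasurableSet (B m k) := fun m k =>
    (Int.measurable_floor.comp (measurable_id.mul_const _)) (measurableSet_singleton k)
  have hdisj : ∀ m : ℕ, Pairwise (Function.onFun Disjoint (B m)) := by
    intro m k k' hkk'
    rw [Function.onFun, Set.disjoint_left]
    intro ω h1 h2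
    exact hkk' (h1.symm.trans h2)
  have hfl : ∀ (m : ℕ) (ω : ℝ), |ω - c m ⌊ω * ((m : ℝ) + 1) ^ 2⌋| ≤ 1 / ((m : ℝ) + 1) ^ 2 := by
    intro m ω
    have hp : (0 : ℝ) < ((m : ℝ) + 1) ^ 2 := by positivity
    have h1 := Int.floor_le (ω * ((m : ℝ) + 1) ^ 2)
    have h2 := Int.lt_floor_add_one (ω * ((m : ℝ) + 1) ^ 2)
    rw [hc, abs_le]
    simp only
    constructor
    · rw [neg_le_sub_iff_le_add, div_le_iff₀ hp, add_mul, one_div_mul_cancel hp.ne']; linarith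
    · rw [sub_le_iff_le_add, ← add_div, le_div_iff₀ hp]; linarith
  have hBsub : ∀ m k, B m k ⊆ Icc (c m k - 1 / ((m : ℝ) + 1) ^ 2) (c m k + 1 / ((m : ℝ) + 1) ^ 2) := by
    intro m k ω hω
    have := hfl m ω
    rw [show ⌊ω * ((m : ℝ) + 1) ^ 2⌋ = k from hω] at this
    have := abs_le.1 this
    exact ⟨by linarith [this.1], by linarith [this.2]⟩
  -- the Riemann sums
  have hsum := hP.tendsto_sum_apply x
  have hlim1 : Tendsto (fun m => inner ℂ y (H.skewResolvent z (∑ k ∈ s m, P (B m k) x))) atTop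
      (𝓝 (inner ℂ y (H.skewResolvent z x))) :=
    tendsto_const_nhds.inner (((H.skewResolvent z).continuous.tendsto x).comp hsum)
  -- Each cell contributes an error of order (m+1)⁻² ‖P x‖. Cauchy–Schwarz over 2(m+1)³ cells, with
  -- ∑ ‖P x‖² ≤ ‖x‖², leaves a total of order (m+1)^(-1/2).
  have hlim2 : Tendsto (fun m => inner ℂ y (H.skewResolvent z (∑ k ∈ s m, P (B m k) x)) -
      ∑ k ∈ s m, (z - Complex.I * c m k)⁻¹ * inner ℂ y (P (B m k) x)) atTop (𝓝 0) := by
    have hb : ∀ m : ℕ, ‖inner ℂ y (H.skewResolvent z (∑ k ∈ s m, P (B m k) x)) -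
        ∑ k ∈ s m, (z - Complex.I * c m k)⁻¹ * inner ℂ y (P (B m k) x)‖ ≤
        ‖y‖ * (|z.re|⁻¹ ^ 2 * (√2 * ‖x‖)) * √(1 / ((m : ℝ) + 1)) := by
      intro m
      have e1 : inner ℂ y (H.skewResolvent z (∑ k ∈ s m, P (B m k) x)) -
          ∑ k ∈ s m, (z - Complex.I * c m k)⁻¹ * inner ℂ y (P (B m k) x) =
          inner ℂ y (∑ k ∈ s m, (H.skewResolvent z (P (B m k) x) -
            (z - Complex.I * c m k)⁻¹ • P (B m k) x)) := by
        rw [map_sum, inner_sum, inner_sum, ← Finset.sum_sub_distrib]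
        refine Finset.sum_congr rfl fun k _ => ?_
        rw [inner_sub_right, inner_smul_right]
      rw [e1, mul_assoc]
      refine (norm_inner_le_norm _ _).trans (mul_le_mul_of_nonneg_left ?_ (norm_nonneg _))
      have hm0 : (0 : ℝ) < (m : ℝ) + 1 := by positivity
      calc ‖∑ k ∈ s m, (H.skewResolvent z (P (B m k) x) - (z - Complex.I * c m k)⁻¹ • P (B m k) x)‖
          ≤ ∑ k ∈ s m, |z.re|⁻¹ ^ 2 * (1 / ((m : ℝ) + 1) ^ 2) * ‖P (B m k) x‖ := by
            refine norm_sum_le_of_le _ fun k _ => ?_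
            refine hP.norm_skewResolvent_sub_le hH hz (hmeas m k) (by positivity) (hBsub m k) ?_
            rw [hP.apply_apply (hmeas m k) (hmeas m k), inter_self]
        _ = |z.re|⁻¹ ^ 2 * (1 / ((m : ℝ) + 1) ^ 2) * ∑ k ∈ s m, ‖P (B m k) x‖ := by
            rw [Finset.mul_sum]
        _ ≤ |z.re|⁻¹ ^ 2 * (1 / ((m : ℝ) + 1) ^ 2) * (√(2 * ((m : ℝ) + 1) ^ 3) * ‖x‖) := by
            refine mul_le_mul_of_nonneg_left ?_ (by positivity)
            have h1 := sq_sum_le_card_mul_sum_sq (s := s m) (f := fun k => ‖P (B m k) x‖)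
            have h2 : ∑ k ∈ s m, ‖P (B m k) x‖ ^ 2 ≤ ‖x‖ ^ 2 := by
              have := hP.norm_sub_sum_sq (s m) (hmeas m) (hdisj m) x
              nlinarith [sq_nonneg ‖x - ∑ k ∈ s m, P (B m k) x‖]
            have h3 : ((s m).card : ℝ) = 2 * ((m : ℝ) + 1) ^ 3 := by
              rw [hs]
              simp only [Int.card_Ico, sub_neg_eq_add]
              rw [show (((m + 1) ^ 3 : ℕ) : ℤ) + (((m + 1) ^ 3 : ℕ) : ℤ)
                = ((2 * (m + 1) ^ 3 : ℕ) : ℤ) by push_cast; ring, Int.toNat_natCast]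
              push_cast; ring
            rw [h3] at h1
            refine abs_le_of_sq_le_sq' ?_ (by positivity) |>.2
            rw [mul_pow, Real.sq_sqrt (by positivity)]
            exact h1.trans (mul_le_mul_of_nonneg_left h2 (by positivity))
        _ = _ := by
            have e2 : √(2 * ((m : ℝ) + 1) ^ 3) = √2 * ((m : ℝ) + 1) ^ 2 * √(1 / ((m : ℝ) + 1)) := by
              rw [Real.sqrt_eq_iff_eq_sq (by positivity) (by positivity), mul_pow, mul_pow,
                Real.sq_sqrt (by positivity), Real.sq_sqrt (by positivity)]
              field_simp
            rw [e2]
            field_simp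
    have ht : Tendsto (fun m : ℕ => ‖y‖ * (|z.re|⁻¹ ^ 2 * (√2 * ‖x‖)) * √(1 / ((m : ℝ) + 1))) atTop
        (𝓝 0) := by
      have := ((Real.continuous_sqrt.tendsto 0).comp
        (tendsto_one_div_add_atTop_nhds_zero_nat (𝕜 := ℝ))).const_mul
          (‖y‖ * (|z.re|⁻¹ ^ 2 * (√2 * ‖x‖)))
      simpa [Function.comp_def] using this
    exact squeeze_zero_norm hb ht
  have hlim3 : Tendsto (fun m => ∑ k ∈ s m, (z - Complex.I * c m k)⁻¹ * inner ℂ y (P (B m k) x))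
      atTop (𝓝 (∫ ω in I, (z - Complex.I * (ω : ℂ))⁻¹ * d ω)) := by
    set D : ℕ → Set ℝ := fun m => {ω | ⌊ω * ((m : ℝ) + 1) ^ 2⌋ ∈ s m} with hD
    set F : ℕ → ℝ → ℂ := fun m ω => (D m).indicator
      (fun ω => (z - Complex.I * c m ⌊ω * ((m : ℝ) + 1) ^ 2⌋)⁻¹ * d ω) ω with hF
    have hDm : ∀ m, MeasurableSet (D m) := fun m =>
      (Int.measurable_floor.comp (measurable_id.mul_const _)) ((s m).measurableSet)
    have hstep : ∀ m, Measurable fun ω : ℝ =>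
        (z - Complex.I * c m ⌊ω * ((m : ℝ) + 1) ^ 2⌋)⁻¹ := fun m =>
      (measurable_from_top (f := fun k : ℤ => (z - Complex.I * c m k)⁻¹)).comp
        (Int.measurable_floor.comp (measurable_id.mul_const _))
    have e1 : ∀ m, ∑ k ∈ s m, (z - Complex.I * c m k)⁻¹ * inner ℂ y (P (B m k) x)
        = ∫ ω in I, F m ω := by
      intro m
      have hint : IntegrableOn (fun ω => (z - Complex.I * c m ⌊ω * ((m : ℝ) + 1) ^ 2⌋)⁻¹ * d ω) I :=
        hd.bdd_mul (c := |z.re|⁻¹) (hstep m).aestronglyMeasurable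
          (Eventually.of_forall fun ω => norm_inv_sub_I_mul_le hz _)
      have e2 : D m = ⋃ k ∈ s m, B m k := by
        ext ω; simp [hD, hBdef]
      rw [hF, setIntegral_indicator (hDm m), e2, inter_comm, iUnion₂_inter,
        integral_biUnion_finset _ (fun k _ => (hmeas m k).inter hI)
          (fun k _ k' _ hk => (hdisj m hk).mono inter_subset_left inter_subset_left)
          (fun k _ => hint.mono_set inter_subset_right)]
      refine Finset.sum_congr rfl fun k _ => ?_
      rw [h _ (hmeas m k), ← integral_const_mul]
      refine setIntegral_congr_fun ((hmeas m k).inter hI) fun ω hω => ?_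
      change (z - Complex.I * c m k)⁻¹ * d ω
        = (z - Complex.I * c m ⌊ω * ((m : ℝ) + 1) ^ 2⌋)⁻¹ * d ω
      rw [show ⌊ω * ((m : ℝ) + 1) ^ 2⌋ = k from hω.1]
    simp only [e1]
    refine tendsto_integral_of_dominated_convergence (fun ω => |z.re|⁻¹ * ‖d ω‖) ?_
      (hd.norm.const_mul _) ?_ ?_
    · intro m
      exact (((hstep m).aestronglyMeasurable).mul hd.aestronglyMeasurable).indicator (hDm m)
    · intro m
      refine Eventually.of_forall fun ω => ?_
      refine (norm_indicator_le_norm_self _ _).trans ?_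
      rw [norm_mul]
      exact mul_le_mul_of_nonneg_right (norm_inv_sub_I_mul_le hz _) (norm_nonneg _)
    · refine Eventually.of_forall fun ω => ?_
      have h1 : Tendsto (fun m : ℕ => c m ⌊ω * ((m : ℝ) + 1) ^ 2⌋) atTop (𝓝 ω) := by
        rw [tendsto_iff_norm_sub_tendsto_zero]
        have h2 : Tendsto (fun m : ℕ => 1 / ((m : ℝ) + 1) ^ 2) atTop (𝓝 0) := by
          have := (tendsto_one_div_add_atTop_nhds_zero_nat (𝕜 := ℝ)).pow 2
          simpa using this
        refine squeeze_zero (fun _ => norm_nonneg _) (fun m => ?_) h2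
        rw [Real.norm_eq_abs, abs_sub_comm]
        exact hfl m ω
      have h2 : Tendsto (fun m : ℕ => (z - Complex.I * c m ⌊ω * ((m : ℝ) + 1) ^ 2⌋)⁻¹ * d ω) atTop
          (𝓝 ((z - Complex.I * (ω : ℂ))⁻¹ * d ω)) := by
        refine Tendsto.mul_const _ (Tendsto.inv₀ ?_ (sub_I_mul_ne_zero hz ω))
        exact (((Complex.continuous_ofReal.tendsto ω).comp h1).const_mul _).const_sub _
      refine h2.congr' ?_
      obtain ⟨N, hN⟩ := exists_nat_gt |ω|
      filter_upwards [eventually_ge_atTop N] with m hm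
      have hmN : (N : ℝ) ≤ m := Nat.cast_le.2 hm
      have hω := abs_lt.1 hN
      have hm0 : (0 : ℝ) < (m : ℝ) + 1 := by positivity
      have : ω ∈ D m := by
        simp only [hD, hs, mem_ofPred_eq, Finset.mem_Ico]
        constructor
        · rw [Int.le_floor]; push_cast; nlinarith [hω.1, pow_pos hm0 2]
        · rw [Int.floor_lt]; push_cast; nlinarith [hω.2, pow_pos hm0 2]
      rw [hF]
      simp only
      rw [indicator_of_mem this]
  have hlim4 := hlim2.add hlim3
  simp only [sub_add_cancel, zero_add] at hlim4
  exact tendsto_nhds_unique hlim1 hlim4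

end IsSpectralMeasure

end Spectral

/-! ### Continuation of Cauchy integrals through the line of integration -/

section CauchyContinuation

/-- Dominated differentiation on the ball of half the distance to the poles `p s`. The measure and
the pole map are general so that spectral integrals and integrals over an arc of a circle are both
covered. -/
theorem hasDerivAt_integral_inv_sub {α : Type*} [MeasurableSpace α] {μ : Measure α}
    {g p : α → ℂ} (hg : Integrable g μ) (hp : AEMeasurable p μ) {z₀ : ℂ} {r : ℝ} (hr : 0 < r)
    (h : ∀ᵐ s ∂μ, r ≤ ‖z₀ - p s‖) :
    HasDerivAt (fun z => ∫ s, (z - p s)⁻¹ * g s ∂μ) (∫ s, -((z₀ - p s) ^ 2)⁻¹ * g s ∂μ) z₀ := by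
  have hmeas : ∀ z, AEStronglyMeasurable (fun s => (z - p s)⁻¹) μ := fun z =>
    ((aemeasurable_const.sub hp).inv).aestronglyMeasurable
  have hlow : ∀ᵐ s ∂μ, ∀ z ∈ Metric.ball z₀ (r / 2), r / 2 ≤ ‖z - p s‖ := by
    filter_upwards [h] with s hs z hz
    have h1 : ‖z₀ - p s‖ ≤ ‖z - p s‖ + ‖z - z₀‖ := by
      have := norm_sub_le (z - p s) (z - z₀)
      rwa [sub_sub_sub_cancel_left, ← norm_neg, neg_sub, norm_sub_rev] at this
    rw [mem_ball_iff_norm] at hz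
    linarith
  refine (hasDerivAt_integral_of_dominated_loc_of_deriv_le (μ := μ)
    (F := fun z s => (z - p s)⁻¹ * g s) (F' := fun z s => -((z - p s) ^ 2)⁻¹ * g s)
    (bound := fun s => ((r / 2) ^ 2)⁻¹ * ‖g s‖)
    (Metric.ball_mem_nhds z₀ (half_pos hr)) (Eventually.of_forall fun z =>
      (hmeas z).mul hg.aestronglyMeasurable) ?_ ?_ ?_ (hg.norm.const_mul _) ?_).2
  · refine hg.bdd_mul (c := r⁻¹) (hmeas z₀) ?_
    filter_upwards [h] with s hs
    rw [norm_inv]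
    exact inv_anti₀ hr hs
  · refine AEStronglyMeasurable.mul ?_ hg.aestronglyMeasurable
    exact (((aemeasurable_const.sub hp).pow_const 2).inv.neg).aestronglyMeasurable
  · filter_upwards [hlow] with s hs z hz
    rw [norm_mul, norm_neg, norm_inv, norm_pow]
    exact mul_le_mul_of_nonneg_right
      (inv_anti₀ (by positivity) (pow_le_pow_left₀ (by positivity) (hs z hz) 2)) (norm_nonneg _)
  · filter_upwards [hlow] with s hs z hz
    have hne : z - p s ≠ 0 := norm_pos_iff.1 ((half_pos hr).trans_le (hs z hz))
    have h1 : HasDerivAt (fun z => z - p s) 1 z := (hasDerivAt_id z).sub_const _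
    have := (h1.inv hne).mul_const (g s)
    convert! this using 1
    rw [div_eq_mul_inv, neg_one_mul]

theorem differentiableAt_integral_inv_sub {α : Type*} [MeasurableSpace α] {μ : Measure α}
    {g p : α → ℂ} (hg : Integrable g μ) (hp : AEMeasurable p μ) {z₀ : ℂ} {r : ℝ} (hr : 0 < r)
    (h : ∀ᵐ s ∂μ, r ≤ ‖z₀ - p s‖) :
    DifferentiableAt ℂ (fun z => ∫ s, (z - p s)⁻¹ * g s ∂μ) z₀ :=
  (hasDerivAt_integral_inv_sub hg hp hr h).differentiableAt

/-- The Cauchy integral of a holomorphic function over a segment continues from the lower to the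
upper half-plane, where it jumps by the residue. -/
theorem exists_cauchy_continuation {f : ℂ → ℂ} {ω₀ ρ ρ' : ℝ} (hρ : 0 < ρ) (hρ' : ρ < ρ')
    (hf : DifferentiableOn ℂ f (Metric.ball (ω₀ : ℂ) ρ')) :
    ∃ g : ℂ → ℂ, (∀ ζ ∈ Metric.ball (ω₀ : ℂ) ρ, DifferentiableAt ℂ g ζ) ∧
      (∀ ζ ∈ Metric.ball (ω₀ : ℂ) ρ, ζ.im < 0 →
        g ζ = ∫ ω in (ω₀ - ρ)..(ω₀ + ρ), (ζ - ω)⁻¹ * f ω) ∧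
      (∀ ζ ∈ Metric.ball (ω₀ : ℂ) ρ, 0 < ζ.im →
        g ζ = (∫ ω in (ω₀ - ρ)..(ω₀ + ρ), (ζ - ω)⁻¹ * f ω)
          + 2 * Real.pi * Complex.I * f ζ) := by
  have hnorm : ∀ θ, ‖circleMap (ω₀ : ℂ) ρ θ - ω₀‖ = ρ := fun θ => by
    rw [← dist_eq_norm]
    exact circleMap_mem_sphere _ hρ.le θ
  have hsph : ∀ θ, circleMap (ω₀ : ℂ) ρ θ ∈ Metric.ball (ω₀ : ℂ) ρ' := fun θ => by
    rw [mem_ball_iff_norm, hnorm]; exact hρ'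
  have hcont : Continuous fun θ => f (circleMap (ω₀ : ℂ) ρ θ) :=
    hf.continuousOn.comp_continuous (continuous_circleMap _ _) hsph
  have hder : ∀ θ, HasDerivAt (circleMap (ω₀ : ℂ) ρ) (circleMap 0 ρ θ * Complex.I) θ :=
    hasDerivAt_circleMap _ _
  have him : ∀ θ, (circleMap (ω₀ : ℂ) ρ θ).im = ρ * Real.sin θ := fun θ => by
    simp [circleMap, Complex.exp_ofReal_mul_I_im]
  have hne : ∀ ζ ∈ Metric.ball (ω₀ : ℂ) ρ, ∀ θ, ζ - circleMap (ω₀ : ℂ) ρ θ ≠ 0 := by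
    intro ζ hζ θ h
    rw [sub_eq_zero.1 h, mem_ball_iff_norm, hnorm] at hζ
    exact lt_irrefl _ hζ
  set D : ℂ → ℝ → ℂ := fun ζ θ => (ζ - circleMap (ω₀ : ℂ) ρ θ)⁻¹ *
    (f (circleMap (ω₀ : ℂ) ρ θ) * (circleMap 0 ρ θ * Complex.I)) with hD
  have hDc : ∀ ζ ∈ Metric.ball (ω₀ : ℂ) ρ, Continuous (D ζ) := by
    intro ζ hζ
    refine Continuous.mul (Continuous.inv₀ (by fun_prop) (hne ζ hζ)) (hcont.mul ?_)
    fun_prop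
  -- primitives
  have key : ∀ ζ : ℂ, ∀ V : Set ℂ, IsOpen V → V ⊆ Metric.ball (ω₀ : ℂ) ρ' → ζ ∉ V →
      (∀ w ∈ V, ∀ t ∈ Icc (0 : ℝ) 1, (ω₀ : ℂ) + t * (w - ω₀) ∈ V) →
      (∀ ω ∈ Icc (ω₀ - ρ) (ω₀ + ρ), (ω : ℂ) ∈ V) →
      ∃ G : ℂ → ℂ, (∫ ω in (ω₀ - ρ)..(ω₀ + ρ), (ζ - ω)⁻¹ * f ω)
          = G (ω₀ + ρ : ℝ) - G (ω₀ - ρ : ℝ) ∧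
        ∀ a b, (∀ θ ∈ uIcc a b, circleMap (ω₀ : ℂ) ρ θ ∈ V) → ζ ∈ Metric.ball (ω₀ : ℂ) ρ →
          ∫ θ in a..b, D ζ θ = G (circleMap ω₀ ρ b) - G (circleMap ω₀ ρ a) := by
    intro ζ V hV hVb hζ hVs hVr
    have hF : DifferentiableOn ℂ (fun w => (ζ - w)⁻¹ * f w) V := by
      refine DifferentiableOn.mul (DifferentiableOn.inv (by fun_prop) fun w hw => ?_) (hf.mono hVb)
      intro h
      exact hζ ((sub_eq_zero.1 h) ▸ hw)
    obtain ⟨G, hG⟩ := exists_primitive_of_starShaped hV hVs hF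
    have hle : ω₀ - ρ ≤ ω₀ + ρ := by linarith
    refine ⟨G, ?_, fun a b hab hζb => ?_⟩
    · refine intervalIntegral.integral_eq_sub_of_hasDerivAt (f := fun ω : ℝ => G ω) ?_ ?_
      · intro ω hω
        rw [uIcc_of_le hle] at hω
        exact (hG _ (hVr ω hω)).comp_ofReal
      · refine ContinuousOn.intervalIntegrable ?_
        rw [uIcc_of_le hle]
        exact hF.continuousOn.comp (Complex.continuous_ofReal.continuousOn) hVr
    · refine intervalIntegral.integral_eq_sub_of_hasDerivAt
        (f := fun θ : ℝ => G (circleMap ω₀ ρ θ)) ?_ ((hDc ζ hζb).intervalIntegrable _ _)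
      intro θ hθ
      have := (hG _ (hab θ hθ)).scomp θ (hder θ)
      convert! this using 1
      rw [hD, smul_eq_mul]
      ring
  have hball : ∀ w ∈ Metric.ball (ω₀ : ℂ) ρ', ∀ t ∈ Icc (0 : ℝ) 1,
      (ω₀ : ℂ) + t * (w - ω₀) ∈ Metric.ball (ω₀ : ℂ) ρ' := by
    intro w hw t ht
    rw [mem_ball_iff_norm] at hw ⊢
    rw [add_sub_cancel_left, norm_mul, Complex.norm_real, Real.norm_of_nonneg ht.1]
    exact (mul_le_of_le_one_left (norm_nonneg _) ht.2).trans_lt hw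
  have hIcc : ∀ ω ∈ Icc (ω₀ - ρ) (ω₀ + ρ), (ω : ℂ) ∈ Metric.ball (ω₀ : ℂ) ρ' := by
    intro ω hω
    rw [mem_ball_iff_norm, ← Complex.ofReal_sub, Complex.norm_real]
    exact (abs_le.2 ⟨by linarith [hω.1], by linarith [hω.2]⟩).trans_lt hρ'
  have hc0 : circleMap (ω₀ : ℂ) ρ 0 = ((ω₀ + ρ : ℝ) : ℂ) := by simp [circleMap]
  have hcp : circleMap (ω₀ : ℂ) ρ Real.pi = ((ω₀ - ρ : ℝ) : ℂ) := by
    simp [circleMap, sub_eq_add_neg]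
  have hcm : circleMap (ω₀ : ℂ) ρ (-Real.pi) = ((ω₀ - ρ : ℝ) : ℂ) := by
    rw [circleMap]
    have : Complex.exp (((-Real.pi : ℝ) : ℂ) * Complex.I) = -1 := by
      push_cast
      rw [neg_mul, Complex.exp_neg, Complex.exp_pi_mul_I]
      norm_num
    rw [this]; push_cast; ring
  -- The segment is traded for the upper semicircle. If Im ζ < 0, the part of the disc above height
  -- Im ζ contains both paths and no pole, so they agree. If Im ζ > 0, the same holds for the
  -- segment and the lower semicircle, and the full circle accounts for 2πi f ζ.
  refine ⟨fun ζ => -∫ θ in (0 : ℝ)..Real.pi, D ζ θ, ?_, ?_, ?_⟩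
  · intro ζ hζ
    refine DifferentiableAt.neg ?_
    simp only [intervalIntegral.integral_of_le Real.pi_pos.le]
    refine differentiableAt_integral_inv_sub (r := ρ - ‖ζ - ω₀‖) ?_
      (continuous_circleMap _ _).measurable.aemeasurable
      (by rw [mem_ball_iff_norm] at hζ; linarith) (Eventually.of_forall fun θ => ?_)
    · refine Continuous.integrableOn_Ioc ?_
      refine hcont.mul ?_
      fun_prop
    · have h2 := norm_sub_norm_le (circleMap (ω₀ : ℂ) ρ θ - ω₀) (ζ - ω₀)
      rw [sub_sub_sub_cancel_right, norm_sub_rev (circleMap _ _ _) ζ, hnorm] at h2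
      exact h2
  · intro ζ hζ him0
    obtain ⟨G, hG1, hG2⟩ := key ζ (Metric.ball (ω₀ : ℂ) ρ' ∩ {w | ζ.im < w.im})
      (Metric.isOpen_ball.inter (isOpen_lt continuous_const Complex.continuous_im))
      inter_subset_left (fun h => lt_irrefl ζ.im h.2)
      (by
        rintro w ⟨hw, hwi⟩ t ht
        refine ⟨hball w hw t ht, ?_⟩
        have hwi' : ζ.im < w.im := hwi
        change ζ.im < ((ω₀ : ℂ) + t * (w - ω₀)).im
        simp only [Complex.add_im, Complex.ofReal_im, Complex.mul_im, Complex.ofReal_re,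
          Complex.sub_im]
        rcases ht.1.eq_or_lt with h0 | h0
        · rw [← h0]; linarith
        · nlinarith [ht.2])
      (fun ω hω => ⟨hIcc ω hω, by simpa using him0⟩)
    have h1 := hG2 0 Real.pi (by
      intro θ hθ
      rw [uIcc_of_le Real.pi_pos.le] at hθ
      refine ⟨hsph θ, ?_⟩
      change ζ.im < _
      rw [him]
      exact him0.trans_le (mul_nonneg hρ.le (Real.sin_nonneg_of_nonneg_of_le_pi hθ.1 hθ.2))) hζ
    simp only [h1, hG1, hc0, hcp, neg_sub]
  · intro ζ hζ him0
    obtain ⟨G, hG1, hG2⟩ := key ζ (Metric.ball (ω₀ : ℂ) ρ' ∩ {w | w.im < ζ.im})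
      (Metric.isOpen_ball.inter (isOpen_lt Complex.continuous_im continuous_const))
      inter_subset_left (fun h => lt_irrefl ζ.im h.2)
      (by
        rintro w ⟨hw, hwi⟩ t ht
        refine ⟨hball w hw t ht, ?_⟩
        have hwi' : w.im < ζ.im := hwi
        change ((ω₀ : ℂ) + t * (w - ω₀)).im < ζ.im
        simp only [Complex.add_im, Complex.ofReal_im, Complex.mul_im, Complex.ofReal_re,
          Complex.sub_im]
        rcases ht.1.eq_or_lt with h0 | h0
        · rw [← h0]; linarith
        · nlinarith [ht.2])
      (fun ω hω => ⟨hIcc ω hω, by simpa using him0⟩)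
    have h1 := hG2 (-Real.pi) 0 (by
      intro θ hθ
      rw [uIcc_of_le (by linarith [Real.pi_pos])] at hθ
      refine ⟨hsph θ, ?_⟩
      change _ < ζ.im
      rw [him]
      refine lt_of_le_of_lt ?_ him0
      exact mul_nonpos_of_nonneg_of_nonpos hρ.le
        (Real.sin_nonpos_of_nonpos_of_neg_pi_le hθ.2 hθ.1)) hζ
    have hfull : ∫ θ in (-Real.pi)..Real.pi, D ζ θ = -(2 * Real.pi * Complex.I * f ζ) := by
      have hper : Function.Periodic (D ζ) (2 * Real.pi) := by
        intro θ
        simp only [hD, periodic_circleMap (ω₀ : ℂ) ρ θ, periodic_circleMap 0 ρ θ]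
      have h2 := hper.intervalIntegral_add_eq (-Real.pi) 0
      rw [show -Real.pi + 2 * Real.pi = Real.pi by ring, zero_add] at h2
      have hd : DiffContOnCl ℂ f (Metric.ball (ω₀ : ℂ) ρ) := by
        refine DifferentiableOn.diffContOnCl ?_
        rw [closure_ball _ hρ.ne']
        exact hf.mono (Metric.closedBall_subset_ball hρ')
      have h3 := hd.circleIntegral_sub_inv_smul hζ
      rw [h2, ← smul_eq_mul (_ * _) (f ζ), ← h3, circleIntegral, ← intervalIntegral.integral_neg]
      refine intervalIntegral.integral_congr fun θ _ => ?_
      simp only [hD, deriv_circleMap, smul_eq_mul]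
      rw [← neg_sub ζ, inv_neg]
      ring
    have hadd := intervalIntegral.integral_add_adjacent_intervals (μ := volume)
      ((hDc ζ hζ).intervalIntegrable (-Real.pi) 0) ((hDc ζ hζ).intervalIntegrable 0 Real.pi)
    rw [hfull, h1, hc0, hcm, ← hG1] at hadd
    linear_combination -hadd

end CauchyContinuation

namespace DelaySystem

/-! ### The form A on the Riemann sheet -/

section Continuation

variable {𝓗 X : Type*} [NormedAddCommGroup 𝓗] [InnerProductSpace ℂ 𝓗] [CompleteSpace 𝓗]
  [AddCommGroup X] [Module ℂ X] [TopologicalSpace X] {S : DelaySystem 𝓗 X}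

theorem A_of_re_pos {z : ℂ} (hz : 0 < z.re) (ψ φ : X) : S.A z ψ φ = S.cauchy z ψ φ := by
  rw [A, if_pos hz]

theorem A_of_re_neg {z : ℂ} (hz : z.re < 0) (ψ φ : X) :
    S.A z ψ φ = S.cauchy z ψ φ + 2 * (Real.pi : ℂ) * S.dens ψ φ (z / Complex.I) := by
  rw [A, if_neg hz.not_gt, if_neg hz.ne]

theorem div_I_im (z : ℂ) : (z / Complex.I).im = -z.re := by
  rw [Complex.div_I]; simp

namespace Standing

variable (hS : S.Standing)
include hS

theorem measurableSet_I : MeasurableSet S.I := hS.I_open.measurableSet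

theorem isOpen_dom : IsOpen S.dom :=
  (isOpen_ne.preimage Complex.continuous_re).union (hS.I_open.preimage Complex.continuous_im)

theorem star_dom {ω₀ : ℝ} (hω₀ : ω₀ ∈ S.I) {w : ℂ} (hw : w ∈ S.dom) {t : ℝ}
    (ht : t ∈ Icc (0 : ℝ) 1) : (ω₀ * Complex.I : ℂ) + t * (w - ω₀ * Complex.I) ∈ S.dom := by
  rcases ht.1.eq_or_lt with h0 | h0
  · right
    rw [← h0]
    simpa using hω₀
  rcases hw with hw | hw
  · left
    simpa using ⟨h0.ne', hw⟩
  · right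
    have h1 := hS.I_conn.out hω₀ hw
    have hi : ((ω₀ * Complex.I : ℂ) + t * (w - ω₀ * Complex.I)).im = ω₀ + t * (w.im - ω₀) := by simp
    rw [hi]
    rcases le_total ω₀ w.im with h | h
    · exact hS.I_conn.out hω₀ hw ⟨by nlinarith [ht.1], by nlinarith [ht.2]⟩
    · exact hS.I_conn.out hw hω₀ ⟨by nlinarith [ht.2], by nlinarith [ht.1]⟩

theorem isPreconnected_dom (h : S.I.Nonempty) : IsPreconnected S.dom := by
  obtain ⟨ω₀, hω₀⟩ := h
  have hst : StarConvex ℝ (ω₀ * Complex.I : ℂ) S.dom := by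
    intro w hw a b ha hb hab
    have := hS.star_dom hω₀ hw (t := b) ⟨hb, by linarith⟩
    convert! this using 1
    rw [Complex.real_smul, Complex.real_smul, eq_sub_iff_add_eq.2 hab]
    push_cast; ring
  exact (hst.isPathConnected (Or.inr (by simpa using hω₀))).isConnected.isPreconnected

theorem cauchy_eq {z : ℂ} (hz : z.re ≠ 0) (ψ φ : X) :
    S.cauchy z ψ φ = inner ℂ (S.ι φ) (S.H.skewResolvent z (S.ι ψ)) :=
  (hS.spectral.inner_skewResolvent_eq_integral hS.self_adjoint hz hS.measurableSet_I
    (hS.dens_int ψ φ) (hS.dens_eq ψ φ)).symm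

theorem differentiableAt_cauchy {z : ℂ} (hz : z.re ≠ 0) (ψ φ : X) :
    DifferentiableAt ℂ (fun z => S.cauchy z ψ φ) z :=
  differentiableAt_integral_inv_sub (μ := volume.restrict S.I) (hS.dens_int ψ φ)
    (by fun_prop) (abs_pos.2 hz)
    (Eventually.of_forall fun ω => abs_re_le_norm_sub_I_mul z ω)

/-- Near the cut `iI`, the form `A` is holomorphic. -/
theorem exists_A_continuation {ω₀ : ℝ} (hω₀ : ω₀ ∈ S.I) (ψ φ : X) :
    ∃ ρ > 0, ∃ G : ℂ → ℂ, (∀ z ∈ Metric.ball (ω₀ * Complex.I : ℂ) ρ, DifferentiableAt ℂ G z) ∧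
      ∀ z ∈ Metric.ball (ω₀ * Complex.I : ℂ) ρ, S.A z ψ φ = G z := by
  obtain ⟨ρ₁, hρ₁, han⟩ := Metric.eventually_nhds_iff_ball.1
    (hS.dens_analytic ψ φ ω₀ (Or.inr ⟨ω₀, hω₀, rfl⟩)).eventually_analyticAt
  obtain ⟨ρ₂, hρ₂, hI⟩ := Metric.isOpen_iff.1 hS.I_open ω₀ hω₀
  set ρ' := min ρ₁ ρ₂
  have hρ'0 : 0 < ρ' := lt_min hρ₁ hρ₂
  set ρ := ρ' / 2
  have hρ0 : 0 < ρ := half_pos hρ'0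
  have hρρ' : ρ < ρ' := half_lt_self hρ'0
  have hf : DifferentiableOn ℂ (S.dens ψ φ) (Metric.ball (ω₀ : ℂ) ρ') := fun w hw =>
    (han w (Metric.ball_subset_ball (min_le_left _ _) hw)).differentiableAt.differentiableWithinAt
  obtain ⟨g, hg, hg1, hg2⟩ := exists_cauchy_continuation hρ0 hρρ' hf
  set J : Set ℝ := Ioc (ω₀ - ρ) (ω₀ + ρ)
  have hJI : J ⊆ S.I := by
    intro ω hω
    refine hI (Metric.ball_subset_ball (min_le_right ρ₁ ρ₂) ?_)
    rw [mem_ball_iff_norm, Real.norm_eq_abs]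
    exact (abs_le.2 ⟨by linarith [hω.1], by linarith [hω.2]⟩).trans_lt hρρ'
  set h : ℂ → ℂ := fun z => ∫ ω in S.I \ J, (z - Complex.I * (ω : ℂ))⁻¹ * S.dens ψ φ ω
  -- The part of `I` away from ω₀ is harmless. On the part near ω₀ put ζ = z / i: then (z - iω)⁻¹ =
  -- -i (ζ - ω)⁻¹, and Re z > 0 means Im ζ < 0, the side from which `g` continues the integral.
  set G : ℂ → ℂ := fun z => h z + -Complex.I * g (z / Complex.I) with hG
  have hmap : ∀ z ∈ Metric.ball (ω₀ * Complex.I : ℂ) ρ, z / Complex.I ∈ Metric.ball (ω₀ : ℂ) ρ := by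
    intro z hz
    rw [mem_ball_iff_norm] at hz ⊢
    rw [show z / Complex.I - ω₀ = (z - ω₀ * Complex.I) / Complex.I by
      rw [sub_div, mul_div_cancel_right₀ _ Complex.I_ne_zero], norm_div, Complex.norm_I, div_one]
    exact hz
  have hh : ∀ z ∈ Metric.ball (ω₀ * Complex.I : ℂ) ρ, DifferentiableAt ℂ h z := by
    intro z hz
    refine differentiableAt_integral_inv_sub (μ := volume.restrict (S.I \ J))
      (r := ρ - ‖z - ω₀ * Complex.I‖)
      ((hS.dens_int ψ φ).mono_set sdiff_subset) (by fun_prop)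
      (by rw [mem_ball_iff_norm] at hz; linarith) ?_
    refine (ae_restrict_iff' (hS.measurableSet_I.diff measurableSet_Ioc)).2
      (Eventually.of_forall fun ω hω => ?_)
    have h1 : ρ ≤ ‖(ω₀ * Complex.I : ℂ) - Complex.I * ω‖ := by
      rw [mul_comm, ← mul_sub, norm_mul, Complex.norm_I, one_mul, ← Complex.ofReal_sub,
        Complex.norm_real, Real.norm_eq_abs]
      by_contra hc
      push Not at hc
      have := abs_lt.1 hc
      exact hω.2 ⟨by linarith [this.2], by linarith [this.1]⟩
    have h2 := norm_sub_norm_le ((ω₀ * Complex.I : ℂ) - Complex.I * ω) (ω₀ * Complex.I - z)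
    rw [sub_sub_sub_cancel_left, norm_sub_rev (_ * _) z] at h2
    linarith
  have hGd : ∀ z ∈ Metric.ball (ω₀ * Complex.I : ℂ) ρ, DifferentiableAt ℂ G z := by
    intro z hz
    refine (hh z hz).add (DifferentiableAt.const_mul ?_ _)
    exact (hg _ (hmap z hz)).comp (f := fun z : ℂ => z / Complex.I) z (by fun_prop)
  have hcau : ∀ z : ℂ, z.re ≠ 0 → S.cauchy z ψ φ = h z + -Complex.I *
      ∫ ω in (ω₀ - ρ)..(ω₀ + ρ), (z / Complex.I - ω)⁻¹ * S.dens ψ φ ω := by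
    intro z hz
    have hint : IntegrableOn (fun ω : ℝ => (z - Complex.I * (ω : ℂ))⁻¹ * S.dens ψ φ ω) S.I :=
      (hS.dens_int ψ φ).bdd_mul (c := |z.re|⁻¹) (by
        refine Measurable.aestronglyMeasurable ?_
        fun_prop) (Eventually.of_forall fun ω => norm_inv_sub_I_mul_le hz ω)
    have h1 := setIntegral_union (μ := volume) (disjoint_sdiff_left (s := J) (t := S.I)) measurableSet_Ioc
      (hint.mono_set sdiff_subset) (hint.mono_set hJI)
    rw [sdiff_union_of_subset hJI] at h1
    rw [cauchy, h1, intervalIntegral.integral_of_le (by linarith), ← integral_const_mul]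
    congr 1
    refine setIntegral_congr_fun measurableSet_Ioc fun ω _ => ?_
    rw [← mul_assoc]
    congr 1
    rw [← Complex.inv_I, ← mul_inv]
    congr 1
    rw [mul_sub, mul_div_cancel₀ _ Complex.I_ne_zero]
  have hpos : ∀ z ∈ Metric.ball (ω₀ * Complex.I : ℂ) ρ, 0 < z.re → S.cauchy z ψ φ = G z := by
    intro z hz hre
    rw [hcau z hre.ne', hG]
    simp only
    rw [hg1 _ (hmap z hz) (by rw [div_I_im]; linarith)]
  refine ⟨ρ, hρ0, G, hGd, fun z hz => ?_⟩
  rcases lt_trichotomy z.re 0 with hre | hre | hre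
  · rw [A_of_re_neg hre, hcau z hre.ne, hG]
    simp only
    rw [hg2 _ (hmap z hz) (by rw [div_I_im]; linarith)]
    -- The jump -i · 2πi f is the term 2π f in the definition of `A` on the left half-plane.
    linear_combination (2 * Real.pi * S.dens ψ φ (z / Complex.I)) * Complex.I_mul_I
  · rw [A, if_neg hre.not_gt, if_pos hre]
    have hne : (𝓝[{w : ℂ | 0 < w.re}] z).NeBot := by
      rw [← mem_closure_iff_nhdsWithin_neBot, Complex.closure_setOfPred_lt_re]
      exact hre.ge
    refine Tendsto.limUnder_eq ?_
    refine ((hGd z hz).continuousAt.tendsto.mono_left nhdsWithin_le_nhds).congr' ?_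
    filter_upwards [self_mem_nhdsWithin,
      mem_nhdsWithin_of_mem_nhds (Metric.isOpen_ball.mem_nhds hz)] with w hw hwb
    exact (hpos w hwb hw).symm
  · rw [A_of_re_pos hre, hpos z hz hre]

theorem differentiableAt_A {z : ℂ} (hz : z ∈ S.dom) (ψ φ : X) :
    DifferentiableAt ℂ (fun z => S.A z ψ φ) z := by
  rcases lt_trichotomy z.re 0 with hre | hre | hre
  · have h1 : (fun z => S.A z ψ φ) =ᶠ[𝓝 z]
        fun z => S.cauchy z ψ φ + 2 * (Real.pi : ℂ) * S.dens ψ φ (z / Complex.I) := by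
      filter_upwards [(isOpen_lt Complex.continuous_re continuous_const).mem_nhds hre] with w hw
      exact A_of_re_neg hw ψ φ
    refine DifferentiableAt.congr_of_eventuallyEq ?_ h1
    refine (hS.differentiableAt_cauchy hre.ne ψ φ).add (DifferentiableAt.const_mul ?_ _)
    have h2 : DifferentiableAt ℂ (S.dens ψ φ) (z / Complex.I) :=
      (hS.dens_analytic ψ φ _ (Or.inl (by
        change 0 < (z / Complex.I).im
        rw [div_I_im]; linarith))).differentiableAt
    exact h2.comp (f := fun z : ℂ => z / Complex.I) z (by fun_prop)
  · obtain ⟨ρ, hρ, G, hG, hAG⟩ := hS.exists_A_continuation (hz.resolve_left (by simpa using hre)) ψ φ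
    have hzb : z ∈ Metric.ball ((z.im : ℂ) * Complex.I) ρ := by
      have : z = (z.im : ℂ) * Complex.I := by
        conv_lhs => rw [← Complex.re_add_im z, hre]
        simp
      rw [← this]
      exact Metric.mem_ball_self hρ
    refine (hG z hzb).congr_of_eventuallyEq ?_
    filter_upwards [Metric.isOpen_ball.mem_nhds hzb] with w hw
    exact hAG w hw
  · have h1 : (fun z => S.A z ψ φ) =ᶠ[𝓝 z] fun z => S.cauchy z ψ φ := by
      filter_upwards [(isOpen_lt continuous_const Complex.continuous_re).mem_nhds hre] with w hw
      exact A_of_re_pos hw ψ φ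
    exact (hS.differentiableAt_cauchy hre.ne' ψ φ).congr_of_eventuallyEq h1

theorem differentiableOn_A (ψ φ : X) : DifferentiableOn ℂ (fun z => S.A z ψ φ) S.dom :=
  fun _ hz => (hS.differentiableAt_A hz ψ φ).differentiableWithinAt

theorem subsingleton_of_I_empty (h : ¬ S.I.Nonempty) : Subsingleton X := by
  rw [not_nonempty_iff_eq_empty] at h
  refine ⟨fun a b => hS.inj ?_⟩
  have h0 : ∀ ψ, S.ι ψ = 0 := by
    intro ψ
    have := hS.dens_eq ψ ψ univ MeasurableSet.univ
    rw [h, inter_empty, setIntegral_empty, hS.spectral.total] at this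
    exact inner_self_eq_zero.1 this
  rw [h0, h0]

/-- For empty `I` the sheet is disconnected and nothing continues to the left half-plane. But then X
is trivial, and the one value of the form is read off from the duality relation for K tested against
0. -/
theorem A_zero_of_I_empty (h : ¬ S.I.Nonempty) {z : ℂ} (hz : z ∈ S.dom) (ψ φ : X) :
    S.A z ψ φ = 0 := by
  have := hS.subsingleton_of_I_empty h
  obtain ⟨y, hy⟩ := hS.K_dual z hz ψ
  obtain ⟨η, hη⟩ := hS.Y_K 0 S.Y.zero_mem
  have := hy 0 S.Y.zero_mem η hη
  rw [map_zero, inner_zero_left, Subsingleton.elim η φ] at this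
  exact this.symm

/-- Identities between forms extend from the right half-plane. -/
theorem A_identity {f : ℂ → ℂ} (hf : DifferentiableOn ℂ f S.dom) (h : S.I.Nonempty)
    (h0 : ∀ z : ℂ, 0 < z.re → f z = 0) {z : ℂ} (hz : z ∈ S.dom) : f z = 0 := by
  have h1 : AnalyticOnNhd ℂ f S.dom := hf.analyticOnNhd hS.isOpen_dom
  have h2 : AnalyticOnNhd ℂ (fun _ : ℂ => (0 : ℂ)) S.dom := analyticOnNhd_const
  refine h1.eqOn_of_preconnected_of_eventuallyEq h2 (hS.isPreconnected_dom h) (z₀ := 1)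
    (Or.inl (by simp)) ?_ hz
  filter_upwards [(isOpen_lt continuous_const Complex.continuous_re).mem_nhds
    (show (0 : ℝ) < (1 : ℂ).re by simp)] with w hw
  exact h0 w hw

variable {z : ℂ} (hz : z ∈ S.dom)
include hz

/-- On the right half-plane the form is a matrix element of the resolvent, so the identity is clear
there and continues over the connected sheet. No algebraic property of the continued density is
assumed, which is why the identity theorem is needed; the next three lemmas follow the same pattern.
-/
theorem A_add_left (ψ ψ' φ : X) : S.A z (ψ + ψ') φ = S.A z ψ φ + S.A z ψ' φ := by
  by_cases h : S.I.Nonempty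
  · have := hS.A_identity (f := fun z => S.A z (ψ + ψ') φ - (S.A z ψ φ + S.A z ψ' φ))
      ((hS.differentiableOn_A _ _).sub ((hS.differentiableOn_A _ _).add (hS.differentiableOn_A _ _)))
      h (fun w hw => by
        simp only [A_of_re_pos hw, hS.cauchy_eq hw.ne', map_add, inner_add_right, sub_self]) hz
    exact sub_eq_zero.1 this
  · simp [hS.A_zero_of_I_empty h hz]

theorem A_smul_left (c : ℂ) (ψ φ : X) : S.A z (c • ψ) φ = c * S.A z ψ φ := by
  by_cases h : S.I.Nonempty
  · have := hS.A_identity (f := fun z => S.A z (c • ψ) φ - c * S.A z ψ φ)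
      ((hS.differentiableOn_A _ _).sub ((hS.differentiableOn_A _ _).const_mul c))
      h (fun w hw => by
        simp only [A_of_re_pos hw, hS.cauchy_eq hw.ne', map_smul, inner_smul_right, sub_self]) hz
    exact sub_eq_zero.1 this
  · simp [hS.A_zero_of_I_empty h hz]

theorem A_add_right (ψ φ φ' : X) : S.A z ψ (φ + φ') = S.A z ψ φ + S.A z ψ φ' := by
  by_cases h : S.I.Nonempty
  · have := hS.A_identity (f := fun z => S.A z ψ (φ + φ') - (S.A z ψ φ + S.A z ψ φ'))
      ((hS.differentiableOn_A _ _).sub ((hS.differentiableOn_A _ _).add (hS.differentiableOn_A _ _)))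
      h (fun w hw => by
        simp only [A_of_re_pos hw, hS.cauchy_eq hw.ne', map_add, inner_add_left, sub_self]) hz
    exact sub_eq_zero.1 this
  · simp [hS.A_zero_of_I_empty h hz]

theorem A_smul_right (c : ℂ) (ψ φ : X) : S.A z ψ (c • φ) = starRingEnd ℂ c * S.A z ψ φ := by
  by_cases h : S.I.Nonempty
  · have := hS.A_identity (f := fun z => S.A z ψ (c • φ) - starRingEnd ℂ c * S.A z ψ φ)
      ((hS.differentiableOn_A _ _).sub ((hS.differentiableOn_A _ _).const_mul _))
      h (fun w hw => by
        simp only [A_of_re_pos hw, hS.cauchy_eq hw.ne', map_smul, inner_smul_left, sub_self]) hz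
    exact sub_eq_zero.1 this
  · simp [hS.A_zero_of_I_empty h hz]

end Standing

end Continuation

end DelaySystem

namespace DelaySystem

/-! ### Continuity of A, linearity of C, and a bound on the eigenvalues -/

section Forms

variable {𝓗 X : Type*} [NormedAddCommGroup 𝓗] [InnerProductSpace ℂ 𝓗] [CompleteSpace 𝓗]
  [AddCommGroup X] [Module ℂ X] [UniformSpace X] [IsUniformAddGroup X] [ContinuousSMul ℂ X]
  [BarrelledSpace ℂ X] {S : DelaySystem 𝓗 X}

namespace Standing

variable (hS : S.Standing)
include hS

theorem continuous_A_right_of_re_ne {z : ℂ} (hz : z.re ≠ 0) (ψ : X) :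
    Continuous fun φ => S.A z ψ φ := by
  have h1 : Continuous fun φ => S.cauchy z ψ φ := by
    simp only [hS.cauchy_eq hz]
    exact S.ι.continuous.inner continuous_const
  rcases lt_or_gt_of_ne hz with h | h
  · simp only [A_of_re_neg h]
    refine h1.add (continuous_const.mul (hS.dens_cont_right _ (Or.inl ?_) ψ))
    change 0 < (z / Complex.I).im
    rw [div_I_im]; linarith
  · simpa only [A_of_re_pos h] using h1

theorem continuous_A_left_of_re_ne {z : ℂ} (hz : z.re ≠ 0) (φ : X) :
    Continuous fun ψ => S.A z ψ φ := by
  have h1 : Continuous fun ψ => S.cauchy z ψ φ := by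
    simp only [hS.cauchy_eq hz]
    exact continuous_const.inner ((S.H.skewResolvent z).continuous.comp S.ι.continuous)
  rcases lt_or_gt_of_ne hz with h | h
  · simp only [A_of_re_neg h]
    refine h1.add (continuous_const.mul (hS.dens_cont_left _ (Or.inl ?_) φ))
    change 0 < (z / Complex.I).im
    rw [div_I_im]; linarith
  · simpa only [A_of_re_pos h] using h1

theorem tendsto_A_right {z : ℂ} (hz : z ∈ S.dom) (ψ φ : X) :
    Tendsto (fun n : ℕ => S.A (z + ((1 / ((n : ℝ) + 1) : ℝ) : ℂ)) ψ φ) atTop (𝓝 (S.A z ψ φ)) := by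
  refine (hS.differentiableAt_A hz ψ φ).continuousAt.tendsto.comp ?_
  have := ((Complex.continuous_ofReal.tendsto 0).comp
    (tendsto_one_div_add_atTop_nhds_zero_nat (𝕜 := ℝ))).const_add z
  simpa [Function.comp_def] using this

/-- Off the cut continuity is inherited from the resolvent and the density. On the cut the form is a
pointwise limit of the forms at z + 1/(n+1), and pointwise limits of continuous functionals on a
barrelled space are continuous. -/
theorem continuous_A_right {z : ℂ} (hz : z ∈ S.dom) (ψ : X) :
    Continuous fun φ => S.A z ψ φ := by
  by_cases hre : z.re = 0
  · have hn : ∀ n : ℕ, (z + ((1 / ((n : ℝ) + 1) : ℝ) : ℂ)).re ≠ 0 := fun n => by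
      rw [Complex.add_re, hre, Complex.ofReal_re, zero_add]; positivity
    let g : ℕ → AntiDual X := fun n =>
      ⟨{ toFun := fun φ => S.A (z + ((1 / ((n : ℝ) + 1) : ℝ) : ℂ)) ψ φ
         map_add' := hS.A_add_right (Or.inl (hn n)) ψ
         map_smul' := fun c φ => hS.A_smul_right (Or.inl (hn n)) c ψ φ },
        hS.continuous_A_right_of_re_ne (hn n) ψ⟩
    have hg : Tendsto (fun n φ => g n φ) atTop (𝓝 fun φ => S.A z ψ φ) :=
      tendsto_pi_nhds.2 fun φ => hS.tendsto_A_right hz ψ φ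
    exact (continuousLinearMapOfTendsto g hg).continuous
  · exact hS.continuous_A_right_of_re_ne hre ψ

theorem continuous_A_left {z : ℂ} (hz : z ∈ S.dom) (φ : X) :
    Continuous fun ψ => S.A z ψ φ := by
  by_cases hre : z.re = 0
  · have hn : ∀ n : ℕ, (z + ((1 / ((n : ℝ) + 1) : ℝ) : ℂ)).re ≠ 0 := fun n => by
      rw [Complex.add_re, hre, Complex.ofReal_re, zero_add]; positivity
    let g : ℕ → X →L[ℂ] ℂ := fun n =>
      ⟨{ toFun := fun ψ => S.A (z + ((1 / ((n : ℝ) + 1) : ℝ) : ℂ)) ψ φ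
         map_add' := fun ψ ψ' => hS.A_add_left (Or.inl (hn n)) ψ ψ' φ
         map_smul' := fun c ψ => hS.A_smul_left (Or.inl (hn n)) c ψ φ },
        hS.continuous_A_left_of_re_ne (hn n) φ⟩
    have hg : Tendsto (fun n ψ => g n ψ) atTop (𝓝 fun ψ => S.A z ψ φ) :=
      tendsto_pi_nhds.2 fun ψ => hS.tendsto_A_right hz ψ φ
    exact (continuousLinearMapOfTendsto g hg).continuous
  · exact hS.continuous_A_left_of_re_ne hre φ

omit [IsUniformAddGroup X] [ContinuousSMul ℂ X] [BarrelledSpace ℂ X]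

theorem denseRange_Y : Dense (S.ι '' (S.Y : Set X)) :=
  hS.dense.dense_image S.ι.continuous hS.Y_dense

theorem eq_of_forall_inner {y y' : X}
    (h : ∀ φ ∈ S.Y, inner ℂ (S.ι φ) (S.ι y) = inner ℂ (S.ι φ) (S.ι y')) : y = y' := by
  refine hS.inj (hS.denseRange_Y.eq_of_inner_right ℂ ?_)
  rintro _ ⟨φ, hφ, rfl⟩
  exact h φ hφ

theorem isKdual_C {z : ℂ} (hz : z ∈ S.dom) (ψ : X) : S.IsKdual (S.A z ψ) (S.C z ψ) :=
  Classical.epsilon_spec (hS.K_dual z hz ψ)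

theorem C_eq_of_isKdual {z : ℂ} (hz : z ∈ S.dom) {ψ y : X} (h : S.IsKdual (S.A z ψ) y) :
    S.C z ψ = y := by
  refine hS.eq_of_forall_inner fun φ hφ => ?_
  obtain ⟨η, hη⟩ := hS.Y_K φ hφ
  rw [hS.isKdual_C hz ψ φ hφ η hη, h φ hφ η hη]

/-- `C(z)` as a linear map. -/
def CL {z : ℂ} (hz : z ∈ S.dom) : X →ₗ[ℂ] X where
  toFun := S.C z
  map_add' ψ ψ' := hS.C_eq_of_isKdual hz fun φ hφ η hη => by
    rw [map_add, inner_add_right, hS.isKdual_C hz ψ φ hφ η hη, hS.isKdual_C hz ψ' φ hφ η hη,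
      hS.A_add_left hz]
  map_smul' c ψ := hS.C_eq_of_isKdual hz fun φ hφ η hη => by
    rw [RingHom.id_apply, map_smul, inner_smul_right, hS.isKdual_C hz ψ φ hφ η hη,
      hS.A_smul_left hz]

/-- `id - e^{-zτ} C(z)` as a linear map. -/
def oneSubL {z : ℂ} (hz : z ∈ S.dom) : X →ₗ[ℂ] X :=
  LinearMap.id - Complex.exp (-z * S.τ) • hS.CL hz

theorem C_eq_zero_of_A {z : ℂ} (hz : z ∈ S.dom) {ψ : X} (h : ∀ φ, S.A z ψ φ = 0) :
    S.C z ψ = 0 :=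
  hS.C_eq_of_isKdual hz fun φ _ η _ => by rw [map_zero, inner_zero_right, h]

theorem injective_oneSub_iff {z : ℂ} (hz : z ∈ S.dom) :
    Function.Injective (S.oneSub z) ↔ ∀ ψ, S.oneSub z ψ = 0 → ψ = 0 :=
  injective_iff_map_eq_zero (hS.oneSubL hz)

/-- The generalized eigenvalues are the points where `id - e^{-zτ} C(z)` is not injective. -/
theorem mem_poles_iff {z : ℂ} (hz : z ∈ S.dom) :
    z ∈ S.poles ↔ ¬ Function.Injective (S.oneSub z) := by
  constructor
  · rintro ⟨-, ψ, hψ, hA⟩ hinj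
    -- χ is annihilated by A(z), hence by C(z), so id - e^{-zτ} C(z) fixes it. Injectivity then
    -- gives χ = ψ, and A(z) would annihilate ψ.
    set χ := S.oneSub z ψ with hχ
    have h1 : ∀ φ, S.A z χ φ = 0 := by
      intro φ
      have h2 : χ = ψ + (-Complex.exp (-z * S.τ)) • S.C z ψ := by
        rw [hχ, oneSub, neg_smul, sub_eq_add_neg]
      rw [h2, hS.A_add_left hz, hS.A_smul_left hz]
      have := congrFun hA φ
      linear_combination this
    have h3 : S.oneSub z χ = χ := by
      rw [oneSub, hS.C_eq_zero_of_A hz h1, smul_zero, sub_zero]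
    have h4 : χ = ψ := hinj (h3.trans hχ)
    exact hψ (funext fun φ => h4 ▸ h1 φ)
  · intro hinj
    rw [hS.injective_oneSub_iff hz] at hinj
    push Not at hinj
    obtain ⟨ψ, h0, hψ⟩ := hinj
    have h1 : ψ = Complex.exp (-z * S.τ) • S.C z ψ := sub_eq_zero.1 h0
    refine ⟨hz, ψ, fun hA => hψ ?_, ?_⟩
    · rw [h1, hS.C_eq_zero_of_A hz (fun φ => congrFun hA φ), smul_zero]
    · funext φ
      conv_lhs => rw [h1]
      rw [hS.A_smul_left hz]

theorem ι_C_of_re_pos {z : ℂ} (hz : 0 < z.re) (ψ : X) :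
    S.ι (S.C z ψ) = S.K (S.H.skewResolvent z (S.ι ψ)) := by
  refine hS.denseRange_Y.eq_of_inner_right ℂ ?_
  rintro _ ⟨φ, hφ, rfl⟩
  obtain ⟨η, hη⟩ := hS.Y_K φ hφ
  rw [hS.isKdual_C (Or.inl hz.ne') ψ φ hφ η hη, A_of_re_pos hz, hS.cauchy_eq hz.ne', hη,
    ContinuousLinearMap.adjoint_inner_left]

/-- For Re z > ‖K‖ this makes e^{-zτ} K (z - iH)⁻¹ a strict contraction of 𝓗. That excludes
eigenvalues there and makes fixed points unique. -/
theorem norm_exp_K_resolvent_le {z : ℂ} (hz : 0 < z.re) (v : 𝓗) :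
    ‖Complex.exp (-z * S.τ) • S.K (S.H.skewResolvent z v)‖ ≤ ‖S.K‖ / z.re * ‖v‖ := by
  rw [norm_smul, Complex.norm_exp]
  have h1 : Real.exp (-z * S.τ).re ≤ 1 := by
    rw [Real.exp_le_one_iff]
    simp only [Complex.mul_re, Complex.neg_re, Complex.ofReal_re, Complex.ofReal_im, mul_zero,
      sub_zero]
    nlinarith [hS.tau_pos]
  have h2 := hS.self_adjoint.norm_skewResolvent_apply_le hz.ne' v
  rw [abs_of_pos hz] at h2
  calc _ ≤ 1 * ‖S.K (S.H.skewResolvent z v)‖ := mul_le_mul_of_nonneg_right h1 (norm_nonneg _)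
    _ ≤ ‖S.K‖ * (z.re⁻¹ * ‖v‖) := by
        rw [one_mul]
        exact (S.K.le_opNorm _).trans (mul_le_mul_of_nonneg_left h2 (norm_nonneg _))
    _ = _ := by ring

theorem re_le_of_mem_poles {z : ℂ} (hz : z ∈ S.poles) : z.re ≤ ‖S.K‖ := by
  by_contra! hc
  have hpos : 0 < z.re := (norm_nonneg _).trans_lt hc
  have hdom : z ∈ S.dom := hz.1
  rw [hS.mem_poles_iff hdom, hS.injective_oneSub_iff hdom] at hz
  push Not at hz
  obtain ⟨ψ, h0, hψ⟩ := hz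
  have h1 : ψ = Complex.exp (-z * S.τ) • S.C z ψ := sub_eq_zero.1 h0
  have h2 := hS.norm_exp_K_resolvent_le hpos (S.ι ψ)
  rw [← hS.ι_C_of_re_pos hpos, ← map_smul, ← h1] at h2
  have h3 : 0 < ‖S.ι ψ‖ := norm_pos_iff.2 fun h => hψ (hS.inj (h.trans (map_zero _).symm))
  have h4 : ‖S.K‖ / z.re < 1 := (div_lt_one hpos).2 hc
  nlinarith

end Standing

end Forms

end DelaySystem

/-! ### Functionals from the Hilbert space that norm the model space -/

section Norming

/-- Functionals on a Banach space whose unit ball is a compact disk in a Hilbert space. -/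
theorem norm_le_of_forall_polar {𝓗 Z : Type*} [NormedAddCommGroup 𝓗] [InnerProductSpace ℂ 𝓗]
    [CompleteSpace 𝓗] [NormedAddCommGroup Z] [NormedSpace ℂ Z] {T : Z →L[ℂ] 𝓗}
    (hT : Function.Injective T) (hB : IsCompact (T '' Metric.closedBall 0 1)) {v : Z} {c : ℝ}
    (hc : 0 ≤ c) (h : ∀ y : 𝓗, (∀ w, ‖inner ℂ y (T w)‖ ≤ ‖w‖) → ‖inner ℂ y (T v)‖ ≤ c) :
    ‖v‖ ≤ c := by
  by_contra! hcv
  obtain ⟨c', hc', hcv'⟩ := exists_between hcv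
  have hc0 : 0 < c' := hc.trans_lt hc'
  set x : Z := ((c' : ℂ))⁻¹ • v with hx
  have hxn : 1 < ‖x‖ := by
    rw [hx, norm_smul, norm_inv, Complex.norm_real, Real.norm_of_nonneg hc0.le,
      ← div_eq_inv_mul, one_lt_div hc0]
    exact hcv'
  have hxB : T x ∉ T '' Metric.closedBall 0 1 := by
    rintro ⟨w, hw, hwx⟩
    rw [hT hwx, mem_closedBall_zero_iff] at hw
    exact hxn.not_ge hw
  have hconv : Convex ℝ (T '' Metric.closedBall 0 1) := by
    have h1 := (convex_closedBall (0 : Z) 1).linear_image (T.toLinearMap.restrictScalars ℝ)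
    exact h1
  -- If v were longer than c' > c, the vector x = v/c' would lie outside the compact, hence closed,
  -- image of the unit ball. The separating functional, divided by `s`, is admissible and exceeds 1
  -- at x.
  obtain ⟨f, s, hfs, hsx⟩ := RCLike.geometric_hahn_banach_closed_point (𝕜 := ℂ) hconv hB.isClosed hxB
  have hs0 : 0 < s := by
    have := hfs 0 ⟨0, by simp, map_zero T⟩
    simpa using this
  have hbound : ∀ w : Z, ‖f (T w)‖ ≤ s * ‖w‖ := by
    intro w
    rcases eq_or_ne w 0 with rfl | hw
    · simp
    have hw0 : 0 < ‖w‖ := norm_pos_iff.2 hw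
    rcases eq_or_ne (f (T w)) 0 with h0 | h0
    · rw [h0, norm_zero]; positivity
    have hf0 : 0 < ‖f (T w)‖ := norm_pos_iff.2 h0
    set a : ℂ := (starRingEnd ℂ (f (T w)) / ‖f (T w)‖) * (‖w‖ : ℂ)⁻¹ with ha
    have han : ‖a • w‖ ≤ 1 := by
      rw [norm_smul, ha, norm_mul, norm_div, RCLike.norm_conj, Complex.norm_real, norm_norm, div_self hf0.ne',
        norm_inv, Complex.norm_real, norm_norm, one_mul, inv_mul_cancel₀ hw0.ne']
    have h1 := hfs (T (a • w)) ⟨_, by simpa using han, rfl⟩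
    rw [map_smul, map_smul, smul_eq_mul, ha] at h1
    have h2 : starRingEnd ℂ (f (T w)) / ‖f (T w)‖ * (‖w‖ : ℂ)⁻¹ * f (T w)
        = ((‖f (T w)‖ / ‖w‖ : ℝ) : ℂ) := by
      have h3 : starRingEnd ℂ (f (T w)) * f (T w) = (‖f (T w)‖ : ℂ) * ‖f (T w)‖ := by
        rw [mul_comm, Complex.mul_conj, Complex.normSq_eq_norm_sq]; push_cast; ring
      have h4 : (‖f (T w)‖ : ℂ) ≠ 0 := Complex.ofReal_ne_zero.2 hf0.ne'
      have h5 : (‖w‖ : ℂ) ≠ 0 := Complex.ofReal_ne_zero.2 hw0.ne'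
      push_cast
      field_simp
      linear_combination h3
    rw [h2] at h1
    have h6 : ‖f (T w)‖ / ‖w‖ < s := by simpa using h1
    rw [div_lt_iff₀ hw0] at h6
    exact h6.le
  set y : 𝓗 := ((s : ℂ))⁻¹ • (InnerProductSpace.toDual ℂ 𝓗).symm f with hy
  have hyi : ∀ u, inner ℂ y u = ((s : ℂ))⁻¹ * f u := by
    intro u
    rw [hy, inner_smul_left, InnerProductSpace.toDual_symm_apply, map_inv₀, Complex.conj_ofReal]
  have h1 := h y (fun w => by
    rw [hyi, norm_mul, norm_inv, Complex.norm_real, Real.norm_of_nonneg hs0.le,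
      inv_mul_le_iff₀ hs0]
    exact hbound w)
  have h2 : v = (c' : ℂ) • x := by
    rw [hx, smul_smul, mul_inv_cancel₀ (Complex.ofReal_ne_zero.2 hc0.ne'), one_smul]
  have h3 : s < ‖f (T x)‖ := hsx.trans_le (Complex.re_le_norm _)
  rw [hyi, h2, map_smul, map_smul, norm_mul, norm_smul, norm_inv, Complex.norm_real,
    Complex.norm_real, Real.norm_of_nonneg hs0.le, Real.norm_of_nonneg hc0.le,
    inv_mul_le_iff₀ hs0] at h1
  nlinarith

end Norming

namespace DelaySystem

universe u v

/-! ### The Banach space model of the operators C(λ) -/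

section Model

variable {𝓗 : Type v} {X : Type u} [NormedAddCommGroup 𝓗] [InnerProductSpace ℂ 𝓗]
  [CompleteSpace 𝓗] [AddCommGroup X] [Module ℂ X] [UniformSpace X] {S : DelaySystem 𝓗 X}

/-- A Banach space with compact unit ball in `X`, through which all `C(z)`, `z ∈ D`, factor. -/
structure CompactModel (S : DelaySystem 𝓗 X) (D : Set ℂ) where
  Z : Type u
  [norm : NormedAddCommGroup Z]
  [space : NormedSpace ℂ Z]
  [complete : CompleteSpace Z]
  j : Z →L[ℂ] X
  inj : Function.Injective j
  compact : IsCompact (j '' Metric.closedBall 0 1)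
  Chat : ℂ → X →L[ℂ] Z
  spec : ∀ z ∈ D, ∀ x, j (Chat z x) = S.C z x
  bdd : ∃ V ∈ 𝓝 (0 : X), ∀ z ∈ D, ∀ x ∈ V, ‖Chat z x‖ ≤ 1

attribute [instance] CompactModel.norm CompactModel.space CompactModel.complete

variable [IsUniformAddGroup X] [ContinuousSMul ℂ X]

namespace Standing

variable (hS : S.Standing)
include hS

/-- The common relatively compact image of `V` lies in a compact disk, whose gauge space is the
model. Since `V` is absorbing, linearity puts every value C(z) x into the span of the disk, and `V`
is sent into the unit ball. -/
theorem exists_compactModel [T2Space X] [LocallyConvexSpace ℝ X] [QuasiCompleteSpace ℂ X]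
    (hC : S.UniformlyCompact) {D : Set ℂ} (hD : IsCompact D) (hDd : D ⊆ S.dom) :
    Nonempty (CompactModel S D) := by
  classical
  obtain ⟨V, hV, hVc⟩ := hC D hD hDd
  obtain ⟨B, hB, hconv, hbal, hne, hsB⟩ := hVc.exists_disk
  obtain ⟨Z, _, _, _, j, hj, hjB⟩ := exists_banach_disk hB hconv hbal hne
  have hVB : ∀ z ∈ D, ∀ x ∈ V, S.C z x ∈ j '' Metric.closedBall 0 1 := by
    intro z hz x hx
    rw [hjB]
    exact hsB (subset_closure (mem_biUnion hz ⟨x, hx, rfl⟩))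
  have hrange : ∀ z ∈ D, ∀ x, ∃ w, j w = S.C z x := by
    intro z hz x
    obtain ⟨r, hr0, hr⟩ := ((absorbent_nhds_zero (𝕜 := ℂ) hV) x).exists_pos
    obtain ⟨v, hv, hvx⟩ := hr (r : ℂ) (by rw [Complex.norm_real]; exact le_abs_self r) rfl
    obtain ⟨w, -, hw⟩ := hVB z hz v hv
    refine ⟨(r : ℂ) • w, ?_⟩
    rw [map_smul, hw, ← hvx]
    exact ((hS.CL (hDd hz)).map_smul _ _).symm
  choose! c hc using hrange
  have hbd : ∀ z ∈ D, ∀ x ∈ V, ‖c z x‖ ≤ 1 := by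
    intro z hz x hx
    obtain ⟨w, hw, hwx⟩ := hVB z hz x hx
    rw [← hj (hwx.trans (hc z hz x).symm)]
    simpa using hw
  have hlin : ∀ z ∈ D, ∃ T : X →L[ℂ] Z, ∀ x, T x = c z x := by
    intro z hz
    let T₀ : X →ₗ[ℂ] Z :=
      { toFun := c z
        map_add' := fun a b => hj (by
          rw [map_add, hc z hz, hc z hz, hc z hz]; exact (hS.CL (hDd hz)).map_add a b)
        map_smul' := fun r a => hj (by
          rw [RingHom.id_apply, map_smul, hc z hz, hc z hz]
          exact (hS.CL (hDd hz)).map_smul r a) }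
    exact ⟨T₀.clmOfExistsBoundedImage ⟨V, hV, (NormedSpace.isVonNBounded_closedBall ℂ Z 1).subset (by
      rintro _ ⟨x, hx, rfl⟩
      rw [mem_closedBall_zero_iff]
      exact hbd z hz x hx)⟩, fun x => rfl⟩
  choose! T hT using hlin
  exact ⟨{ Z := Z, j := j, inj := hj, compact := hjB ▸ hB, Chat := T
           spec := fun z hz x => by rw [hT z hz, hc z hz]
           bdd := ⟨V, hV, fun z hz x hx => by rw [hT z hz]; exact hbd z hz x hx⟩ }⟩

/-- Against a vector of `Y` the matrix element is A(z) tested on K*φ, which is holomorphic. A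
general vector is approximated from `Y`, uniformly in z because of the bound `M`. -/
theorem differentiableOn_inner_C {U : Set ℂ} (hU : IsOpen U) (hUd : U ⊆ S.dom) (y : 𝓗) (x : X)
    {M : ℝ} (hM : ∀ z ∈ U, ‖S.ι (S.C z x)‖ ≤ M) :
    DifferentiableOn ℂ (fun z => inner ℂ y (S.ι (S.C z x))) U := by
  obtain ⟨s, hs, hsy⟩ := mem_closure_iff_seq_limit.1 (hS.denseRange_Y y)
  choose φ hφY hφs using hs
  have h1 : TendstoLocallyUniformlyOn (fun n z => inner ℂ (s n) (S.ι (S.C z x)))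
      (fun z => inner ℂ y (S.ι (S.C z x))) atTop U := by
    refine TendstoUniformlyOn.tendstoLocallyUniformlyOn ?_
    rw [Metric.tendstoUniformlyOn_iff]
    intro ε hε
    have h2 : Tendsto (fun n => ‖y - s n‖ * (|M| + 1)) atTop (𝓝 0) := by
      have := ((hsy.const_sub y).norm).mul_const (|M| + 1)
      simpa using this
    filter_upwards [h2.eventually (gt_mem_nhds hε)] with n hn z hz
    rw [dist_eq_norm, ← inner_sub_left]
    refine lt_of_le_of_lt ((norm_inner_le_norm _ _).trans (mul_le_mul_of_nonneg_left ?_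
      (norm_nonneg _))) hn
    exact (hM z hz).trans ((le_abs_self M).trans (by linarith))
  refine h1.differentiableOn (Eventually.of_forall fun n => ?_) hU
  obtain ⟨η, hη⟩ := hS.Y_K (φ n) (hφY n)
  refine ((hS.differentiableOn_A x η).mono hUd).congr fun z hz => ?_
  rw [← hφs, hS.isKdual_C (hUd hz) x (φ n) (hφY n) η hη]

end Standing

namespace CompactModel

variable {D : Set ℂ} (M : CompactModel S D)

theorem exists_norm_Chat_le (x : X) : ∃ c, ∀ z ∈ D, ‖M.Chat z x‖ ≤ c := by
  obtain ⟨V, hV, hVb⟩ := M.bdd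
  obtain ⟨r, hr0, hr⟩ := ((absorbent_nhds_zero (𝕜 := ℂ) hV) x).exists_pos
  obtain ⟨v, hv, hvx⟩ := hr (r : ℂ) (by rw [Complex.norm_real]; exact le_abs_self r) rfl
  refine ⟨r, fun z hz => ?_⟩
  rw [← hvx]
  simp only [map_smul, norm_smul, Complex.norm_real, Real.norm_of_nonneg hr0.le]
  exact mul_le_of_le_one_right hr0.le (hVb z hz v hv)

/-- `e^{-zτ} C(z)` acting on the model space. -/
def T (z : ℂ) : M.Z →L[ℂ] M.Z := Complex.exp (-z * S.τ) • (M.Chat z).comp M.j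

theorem T_apply (z : ℂ) (v : M.Z) : M.T z v = Complex.exp (-z * S.τ) • M.Chat z (M.j v) := rfl

theorem isCompactOperator_T (z : ℂ) : IsCompactOperator (M.T z) := by
  refine ⟨(fun x => Complex.exp (-z * S.τ) • M.Chat z x) '' (M.j '' Metric.closedBall 0 1),
    M.compact.image ((M.Chat z).continuous.const_smul _), ?_⟩
  refine mem_of_superset (Metric.closedBall_mem_nhds (0 : M.Z) one_pos) fun v hv => ?_
  exact ⟨M.j v, ⟨v, hv, rfl⟩, rfl⟩

/-- Banach–Steinhaus on the model space: pointwise bounds come from the common neighbourhood in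
`bdd`. -/
theorem exists_norm_T_le (hD : IsCompact D) : ∃ c, ∀ z ∈ D, ‖M.T z‖ ≤ c := by
  have h1 : ∃ c, ∀ z : D, ‖(M.Chat z).comp M.j‖ ≤ c := by
    refine banach_steinhaus fun v => ?_
    obtain ⟨c, hc⟩ := M.exists_norm_Chat_le (M.j v)
    exact ⟨c, fun z => hc z z.2⟩
  obtain ⟨c, hc⟩ := h1
  obtain ⟨e, he⟩ := (hD.image (f := fun z : ℂ => Complex.exp (-z * S.τ)) (by fun_prop)).isBounded.exists_norm_le
  refine ⟨|e| * |c|, fun z hz => ?_⟩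
  rw [T, norm_smul]
  exact mul_le_mul ((he _ ⟨z, hz, rfl⟩).trans (le_abs_self e)) ((hc ⟨z, hz⟩).trans (le_abs_self c))
    (norm_nonneg _) (abs_nonneg _)

section Holomorphy

variable (hS : S.Standing)
include hS

/-- The functionals used to test holomorphy on the model space. -/
def polar : Set 𝓗 := {y | ∀ w : M.Z, ‖inner ℂ y (S.ι (M.j w))‖ ≤ ‖w‖}

theorem norm_le_of_polar {v : M.Z} {c : ℝ} (hc : 0 ≤ c)
    (h : ∀ y ∈ M.polar, ‖inner ℂ y (S.ι (M.j v))‖ ≤ c) : ‖v‖ ≤ c :=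
  norm_le_of_forall_polar (T := S.ι.comp M.j) (hS.inj.comp M.inj)
    (by
      have := M.compact.image S.ι.continuous
      rwa [← image_comp] at this) hc h

/-- The functional `v ↦ (v, y)` on the model space. -/
def test (y : 𝓗) : M.Z →L[ℂ] ℂ := (innerSL ℂ y).comp (S.ι.comp M.j)

theorem differentiableOn_test (hDd : D ⊆ S.dom) (y : 𝓗) (x : X) {U : Set ℂ} (hU : IsOpen U)
    (hUD : U ⊆ D) : DifferentiableOn ℂ (fun z => inner ℂ y (S.ι (M.j (M.Chat z x)))) U := by
  obtain ⟨c, hc⟩ := M.exists_norm_Chat_le x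
  refine (hS.differentiableOn_inner_C hU (hUD.trans hDd) y x
    (M := ‖S.ι.comp M.j‖ * |c|) fun z hz => ?_).congr fun z hz => by rw [M.spec z (hUD hz)]
  rw [← M.spec z (hUD hz)]
  exact ((S.ι.comp M.j).le_opNorm _).trans
    (mul_le_mul_of_nonneg_left ((hc z (hUD hz)).trans (le_abs_self c)) (norm_nonneg _))

theorem differentiableAt_Chat (hDd : D ⊆ S.dom) {z₀ : ℂ} (hz₀ : z₀ ∈ interior D) (x : X) :
    DifferentiableAt ℂ (fun z => M.Chat z x) z₀ := by
  obtain ⟨r, hr, hrD⟩ := Metric.isOpen_iff.1 isOpen_interior z₀ hz₀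
  obtain ⟨c, hc⟩ := M.exists_norm_Chat_le x
  refine differentiableAt_of_norming hr (M.test '' M.polar) ?_ ?_
    (M := c) (fun z hz => hc z (interior_subset (hrD hz))) ?_
  · rintro _ ⟨y, hy, rfl⟩ v
    exact hy v
  · intro v c hc h
    exact M.norm_le_of_polar hS hc fun y hy => h _ ⟨y, hy, rfl⟩
  · rintro _ ⟨y, hy, rfl⟩
    exact M.differentiableOn_test hS hDd y x Metric.isOpen_ball (hrD.trans interior_subset)

/-- Polar functionals paired with vectors of the unit ball norm the operators of the model space,
and these matrix elements are holomorphic. Holomorphy in operator norm is what the determinant and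
the inverse of 1 - T(z) require. -/
theorem differentiableAt_T (hD : IsCompact D) (hDd : D ⊆ S.dom) {z₀ : ℂ}
    (hz₀ : z₀ ∈ interior D) : DifferentiableAt ℂ M.T z₀ := by
  obtain ⟨r, hr, hrD⟩ := Metric.isOpen_iff.1 isOpen_interior z₀ hz₀
  obtain ⟨c, hc⟩ := M.exists_norm_T_le hD
  refine differentiableAt_of_norming hr
    {L | ∃ y ∈ M.polar, ∃ v : M.Z, ‖v‖ ≤ 1 ∧
      L = (M.test y).comp (ContinuousLinearMap.apply ℂ M.Z v)} ?_ ?_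
    (M := c) (fun z hz => hc z (interior_subset (hrD hz))) ?_
  · rintro _ ⟨y, hy, v, hv, rfl⟩ W
    refine (hy (W v)).trans ?_
    exact (W.le_opNorm v).trans (mul_le_of_le_one_right (norm_nonneg _) hv)
  · intro W c hc h
    refine ContinuousLinearMap.opNorm_le_of_unit_norm hc fun v hv => ?_
    exact M.norm_le_of_polar hS hc fun y hy => h _ ⟨y, hy, v, hv.le, rfl⟩
  · rintro _ ⟨y, hy, v, hv, rfl⟩
    have h1 := M.differentiableOn_test hS hDd y (M.j v) Metric.isOpen_ball
      (hrD.trans interior_subset)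
    have h2 : DifferentiableOn ℂ (fun z : ℂ => Complex.exp (-z * S.τ) *
        inner ℂ y (S.ι (M.j (M.Chat z (M.j v))))) (Metric.ball z₀ r) :=
      DifferentiableOn.mul (by fun_prop) h1
    refine h2.congr fun z _ => ?_
    change inner ℂ y (S.ι (M.j (M.T z v))) = _
    rw [T_apply, map_smul, map_smul, inner_smul_right]

/-- A vector in the kernel of id - e^{-zτ} C(z) equals e^{-zτ} C(z) of itself, so it already belongs
to the model space. -/
theorem injective_oneSub_iff (hDd : D ⊆ S.dom) {z : ℂ} (hz : z ∈ D) :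
    Function.Injective (S.oneSub z) ↔
      Function.Injective ⇑((1 : M.Z →L[ℂ] M.Z) - M.T z) := by
  rw [hS.injective_oneSub_iff (hDd hz), injective_iff_map_eq_zero]
  constructor
  · intro h v hv
    have h1 : v = M.T z v := sub_eq_zero.1 hv
    refine M.inj ?_
    rw [map_zero]
    refine h _ ?_
    rw [oneSub, ← M.spec z hz, ← map_smul, ← T_apply, ← h1, sub_self]
  · intro h x hx
    have h1 : x = M.j (Complex.exp (-z * S.τ) • M.Chat z x) := by
      rw [map_smul, M.spec z hz]
      exact sub_eq_zero.1 hx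
    have h2 := h (Complex.exp (-z * S.τ) • M.Chat z x) (by
      change _ - M.T z _ = 0
      rw [T_apply, ← h1]
      exact sub_self _)
    rw [h1, h2, map_zero]

/-- The inverse of `id - e^{-zτ} C(z)`. -/
theorem oneSub_inverse (hDd : D ⊆ S.dom) {z : ℂ} (hz : z ∈ D) (hu : IsUnit (1 - M.T z)) (y : X) :
    S.oneSub z (y + M.j (Ring.inverse (1 - M.T z) (Complex.exp (-z * S.τ) • M.Chat z y))) = y := by
  -- The identity (1 - jc)⁻¹ = 1 + j (1 - cj)⁻¹ c with c = e^{-zτ} `Chat`: the inverse on X is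
  -- expressed by an inverse on the Banach space, where cj is T(z).
  set w := Complex.exp (-z * S.τ) • M.Chat z y with hw
  set v := Ring.inverse (1 - M.T z) w with hv
  have h1 : v - M.T z v = w := by
    have : ((1 - M.T z) * Ring.inverse (1 - M.T z)) w = w := by
      rw [Ring.mul_inverse_cancel _ hu]; rfl
    exact this
  have h2 : S.C z (y + M.j v) = S.C z y + S.C z (M.j v) := (hS.CL (hDd hz)).map_add _ _
  rw [oneSub, h2, smul_add, ← M.spec z hz y, ← M.spec z hz (M.j v), ← map_smul M.j,
    ← map_smul M.j, ← hw, ← T_apply, add_sub_assoc, ← map_add M.j, ← map_sub M.j]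
  have : v - (w + M.T z v) = 0 := by rw [← h1]; abel
  rw [this, map_zero, add_zero]

end Holomorphy

end CompactModel

end Model

end DelaySystem

/-! ### Discreteness of the eigenvalues and holomorphy of the retarded resolvent -/

namespace DelaySystem

namespace Standing

variable {𝓗 X : Type*} [NormedAddCommGroup 𝓗] [InnerProductSpace ℂ 𝓗] [CompleteSpace 𝓗]
  [AddCommGroup X] [Module ℂ X] [UniformSpace X] [IsUniformAddGroup X] [ContinuousSMul ℂ X]
  [T2Space X] [LocallyConvexSpace ℝ X] [QuasiCompleteSpace ℂ X]
  {S : DelaySystem 𝓗 X} (hS : S.Standing) (hC : S.UniformlyCompact)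
include hS hC

theorem bijective_oneSub {z : ℂ} (hz : z ∈ S.dom \ S.poles) :
    Function.Bijective (S.oneSub z) := by
  have hinj : Function.Injective (S.oneSub z) := by
    by_contra h
    exact hz.2 ((hS.mem_poles_iff hz.1).2 h)
  have hD : ({z} : Set ℂ) ⊆ S.dom := singleton_subset_iff.2 hz.1
  obtain ⟨M⟩ := hS.exists_compactModel hC isCompact_singleton hD
  have hu := (M.isCompactOperator_T z).isUnit_one_sub_of_injective
    ((M.injective_oneSub_iff hS hD (mem_singleton z)).1 hinj)
  exact ⟨hinj, fun y => ⟨_, M.oneSub_inverse hS hD (mem_singleton z) hu y⟩⟩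

theorem poles_eq_empty_of_I_empty (h : ¬ S.I.Nonempty) : S.poles = ∅ := by
  rw [eq_empty_iff_forall_notMem]
  intro z hz
  have := hS.subsingleton_of_I_empty h
  exact (hS.mem_poles_iff hz.1).1 hz (Function.injective_of_subsingleton _)

omit [T2Space X] [LocallyConvexSpace ℝ X] [QuasiCompleteSpace ℂ X] [IsUniformAddGroup X]
  [ContinuousSMul ℂ X] hC in
theorem exists_closedBall_subset_dom {z₀ : ℂ} (hz₀ : z₀ ∈ S.dom) :
    ∃ r > 0, Metric.closedBall z₀ r ⊆ S.dom := by
  exact Metric.nhds_basis_closedBall.mem_iff.1 (hS.isOpen_dom.mem_nhds hz₀)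

/-- Around every point a model over a closed disc presents the eigenvalues as zeros of a
determinant. The sheet is connected when `I` is nonempty, and ‖K‖ + 1 is a point that is not an
eigenvalue. -/
theorem eventually_notMem_poles {z₀ : ℂ} (hz₀ : z₀ ∈ S.dom) : ∀ᶠ z in 𝓝[≠] z₀, z ∉ S.poles := by
  by_cases hI : S.I.Nonempty
  · have hpos : (‖S.K‖ + 1 : ℂ) ∈ S.dom := Or.inl (by
      simp only [Complex.add_re, Complex.ofReal_re, Complex.one_re]; positivity)
    refine eventually_notMem_of_locally_zero_set hS.isOpen_dom (hS.isPreconnected_dom hI) ?_ hpos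
      (fun h => ?_) hz₀
    · intro z₁ hz₁
      obtain ⟨r, hr, hrd⟩ := hS.exists_closedBall_subset_dom hz₁
      obtain ⟨M⟩ := hS.exists_compactModel hC (isCompact_closedBall z₁ r) hrd
      have hint : ∀ᶠ z in 𝓝 z₁, z ∈ Metric.ball z₁ r := Metric.ball_mem_nhds _ hr
      obtain ⟨d, hd, hdz⟩ := exists_analyticAt_eq_zero_iff_not_injective (T := M.T) (z₀ := z₁)
        (by
          filter_upwards [hint] with z hz
          exact M.differentiableAt_T hS (isCompact_closedBall z₁ r) hrd
            (Metric.ball_subset_interior_closedBall hz)) (M.isCompactOperator_T z₁)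
      refine ⟨d, hd, ?_⟩
      filter_upwards [hdz, hint] with z h1 h2
      have hzD : z ∈ Metric.closedBall z₁ r := Metric.ball_subset_closedBall h2
      rw [h1, hS.mem_poles_iff (hrd hzD), M.injective_oneSub_iff hS hrd hzD]
    · have := hS.re_le_of_mem_poles h
      simp only [Complex.add_re, Complex.ofReal_re, Complex.one_re] at this
      linarith
  · rw [hS.poles_eq_empty_of_I_empty hC hI]
    exact Eventually.of_forall fun _ => notMem_empty _

theorem finite_inter_poles {D : Set ℂ} (hD : IsCompact D) (hDd : D ⊆ S.dom) :
    (D ∩ S.poles).Finite :=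
  finite_inter_of_eventually_notMem (fun _ hz => hS.eventually_notMem_poles hC hz) hD hDd

theorem exists_punctured_ball {z₀ : ℂ} (hz₀ : z₀ ∈ S.dom) :
    ∃ r > 0, Metric.ball z₀ r \ {z₀} ⊆ S.dom \ S.poles := by
  have h1 := hS.eventually_notMem_poles hC hz₀
  rw [eventually_nhdsWithin_iff] at h1
  obtain ⟨r, hr, h⟩ := Metric.eventually_nhds_iff_ball.1
    (h1.and (hS.isOpen_dom.mem_nhds hz₀))
  exact ⟨r, hr, fun z hz => ⟨(h z hz.1).2, (h z hz.1).1 hz.2⟩⟩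

theorem isOpen_dom_diff_poles : IsOpen (S.dom \ S.poles) := by
  rw [Metric.isOpen_iff]
  intro z hz
  obtain ⟨r, hr, h⟩ := hS.exists_punctured_ball hC hz.1
  refine ⟨r, hr, fun w hw => ?_⟩
  by_cases hwz : w = z
  · rw [hwz]; exact hz
  · exact h ⟨hw, hwz⟩

/-- The inverse of `id - e^{-zτ} C(z)` as a linear map. -/
def Q {z : ℂ} (hz : z ∈ S.dom \ S.poles) : X →ₗ[ℂ] X :=
  (LinearEquiv.ofBijective (hS.oneSubL hz.1) (hS.bijective_oneSub hC hz)).symm.toLinearMap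

theorem oneSub_Q {z : ℂ} (hz : z ∈ S.dom \ S.poles) (y : X) : S.oneSub z (hS.Q hC hz y) = y :=
  (LinearEquiv.ofBijective (hS.oneSubL hz.1) (hS.bijective_oneSub hC hz)).apply_symm_apply y

theorem R_eq {z : ℂ} (hz : z ∈ S.dom \ S.poles) (y φ : X) :
    S.R z y φ = S.A z (hS.Q hC hz y) φ := by
  have hb := hS.bijective_oneSub hC hz
  rw [R]
  congr 1
  refine hb.1 ?_
  rw [hS.oneSub_Q hC hz, Function.rightInverse_invFun hb.2]

theorem R_eq_of_oneSub {z : ℂ} (hz : z ∈ S.dom \ S.poles) {x y : X} (h : S.oneSub z x = y)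
    (φ : X) : S.R z y φ = S.A z x φ := by
  rw [hS.R_eq hC hz]
  congr 1
  exact (hS.bijective_oneSub hC hz).1 ((hS.oneSub_Q hC hz y).trans h.symm)

theorem R_add_left {z : ℂ} (hz : z ∈ S.dom \ S.poles) (y y' φ : X) :
    S.R z (y + y') φ = S.R z y φ + S.R z y' φ := by
  simp only [hS.R_eq hC hz, map_add, hS.A_add_left hz.1]

theorem R_smul_left {z : ℂ} (hz : z ∈ S.dom \ S.poles) (c : ℂ) (y φ : X) :
    S.R z (c • y) φ = c * S.R z y φ := by
  simp only [hS.R_eq hC hz, map_smul, hS.A_smul_left hz.1]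

theorem R_add_right {z : ℂ} (hz : z ∈ S.dom \ S.poles) (y φ φ' : X) :
    S.R z y (φ + φ') = S.R z y φ + S.R z y φ' := by
  simp only [hS.R_eq hC hz, hS.A_add_right hz.1]

theorem R_smul_right {z : ℂ} (hz : z ∈ S.dom \ S.poles) (c : ℂ) (y φ : X) :
    S.R z y (c • φ) = starRingEnd ℂ c * S.R z y φ := by
  simp only [hS.R_eq hC hz, hS.A_smul_right hz.1]

variable [BarrelledSpace ℂ X]

theorem continuous_R_right {z : ℂ} (hz : z ∈ S.dom \ S.poles) (y : X) :
    Continuous fun φ => S.R z y φ := by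
  simp only [hS.R_eq hC hz]
  exact hS.continuous_A_right hz.1 _

/-- The resolvent is A(z) applied to y + j(w(z)), with `w` holomorphic into the model space. The
second summand is the diagonal of a function holomorphic in each variable separately;
Banach–Steinhaus on the model space makes it locally bounded, as the diagonal argument requires. -/
theorem differentiableAt_R {z₀ : ℂ} (hz₀ : z₀ ∈ S.dom \ S.poles) (y φ : X) :
    DifferentiableAt ℂ (fun z => S.R z y φ) z₀ := by
  obtain ⟨r, hr, hrd⟩ := Metric.nhds_basis_closedBall.mem_iff.1
    ((hS.isOpen_dom_diff_poles hC).mem_nhds hz₀)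
  have hrd' : Metric.closedBall z₀ r ⊆ S.dom := hrd.trans sdiff_subset
  have hcpt := isCompact_closedBall z₀ r
  obtain ⟨M⟩ := hS.exists_compactModel hC hcpt hrd'
  have hu : ∀ z ∈ Metric.closedBall z₀ r, IsUnit (1 - M.T z) := fun z hz =>
    (M.isCompactOperator_T z).isUnit_one_sub_of_injective
      ((M.injective_oneSub_iff hS hrd' hz).1 (hS.bijective_oneSub hC (hrd hz)).1)
  set w : ℂ → M.Z := fun z => Ring.inverse (1 - M.T z) (Complex.exp (-z * S.τ) • M.Chat z y)
    with hw
  have hwd : ∀ z ∈ Metric.ball z₀ r, DifferentiableAt ℂ w z := by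
    intro z hz
    have hzi := Metric.ball_subset_interior_closedBall hz
    have h1 : DifferentiableAt ℂ (fun z => Ring.inverse (1 - M.T z)) z := by
      obtain ⟨U, hU⟩ := hu z (Metric.ball_subset_closedBall hz)
      have h2 := differentiableAt_inverse (𝕜 := ℂ) (R := M.Z →L[ℂ] M.Z) U.isUnit
      rw [hU] at h2
      exact h2.comp (f := fun z => 1 - M.T z) z
        ((differentiableAt_const _).sub (M.differentiableAt_T hS hcpt hrd' hzi))
    refine h1.clm_apply (DifferentiableAt.smul (by fun_prop) ?_)
    exact M.differentiableAt_Chat hS hrd' hzi y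
  -- the restricted forms are uniformly bounded
  have hAlin : ∀ z ∈ S.dom, ∃ L : X →L[ℂ] ℂ, ∀ x, L x = S.A z x φ := fun z hz =>
    ⟨⟨{ toFun := fun ψ => S.A z ψ φ
        map_add' := fun ψ ψ' => hS.A_add_left hz ψ ψ' φ
        map_smul' := fun c ψ => hS.A_smul_left hz c ψ φ }, hS.continuous_A_left hz φ⟩,
      fun _ => rfl⟩
  choose! L hL using hAlin
  obtain ⟨c, hc⟩ : ∃ c, ∀ z : Metric.closedBall z₀ r, ‖(L z).comp M.j‖ ≤ c := by
    refine banach_steinhaus fun v => ?_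
    have h1 : ContinuousOn (fun z => S.A z (M.j v) φ) (Metric.closedBall z₀ r) :=
      (hS.differentiableOn_A _ _).continuousOn.mono hrd'
    obtain ⟨c, hc⟩ := (hcpt.image_of_continuousOn h1).isBounded.exists_norm_le
    refine ⟨c, fun z => ?_⟩
    change ‖L z (M.j v)‖ ≤ c
    rw [hL z (hrd' z.2)]
    exact hc _ ⟨z, z.2, rfl⟩
  have hsub : Metric.closedBall z₀ (r / 2) ⊆ Metric.ball z₀ r :=
    Metric.closedBall_subset_ball (half_lt_self hr)
  obtain ⟨c', hc'⟩ := ((isCompact_closedBall z₀ (r / 2)).image_of_continuousOn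
    (fun z hz => (hwd z (hsub hz)).continuousAt.continuousWithinAt)).isBounded.exists_norm_le
  have hball : Metric.ball z₀ (r / 2) ⊆ Metric.ball z₀ r :=
    Metric.ball_subset_closedBall.trans hsub
  have hballd : Metric.ball z₀ (r / 2) ⊆ S.dom :=
    hball.trans (Metric.ball_subset_closedBall.trans hrd')
  have hdiag : DifferentiableAt ℂ (fun z => S.A z (M.j (w z)) φ) z₀ := by
    refine differentiableAt_diag (G := fun z v => S.A z (M.j (w v)) φ) (half_pos hr)
      (M := |c| * |c'|) ?_ ?_ ?_
    · intro v _
      exact (hS.differentiableOn_A _ _).mono hballd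
    · intro z hz v hv
      have h1 : (fun v => S.A z (M.j (w v)) φ) = fun v => ((L z).comp M.j) (w v) := by
        funext v
        exact (hL z (hballd hz) _).symm
      rw [h1]
      exact ((((L z).comp M.j).differentiableAt).comp v (hwd v (hball hv))).differentiableWithinAt
    · intro z hz v hv
      have h1 : S.A z (M.j (w v)) φ = ((L z).comp M.j) (w v) := (hL z (hballd hz) _).symm
      rw [h1]
      refine (((L z).comp M.j).le_opNorm _).trans (mul_le_mul ?_ ?_ (norm_nonneg _) (abs_nonneg _))
      · exact (hc ⟨z, Metric.ball_subset_closedBall (hball hz)⟩).trans (le_abs_self _)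
      · exact (hc' _ ⟨v, Metric.ball_subset_closedBall hv, rfl⟩).trans (le_abs_self _)
  refine ((hS.differentiableAt_A hz₀.1 y φ).add hdiag).congr_of_eventuallyEq ?_
  filter_upwards [Metric.ball_mem_nhds z₀ hr] with z hz
  have hzD := Metric.ball_subset_closedBall hz
  rw [hS.R_eq_of_oneSub hC (hrd hzD) (M.oneSub_inverse hS hrd' hzD (hu z hzD) y),
    hS.A_add_left (hrd' hzD)]
  rfl

theorem differentiableOn_R (y φ : X) :
    DifferentiableOn ℂ (fun z => S.R z y φ) (S.dom \ S.poles) :=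
  fun _ hz => (hS.differentiableAt_R hC hz y φ).differentiableWithinAt

/-- Local equicontinuity of the resolvent. -/
theorem exists_seminorm_R_le {D : Set ℂ} (hD : IsCompact D) (hDd : D ⊆ S.dom \ S.poles) (y : X) :
    ∃ q : Seminorm ℂ X, Continuous q ∧ ∀ z ∈ D, ∀ φ, ‖S.R z y φ‖ ≤ q φ := by
  have hf : ∀ z : D, ∃ p : Seminorm ℂ X, Continuous p ∧ ∀ φ, p φ = ‖S.R z y φ‖ := fun z =>
    ⟨Seminorm.of (fun φ => ‖S.R z y φ‖)
      (fun φ φ' => by rw [hS.R_add_right hC (hDd z.2)]; exact norm_add_le _ _)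
      (fun c φ => by rw [hS.R_smul_right hC (hDd z.2), norm_mul, RCLike.norm_conj]),
      (hS.continuous_R_right hC (hDd z.2) y).norm, fun _ => rfl⟩
  choose p hp hpe using hf
  obtain ⟨q, hq, hpq⟩ := exists_continuous_seminorm_bound p hp (fun φ => by
    obtain ⟨c, hc⟩ := (hD.image_of_continuousOn
      ((hS.differentiableOn_R hC y φ).continuousOn.mono hDd)).isBounded.exists_norm_le
    exact ⟨c, fun z => by rw [hpe]; exact hc _ ⟨z, z.2, rfl⟩⟩)
  exact ⟨q, hq, fun z hz φ => by rw [← hpe ⟨z, hz⟩]; exact hpq _ _⟩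

end Standing

end DelaySystem

/-! ### Laurent expansion of the resolvent in the strong dual -/

section LaurentLinear

variable {f g : ℂ → ℂ} {z₀ : ℂ} {ρ : ℝ}

theorem circleIntegrable_laurent (hρ : 0 < ρ) (hf : ContinuousOn f (Metric.sphere z₀ ρ)) (j : ℤ) :
    CircleIntegrable (fun ζ => (z₀ - ζ) ^ (j - 1) * f ζ) z₀ ρ := by
  refine ContinuousOn.circleIntegrable hρ.le (ContinuousOn.mul ?_ hf)
  refine ContinuousOn.zpow₀ (by fun_prop) _ fun ζ hζ => Or.inl ?_
  intro h
  rw [mem_sphere_iff_norm, ← sub_eq_zero.1 h, sub_self, norm_zero] at hζ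
  exact hρ.ne hζ

theorem laurentCoeff_add (hρ : 0 < ρ) (hf : ContinuousOn f (Metric.sphere z₀ ρ))
    (hg : ContinuousOn g (Metric.sphere z₀ ρ)) (j : ℤ) :
    laurentCoeff (fun z => f z + g z) z₀ ρ j = laurentCoeff f z₀ ρ j + laurentCoeff g z₀ ρ j := by
  simp only [laurentCoeff, mul_add]
  rw [circleIntegral.integral_add (circleIntegrable_laurent hρ hf j)
    (circleIntegrable_laurent hρ hg j)]
  ring

theorem laurentCoeff_const_mul (c : ℂ) (j : ℤ) :
    laurentCoeff (fun z => c * f z) z₀ ρ j = c * laurentCoeff f z₀ ρ j := by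
  simp only [laurentCoeff, mul_left_comm _ c]
  rw [circleIntegral.integral_const_mul]
  ring

theorem laurentCoeff_congr (hρ : 0 < ρ) (h : EqOn f g (Metric.sphere z₀ ρ)) (j : ℤ) :
    laurentCoeff f z₀ ρ j = laurentCoeff g z₀ ρ j := by
  simp only [laurentCoeff]
  rw [circleIntegral.integral_congr hρ.le fun ζ hζ => by
    rw [h hζ]]

end LaurentLinear

namespace DelaySystem

section Expansion

variable {𝓗 X : Type*} [NormedAddCommGroup 𝓗] [InnerProductSpace ℂ 𝓗] [CompleteSpace 𝓗]
  [AddCommGroup X] [Module ℂ X] [UniformSpace X] [IsUniformAddGroup X] [ContinuousSMul ℂ X]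
  [T2Space X] [LocallyConvexSpace ℝ X] [QuasiCompleteSpace ℂ X] [BarrelledSpace ℂ X]

/-- A Laurent expansion of the resolvent on a punctured ball. -/
structure IsExpansion (S : DelaySystem 𝓗 X) (z : ℂ) (r : ℝ) (E : ℤ → X →ₗ[ℂ] AntiDual X) :
    Prop where
  pos : 0 < r
  subset : Metric.ball z r \ {z} ⊆ S.dom \ S.poles
  coeff : ∀ ρ, 0 < ρ → ρ < r → ∀ j y φ, E j y φ = laurentCoeff (fun w => S.R w y φ) z ρ j

namespace Standing

variable {S : DelaySystem 𝓗 X} (hS : S.Standing) (hC : S.UniformlyCompact)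
include hS hC

/-- The coefficients are circle integrals. Their continuity in φ comes from the seminorm that
dominates the resolvent on the circle, their linearity from that of the resolvent. -/
theorem exists_isExpansion {z : ℂ} (hz : z ∈ S.dom) :
    ∃ (r : ℝ) (E : ℤ → X →ₗ[ℂ] AntiDual X), S.IsExpansion z r E := by
  obtain ⟨r, hr, hsub⟩ := hS.exists_punctured_ball hC hz
  have hρ : 0 < r / 2 := half_pos hr
  have hρr : r / 2 < r := half_lt_self hr
  have hsph : Metric.sphere z (r / 2) ⊆ S.dom \ S.poles :=
    (sphere_subset_punctured_ball hρ hρr).trans hsub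
  have hcont : ∀ y φ, ContinuousOn (fun w => S.R w y φ) (Metric.sphere z (r / 2)) := fun y φ =>
    (hS.differentiableOn_R hC y φ).continuousOn.mono hsph
  have hlin : ∀ (j : ℤ) (y : X), ∃ F : AntiDual X,
      ∀ φ, F φ = laurentCoeff (fun w => S.R w y φ) z (r / 2) j := by
    intro j y
    obtain ⟨q, hq, hqR⟩ := hS.exists_seminorm_R_le hC (isCompact_sphere z (r / 2)) hsph y
    let F₀ : X →ₗ⋆[ℂ] ℂ :=
      { toFun := fun φ => laurentCoeff (fun w => S.R w y φ) z (r / 2) j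
        map_add' := fun φ φ' => by
          rw [← laurentCoeff_add hρ (hcont y φ) (hcont y φ')]
          exact laurentCoeff_congr hρ (fun w hw => hS.R_add_right hC (hsph hw) y φ φ') j
        map_smul' := fun c φ => by
          rw [smul_eq_mul, ← laurentCoeff_const_mul]
          exact laurentCoeff_congr hρ (fun w hw => hS.R_smul_right hC (hsph hw) c y φ) j }
    have hb : ∀ φ, ‖F₀ φ‖ ≤ (r / 2) ^ j * q φ := fun φ =>
      norm_laurentCoeff_le hρ (fun ζ hζ => hqR ζ hζ φ) j
    refine ⟨⟨F₀, ?_⟩, fun φ => rfl⟩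
    refine continuous_of_continuousAt_zero F₀ ?_
    rw [ContinuousAt, map_zero]
    refine squeeze_zero_norm hb ?_
    have := (hq.tendsto 0).const_mul ((r / 2) ^ j)
    rwa [map_zero, mul_zero] at this
  choose F hF using hlin
  refine ⟨r, fun j =>
    { toFun := F j
      map_add' := fun y y' => by
        ext φ
        rw [_root_.add_apply, hF, hF, hF, ← laurentCoeff_add hρ (hcont y φ) (hcont y' φ)]
        exact laurentCoeff_congr hρ (fun w hw => hS.R_add_left hC (hsph hw) y y' φ) j
      map_smul' := fun c y => by
        ext φ
        rw [RingHom.id_apply, _root_.smul_apply, hF, hF, smul_eq_mul,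
          ← laurentCoeff_const_mul]
        exact laurentCoeff_congr hρ (fun w hw => hS.R_smul_left hC (hsph hw) c y φ) j },
    hr, hsub, fun ρ hρ0 hρr' j y φ => ?_⟩
  exact (hF j y φ).trans (laurentCoeff_eq
    ((hS.differentiableOn_R hC y φ).mono hsub) hρ hρr hρ0 hρr' j)

end Standing

variable {S : DelaySystem 𝓗 X} (hS : S.Standing) (hC : S.UniformlyCompact)

namespace IsExpansion

variable {z : ℂ} {r : ℝ} {E : ℤ → X →ₗ[ℂ] AntiDual X} (hE : S.IsExpansion z r E)
include hS hC hE

theorem differentiableOn_R (y φ : X) :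
    DifferentiableOn ℂ (fun w => S.R w y φ) (Metric.ball z r \ {z}) :=
  (hS.differentiableOn_R hC y φ).mono hE.subset

/-- One seminorm for two radii: in the application they lie on either side of the distance to the
centre, one for positive and one for nonpositive indices. -/
theorem exists_seminorm_le (y : X) {ρ₁ ρ₂ : ℝ} (h1 : 0 < ρ₁) (h1r : ρ₁ < r) (h2 : 0 < ρ₂)
    (h2r : ρ₂ < r) : ∃ q : Seminorm ℂ X, Continuous q ∧ ∀ j φ,
      ‖E j y φ‖ ≤ ρ₁ ^ j * q φ ∧ ‖E j y φ‖ ≤ ρ₂ ^ j * q φ := by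
  obtain ⟨q, hq, hqR⟩ := hS.exists_seminorm_R_le hC
    ((isCompact_sphere z ρ₁).union (isCompact_sphere z ρ₂))
    (union_subset ((sphere_subset_punctured_ball h1 h1r).trans hE.subset)
      ((sphere_subset_punctured_ball h2 h2r).trans hE.subset)) y
  refine ⟨q, hq, fun j φ => ⟨?_, ?_⟩⟩
  · rw [hE.coeff ρ₁ h1 h1r]
    exact norm_laurentCoeff_le h1 (fun ζ hζ => hqR ζ (Or.inl hζ) φ) j
  · rw [hE.coeff ρ₂ h2 h2r]
    exact norm_laurentCoeff_le h2 (fun ζ hζ => hqR ζ (Or.inr hζ) φ) j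

theorem isLaurent : S.IsLaurent z E := by
  refine ⟨r, hE.pos, fun w hwz hwr => ?_⟩
  have hw : w ∈ Metric.ball z r \ {z} := ⟨mem_ball_iff_norm.2 hwr, hwz⟩
  have hwd := hE.subset hw
  refine ⟨hwd, fun y => ?_⟩
  set d := ‖w - z‖ with hd
  have hd0 : 0 < d := norm_pos_iff.2 (sub_ne_zero.2 hwz)
  obtain ⟨ρ₁, h1, h1r⟩ := exists_between hwr
  have h10 : 0 < ρ₁ := hd0.trans h1
  have h20 : 0 < d / 2 := half_pos hd0
  obtain ⟨q, hq, hEq⟩ := hE.exists_seminorm_le hS hC y h10 h1r h20 ((half_lt_self hd0).trans hwr)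
  let F : AntiDual X :=
    ⟨{ toFun := fun φ => S.R w y φ
       map_add' := hS.R_add_right hC hwd y
       map_smul' := fun c φ => hS.R_smul_right hC hwd c y φ }, hS.continuous_R_right hC hwd y⟩
  refine ⟨F, fun φ => rfl, ?_⟩
  have hdj : ∀ j : ℤ, ‖(z - w) ^ (-j)‖ = (d ^ j)⁻¹ := fun j => by
    rw [norm_zpow, norm_sub_rev, zpow_neg]
  -- The circle of radius d/2 controls the positive indices, the larger circle of radius ρ₁ > d the
  -- others; both sides become geometric.
  set v : ℤ → ℝ := fun j => if 0 < j then (1 / 2 : ℝ) ^ j else (ρ₁ / d) ^ j with hv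
  refine hasSum_antiDual hq (v := v) ?_ ?_ ?_
  · refine Summable.of_nat_of_neg ?_ ?_
    · refine (summable_geometric_of_lt_one (by norm_num) (by norm_num : (1 / 2 : ℝ) < 1)).congr ?_
      intro n
      simp only [hv]
      split_ifs with h
      · rw [zpow_natCast]
      · have : n = 0 := by omega
        subst this; simp
    · refine (summable_geometric_of_lt_one (r := d / ρ₁) (by positivity)
        ((div_lt_one h10).2 h1)).congr fun n => ?_
      simp only [hv]
      rw [if_neg (by omega), zpow_neg, zpow_natCast, ← inv_pow, inv_div]
  · intro j φ
    rw [_root_.smul_apply, norm_smul, hdj]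
    have hdj0 : 0 < d ^ j := zpow_pos hd0 j
    simp only [hv]
    split_ifs with h
    · calc _ ≤ (d ^ j)⁻¹ * ((d / 2) ^ j * q φ) :=
            mul_le_mul_of_nonneg_left (hEq j φ).2 (by positivity)
        _ = _ := by
            rw [div_zpow, one_div, inv_zpow]
            field_simp
    · calc _ ≤ (d ^ j)⁻¹ * (ρ₁ ^ j * q φ) :=
            mul_le_mul_of_nonneg_left (hEq j φ).1 (by positivity)
        _ = _ := by
            rw [div_zpow]
            field_simp
  · intro φ
    have := hasSum_laurent (hE.differentiableOn_R hS hC y φ) hw h10 h1r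
    refine this.congr_fun ?_ |> fun h => h
    intro j
    rw [_root_.smul_apply, smul_eq_mul, hE.coeff ρ₁ h10 h1r]

end IsExpansion

end Expansion

end DelaySystem

/-! ### Laplace transforms and their inversion -/

open scoped FourierTransform in
/-- The Fourier transform maps `L¹ ∩ L²` to `L²`. -/
theorem memLp_fourier {E : Type*} [NormedAddCommGroup E] [InnerProductSpace ℂ E] [CompleteSpace E]
    {f : ℝ → E} (h1 : Integrable f) (h2 : MemLp f 2) : MemLp (𝓕 f) 2 := by
  set F : Lp (α := ℝ) E 2 volume := 𝓕 (h2.toLp f) with hF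
  have hFm : MemLp (F : ℝ → E) 2 := Lp.memLp F
  have hc : Continuous (𝓕 f) :=
    VectorFourier.fourierIntegral_continuous Real.continuous_fourierChar
      (innerSL ℝ).continuous₂ h1
  -- The L² transform and the integral transform are compared by testing: on test functions both
  -- move the transform onto the test function, the first through tempered distributions, the second
  -- through Fubini.
  have hae : (F : ℝ → E) =ᵐ[volume] 𝓕 f := by
    refine ae_eq_of_integral_contDiff_smul_eq
      (hFm.locallyIntegrable (by norm_num)) hc.locallyIntegrable fun g hg hgs => ?_
    have hgs' : HasCompactSupport (fun x => (g x : ℂ)) := hgs.comp_left (g := fun r : ℝ => (r : ℂ)) rfl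
    have hg' : ContDiff ℝ (⊤ : ℕ∞) (fun x => (g x : ℂ)) := Complex.ofRealCLM.contDiff.comp hg
    set G : SchwartzMap ℝ ℂ := hgs'.toSchwartzMap hg' with hG
    have e1 : ∫ x, G x • (F : ℝ → E) x = ∫ x, (𝓕 G) x • (h2.toLp f : ℝ → E) x := by
      rw [← Lp.toTemperedDistribution_apply, ← Lp.toTemperedDistribution_apply, hF,
        ← Lp.fourier_toTemperedDistribution_eq]
      rfl
    have e2 : ∫ x, (𝓕 G) x • (h2.toLp f : ℝ → E) x = ∫ x, (𝓕 G) x • f x := by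
      refine integral_congr_ae ?_
      filter_upwards [h2.coeFn_toLp] with x hx
      rw [hx]
    have e3 : ∫ x, (𝓕 G) x • f x = ∫ x, G x • (𝓕 f) x := by
      have := VectorFourier.integral_fourierIntegral_smul_eq_flip (L := innerₗ ℝ) (μ := volume)
        (ν := volume) Real.continuous_fourierChar continuous_inner G.integrable h1
      simpa using! this
    have e4 := (e1.trans e2).trans e3
    have e5 : ∀ x, G x = (g x : ℂ) := fun x => rfl
    simpa [e5] using e4
  exact hFm.ae_eq hae

/-- The Laplace transform of a function on the half-line. -/
def laplace {E : Type*} [NormedAddCommGroup E] [NormedSpace ℂ E] (v : ℝ → E) (z : ℂ) : E :=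
  ∫ t in Ioi (0 : ℝ), Complex.exp (-z * t) • v t

section Laplace

variable {E : Type*} [NormedAddCommGroup E] [NormedSpace ℂ E]

-- Along a vertical line the Laplace transform is the Fourier transform of the damped function cut
-- off to the half-line; the factor 2π comes from the normalisation of `𝓕`.
open scoped FourierTransform in
theorem fourier_indicator_eq_laplace (v : ℝ → E) (a ξ : ℝ) :
    𝓕 ((Ioi (0 : ℝ)).indicator fun t : ℝ => Complex.exp (-a * t) • v t) ξ
      = laplace v (vline a (2 * Real.pi * ξ)) := by
  rw [Real.fourier_eq', laplace, ← integral_indicator measurableSet_Ioi]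
  congr 1
  ext t
  by_cases ht : t ∈ Ioi (0 : ℝ)
  · rw [indicator_of_mem ht, indicator_of_mem ht, smul_smul, ← Complex.exp_add]
    congr 2
    simp [vline]
    ring
  · rw [indicator_of_notMem ht, indicator_of_notMem ht, smul_zero]

theorem integrable_exp_smul_congr_re {v : ℝ → E} {a : ℝ} {z : ℂ} (hz : z.re = a)
    (h : IntegrableOn (fun t : ℝ => Complex.exp (-a * t) • v t) (Ioi 0)) :
    IntegrableOn (fun t : ℝ => Complex.exp (-z * t) • v t) (Ioi 0) := by
  have h1 : ∀ t : ℝ, Complex.exp (-z * t) • v t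
      = Complex.exp (-(z.im * Complex.I) * t) • Complex.exp (-a * t) • v t := fun t => by
    rw [smul_smul, ← Complex.exp_add]
    congr 2
    apply Complex.ext <;> simp [hz]
  simp_rw [h1]
  refine Integrable.bdd_smul (𝕜 := ℂ) h 1 (Continuous.aestronglyMeasurable (by fun_prop)) ?_
  refine Eventually.of_forall fun t => ?_
  rw [Complex.norm_exp]
  simp

variable [CompleteSpace E]

open scoped FourierTransform in
/-- **Laplace inversion** at a point of continuity, when the transform is integrable. -/
theorem laplace_inversion {v : ℝ → E} {a t : ℝ} (ht : 0 < t)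
    (h : IntegrableOn (fun t : ℝ => Complex.exp (-a * t) • v t) (Ioi 0))
    (hv : ContinuousAt v t) (hG : Integrable fun s : ℝ => laplace v (vline a s)) :
    (2 * Real.pi : ℂ)⁻¹ • ∫ s : ℝ, Complex.exp (vline a s * t) • laplace v (vline a s) = v t := by
  set k := (Ioi (0 : ℝ)).indicator fun t : ℝ => Complex.exp (-a * t) • v t with hk
  have hk1 : Integrable k := (integrable_indicator_iff measurableSet_Ioi).2 h
  have hFk : 𝓕 k = fun ξ : ℝ => laplace v (vline a (2 * Real.pi * ξ)) := by
    ext ξ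
    exact fourier_indicator_eq_laplace v a ξ
  have hk2 : Integrable (𝓕 k) := hFk ▸ hG.comp_mul_left' (by positivity)
  have hk3 : ContinuousAt k t := by
    have : (fun t : ℝ => Complex.exp (-a * t) • v t) =ᶠ[𝓝 t] k := by
      filter_upwards [Ioi_mem_nhds ht] with s hs
      rw [hk, indicator_of_mem hs]
    refine ContinuousAt.congr ?_ this
    exact ContinuousAt.smul (by fun_prop) hv
  have h1 := hk1.fourierInv_fourier_eq hk2 hk3
  rw [Real.fourierInv_eq', hFk, hk, indicator_of_mem (mem_Ioi.2 ht)] at h1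
  have h2 : ∫ ξ : ℝ, Complex.exp (↑(2 * Real.pi * inner ℝ ξ t) * Complex.I) •
        laplace v (vline a (2 * Real.pi * ξ))
      = (2 * Real.pi : ℂ)⁻¹ • ∫ s : ℝ, Complex.exp (s * t * Complex.I) • laplace v (vline a s) := by
    have := Measure.integral_comp_mul_left
      (fun s : ℝ => Complex.exp (s * t * Complex.I) • laplace v (vline a s)) (2 * Real.pi)
    rw [abs_of_pos (by positivity)] at this
    rw [show ((2 * Real.pi : ℂ)⁻¹) = (((2 * Real.pi)⁻¹ : ℝ) : ℂ) by push_cast; rfl,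
      Complex.coe_smul, ← this]
    congr 1
    ext ξ
    congr 2
    simp
    ring
  rw [h2] at h1
  have h3 := congrArg (fun w => Complex.exp (a * t) • w) h1
  simp only [smul_smul, ← Complex.exp_add] at h3
  rw [show (a : ℂ) * t + -a * t = 0 by ring, Complex.exp_zero, one_smul] at h3
  rw [← h3, mul_smul, smul_comm (Complex.exp (a * t)) (2 * Real.pi : ℂ)⁻¹,
    ← integral_smul (Complex.exp (a * t))]
  refine congrArg (fun w : E => (2 * Real.pi : ℂ)⁻¹ • w)
    (integral_congr_ae (Eventually.of_forall fun s => ?_))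
  simp only
  rw [smul_smul, ← Complex.exp_add]
  congr 2
  simp [vline]
  ring

/-- The Laplace transform of a primitive. -/
theorem laplace_primitive {v : ℝ → E} {z : ℂ} (hz : 0 < z.re)
    (h : IntegrableOn (fun t : ℝ => Complex.exp (-z * t) • v t) (Ioi 0)) :
    IntegrableOn (fun t : ℝ => Complex.exp (-z * t) • ∫ s in (0 : ℝ)..t, v s) (Ioi 0) ∧
      laplace (fun t => ∫ s in (0 : ℝ)..t, v s) z = z⁻¹ • laplace v z := by
  -- The damped primitive is the convolution of the damped function `g` with the damped Heaviside
  -- function `f`, and the integral of a convolution factors.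
  set f : ℝ → ℂ := (Ioi (0 : ℝ)).indicator fun t : ℝ => Complex.exp (-z * t) with hf
  set g : ℝ → E := (Ioi (0 : ℝ)).indicator fun t : ℝ => Complex.exp (-z * t) • v t with hg
  have hzz : z ≠ 0 := fun h => by simp [h] at hz
  have hfi : Integrable f :=
    (integrable_indicator_iff measurableSet_Ioi).2
      (integrableOn_exp_mul_complex_Ioi (by simpa using hz) 0)
  have hgi : Integrable g := (integrable_indicator_iff measurableSet_Ioi).2 h
  have hfint : ∫ t, f t = z⁻¹ := by
    rw [hf, integral_indicator measurableSet_Ioi, integral_exp_mul_complex_Ioi (by simpa using hz)]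
    simp [neg_div_neg_eq]
  let L : E →L[ℂ] ℂ →L[ℂ] E := (ContinuousLinearMap.lsmul ℂ ℂ).flip
  have hLapp : ∀ x c, L x c = c • x := fun x c => rfl
  have hconv : ∀ t, (convolution g f L volume) t
      = (Ioi (0 : ℝ)).indicator (fun t : ℝ => Complex.exp (-z * t) • ∫ s in (0 : ℝ)..t, v s) t := by
    intro t
    rw [convolution]
    simp only [hLapp]
    by_cases ht : 0 < t
    · rw [indicator_of_mem (mem_Ioi.2 ht), ← intervalIntegral.integral_smul,
        intervalIntegral.integral_of_le ht.le, integral_Ioc_eq_integral_Ioo,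
        ← integral_indicator measurableSet_Ioo]
      congr 1
      ext s
      by_cases hs : s ∈ Ioo 0 t
      · rw [indicator_of_mem hs, hf, indicator_of_mem (show t - s ∈ Ioi 0 from sub_pos.2 hs.2), hg,
          indicator_of_mem (mem_Ioi.2 hs.1), smul_smul, ← Complex.exp_add]
        congr 2
        push_cast
        ring
      · rw [indicator_of_notMem hs]
        by_cases hs0 : 0 < s
        · rw [hf, indicator_of_notMem, zero_smul]
          intro h'
          exact hs ⟨hs0, sub_pos.1 h'⟩
        · rw [hg, indicator_of_notMem (by exact hs0), smul_zero]
    · rw [indicator_of_notMem (by exact ht)]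
      have : ∀ s, f (t - s) • g s = 0 := fun s => by
        by_cases hs0 : 0 < s
        · rw [hf, indicator_of_notMem, zero_smul]
          simp only [mem_Ioi, not_lt]
          linarith
        · rw [hg, indicator_of_notMem (by exact hs0), smul_zero]
      simp [this]
  have hconv' := funext hconv
  constructor
  · rw [← integrable_indicator_iff measurableSet_Ioi, ← hconv']
    exact hgi.integrable_convolution L hfi
  · have h1 := integral_convolution L (μ := volume) (ν := volume) hgi hfi
    rw [hconv', integral_indicator measurableSet_Ioi, hLapp, hfint, hg,
      integral_indicator measurableSet_Ioi] at h1
    exact h1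

theorem ContinuousLinearMap.laplace_comp {F : Type*} [NormedAddCommGroup F] [NormedSpace ℂ F]
    [CompleteSpace F] (T : E →L[ℂ] F) {v : ℝ → E} {z : ℂ}
    (h : IntegrableOn (fun t : ℝ => Complex.exp (-z * t) • v t) (Ioi 0)) :
    IntegrableOn (fun t : ℝ => Complex.exp (-z * t) • T (v t)) (Ioi 0) ∧
      laplace (fun t => T (v t)) z = T (laplace v z) := by
  have e : (fun t : ℝ => Complex.exp (-z * t) • T (v t))
      = fun t : ℝ => T (Complex.exp (-z * t) • v t) := by
    ext t
    rw [map_smul]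
  refine ⟨e ▸ T.integrable_comp h, ?_⟩
  rw [laplace, e, laplace, T.integral_comp_comm h]

end Laplace

open scoped FourierTransform in
theorem memLp_laplace {E : Type*} [NormedAddCommGroup E] [InnerProductSpace ℂ E] [CompleteSpace E]
    {v : ℝ → E} {a : ℝ}
    (h1 : IntegrableOn (fun t : ℝ => Complex.exp (-a * t) • v t) (Ioi 0))
    (h2 : MemLp (fun t : ℝ => Complex.exp (-a * t) • v t) 2 (volume.restrict (Ioi 0))) :
    Integrable fun s : ℝ => ‖laplace v (vline a s)‖ ^ 2 := by
  set k := (Ioi (0 : ℝ)).indicator fun t : ℝ => Complex.exp (-a * t) • v t with hk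
  have hk1 : Integrable k := (integrable_indicator_iff measurableSet_Ioi).2 h1
  have hk2 : MemLp k 2 := (memLp_indicator_iff_restrict measurableSet_Ioi).2 h2
  have h3 := (memLp_fourier hk1 hk2).integrable_norm_pow (by norm_num)
  have h4 : Integrable fun ξ : ℝ => ‖laplace v (vline a (2 * Real.pi * ξ))‖ ^ 2 := by
    refine h3.congr (Eventually.of_forall fun ξ => ?_)
    simp only [hk, fourier_indicator_eq_laplace]
  exact (integrable_comp_mul_left_iff (fun s : ℝ => ‖laplace v (vline a s)‖ ^ 2)
    (by positivity : (2 * Real.pi) ≠ 0)).1 h4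

/-! ### Energy estimate, Grönwall and the transform of a mild solution -/

section Growth

variable {𝓗 : Type*} [NormedAddCommGroup 𝓗] [InnerProductSpace ℂ 𝓗] [CompleteSpace 𝓗]
  {H : 𝓗 →ₗ.[ℂ] 𝓗}

/-- A differentiable curve whose norm has derivative at most `k`, in the weak sense
`Re (V, V') ≤ ‖V‖ k`, grows at most like the primitive of `k`. -/
theorem norm_le_add_integral_of_re_inner_le {V V' : ℝ → 𝓗} {k : ℝ → ℝ}
    (hV : ∀ s, HasDerivAt V (V' s) s) (hk : Continuous k)
    (h : ∀ s, 0 < s → (inner ℂ (V s) (V' s)).re ≤ ‖V s‖ * k s) (hk0 : ∀ s, 0 < s → 0 ≤ k s)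
    {t : ℝ} (ht : 0 ≤ t) : ‖V t‖ ≤ ‖V 0‖ + ∫ s in (0 : ℝ)..t, k s := by
  refine le_of_forall_pos_le_add fun ε hε => ?_
  let _ : InnerProductSpace ℝ 𝓗 := InnerProductSpace.rclikeToReal ℂ 𝓗
  have hpos : ∀ s, 0 < ‖V s‖ ^ 2 + ε ^ 2 := fun s => by positivity
  -- The ε keeps the square root differentiable where V vanishes.
  set N : ℝ → ℝ := fun s => Real.sqrt (‖V s‖ ^ 2 + ε ^ 2) - ∫ r in (0 : ℝ)..s, k r with hN
  have hd : ∀ s, HasDerivAt N ((2 * (inner ℂ (V s) (V' s)).re) /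
      (2 * Real.sqrt (‖V s‖ ^ 2 + ε ^ 2)) - k s) s := by
    intro s
    have h1 : HasDerivAt (fun s => ‖V s‖ ^ 2 + ε ^ 2) (2 * (inner ℂ (V s) (V' s)).re) s :=
      ((hV s).norm_sq).add_const _
    exact (h1.sqrt (hpos s).ne').sub
      (hk.integral_hasStrictDerivAt 0 s).hasDerivAt
  have hanti : AntitoneOn N (Ici 0) := by
    refine antitoneOn_of_deriv_nonpos (convex_Ici 0)
      (fun s _ => (hd s).continuousAt.continuousWithinAt)
      (fun s _ => (hd s).differentiableAt.differentiableWithinAt) fun s hs => ?_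
    rw [interior_Ici, mem_Ioi] at hs
    rw [(hd s).deriv, sub_nonpos, mul_div_mul_left _ _ two_ne_zero,
      div_le_iff₀ (Real.sqrt_pos.2 (hpos s))]
    refine (h s hs).trans ?_
    rw [mul_comm]
    refine mul_le_mul_of_nonneg_left ?_ (hk0 s hs)
    refine Real.le_sqrt_of_sq_le ?_
    linarith [sq_nonneg ε]
  have h1 := hanti (mem_Ici.2 le_rfl) (mem_Ici.2 ht) ht
  simp only [hN, intervalIntegral.integral_same, sub_zero] at h1
  have h2 : ‖V t‖ ≤ Real.sqrt (‖V t‖ ^ 2 + ε ^ 2) :=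
    Real.le_sqrt_of_sq_le (by linarith [sq_nonneg ε])
  have h3 : Real.sqrt (‖V 0‖ ^ 2 + ε ^ 2) ≤ ‖V 0‖ + ε :=
    Real.sqrt_le_iff.2 ⟨by positivity, by nlinarith [norm_nonneg (V 0)]⟩
  linarith

/-- The energy estimate for mild solutions of `u' = iH u + w` with `H` self-adjoint. -/
theorem IsSelfAdjoint.norm_mild_le (hH : IsSelfAdjoint H) {u w : ℝ → 𝓗} {x : 𝓗}
    (hu : Continuous u) (hw : ∀ a b, IntervalIntegrable w volume a b)
    (heq : ∀ t, 0 ≤ t → ∃ v, ((∫ s in (0 : ℝ)..t, u s), v) ∈ H.graph ∧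
      u t = x + Complex.I • v + ∫ s in (0 : ℝ)..t, w s) {t : ℝ} (ht : 0 ≤ t) :
    ‖u t‖ ≤ ‖u 0‖ + ∫ s in (0 : ℝ)..t, ‖w s‖ := by
  set W : ℝ → ℝ := fun s => ∫ r in (0 : ℝ)..s, ‖w r‖ with hW
  have hWc : Continuous W := intervalIntegral.continuous_primitive (fun a b => (hw a b).norm) 0
  have hWs : ∀ s r, W r - W s = ∫ m in s..r, ‖w m‖ := fun s r =>
    intervalIntegral.integral_interval_sub_left (hw 0 r).norm (hw 0 s).norm
  have hWm : Monotone W := fun s r hsr => by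
    rw [← sub_nonneg, hWs]
    exact intervalIntegral.integral_nonneg hsr fun _ _ => norm_nonneg _
  set U : ℝ → 𝓗 := fun s => ∫ r in (0 : ℝ)..s, u r with hU
  have hUd : ∀ s, HasDerivAt U (u s) s := fun s => (hu.integral_hasStrictDerivAt 0 s).hasDerivAt
  -- `u` itself need not be differentiable, so the energy argument is applied to the increments U(s
  -- + δ) - U(s) of its primitive. Their derivative is iH of the increment, invisible to the real
  -- part, plus an integral of `w`. Dividing by δ and letting δ tend to 0 returns to `u`.
  have hbound : ∀ δ : ℝ, 0 < δ → ‖U (t + δ) - U t‖ ≤ ‖U δ‖ + δ * W (t + δ) := by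
    intro δ hδ
    have h1 := norm_le_add_integral_of_re_inner_le (V := fun s => U (s + δ) - U s)
      (V' := fun s => u (s + δ) - u s) (k := fun s => W (s + δ) - W s)
      (fun s => ((hUd (s + δ)).comp_add_const s δ).sub (hUd s)) (by fun_prop) ?_
      (fun s _ => sub_nonneg.2 (hWm (by linarith))) ht
    · simp only [zero_add] at h1
      have h0 : U 0 = 0 := intervalIntegral.integral_same
      rw [h0, sub_zero] at h1
      refine h1.trans (add_le_add le_rfl ?_)
      have e1 : ∫ s in (0 : ℝ)..t, (W (s + δ) - W s)
          = (∫ s in t..t + δ, W s) - ∫ s in (0 : ℝ)..δ, W s := by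
        have hWδ : Continuous fun s => W (s + δ) := by fun_prop
        rw [intervalIntegral.integral_sub (hWδ.intervalIntegrable _ _)
          (hWc.intervalIntegrable _ _), intervalIntegral.integral_comp_add_right, zero_add]
        have a1 := intervalIntegral.integral_add_adjacent_intervals
          (hWc.intervalIntegrable (μ := volume) 0 δ) (hWc.intervalIntegrable δ (t + δ))
        have a2 := intervalIntegral.integral_add_adjacent_intervals
          (hWc.intervalIntegrable (μ := volume) 0 t) (hWc.intervalIntegrable t (t + δ))
        linarith
      rw [e1]
      have e2 : 0 ≤ ∫ s in (0 : ℝ)..δ, W s :=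
        intervalIntegral.integral_nonneg hδ.le fun s hs =>
          (le_of_eq (by simp [hW])).trans (hWm hs.1)
      have e3 : ∫ s in t..t + δ, W s ≤ ∫ s in t..t + δ, W (t + δ) :=
        intervalIntegral.integral_mono_on (by linarith) (hWc.intervalIntegrable _ _)
          (by simp) fun s hs => hWm hs.2
      rw [intervalIntegral.integral_const, add_sub_cancel_left, smul_eq_mul] at e3
      linarith
    · intro s hs
      obtain ⟨v, hv, huv⟩ := heq s hs.le
      obtain ⟨v', hv', huv'⟩ := heq (s + δ) (by linarith)
      have hg : (U (s + δ) - U s, v' - v) ∈ H.graph := H.graph.sub_mem hv' hv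
      have e : u (s + δ) - u s = Complex.I • (v' - v) + ∫ r in s..s + δ, w r := by
        rw [huv, huv', ← intervalIntegral.integral_interval_sub_left (hw 0 (s + δ)) (hw 0 s),
          smul_sub]
        abel
      rw [e, inner_add_right, Complex.add_re, hH.re_inner_I_graph hg, zero_add]
      refine (Complex.re_le_norm _).trans ((norm_inner_le_norm _ _).trans ?_)
      refine mul_le_mul_of_nonneg_left ?_ (norm_nonneg _)
      rw [hWs]
      exact intervalIntegral.norm_integral_le_integral_norm (by linarith)
  have hlim : ∀ s, Tendsto (fun δ : ℝ => δ⁻¹ • (U (s + δ) - U s)) (𝓝[>] 0) (𝓝 (u s)) := fun s =>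
    (hasDerivAt_iff_tendsto_slope_zero.1 (hUd s)).mono_left
      (nhdsWithin_mono _ fun x hx => ne_of_gt hx)
  have hl := (hlim t).norm
  have hr : Tendsto (fun δ : ℝ => ‖δ⁻¹ • (U (0 + δ) - U 0)‖ + W (t + δ)) (𝓝[>] 0)
      (𝓝 (‖u 0‖ + W t)) := by
    refine (hlim 0).norm.add ?_
    have : Tendsto (fun δ : ℝ => W (t + δ)) (𝓝 0) (𝓝 (W (t + 0))) :=
      (hWc.comp (by fun_prop : Continuous fun δ : ℝ => t + δ)).tendsto 0
    rw [add_zero] at this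
    exact this.mono_left nhdsWithin_le_nhds
  refine le_of_tendsto_of_tendsto hl hr ?_
  filter_upwards [self_mem_nhdsWithin] with δ hδ
  have hδ' : 0 < δ := hδ
  have h0 : U 0 = 0 := intervalIntegral.integral_same
  have := hbound δ hδ'
  rw [h0, sub_zero, zero_add, norm_smul, norm_smul, Real.norm_of_nonneg (inv_nonneg.2 hδ'.le)]
  calc δ⁻¹ * ‖U (t + δ) - U t‖ ≤ δ⁻¹ * (‖U δ‖ + δ * W (t + δ)) := by gcongr
    _ = δ⁻¹ * ‖U δ‖ + W (t + δ) := by field_simp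

/-- Grönwall's inequality in integral form. -/
theorem le_mul_exp_of_le_add_integral {φ : ℝ → ℝ} (hφ : Continuous φ) {c κ : ℝ} (hκ : 0 ≤ κ)
    (h : ∀ t, 0 ≤ t → φ t ≤ c + κ * ∫ s in (0 : ℝ)..t, φ s) {t : ℝ} (ht : 0 ≤ t) :
    φ t ≤ c * Real.exp (κ * t) := by
  set N : ℝ → ℝ := fun s => Real.exp (-(κ * s)) * (c + κ * ∫ r in (0 : ℝ)..s, φ r) with hN
  have hd : ∀ s, HasDerivAt N (Real.exp (-(κ * s)) * (-(κ * 1)) * (c + κ * ∫ r in (0 : ℝ)..s, φ r)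
      + Real.exp (-(κ * s)) * (κ * φ s)) s := fun s =>
    (((hasDerivAt_id s).const_mul κ).neg.exp).mul
      (((hφ.integral_hasStrictDerivAt 0 s).hasDerivAt.const_mul κ).const_add c)
  have hanti : AntitoneOn N (Ici 0) := by
    refine antitoneOn_of_deriv_nonpos (convex_Ici 0)
      (fun s _ => (hd s).continuousAt.continuousWithinAt)
      (fun s _ => (hd s).differentiableAt.differentiableWithinAt) fun s hs => ?_
    rw [interior_Ici, mem_Ioi] at hs
    rw [(hd s).deriv]
    have h1 := h s hs.le
    have h2 := mul_nonneg (mul_nonneg (Real.exp_pos (-(κ * s))).le hκ) (sub_nonneg.2 h1)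
    linarith
  have h1 := hanti (mem_Ici.2 le_rfl) (mem_Ici.2 ht) ht
  simp only [hN, intervalIntegral.integral_same, mul_zero, neg_zero, Real.exp_zero, one_mul,
    add_zero] at h1
  refine (h t ht).trans ?_
  have h2 := mul_le_mul_of_nonneg_right h1 (Real.exp_pos (κ * t)).le
  rwa [mul_right_comm, ← Real.exp_add, neg_add_cancel, Real.exp_zero, one_mul] at h2

/-- The Laplace transform of a mild solution of `u' = iH u + w`. -/
theorem IsSelfAdjoint.laplace_mild (hH : IsSelfAdjoint H) {u w : ℝ → 𝓗} {x : 𝓗} {z : ℂ}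
    (hz : 0 < z.re)
    (hu : IntegrableOn (fun t : ℝ => Complex.exp (-z * t) • u t) (Ioi 0))
    (hw : IntegrableOn (fun t : ℝ => Complex.exp (-z * t) • w t) (Ioi 0))
    (heq : ∀ t, 0 ≤ t → ∃ v, ((∫ s in (0 : ℝ)..t, u s), v) ∈ H.graph ∧
      u t = x + Complex.I • v + ∫ s in (0 : ℝ)..t, w s) :
    laplace u z = H.skewResolvent z (x + laplace w z) := by
  have hz0 : z.re ≠ 0 := hz.ne'
  have hzz : z ≠ 0 := fun h => by simp [h] at hz
  set R := H.skewResolvent z with hR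
  obtain ⟨hU, hUl⟩ := laplace_primitive hz hu
  obtain ⟨hW, hWl⟩ := laplace_primitive hz hw
  set U : ℝ → 𝓗 := fun t => ∫ s in (0 : ℝ)..t, u s
  set W : ℝ → 𝓗 := fun t => ∫ s in (0 : ℝ)..t, w s
  obtain ⟨hRu, hRul⟩ := R.laplace_comp hu
  obtain ⟨hRU, hRUl⟩ := R.laplace_comp hU
  obtain ⟨hRW, hRWl⟩ := R.laplace_comp hW
  have hexp : IntegrableOn (fun t : ℝ => Complex.exp (-z * t)) (Ioi 0) :=
    integrableOn_exp_mul_complex_Ioi (by simpa using hz) 0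
  have hconst : laplace (fun _ => R x) z = z⁻¹ • R x := by
    rw [laplace, integral_smul_const, integral_exp_mul_complex_Ioi (by simpa using hz)]
    simp [neg_div_neg_eq]
  -- Applying the resolvent `R` to the mild equation removes the unbounded term, since i R H U = z R
  -- U - U. The transforms of the terms then combine with those of the primitives, where z⁻¹ appears
  -- as a common factor.
  have hpt : ∀ t ∈ Ioi (0 : ℝ), Complex.exp (-z * t) • R (u t)
      = Complex.exp (-z * t) • R x + z • (Complex.exp (-z * t) • R (U t))
        - Complex.exp (-z * t) • U t + Complex.exp (-z * t) • R (W t) := by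
    intro t ht
    obtain ⟨v, hv, huv⟩ := heq t (le_of_lt ht)
    have h1 := hH.skewResolvent_apply hz0 hv
    rw [map_sub, map_smul, map_smul, sub_eq_iff_eq_add] at h1
    have h2 : R (u t) = R x + z • R (U t) - U t + R (W t) := by
      rw [huv, map_add, map_add, map_smul]
      have : Complex.I • R v = z • R (U t) - U t := by
        rw [eq_sub_iff_add_eq, add_comm]
        exact h1.symm
      rw [this]
      abel
    rw [h2, smul_comm z, smul_add, smul_sub, smul_add]
  have hL : laplace (fun t => R (u t)) z
      = z⁻¹ • R x + z • (z⁻¹ • R (laplace u z)) - z⁻¹ • laplace u z + z⁻¹ • R (laplace w z) := by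
    have e1 : laplace (fun t => R (U t)) z = z⁻¹ • R (laplace u z) := by rw [hRUl, hUl, map_smul]
    have e2 : laplace (fun t => R (W t)) z = z⁻¹ • R (laplace w z) := by rw [hRWl, hWl, map_smul]
    rw [← hconst, ← e1, ← e2, ← hUl, laplace, setIntegral_congr_fun measurableSet_Ioi hpt]
    rw [integral_add, integral_sub, integral_add, integral_smul]
    · rfl
    · exact hexp.smul_const _
    · exact hRU.smul z
    · exact (hexp.smul_const _).add (hRU.smul z)
    · exact hU
    · exact ((hexp.smul_const _).add (hRU.smul z)).sub hU
    · exact hRW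
  rw [hRul, smul_inv_smul₀ hzz] at hL
  have h3 : z⁻¹ • laplace u z = z⁻¹ • (R x + R (laplace w z)) := by
    rw [smul_add]
    have : z⁻¹ • R x + R (laplace u z) - z⁻¹ • laplace u z + z⁻¹ • R (laplace w z)
        = R (laplace u z) + (z⁻¹ • R x + z⁻¹ • R (laplace w z) - z⁻¹ • laplace u z) := by abel
    rw [this, left_eq_add, sub_eq_zero] at hL
    exact hL.symm
  rw [map_add]
  exact smul_right_injective _ (inv_ne_zero hzz) h3

end Growth

namespace DelaySystem

/-! ### Growth and Laplace transform of solutions of the delay equation -/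

section MildSolution

variable {𝓗 X : Type*} [NormedAddCommGroup 𝓗] [InnerProductSpace ℂ 𝓗] [CompleteSpace 𝓗]
  [AddCommGroup X] [Module ℂ X] [TopologicalSpace X] {S : DelaySystem 𝓗 X}

/-- The delayed term `t ↦ K u(t - τ)`. -/
def delayed (S : DelaySystem 𝓗 X) (u : ℝ → 𝓗) (t : ℝ) : 𝓗 := S.K (u (t - S.τ))

/-- The history part `∫ e^{-z(τ+s)} K f(s) ds` of the Laplace transform of the delayed term. -/
def historyTransform (S : DelaySystem 𝓗 X) (f : ℝ → 𝓗) (z : ℂ) : 𝓗 :=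
  ∫ s in Icc (-S.τ) 0, Complex.exp (-z * (S.τ + s)) • S.K (f s)

variable {x : 𝓗} {f u : ℝ → 𝓗}

namespace IsMildSolution

variable (hu : S.IsMildSolution x f u)
include hu

theorem ae_eq_history : ∀ᵐ s ∂(volume.restrict (Icc (-S.τ) 0)), f s = u s := by
  rw [← restrict_Ico_eq_restrict_Icc]
  filter_upwards [ae_restrict_mem measurableSet_Ico] with s hs
  exact (hu.hist s hs).symm

theorem memLp_delayed (hf : MemLp f 2 (volume.restrict (Icc (-S.τ) 0))) :
    MemLp (S.delayed u) 2 (volume.restrict (Ioc 0 S.τ)) := by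
  have h1 : MemLp u 2 (volume.restrict (Icc (-S.τ) 0)) := hf.ae_eq hu.ae_eq_history
  have h2 := (measurePreserving_sub_right (volume : Measure ℝ) S.τ).restrict_preimage
    (measurableSet_Icc (a := -S.τ) (b := 0))
  have h3 := (S.K.comp_memLp' h1).comp_measurePreserving h2
  have e : (fun x => x - S.τ) ⁻¹' Icc (-S.τ) 0 = Icc 0 S.τ := by
    rw [preimage_sub_const_Icc]
    simp
  rw [e, ← restrict_Ioc_eq_restrict_Icc] at h3
  exact h3

theorem continuousOn_delayed : ContinuousOn (S.delayed u) (Ici S.τ) :=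
  S.K.continuous.comp_continuousOn
    (hu.cont.comp (by fun_prop) fun t ht => mem_Ici.2 (sub_nonneg.2 ht))

theorem integrableOn_delayed (hf : MemLp f 2 (volume.restrict (Icc (-S.τ) 0))) (T : ℝ) :
    IntegrableOn (S.delayed u) (Ioc 0 T) := by
  have h1 : IntegrableOn (S.delayed u) (Ioc 0 S.τ) :=
    (hu.memLp_delayed hf).integrable (by norm_num)
  have h2 : IntegrableOn (S.delayed u) (Icc S.τ T) :=
    (hu.continuousOn_delayed.mono Icc_subset_Ici_self).integrableOn_Icc
  refine (h1.union h2).mono_set fun s hs => ?_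
  rcases le_total s S.τ with h | h
  · exact Or.inl ⟨hs.1, h⟩
  · exact Or.inr ⟨h, hs.2⟩

theorem mild_eq {t : ℝ} (ht : 0 ≤ t) :
    ∃ v, ((∫ s in (0 : ℝ)..t, u s), v) ∈ S.H.graph ∧
      u t = x + Complex.I • v + ∫ s in (0 : ℝ)..t, S.delayed u s := by
  obtain ⟨h, e⟩ := hu.eqn t ht
  exact ⟨_, S.H.mem_graph ⟨_, h⟩, e⟩

/-- The energy estimate treats the delayed term as a source. After the shift by τ its norm
integrates to at most a constant plus ‖K‖ times the integral of ‖u‖, and Grönwall's inequality gives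
the rate ‖K‖. -/
theorem exists_growth (hS : S.Standing) (hf : MemLp f 2 (volume.restrict (Icc (-S.τ) 0))) :
    ∃ c, 0 ≤ c ∧ ∀ t, 0 ≤ t → ‖u t‖ ≤ c * Real.exp (‖S.K‖ * t) := by
  have hτ := hS.tau_pos
  -- A continuous extension by u(0) to negative times. The true history enters only through `c₁`;
  -- the part of the extension on [-τ, 0], counted in `c₂`, is a harmless overestimate.
  set u' : ℝ → 𝓗 := fun t => u (max t 0) with hu'
  have hu'c : Continuous u' :=
    hu.cont.comp_continuous (by fun_prop) fun t => mem_Ici.2 (le_max_right _ _)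
  have hu'e : ∀ t, 0 ≤ t → u' t = u t := fun t ht => by rw [hu']; simp only [max_eq_left ht]
  set w : ℝ → 𝓗 := (Ioi (0 : ℝ)).indicator (S.delayed u) with hw
  have hwi : ∀ a b, IntervalIntegrable w volume a b := by
    intro a b
    rw [intervalIntegrable_iff, IntegrableOn, hw, integrable_indicator_iff measurableSet_Ioi,
      IntegrableOn, Measure.restrict_restrict measurableSet_Ioi]
    refine (hu.integrableOn_delayed hf (max a b)).mono_set fun s hs => ⟨hs.1, ?_⟩
    exact hs.2.2
  have hwe : ∀ t, 0 ≤ t → ∫ s in (0 : ℝ)..t, w s = ∫ s in (0 : ℝ)..t, S.delayed u s := by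
    intro t ht
    rw [intervalIntegral.integral_of_le ht, intervalIntegral.integral_of_le ht]
    exact setIntegral_congr_fun measurableSet_Ioc fun s hs => indicator_of_mem (mem_Ioi.2 hs.1) _
  have hue : ∀ t, 0 ≤ t → ∫ s in (0 : ℝ)..t, u' s = ∫ s in (0 : ℝ)..t, u s := by
    intro t ht
    refine intervalIntegral.integral_congr fun s hs => ?_
    rw [uIcc_of_le ht] at hs
    exact hu'e s hs.1
  have henergy : ∀ t, 0 ≤ t → ‖u' t‖ ≤ ‖u' 0‖ + ∫ s in (0 : ℝ)..t, ‖w s‖ := by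
    intro t ht
    refine hS.self_adjoint.norm_mild_le (x := x) hu'c hwi (fun r hr => ?_) ht
    rw [hue r hr, hwe r hr, hu'e r hr]
    exact hu.mild_eq hr
  set c₁ := ∫ s in Ioc (0 : ℝ) S.τ, ‖S.delayed u s‖ with hc₁
  set c₂ := ∫ s in (-S.τ)..(0 : ℝ), ‖u' s‖ with hc₂
  have hc₁' : 0 ≤ c₁ := integral_nonneg fun _ => norm_nonneg _
  have hc₂' : 0 ≤ c₂ :=
    intervalIntegral.integral_nonneg (by linarith) fun _ _ => norm_nonneg _
  have hwint : ∀ t, 0 ≤ t → ∫ s in (0 : ℝ)..t, ‖w s‖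
      ≤ c₁ + ‖S.K‖ * (c₂ + ∫ s in (0 : ℝ)..t, ‖u' s‖) := by
    intro t ht
    have hind : IntegrableOn (fun s => ‖S.delayed u s‖) (Ioc 0 S.τ) :=
      (hu.integrableOn_delayed hf S.τ).norm
    have hindi : Integrable ((Ioc (0 : ℝ) S.τ).indicator fun s => ‖S.delayed u s‖) :=
      (integrable_indicator_iff measurableSet_Ioc).2 hind
    have hcont : Continuous fun s => ‖S.K‖ * ‖u' (s - S.τ)‖ := by fun_prop
    have h1 : ∫ s in (0 : ℝ)..t, ‖w s‖
        ≤ ∫ s in (0 : ℝ)..t, ((Ioc (0 : ℝ) S.τ).indicator (fun s => ‖S.delayed u s‖) s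
          + ‖S.K‖ * ‖u' (s - S.τ)‖) := by
      refine intervalIntegral.integral_mono_on ht (hwi _ _).norm
        (hindi.intervalIntegrable.add (hcont.intervalIntegrable _ _)) fun s hs => ?_
      by_cases hs0 : 0 < s
      · rw [hw, indicator_of_mem (mem_Ioi.2 hs0)]
        by_cases hsτ : s ≤ S.τ
        · rw [indicator_of_mem (show s ∈ Ioc 0 S.τ from ⟨hs0, hsτ⟩)]
          exact le_add_of_nonneg_right (by positivity)
        · rw [indicator_of_notMem (fun h => hsτ h.2), zero_add,
            hu'e _ (sub_nonneg.2 (not_le.1 hsτ).le)]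
          exact S.K.le_opNorm _
      · rw [hw, indicator_of_notMem (by exact hs0), norm_zero]
        exact add_nonneg (indicator_nonneg (fun _ _ => norm_nonneg _) _) (by positivity)
    have h2 : ∫ s in (0 : ℝ)..t, (Ioc (0 : ℝ) S.τ).indicator (fun s => ‖S.delayed u s‖) s ≤ c₁ := by
      rw [intervalIntegral.integral_of_le ht, hc₁,
        ← integral_indicator (f := fun s => ‖S.delayed u s‖) measurableSet_Ioc]
      exact setIntegral_le_integral hindi
        (Eventually.of_forall fun s => indicator_nonneg (fun _ _ => norm_nonneg _) _)
    have h3 : ∫ s in (0 : ℝ)..t, ‖S.K‖ * ‖u' (s - S.τ)‖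
        ≤ ‖S.K‖ * (c₂ + ∫ s in (0 : ℝ)..t, ‖u' s‖) := by
      rw [intervalIntegral.integral_const_mul]
      refine mul_le_mul_of_nonneg_left ?_ (norm_nonneg _)
      rw [intervalIntegral.integral_comp_sub_right (fun s => ‖u' s‖), zero_sub, hc₂,
        intervalIntegral.integral_add_adjacent_intervals (hu'c.norm.intervalIntegrable _ _)
          (hu'c.norm.intervalIntegrable _ _)]
      exact intervalIntegral.integral_mono_interval le_rfl (by linarith) (by linarith)
        (Eventually.of_forall fun _ => norm_nonneg _) (hu'c.norm.intervalIntegrable _ _)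
    rw [intervalIntegral.integral_add hindi.intervalIntegrable (hcont.intervalIntegrable _ _)] at h1
    linarith
  refine ⟨‖u' 0‖ + c₁ + ‖S.K‖ * c₂, by positivity, fun t ht => ?_⟩
  rw [← hu'e t ht]
  refine le_mul_exp_of_le_add_integral (φ := fun t => ‖u' t‖) hu'c.norm (norm_nonneg S.K)
    (fun r hr => ?_) ht
  have h1 := henergy r hr
  have h2 := hwint r hr
  linarith

variable (hS : S.Standing) (hf : MemLp f 2 (volume.restrict (Icc (-S.τ) 0))) {a : ℝ}
  (ha : ‖S.K‖ < a)
include hS hf ha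

theorem integrableOn_exp_smul :
    IntegrableOn (fun t : ℝ => Complex.exp (-a * t) • u t) (Ioi 0) := by
  obtain ⟨c, hc, hgr⟩ := hu.exists_growth hS hf
  refine Integrable.mono' (g := fun t => c * Real.exp (-(a - ‖S.K‖) * t))
    ((integrableOn_exp_mul_Ioi (by linarith) 0).const_mul c) ?_ ?_
  · refine ContinuousOn.aestronglyMeasurable ?_ measurableSet_Ioi
    exact ContinuousOn.smul (by fun_prop) (hu.cont.mono Ioi_subset_Ici_self)
  · filter_upwards [ae_restrict_mem measurableSet_Ioi] with t ht
    rw [norm_smul, Complex.norm_exp]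
    have e : (-(a : ℂ) * t).re = -a * t := by simp
    rw [e]
    calc Real.exp (-a * t) * ‖u t‖ ≤ Real.exp (-a * t) * (c * Real.exp (‖S.K‖ * t)) := by
          gcongr
          exact hgr t (le_of_lt ht)
      _ = c * (Real.exp (-a * t) * Real.exp (‖S.K‖ * t)) := by ring
      _ = c * Real.exp (-(a - ‖S.K‖) * t) := by
          rw [← Real.exp_add]
          ring_nf

/-- Up to time τ the delayed term is the L² history; afterwards it is dominated by a decaying
exponential. Exponent 1 makes the transform exist, exponent 2 feeds Plancherel. -/
theorem memLp_exp_smul_delayed {p : ENNReal} (hp : p = 1 ∨ p = 2) :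
    MemLp (fun t : ℝ => Complex.exp (-a * t) • S.delayed u t) p (volume.restrict (Ioi 0)) := by
  have ha0 : 0 < a := (norm_nonneg _).trans_lt ha
  have hτ := hS.tau_pos
  obtain ⟨c, hc, hgr⟩ := hu.exists_growth hS hf
  have hexp : ∀ t : ℝ, ‖Complex.exp (-(a : ℂ) * t)‖ = Real.exp (-a * t) := fun t => by
    rw [Complex.norm_exp]
    simp
  have hp2 : p ≤ 2 := by rcases hp with rfl | rfl <;> norm_num
  have h1 : MemLp (fun t : ℝ => Complex.exp (-a * t) • S.delayed u t) p
      (volume.restrict (Ioc 0 S.τ)) := by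
    have h0 := (hu.memLp_delayed hf).mono_exponent hp2
    refine h0.of_le (AEStronglyMeasurable.smul (Continuous.aestronglyMeasurable (by fun_prop))
      h0.1) ?_
    filter_upwards [ae_restrict_mem measurableSet_Ioc] with t ht
    rw [norm_smul, hexp]
    refine mul_le_of_le_one_left (norm_nonneg _) (Real.exp_le_one_iff.2 ?_)
    nlinarith [ht.1]
  have h2 : MemLp (fun t : ℝ => Complex.exp (-a * t) • S.delayed u t) p
      (volume.restrict (Ioi S.τ)) := by
    have hb : MemLp (fun t => (‖S.K‖ * c) * Real.exp (-(a - ‖S.K‖) * t)) p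
        (volume.restrict (Ioi S.τ)) := by
      refine MemLp.const_mul ?_ _
      rcases hp with rfl | rfl
      · exact memLp_one_iff_integrable.2 (integrableOn_exp_mul_Ioi (by linarith) _)
      · rw [memLp_two_iff_integrable_sq (Continuous.aestronglyMeasurable (by fun_prop))]
        have : ∀ t : ℝ, Real.exp (-(a - ‖S.K‖) * t) ^ 2
            = Real.exp ((-2 * (a - ‖S.K‖)) * t) := fun t => by
          rw [← Real.exp_nat_mul]
          congr 1
          push_cast
          ring
        simp_rw [this]
        exact integrableOn_exp_mul_Ioi (by linarith) _
    refine hb.of_le ?_ ?_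
    · refine ContinuousOn.aestronglyMeasurable ?_ measurableSet_Ioi
      exact ContinuousOn.smul (by fun_prop) (hu.continuousOn_delayed.mono Ioi_subset_Ici_self)
    · filter_upwards [ae_restrict_mem measurableSet_Ioi] with t ht
      have ht' : S.τ < t := ht
      rw [norm_smul, hexp, Real.norm_of_nonneg (by positivity)]
      calc Real.exp (-a * t) * ‖S.delayed u t‖
          ≤ Real.exp (-a * t) * (‖S.K‖ * (c * Real.exp (‖S.K‖ * (t - S.τ)))) := by
            gcongr
            refine (S.K.le_opNorm _).trans ?_
            gcongr
            exact hgr _ (by linarith)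
        _ ≤ Real.exp (-a * t) * (‖S.K‖ * (c * Real.exp (‖S.K‖ * t))) := by
            gcongr
            linarith
        _ = ‖S.K‖ * c * (Real.exp (-a * t) * Real.exp (‖S.K‖ * t)) := by ring
        _ = ‖S.K‖ * c * Real.exp (-(a - ‖S.K‖) * t) := by
            rw [← Real.exp_add]
            ring_nf
  rw [← memLp_indicator_iff_restrict measurableSet_Ioc] at h1
  rw [← memLp_indicator_iff_restrict measurableSet_Ioi] at h2 ⊢
  refine (h1.add h2).ae_eq (Eventually.of_forall fun t => ?_)
  rw [← Ioc_union_Ioi_eq_Ioi hτ.le, indicator_union_of_disjoint Ioc_disjoint_Ioi_same]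
  rfl

theorem integrableOn_exp_smul_delayed :
    IntegrableOn (fun t : ℝ => Complex.exp (-a * t) • S.delayed u t) (Ioi 0) :=
  memLp_one_iff_integrable.1 (hu.memLp_exp_smul_delayed hS hf ha (Or.inl rfl))

omit ha in
theorem laplace_delayed {z : ℂ} (hz : ‖S.K‖ < z.re) :
    laplace (S.delayed u) z = S.historyTransform f z
      + Complex.exp (-z * S.τ) • S.K (laplace u z) := by
  have hτ := hS.tau_pos
  have hi := integrable_exp_smul_congr_re rfl (hu.integrableOn_exp_smul_delayed hS hf hz)
  have hiu := integrable_exp_smul_congr_re rfl (hu.integrableOn_exp_smul hS hf hz)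
  rw [laplace, ← Ioc_union_Ioi_eq_Ioi hτ.le, setIntegral_union Ioc_disjoint_Ioi_same
    measurableSet_Ioi (hi.mono_set Ioc_subset_Ioi_self)
    (hi.mono_set (Ioi_subset_Ioi hτ.le))]
  congr 1
  · have e1 : S.historyTransform f z
        = ∫ s in Icc (-S.τ) 0, Complex.exp (-z * (S.τ + s)) • S.K (u s) := by
      refine integral_congr_ae ?_
      filter_upwards [hu.ae_eq_history] with s hs
      rw [hs]
    rw [e1, integral_Icc_eq_integral_Ioc, ← intervalIntegral.integral_of_le hτ.le,
      ← intervalIntegral.integral_of_le (by linarith)]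
    have := intervalIntegral.integral_comp_sub_right
      (fun s : ℝ => Complex.exp (-z * (S.τ + s)) • S.K (u s)) (a := 0) (b := S.τ) S.τ
    rw [zero_sub, sub_self] at this
    rw [← this]
    refine intervalIntegral.integral_congr fun t _ => ?_
    simp only [delayed]
    congr 3
    push_cast
    ring
  · have e1 := (measurePreserving_sub_right (volume : Measure ℝ) S.τ).setIntegral_preimage_emb
      (measurableEmbedding_subRight S.τ)
      (fun r : ℝ => Complex.exp (-z * (r + S.τ)) • S.K (u r)) (Ioi 0)
    rw [preimage_sub_const_Ioi, zero_add] at e1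
    have e2 : ∫ t in Ioi S.τ, Complex.exp (-z * t) • S.delayed u t
        = ∫ t in Ioi S.τ, Complex.exp (-z * (((t - S.τ : ℝ) : ℂ) + S.τ)) • S.K (u (t - S.τ)) := by
      refine setIntegral_congr_fun measurableSet_Ioi fun t _ => ?_
      simp only [delayed]
      congr 3
      push_cast
      ring
    rw [e2, e1, laplace, ← S.K.integral_comp_comm hiu, ← integral_smul]
    refine setIntegral_congr_fun measurableSet_Ioi fun t _ => ?_
    simp only [map_smul, smul_smul, ← Complex.exp_add]
    congr 2
    ring

omit ha in
theorem laplace_eq {z : ℂ} (hz : ‖S.K‖ < z.re) :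
    laplace u z = S.H.skewResolvent z (x + laplace (S.delayed u) z) :=
  hS.self_adjoint.laplace_mild ((norm_nonneg _).trans_lt hz)
    (integrable_exp_smul_congr_re rfl (hu.integrableOn_exp_smul hS hf hz))
    (integrable_exp_smul_congr_re rfl (hu.integrableOn_exp_smul_delayed hS hf hz))
    fun _ ht => hu.mild_eq ht

end IsMildSolution

end MildSolution

end DelaySystem

/-! ### Principal value inversion of Cauchy transforms -/

section PrincipalValue

theorem tendsto_lineInt_vline {Φ : ℂ → ℂ} {a : ℝ} (h : Integrable fun s => Φ (vline a s)) :
    Tendsto (fun b : ℝ => lineInt Φ (vline a) (-b) b) atTop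
      (𝓝 (Complex.I * ∫ s, Φ (vline a s))) := by
  simp only [lineInt_vline]
  exact (intervalIntegral_tendsto_integral h tendsto_neg_atTop_atBot tendsto_id).const_mul _

theorem integrable_inv_sq_add_sq {a : ℝ} (ha : a ≠ 0) : Integrable fun s : ℝ => (a ^ 2 + s ^ 2)⁻¹ := by
  have h1 := (integrable_inv_one_add_sq.comp_div ha).const_mul (a ^ 2)⁻¹
  refine h1.congr (Eventually.of_forall fun s => ?_)
  simp only
  rw [← mul_inv]
  congr 1
  field_simp

/-- A convolution of two integrable functions. It is the common majorant for all integrals along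
vertical lines that involve the spectral density. -/
theorem integrable_poisson {G : ℝ → ℂ} (hG : Integrable G) {a : ℝ} (ha : a ≠ 0) :
    Integrable fun s : ℝ => ∫ ω, ‖G ω‖ * (a ^ 2 + (s - ω) ^ 2)⁻¹ :=
  hG.norm.integrable_convolution (ContinuousLinearMap.mul ℝ ℝ) (integrable_inv_sq_add_sq ha)

theorem norm_sq_vline_sub (a s ω : ℝ) :
    ‖vline a s - Complex.I * ω‖ ^ 2 = a ^ 2 + (s - ω) ^ 2 := by
  rw [← Complex.normSq_eq_norm_sq, Complex.normSq_apply]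
  simp [vline]
  ring

@[simp] theorem vline_re (a s : ℝ) : (vline a s).re = a := by simp [vline]

theorem continuous_vline (a : ℝ) : Continuous (vline a) := (contDiff_vline a).continuous

theorem laplace_one {z : ℂ} (hz : 0 < z.re) :
    IntegrableOn (fun t : ℝ => Complex.exp (-z * t) • (1 : ℂ)) (Ioi 0) ∧
      laplace (fun _ => (1 : ℂ)) z = z⁻¹ := by
  constructor
  · simpa using integrableOn_exp_mul_complex_Ioi (a := -z) (by simpa using hz) 0
  · have := integral_exp_mul_complex_Ioi (a := -z) (by simpa using hz) 0
    simp only [laplace, smul_eq_mul, mul_one, this]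
    simp [neg_div_neg_eq]

theorem laplace_id {z : ℂ} (hz : 0 < z.re) :
    IntegrableOn (fun t : ℝ => Complex.exp (-z * t) • (t : ℂ)) (Ioi 0) ∧
      laplace (fun t : ℝ => (t : ℂ)) z = (z ^ 2)⁻¹ := by
  have h := laplace_primitive hz (laplace_one hz).1
  have e : (fun t : ℝ => ∫ s in (0 : ℝ)..t, (1 : ℂ)) = fun t : ℝ => (t : ℂ) := by
    ext t
    simp
  rw [(laplace_one hz).2] at h
  simp only [e] at h
  refine ⟨?_, by rw [h.2, smul_eq_mul, sq, mul_inv]⟩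
  have e' : ∀ t : ℝ, ∫ s in (0 : ℝ)..t, (1 : ℂ) = t := fun t => by simp
  simpa only [e'] using h.1

variable {G : ℝ → ℂ} (hG : Integrable G)
include hG

theorem continuous_integral_exp :
    Continuous fun t : ℝ => ∫ ω : ℝ, Complex.exp (Complex.I * ω * t) * G ω := by
  refine continuous_of_dominated (bound := fun ω => ‖G ω‖) (fun t => ?_) (fun t => ?_) hG.norm ?_
  · exact (Continuous.aestronglyMeasurable (by fun_prop)).mul hG.1
  · refine Eventually.of_forall fun ω => ?_
    rw [norm_mul, Complex.norm_exp]
    simp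
  · exact Eventually.of_forall fun ω => by fun_prop

/-- The Laplace transform of a weighted Fourier integral. -/
theorem laplace_integral_exp {p : ℝ → ℂ} {z : ℂ}
    (h : IntegrableOn (fun t : ℝ => Complex.exp (-z * t) • p t) (Ioi 0)) :
    IntegrableOn (fun t : ℝ => Complex.exp (-z * t) •
        (p t * ∫ ω : ℝ, Complex.exp (Complex.I * ω * t) * G ω)) (Ioi 0) ∧
      laplace (fun t => p t * ∫ ω : ℝ, Complex.exp (Complex.I * ω * t) * G ω) z
        = ∫ ω : ℝ, laplace p (z - Complex.I * ω) * G ω := by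
  have hF : Integrable (fun q : ℝ × ℝ => Complex.exp (Complex.I * q.2 * q.1) *
      ((Complex.exp (-z * q.1) • p q.1) * G q.2)) ((volume.restrict (Ioi 0)).prod volume) := by
    refine (Integrable.mul_prod h hG).bdd_mul (c := 1)
      (Continuous.aestronglyMeasurable (by fun_prop)) (Eventually.of_forall fun q => ?_)
    rw [Complex.norm_exp]
    simp
  have e1 : ∀ t : ℝ, ∫ ω : ℝ, Complex.exp (Complex.I * ω * t) *
      ((Complex.exp (-z * t) • p t) * G ω)
      = Complex.exp (-z * t) • (p t * ∫ ω : ℝ, Complex.exp (Complex.I * ω * t) * G ω) := by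
    intro t
    rw [smul_eq_mul, smul_eq_mul, ← mul_assoc, ← integral_const_mul]
    congr 1
    ext ω
    ring
  constructor
  · refine hF.integral_prod_left.congr (Eventually.of_forall fun t => ?_)
    exact e1 t
  · rw [laplace]
    simp_rw [← e1]
    rw [integral_integral_swap hF]
    congr 1
    ext ω
    rw [laplace, ← integral_mul_const]
    congr 1
    ext t
    rw [smul_eq_mul, smul_eq_mul, ← mul_assoc, ← mul_assoc, ← Complex.exp_add]
    congr 3
    ring

theorem laplace_fourierIntegral {z : ℂ} (hz : 0 < z.re) :
    IntegrableOn (fun t : ℝ => Complex.exp (-z * t) •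
        (∫ ω : ℝ, Complex.exp (Complex.I * ω * t) * G ω)) (Ioi 0) ∧
      laplace (fun t => ∫ ω : ℝ, Complex.exp (Complex.I * ω * t) * G ω) z
        = ∫ ω : ℝ, (z - Complex.I * ω)⁻¹ * G ω := by
  have h := laplace_integral_exp hG (laplace_one hz).1
  simp only [one_mul] at h
  refine ⟨h.1, h.2.trans ?_⟩
  congr 1
  ext ω
  rw [(laplace_one _).2]
  simpa using hz

theorem tendsto_cauchy_vline {a : ℝ} (ha : 0 < a) {l : Filter ℝ} [l.IsCountablyGenerated]
    (hl : Tendsto (fun s => |s|) l atTop) :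
    Tendsto (fun s => ∫ ω : ℝ, (vline a s - Complex.I * ω)⁻¹ * G ω) l (𝓝 0) := by
  have h0 : ∫ ω : ℝ, (0 : ℂ) * G ω = 0 := by simp
  rw [← h0]
  refine tendsto_integral_filter_of_dominated_convergence (fun ω => a⁻¹ * ‖G ω‖) ?_ ?_
    (hG.norm.const_mul _) ?_
  · refine Eventually.of_forall fun s => AEStronglyMeasurable.mul ?_ hG.1
    exact (Measurable.inv (by fun_prop)).aestronglyMeasurable
  · refine Eventually.of_forall fun s => Eventually.of_forall fun ω => ?_
    rw [norm_mul]
    gcongr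
    have := norm_inv_sub_I_mul_le (z := vline a s) (by simpa using ha.ne') ω
    rwa [vline_re, abs_of_pos ha] at this
  · refine Eventually.of_forall fun ω => Tendsto.mul_const _ ?_
    rw [tendsto_zero_iff_norm_tendsto_zero]
    simp only [norm_inv]
    refine tendsto_inv_atTop_zero.comp (tendsto_atTop_mono (f := fun s => |s| - |ω|) (fun s => ?_)
      (tendsto_atTop_add_const_right _ _ hl))
    have h1 := Complex.abs_im_le_norm (vline a s - Complex.I * ω)
    have h2 : (vline a s - Complex.I * ω).im = s - ω := by simp [vline]
    rw [h2] at h1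
    exact (abs_sub_abs_le_abs_sub s ω).trans h1

/-- The Cauchy transform `q` tends to 0 along the line without a rate, so the integral converges
only conditionally. One integration by parts replaces `q` by `q₂`, the Laplace transform of t e₀(t),
which is integrable by the Poisson bound. Inversion returns t e₀(t); the factor 1/t from integrating
the exponential cancels the t, and the boundary terms vanish. -/
theorem tendsto_lineInt_exp_mul_cauchy {a t : ℝ} (ha : 0 < a) (ht : 0 < t) :
    Tendsto (fun b : ℝ => (2 * Real.pi * Complex.I)⁻¹ *
      lineInt (fun z => Complex.exp (z * t) * ∫ ω : ℝ, (z - Complex.I * ω)⁻¹ * G ω) (vline a) (-b) b)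
      atTop (𝓝 (∫ ω : ℝ, Complex.exp (Complex.I * ω * t) * G ω)) := by
  set q : ℂ → ℂ := fun z => ∫ ω : ℝ, (z - Complex.I * ω)⁻¹ * G ω with hq
  set q₂ : ℂ → ℂ := fun z => ∫ ω : ℝ, ((z - Complex.I * ω) ^ 2)⁻¹ * G ω with hq₂
  set e₀ : ℝ → ℂ := fun t => ∫ ω : ℝ, Complex.exp (Complex.I * ω * t) * G ω with he₀
  have htc : (t : ℂ) ≠ 0 := by exact_mod_cast ht.ne'
  have hre : ∀ s, (vline a s).re ≠ 0 := fun s => by rw [vline_re]; exact ha.ne'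
  have hqd : ∀ s, HasDerivAt (fun s : ℝ => q (vline a s)) (Complex.I * -q₂ (vline a s)) s := by
    intro s
    have h1 := hasDerivAt_integral_inv_sub (μ := volume) hG (p := fun ω : ℝ => Complex.I * ω)
      (by fun_prop) (abs_pos.2 (hre s))
      (Eventually.of_forall fun ω => abs_re_le_norm_sub_I_mul (vline a s) ω)
    have h2 : ∫ ω : ℝ, -((vline a s - Complex.I * ω) ^ 2)⁻¹ * G ω = -q₂ (vline a s) := by
      rw [hq₂, ← integral_neg]
      simp only [neg_mul]
    rw [h2] at h1
    have := HasDerivAt.comp s h1 (hasDerivAt_vline a s)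
    rwa [mul_comm] at this
  have hLap : ∀ s, laplace (fun t : ℝ => (t : ℂ) * e₀ t) (vline a s) = q₂ (vline a s) := by
    intro s
    rw [(laplace_integral_exp hG (laplace_id (by simpa using ha)).1).2]
    refine integral_congr_ae (Eventually.of_forall fun ω => ?_)
    simp only
    rw [(laplace_id (by simpa using ha)).2]
  have hq₂i : Integrable fun s => q₂ (vline a s) := by
    have hc : Continuous fun s => q₂ (vline a s) := by
      refine continuous_of_dominated (bound := fun ω => (a⁻¹) ^ 2 * ‖G ω‖) (fun s => ?_)
        (fun s => Eventually.of_forall fun ω => ?_) (hG.norm.const_mul _)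
        (Eventually.of_forall fun ω => ?_)
      · exact AEStronglyMeasurable.mul (Measurable.inv (by fun_prop)).aestronglyMeasurable hG.1
      · rw [norm_mul, ← inv_pow, norm_pow]
        gcongr
        have := norm_inv_sub_I_mul_le (hre s) ω
        rwa [vline_re, abs_of_pos ha] at this
      · refine Continuous.mul (Continuous.inv₀ ?_ fun s => ?_) continuous_const
        · exact ((continuous_vline a).sub continuous_const).pow 2
        · exact pow_ne_zero 2 (sub_I_mul_ne_zero (hre s) ω)
    refine (integrable_poisson hG ha.ne').mono' hc.aestronglyMeasurable
      (Eventually.of_forall fun s => ?_)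
    refine (norm_integral_le_integral_norm _).trans (le_of_eq (integral_congr_ae ?_))
    refine Eventually.of_forall fun ω => ?_
    simp only
    rw [norm_mul, norm_inv, norm_pow, norm_sq_vline_sub, mul_comm]
  have hinv := laplace_inversion (v := fun t : ℝ => (t : ℂ) * e₀ t) (a := a) ht
    (laplace_integral_exp hG (z := a) (laplace_id (by simpa using ha)).1).1
    ((Complex.continuous_ofReal.mul (continuous_integral_exp hG)).continuousAt)
    (by simpa only [hLap] using hq₂i)
  simp only [hLap, smul_eq_mul] at hinv
  have hexpn : ∀ s, ‖Complex.exp (vline a s * t)‖ = Real.exp (a * t) := fun s => by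
    rw [Complex.norm_exp]
    simp [vline]
  have hei : Integrable fun s => Complex.exp (vline a s * t) * q₂ (vline a s) := by
    refine hq₂i.bdd_mul (c := Real.exp (a * t)) ?_ (Eventually.of_forall fun s => (hexpn s).le)
    have := continuous_vline a
    exact Continuous.aestronglyMeasurable (by fun_prop)
  have hed : ∀ s, HasDerivAt (fun s => Complex.exp (vline a s * t) / (Complex.I * t))
      (Complex.exp (vline a s * t)) s := by
    intro s
    have h1 := (((hasDerivAt_vline a s).mul_const (t : ℂ)).cexp).div_const (Complex.I * t)
    rwa [mul_div_cancel_right₀ _ (mul_ne_zero Complex.I_ne_zero htc)] at h1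
  have hparts : ∀ b : ℝ, (2 * Real.pi * Complex.I)⁻¹ *
      lineInt (fun z => Complex.exp (z * t) * q z) (vline a) (-b) b
      = (2 * Real.pi : ℂ)⁻¹ * (Complex.exp (vline a b * t) / (Complex.I * t) * q (vline a b)
        - Complex.exp (vline a (-b) * t) / (Complex.I * t) * q (vline a (-b)))
        + (t : ℂ)⁻¹ * ((2 * Real.pi : ℂ)⁻¹ *
          ∫ s in (-b)..b, Complex.exp (vline a s * t) * q₂ (vline a s)) := by
    intro b
    have h1 := intervalIntegral.integral_mul_deriv_eq_deriv_mul (a := -b) (b := b)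
      (u := fun s => q (vline a s)) (v := fun s => Complex.exp (vline a s * t) / (Complex.I * t))
      (fun s _ => hqd s) (fun s _ => hed s)
      ((hq₂i.intervalIntegrable.neg).const_mul Complex.I)
      (Continuous.intervalIntegrable (by have := continuous_vline a; fun_prop) _ _)
    rw [lineInt_vline]
    have h2 : ∫ s in (-b)..b, Complex.exp (vline a s * t) * q (vline a s)
        = ∫ s in (-b)..b, q (vline a s) * Complex.exp (vline a s * t) := by
      simp only [mul_comm]
    have h3 : ∫ s in (-b)..b, Complex.I * -q₂ (vline a s) *
          (Complex.exp (vline a s * t) / (Complex.I * t))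
        = -(t : ℂ)⁻¹ * ∫ s in (-b)..b, Complex.exp (vline a s * t) * q₂ (vline a s) := by
      rw [← intervalIntegral.integral_const_mul]
      refine intervalIntegral.integral_congr fun s _ => ?_
      have := Complex.I_ne_zero
      field_simp
    rw [h2, h1, h3]
    have := Complex.I_ne_zero
    rw [mul_inv, mul_assoc, inv_mul_cancel_left₀ this]
    ring
  have hb : ∀ σ : ℝ → ℝ, Tendsto (fun b => |σ b|) atTop atTop →
      Tendsto (fun b => Complex.exp (vline a (σ b) * t) / (Complex.I * t) * q (vline a (σ b)))
        atTop (𝓝 0) := by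
    intro σ hσ
    have h1 : Tendsto (fun b => q (vline a (σ b))) atTop (𝓝 0) := by
      have := tendsto_cauchy_vline hG ha (l := Filter.map σ atTop) hσ
      exact this
    have h2 := h1.norm.const_mul (Real.exp (a * t) / t)
    rw [norm_zero, mul_zero] at h2
    refine squeeze_zero_norm (fun b => le_of_eq ?_) h2
    rw [norm_mul, norm_div, hexpn]
    simp [abs_of_pos ht]
  have hlim := ((hb id tendsto_abs_atTop_atTop).sub (hb (fun b => -b)
    (by simpa using tendsto_abs_atTop_atTop))).const_mul ((2 * Real.pi : ℂ)⁻¹)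
  have hlim2 := ((intervalIntegral_tendsto_integral hei tendsto_neg_atTop_atBot
    tendsto_id).const_mul ((2 * Real.pi : ℂ)⁻¹)).const_mul ((t : ℂ)⁻¹)
  have := hlim.add hlim2
  rw [hinv, inv_mul_cancel_left₀ htc, sub_zero, mul_zero, zero_add] at this
  exact this.congr fun b => (hparts b).symm

end PrincipalValue

theorem integrable_exp_vline_mul {Φ : ℂ → ℂ} {a : ℝ} (h : Integrable fun s => Φ (vline a s)) (t : ℝ) :
    Integrable fun s => Complex.exp (vline a s * t) * Φ (vline a s) := by
  have hv := continuous_vline a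
  refine h.bdd_mul (c := Real.exp (a * t)) (Continuous.aestronglyMeasurable (by fun_prop))
    (Eventually.of_forall fun s => le_of_eq ?_)
  rw [Complex.norm_exp]
  simp [vline]

namespace DelaySystem

/-! ### Square integrability of the resolvent along vertical lines -/

section Line

variable {𝓗 X : Type*} [NormedAddCommGroup 𝓗] [InnerProductSpace ℂ 𝓗] [CompleteSpace 𝓗]
  [AddCommGroup X] [Module ℂ X] [TopologicalSpace X] {S : DelaySystem 𝓗 X}

theorem cauchy_eq_integral_indicator (hS : S.Standing) (z : ℂ) (ψ φ : X) :
    S.cauchy z ψ φ =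
      ∫ ω : ℝ, (z - Complex.I * ω)⁻¹ * S.I.indicator (fun ω : ℝ => S.dens ψ φ ω) ω := by
  rw [cauchy, ← integral_indicator hS.measurableSet_I]
  congr 1
  ext ω
  by_cases h : ω ∈ S.I
  · rw [indicator_of_mem h, indicator_of_mem h]
  · rw [indicator_of_notMem h, indicator_of_notMem h, mul_zero]

theorem integrable_indicator_dens (hS : S.Standing) (ψ φ : X) :
    Integrable (S.I.indicator fun ω : ℝ => S.dens ψ φ ω) :=
  (integrable_indicator_iff hS.measurableSet_I).2 (hS.dens_int ψ φ)

namespace Standing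

variable (hS : S.Standing)
include hS

theorem re_mul_norm_sq_resolvent {z : ℂ} (hz : z.re ≠ 0) (φ : X) :
    z.re * ‖S.H.skewResolvent z (S.ι φ)‖ ^ 2 = (S.cauchy z φ φ).re := by
  obtain ⟨w, hw, e⟩ := hS.self_adjoint.skewResolvent_graph hz (S.ι φ)
  rw [hS.cauchy_eq hz, ← inner_conj_symm, Complex.conj_re]
  conv_rhs => rw [← e]
  rw [inner_sub_right, Complex.sub_re, e, hS.self_adjoint.re_inner_I_graph hw, inner_smul_right,
    inner_self_eq_norm_sq_to_K, sub_zero]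
  have e : (((‖S.H.skewResolvent z (S.ι φ)‖ : ℝ) : ℂ)) ^ 2
      = ((‖S.H.skewResolvent z (S.ι φ)‖ ^ 2 : ℝ) : ℂ) := by push_cast; rfl
  exact ((congrArg (fun c => (z * c).re) e).trans (by simp [-Complex.ofReal_pow])).symm

theorem continuous_cauchy_comp {γ : ℝ → ℂ} (hγ : Continuous γ) (h : ∀ s, (γ s).re ≠ 0) (ψ φ : X) :
    Continuous fun s => S.cauchy (γ s) ψ φ :=
  continuous_iff_continuousAt.2 fun s =>
    ContinuousAt.comp (g := fun z => S.cauchy z ψ φ)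
      (hS.differentiableAt_cauchy (h s) ψ φ).continuousAt hγ.continuousAt

/-- The resolvent of a vector of `X` is square integrable along vertical lines. -/
theorem integrable_norm_sq_resolvent {a : ℝ} (ha : 0 < a) (φ : X) :
    Integrable (fun s => ‖S.H.skewResolvent (vline a s) (S.ι φ)‖ ^ 2) ∧
    Integrable (fun s => ‖S.H.skewResolvent (-(starRingEnd ℂ (vline a s))) (S.ι φ)‖ ^ 2) := by
  have hre : ∀ s, (vline a s).re ≠ 0 := fun s => by rw [vline_re]; exact ha.ne'
  have hre' : ∀ s, (-(starRingEnd ℂ (vline a s))).re = -a := fun s => by simp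
  have hre'' : ∀ s, (-(starRingEnd ℂ (vline a s))).re ≠ 0 := fun s => by
    rw [hre']; exact neg_ne_zero.2 ha.ne'
  set G := S.I.indicator fun ω : ℝ => S.dens φ φ ω with hG
  have hGi : Integrable G := integrable_indicator_dens hS φ φ
  have h1 : ∀ s, ‖S.H.skewResolvent (vline a s) (S.ι φ)‖ ^ 2
      = a⁻¹ * (S.cauchy (vline a s) φ φ).re := fun s => by
    rw [← hS.re_mul_norm_sq_resolvent (hre s), vline_re, inv_mul_cancel_left₀ ha.ne']
  have h2 : ∀ s, ‖S.H.skewResolvent (-(starRingEnd ℂ (vline a s))) (S.ι φ)‖ ^ 2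
      = -a⁻¹ * (S.cauchy (-(starRingEnd ℂ (vline a s))) φ φ).re := fun s => by
    rw [← hS.re_mul_norm_sq_resolvent (hre'' s), hre']
    field_simp
  have hinv : ∀ z : ℂ, z.re ≠ 0 → Integrable fun ω : ℝ => (z - Complex.I * ω)⁻¹ * G ω :=
    fun z hz => hGi.bdd_mul (c := |z.re|⁻¹) (Measurable.inv (by fun_prop)).aestronglyMeasurable
      (Eventually.of_forall fun ω => norm_inv_sub_I_mul_le hz ω)
  -- The point z and its mirror image -z̄ are taken together: the difference of the two Cauchy
  -- kernels is the Poisson kernel 2a/(a² + (s - ω)²), integrable in s, which a single kernel is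
  -- not.
  have hsum : ∀ s, ‖S.H.skewResolvent (vline a s) (S.ι φ)‖ ^ 2
      + ‖S.H.skewResolvent (-(starRingEnd ℂ (vline a s))) (S.ι φ)‖ ^ 2
      ≤ 2 * ∫ ω, ‖G ω‖ * (a ^ 2 + (s - ω) ^ 2)⁻¹ := by
    intro s
    have e1 : ∀ ω : ℝ, (vline a s - Complex.I * ω)⁻¹ * G ω
        - (-(starRingEnd ℂ (vline a s)) - Complex.I * ω)⁻¹ * G ω
        = (2 * a * (a ^ 2 + (s - ω) ^ 2)⁻¹ : ℝ) * G ω := by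
      intro ω
      have e2 : -(starRingEnd ℂ (vline a s)) - Complex.I * ω
          = -(starRingEnd ℂ (vline a s - Complex.I * ω)) := by
        simp
        ring
      rw [e2, ← sub_mul, inv_neg, sub_neg_eq_add, ← map_inv₀, Complex.add_conj, Complex.inv_re,
        Complex.normSq_eq_norm_sq, norm_sq_vline_sub]
      congr 2
      simp
      ring
    have e3 : S.cauchy (vline a s) φ φ - S.cauchy (-(starRingEnd ℂ (vline a s))) φ φ
        = ∫ ω : ℝ, (2 * a * (a ^ 2 + (s - ω) ^ 2)⁻¹ : ℝ) * G ω := by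
      rw [cauchy_eq_integral_indicator hS, cauchy_eq_integral_indicator hS,
        ← integral_sub (hinv _ (hre s)) (hinv _ (hre'' s))]
      exact integral_congr_ae (Eventually.of_forall e1)
    have e4 : ‖S.cauchy (vline a s) φ φ - S.cauchy (-(starRingEnd ℂ (vline a s))) φ φ‖
        ≤ 2 * a * ∫ ω, ‖G ω‖ * (a ^ 2 + (s - ω) ^ 2)⁻¹ := by
      rw [e3, ← integral_const_mul]
      refine (norm_integral_le_integral_norm _).trans (le_of_eq (integral_congr_ae ?_))
      refine Eventually.of_forall fun ω => ?_
      simp only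
      rw [norm_mul, Complex.norm_real, Real.norm_of_nonneg (by positivity)]
      ring
    rw [h1, h2]
    have e5 := (Complex.re_le_norm _).trans e4
    rw [Complex.sub_re] at e5
    calc a⁻¹ * (S.cauchy (vline a s) φ φ).re
          + -a⁻¹ * (S.cauchy (-(starRingEnd ℂ (vline a s))) φ φ).re
        = a⁻¹ * ((S.cauchy (vline a s) φ φ).re
          - (S.cauchy (-(starRingEnd ℂ (vline a s))) φ φ).re) := by ring
      _ ≤ a⁻¹ * (2 * a * ∫ ω, ‖G ω‖ * (a ^ 2 + (s - ω) ^ 2)⁻¹) := by gcongr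
      _ = 2 * ∫ ω, ‖G ω‖ * (a ^ 2 + (s - ω) ^ 2)⁻¹ := by field_simp
  have hdom := (integrable_poisson hGi ha.ne').const_mul 2
  have hv := continuous_vline a
  constructor
  · refine hdom.mono' ?_ (Eventually.of_forall fun s => ?_)
    · simp_rw [h1]
      exact (continuous_const.mul (Complex.continuous_re.comp
        (hS.continuous_cauchy_comp hv hre φ φ))).aestronglyMeasurable
    · rw [Real.norm_of_nonneg (by positivity)]
      exact (le_add_of_nonneg_right (by positivity)).trans (hsum s)
  · refine hdom.mono' ?_ (Eventually.of_forall fun s => ?_)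
    · simp_rw [h2]
      exact (continuous_const.mul (Complex.continuous_re.comp (hS.continuous_cauchy_comp
        (Complex.continuous_conj.comp hv).neg hre'' φ φ))).aestronglyMeasurable
    · rw [Real.norm_of_nonneg (by positivity)]
      exact (le_add_of_nonneg_left (by positivity)).trans (hsum s)

/-- Moving the resolvent onto φ turns the integrand into an inner product of two functions that are
square integrable on the line. -/
theorem integrable_inner_resolvent {a : ℝ} (ha : 0 < a) (φ : X) {w : ℝ → 𝓗} {b : ℝ → ℝ}
    (hb : Integrable b) (hwb : ∀ s, ‖w s‖ ^ 2 ≤ b s)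
    (hm : AEStronglyMeasurable
      (fun s => inner ℂ (S.ι φ) (S.H.skewResolvent (vline a s) (w s))) volume) :
    Integrable fun s => inner ℂ (S.ι φ) (S.H.skewResolvent (vline a s) (w s)) := by
  refine ((hS.integrable_norm_sq_resolvent ha φ).2.add hb).mono' hm
    (Eventually.of_forall fun s => ?_)
  have hre : (-(starRingEnd ℂ (vline a s))).re ≠ 0 := by simpa using ha.ne'
  have h1 := hS.self_adjoint.inner_skewResolvent hre (S.ι φ) (w s)
  rw [map_neg, Complex.conj_conj, neg_neg] at h1
  have h2 : inner ℂ (S.ι φ) (S.H.skewResolvent (vline a s) (w s))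
      = -inner ℂ (S.H.skewResolvent (-(starRingEnd ℂ (vline a s))) (S.ι φ)) (w s) := by
    rw [h1, neg_neg]
  rw [h2, norm_neg]
  refine (norm_inner_le_norm _ _).trans ?_
  have h3 := hwb s
  simp only [Pi.add_apply]
  nlinarith [sq_nonneg (‖S.H.skewResolvent (-(starRingEnd ℂ (vline a s))) (S.ι φ)‖ - ‖w s‖),
    norm_nonneg (w s), norm_nonneg (S.H.skewResolvent (-(starRingEnd ℂ (vline a s))) (S.ι φ)),
    sq_nonneg (‖S.H.skewResolvent (-(starRingEnd ℂ (vline a s))) (S.ι φ)‖), sq_nonneg ‖w s‖]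

end Standing

end Line

/-! ### The inverse Laplace formula for the mild solution -/

section Inversion

variable {𝓗 X : Type*} [NormedAddCommGroup 𝓗] [InnerProductSpace ℂ 𝓗] [CompleteSpace 𝓗]
    [AddCommGroup X] [Module ℂ X] [UniformSpace X] [IsUniformAddGroup X] [ContinuousSMul ℂ X]
    [T2Space X] [LocallyConvexSpace ℝ X] [QuasiCompleteSpace ℂ X] [BarrelledSpace ℂ X]
    {S : DelaySystem 𝓗 X} (hS : S.Standing) (hC : S.UniformlyCompact)
include hS hC

omit hC in
theorem Standing.mem_dom_diff_poles {z : ℂ} (hz : ‖S.K‖ < z.re) : z ∈ S.dom \ S.poles := by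
  have h0 : z.re ≠ 0 := ((norm_nonneg S.K).trans_lt hz).ne'
  have h1 : z ∉ S.poles := fun h => (hS.re_le_of_mem_poles h).not_gt hz
  exact ⟨Or.inl h0, h1⟩

/-- For large `Re z`, the retarded resolvent is `R_z ξ` with `ξ = y + e^{-zτ} K R_z ξ`. -/
theorem Standing.exists_R_eq_inner {z : ℂ} (hz : ‖S.K‖ < z.re) (y : X) :
    ∃ ξ : 𝓗, ξ = S.ι y + Complex.exp (-z * S.τ) • S.K (S.H.skewResolvent z ξ) ∧
      (∀ φ, S.R z y φ = inner ℂ (S.ι φ) (S.H.skewResolvent z ξ)) := by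
  have hz0 : 0 < z.re := (norm_nonneg _).trans_lt hz
  have hm := hS.mem_dom_diff_poles hz
  have h1 := hS.oneSub_Q hC hm y
  refine ⟨S.ι (hS.Q hC hm y), ?_, fun φ => ?_⟩
  · have h2 := congrArg S.ι h1
    rw [oneSub, map_sub, map_smul, hS.ι_C_of_re_pos hz0, sub_eq_iff_eq_add] at h2
    exact h2
  · rw [hS.R_eq hC hm, A_of_re_pos hz0, hS.cauchy_eq hz0.ne']

omit hC in
theorem Standing.fixed_point_unique {z : ℂ} (hz : ‖S.K‖ < z.re) {b ξ ξ' : 𝓗}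
    (h : ξ = b + Complex.exp (-z * S.τ) • S.K (S.H.skewResolvent z ξ))
    (h' : ξ' = b + Complex.exp (-z * S.τ) • S.K (S.H.skewResolvent z ξ')) : ξ = ξ' := by
  have hz0 : 0 < z.re := (norm_nonneg _).trans_lt hz
  have h1 : ξ - ξ' = Complex.exp (-z * S.τ) • S.K (S.H.skewResolvent z (ξ - ξ')) := by
    conv_lhs => rw [h, h']
    rw [map_sub, map_sub, smul_sub]
    abel
  have h2 := hS.norm_exp_K_resolvent_le hz0 (ξ - ξ')
  rw [← h1] at h2
  have h3 : ‖S.K‖ / z.re < 1 := (div_lt_one hz0).2 hz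
  have h4 : ‖ξ - ξ'‖ = 0 := by nlinarith [norm_nonneg (ξ - ξ')]
  exact sub_eq_zero.1 (norm_eq_zero.1 h4)

/-- The initial value plus the transform of the delayed term satisfies the fixed-point equation ξ =
y + e^{-zτ} K (z - iH)⁻¹ ξ, with y the initial value plus the history transform. So does the vector
behind the retarded resolvent, and the solution is unique. -/
theorem IsMildSolution.inner_laplace_eq_R {x g : X} {f u : ℝ → 𝓗}
    (hu : S.IsMildSolution (S.ι x) f u) (hf : MemLp f 2 (volume.restrict (Icc (-S.τ) 0)))
    {z : ℂ} (hz : ‖S.K‖ < z.re) (hg : S.ι g = S.historyTransform f z) (φ : X) :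
    inner ℂ (S.ι φ) (laplace u z) = S.R z (x + g) φ := by
  obtain ⟨ξ, hξ, hR⟩ := hS.exists_R_eq_inner hC hz (x + g)
  have h1 := hu.laplace_eq hS hf hz
  have h2 := hu.laplace_delayed hS hf hz
  have h3 : S.ι x + laplace (S.delayed u) z = S.ι (x + g)
      + Complex.exp (-z * S.τ) • S.K (S.H.skewResolvent z (S.ι x + laplace (S.delayed u) z)) := by
    rw [← h1, map_add, hg, add_assoc, ← h2]
  rw [hR, hS.fixed_point_unique hz hξ h3, ← h1]

theorem Standing.continuous_R_vline {a : ℝ} (ha : ‖S.K‖ < a) (y φ : X) :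
    Continuous fun s => S.R (vline a s) y φ :=
  continuous_iff_continuousAt.2 fun s =>
    ContinuousAt.comp (g := fun z => S.R z y φ)
      (hS.differentiableAt_R hC (hS.mem_dom_diff_poles (by simpa using ha)) y φ).continuousAt
      (continuous_vline a).continuousAt

omit hC in
theorem Standing.tendsto_lineInt_cauchy {a t : ℝ} (ha : 0 < a) (ht : 0 < t) (ψ φ : X) :
    Tendsto (fun b : ℝ => (2 * Real.pi * Complex.I)⁻¹ *
      lineInt (fun z => Complex.exp (z * t) * S.cauchy z ψ φ) (vline a) (-b) b) atTop
      (𝓝 (∫ ω : ℝ, Complex.exp (Complex.I * ω * t) *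
        S.I.indicator (fun ω : ℝ => S.dens ψ φ ω) ω)) := by
  simp only [cauchy_eq_integral_indicator hS]
  exact tendsto_lineInt_exp_mul_cauchy (integrable_indicator_dens hS ψ φ) ha ht

/-- Splitting a contour integral along a vertical line into a free part, convergent as a principal
value, and an absolutely convergent part. -/
theorem Standing.tendsto_lineInt_of_integrable_sub {a t : ℝ} (ha : 0 < a) (ht : 0 < t) (ψ φ : X)
    {Φ : ℂ → ℂ} (hΦ : Continuous fun s => Φ (vline a s))
    (h : Integrable fun s => Φ (vline a s) - S.cauchy (vline a s) ψ φ) :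
    Tendsto (fun b : ℝ => (2 * Real.pi * Complex.I)⁻¹ *
      lineInt (fun z => Complex.exp (z * t) * Φ z) (vline a) (-b) b) atTop
      (𝓝 ((∫ ω : ℝ, Complex.exp (Complex.I * ω * t) *
          S.I.indicator (fun ω : ℝ => S.dens ψ φ ω) ω) +
        (2 * Real.pi : ℂ)⁻¹ * ∫ s, Complex.exp (vline a s * t) *
          (Φ (vline a s) - S.cauchy (vline a s) ψ φ))) := by
  have h1 := hS.tendsto_lineInt_cauchy ha ht ψ φ
  have h2 := (tendsto_lineInt_vline (Φ := fun z => Complex.exp (z * t) *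
    (Φ z - S.cauchy z ψ φ)) (a := a)
    (integrable_exp_vline_mul (Φ := fun z => Φ z - S.cauchy z ψ φ) h t)).const_mul
      ((2 * Real.pi * Complex.I : ℂ)⁻¹)
  rw [mul_inv, mul_assoc, inv_mul_cancel_left₀ Complex.I_ne_zero] at h2
  refine (h1.add h2).congr fun b => ?_
  rw [← mul_inv, ← mul_add, lineInt_vline, lineInt_vline, lineInt_vline, ← mul_add]
  have hv := continuous_vline a
  have hc := hS.continuous_cauchy_comp hv (fun s => by rw [vline_re]; exact ha.ne') ψ φ
  have hexp : Continuous fun s => Complex.exp (vline a s * t) := by fun_prop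
  have hi₁ : IntervalIntegrable (fun s => Complex.exp (vline a s * t) *
      S.cauchy (vline a s) ψ φ) volume (-b) b := (hexp.mul hc).intervalIntegrable _ _
  have hi₂ : IntervalIntegrable (fun s => Complex.exp (vline a s * t) *
      (Φ (vline a s) - S.cauchy (vline a s) ψ φ)) volume (-b) b :=
    (hexp.mul (hΦ.sub hc)).intervalIntegrable _ _
  rw [← intervalIntegral.integral_add hi₁ hi₂]
  congr 2
  refine intervalIntegral.integral_congr fun s _ => ?_
  ring

/-- The inverse Laplace formula. -/
theorem IsMildSolution.tendsto_lineInt {x : X} {g : ℂ → X} {f u : ℝ → 𝓗}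
    (hu : S.IsMildSolution (S.ι x) f u) (hf : MemLp f 2 (volume.restrict (Icc (-S.τ) 0)))
    {a : ℝ} (ha : ‖S.K‖ < a) (hg : ∀ z, S.ι (g z) = S.historyTransform f z)
    {t : ℝ} (ht : 0 < t) (ψ : X) :
    Tendsto (fun b : ℝ => (2 * Real.pi * Complex.I)⁻¹ *
      lineInt (fun z => Complex.exp (z * t) * S.R z (x + g z) ψ) (vline a) (-b) b) atTop
      (𝓝 (inner ℂ (S.ι ψ) (u t))) := by
  have ha0 : 0 < a := (norm_nonneg _).trans_lt ha
  have hre : ∀ s, ‖S.K‖ < (vline a s).re := fun s => by simpa using ha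
  have hre0 : ∀ s, 0 < (vline a s).re := fun s => by simpa using ha0
  set G := S.I.indicator fun ω : ℝ => S.dens x ψ ω with hG
  have hGi : Integrable G := integrable_indicator_dens hS x ψ
  set e₀ : ℝ → ℂ := fun t => ∫ ω : ℝ, Complex.exp (Complex.I * ω * t) * G ω with he₀
  have hui := hu.integrableOn_exp_smul hS hf ha
  have hwi := hu.integrableOn_exp_smul_delayed hS hf ha
  -- The Fourier integral of the density is subtracted because its transform is not absolutely
  -- integrable. What is left has as transform the resolvent applied to the transform of the delayed
  -- term, tested against ψ, and that is integrable on the line.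
  set v : ℝ → ℂ := fun t => inner ℂ (S.ι ψ) (u t) - e₀ t with hv
  have hlu : ∀ s, laplace (fun t => inner ℂ (S.ι ψ) (u t)) (vline a s)
      = S.R (vline a s) (x + g (vline a s)) ψ := fun s => by
    rw [← hu.inner_laplace_eq_R hS hC hf (hre s) (hg _)]
    exact ((innerSL ℂ (S.ι ψ)).laplace_comp
      (integrable_exp_smul_congr_re (vline_re a s) hui)).2
  have hlui : ∀ z : ℂ, z.re = a → IntegrableOn
      (fun t : ℝ => Complex.exp (-z * t) • inner ℂ (S.ι ψ) (u t)) (Ioi 0) := fun z hz =>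
    ((innerSL ℂ (S.ι ψ)).laplace_comp (integrable_exp_smul_congr_re hz hui)).1
  have hle : ∀ s, laplace e₀ (vline a s) = S.cauchy (vline a s) x ψ := fun s => by
    rw [(laplace_fourierIntegral hGi (hre0 s)).2, cauchy_eq_integral_indicator hS]
  have hlv : ∀ s, laplace v (vline a s)
      = S.R (vline a s) (x + g (vline a s)) ψ - S.cauchy (vline a s) x ψ := fun s => by
    rw [← hlu, ← hle, laplace, laplace, laplace, ← integral_sub (hlui _ (vline_re a s))
      (laplace_fourierIntegral hGi (hre0 s)).1]
    simp only [hv, smul_sub, he₀]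
  have hvi : IntegrableOn (fun t : ℝ => Complex.exp (-a * t) • v t) (Ioi 0) := by
    have := (hlui a (Complex.ofReal_re a)).sub
      (laplace_fourierIntegral hGi (z := a) (by simpa using ha0)).1
    refine this.congr (Eventually.of_forall fun t => ?_)
    simp only [Pi.sub_apply, hv, smul_sub, he₀]
  have hRw : ∀ s, laplace v (vline a s) = inner ℂ (S.ι ψ)
      (S.H.skewResolvent (vline a s) (laplace (S.delayed u) (vline a s))) := fun s => by
    rw [hlv, hS.cauchy_eq (hre0 s).ne', ← hu.inner_laplace_eq_R hS hC hf (hre s) (hg _),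
      hu.laplace_eq hS hf (hre s), map_add, inner_add_right, add_sub_cancel_left]
  have hmeas : Continuous fun s => laplace v (vline a s) := by
    have h1 : Continuous fun s => laplace v (vline a (2 * Real.pi * ((2 * Real.pi)⁻¹ * s))) := by
      simp_rw [← fourier_indicator_eq_laplace]
      have hk : Integrable ((Ioi (0 : ℝ)).indicator fun t : ℝ => Complex.exp (-a * t) • v t) :=
        (integrable_indicator_iff measurableSet_Ioi).2 hvi
      have := VectorFourier.fourierIntegral_continuous Real.continuous_fourierChar
        (innerSL ℝ).continuous₂ hk
      exact this.comp (continuous_const.mul continuous_id)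
    refine h1.congr fun s => ?_
    rw [mul_inv_cancel_left₀ (by positivity)]
  have hint : Integrable fun s => laplace v (vline a s) := by
    simp_rw [hRw]
    refine hS.integrable_inner_resolvent ha0 ψ
      (memLp_laplace hwi (hu.memLp_exp_smul_delayed hS hf ha (Or.inr rfl))) (fun s => le_rfl) ?_
    simp_rw [← hRw]
    exact hmeas.aestronglyMeasurable
  have hcv : ContinuousAt v t :=
    ((continuous_const.inner continuous_id).continuousAt.comp
      (hu.cont.continuousAt (Ici_mem_nhds ht))).sub (continuous_integral_exp hGi).continuousAt
  have hinv := laplace_inversion ht hvi hcv hint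
  simp only [smul_eq_mul, hlv] at hinv
  have hcR : Continuous fun s => S.R (vline a s) (x + g (vline a s)) ψ := by
    have := hmeas.add (hS.continuous_cauchy_comp (continuous_vline a) (fun s => (hre0 s).ne') x ψ)
    refine this.congr fun s => ?_
    rw [Pi.add_apply, hlv, sub_add_cancel]
  have := hS.tendsto_lineInt_of_integrable_sub hC ha0 ht x ψ
    (Φ := fun z => S.R z (x + g z) ψ) hcR (by simpa only [hlv] using hint)
  rw [hinv] at this
  have e : e₀ t + v t = inner ℂ (S.ι ψ) (u t) := add_sub_cancel _ _
  rwa [← e]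

/-- The contribution of the initial value alone has a limit along the vertical line. -/
theorem Standing.exists_tendsto_lineInt {a : ℝ} (ha : ‖S.K‖ < a) {t : ℝ} (ht : 0 < t) (x ψ : X) :
    ∃ L, Tendsto (fun b : ℝ => (2 * Real.pi * Complex.I)⁻¹ *
      lineInt (fun z => Complex.exp (z * t) * S.R z x ψ) (vline a) (-b) b) atTop (𝓝 L) := by
  have ha0 : 0 < a := (norm_nonneg _).trans_lt ha
  have hre : ∀ s, ‖S.K‖ < (vline a s).re := fun s => by simpa using ha
  have hre0 : ∀ s, 0 < (vline a s).re := fun s => by simpa using ha0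
  choose ξ hξ hR using fun s => hS.exists_R_eq_inner hC (hre s) x
  set w : ℝ → 𝓗 := fun s => Complex.exp (-(vline a s) * S.τ) •
    S.K (S.H.skewResolvent (vline a s) (ξ s)) with hw
  have hsub : ∀ s, S.R (vline a s) x ψ - S.cauchy (vline a s) x ψ
      = inner ℂ (S.ι ψ) (S.H.skewResolvent (vline a s) (w s)) := fun s => by
    rw [hR, hS.cauchy_eq (hre0 s).ne', ← inner_sub_right, ← map_sub]
    congr 2
    rw [sub_eq_iff_eq_add']
    exact hξ s
  have hexp : ∀ s, ‖Complex.exp (-(vline a s) * S.τ)‖ ≤ 1 := fun s => by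
    rw [Complex.norm_exp, Real.exp_le_one_iff]
    have := mul_pos ha0 hS.tau_pos
    simp [vline]
    linarith
  have hwn : ∀ s, ‖w s‖ ≤ ‖S.K‖ * ‖S.H.skewResolvent (vline a s) (ξ s)‖ := fun s => by
    rw [hw]
    simp only [norm_smul]
    exact (mul_le_of_le_one_left (norm_nonneg _) (hexp s)).trans (S.K.le_opNorm _)
  have hθ : ‖S.K‖ / a < 1 := (div_lt_one ha0).2 ha
  have hθ' : 0 < 1 - ‖S.K‖ / a := sub_pos.2 hθ
  -- A Neumann type bound: the resolvent of ξ is that of x plus a part at most ‖K‖/a < 1 times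
  -- itself. Square integrability along the line is thereby inherited from x.
  have hξn : ∀ s, ‖S.H.skewResolvent (vline a s) (ξ s)‖
      ≤ (1 - ‖S.K‖ / a)⁻¹ * ‖S.H.skewResolvent (vline a s) (S.ι x)‖ := fun s => by
    have h1 : S.H.skewResolvent (vline a s) (ξ s) = S.H.skewResolvent (vline a s) (S.ι x)
        + S.H.skewResolvent (vline a s) (w s) := by
      rw [← map_add]
      congr 1
      exact hξ s
    have h2 := hS.self_adjoint.norm_skewResolvent_apply_le (hre0 s).ne' (w s)
    rw [vline_re, abs_of_pos ha0] at h2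
    have h3 : ‖S.H.skewResolvent (vline a s) (w s)‖
        ≤ ‖S.K‖ / a * ‖S.H.skewResolvent (vline a s) (ξ s)‖ := by
      refine h2.trans ((mul_le_mul_of_nonneg_left (hwn s) (by positivity)).trans (le_of_eq ?_))
      ring
    have h4 := norm_add_le (S.H.skewResolvent (vline a s) (S.ι x))
      (S.H.skewResolvent (vline a s) (w s))
    rw [← h1] at h4
    rw [inv_mul_eq_div, le_div_iff₀ hθ']
    linarith
  have hcR := hS.continuous_R_vline hC ha x ψ
  refine ⟨_, hS.tendsto_lineInt_of_integrable_sub hC ha0 ht x ψ (Φ := fun z => S.R z x ψ) hcR ?_⟩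
  simp_rw [hsub]
  refine hS.integrable_inner_resolvent ha0 ψ
    (b := fun s => (‖S.K‖ * (1 - ‖S.K‖ / a)⁻¹) ^ 2 *
      ‖S.H.skewResolvent (vline a s) (S.ι x)‖ ^ 2)
    ((hS.integrable_norm_sq_resolvent ha0 x).1.const_mul _) (fun s => ?_) ?_
  · rw [← mul_pow]
    refine pow_le_pow_left₀ (norm_nonneg _) ((hwn s).trans ?_) 2
    rw [mul_assoc]
    exact mul_le_mul_of_nonneg_left (hξn s) (norm_nonneg _)
  · simp_rw [← hsub]
    exact (hcR.sub (hS.continuous_cauchy_comp (continuous_vline a)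
      (fun s => (hre0 s).ne') x ψ)).aestronglyMeasurable

end Inversion

end DelaySystem

/-! ### Powers of the shift resolvent and moments of the history -/

section RepeatedIntegrals

/-- Cauchy's formula for repeated integration, one step. -/
theorem integral_integral_pow_smul {E : Type*} [NormedAddCommGroup E] [NormedSpace ℂ E]
    [CompleteSpace E] {F : ℝ → E} {s : ℝ} (hF : IntegrableOn F (Ioc s 0)) (n : ℕ) :
    ∫ r in Ioc s 0, ∫ m in Ioc r 0, (((m - r : ℝ) : ℂ) ^ n / n.factorial) • F m
      = ∫ m in Ioc s 0, (((m - s : ℝ) : ℂ) ^ (n + 1) / (n + 1).factorial) • F m := by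
  set κ : ℝ × ℝ → ℂ := {p : ℝ × ℝ | p.1 < p.2}.indicator
    (fun p => ((p.2 - p.1 : ℝ) : ℂ) ^ n / n.factorial) with hκ
  have hmeasS : MeasurableSet {p : ℝ × ℝ | p.1 < p.2} := measurableSet_lt measurable_fst measurable_snd
  have hκm : Measurable κ := Measurable.indicator (by fun_prop) hmeasS
  set μ := volume.restrict (Ioc s 0) with hμ
  have hFμ : Integrable F μ := hF
  have hint : Integrable (fun p : ℝ × ℝ => κ p • F p.2) (μ.prod μ) := by
    refine Integrable.bdd_smul (𝕜 := ℂ) (hFμ.comp_snd μ) (|s| ^ n) hκm.aestronglyMeasurable ?_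
    have h1 : ∀ᵐ p ∂(μ.prod μ), p ∈ Ioc s 0 ×ˢ Ioc s 0 := by
      rw [hμ, Measure.prod_restrict]
      exact ae_restrict_mem (measurableSet_Ioc.prod measurableSet_Ioc)
    filter_upwards [h1] with p hp
    by_cases hp' : p ∈ {p : ℝ × ℝ | p.1 < p.2}
    · rw [hκ, indicator_of_mem hp', norm_div, norm_pow, Complex.norm_real, Complex.norm_natCast]
      have hlt : p.1 < p.2 := hp'
      have h2 : ‖p.2 - p.1‖ ≤ |s| := by
        rw [Real.norm_eq_abs, abs_of_pos (sub_pos.2 hlt)]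
        have := hp.1.1
        have := hp.2.2
        linarith [neg_abs_le s]
      refine (div_le_self (by positivity) ?_).trans (pow_le_pow_left₀ (norm_nonneg _) h2 n)
      exact_mod_cast Nat.one_le_iff_ne_zero.2 n.factorial_ne_zero
    · rw [hκ, indicator_of_notMem hp', norm_zero]
      positivity
  have e1 : ∀ r ∈ Ioc s 0, ∫ m in Ioc r 0, (((m - r : ℝ) : ℂ) ^ n / n.factorial) • F m
      = ∫ m, κ (r, m) • F m ∂μ := by
    intro r hr
    rw [hμ, ← integral_indicator measurableSet_Ioc, ← integral_indicator measurableSet_Ioc]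
    congr 1
    ext m
    by_cases hm : m ∈ Ioc r 0
    · rw [indicator_of_mem hm, indicator_of_mem (show m ∈ Ioc s 0 from ⟨hr.1.trans hm.1, hm.2⟩), hκ,
        indicator_of_mem (show (r, m) ∈ {p : ℝ × ℝ | p.1 < p.2} from hm.1)]
    · rw [indicator_of_notMem hm]
      by_cases hm' : m ∈ Ioc s 0
      · rw [indicator_of_mem hm', hκ, indicator_of_notMem, zero_smul]
        intro h
        exact hm ⟨h, hm'.2⟩
      · rw [indicator_of_notMem hm']
  rw [setIntegral_congr_fun measurableSet_Ioc e1]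
  change ∫ r, (∫ m, κ (r, m) • F m ∂μ) ∂μ = _
  rw [integral_integral_swap hint]
  refine setIntegral_congr_fun measurableSet_Ioc fun m hm => ?_
  rw [integral_smul_const]
  congr 1
  have e2 : ∫ r, κ (r, m) ∂μ = ∫ r in s..m, ((m - r : ℝ) : ℂ) ^ n / n.factorial := by
    rw [hμ, ← integral_indicator (measurableSet_Ioc (a := s) (b := 0)),
      intervalIntegral.integral_of_le hm.1.le, integral_Ioc_eq_integral_Ioo,
      ← integral_indicator measurableSet_Ioo]
    congr 1
    ext r
    by_cases hr : r ∈ Ioo s m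
    · rw [indicator_of_mem hr, indicator_of_mem (show r ∈ Ioc s 0 from ⟨hr.1, hr.2.le.trans hm.2⟩),
        hκ, indicator_of_mem (show (r, m) ∈ {p : ℝ × ℝ | p.1 < p.2} from hr.2)]
    · rw [indicator_of_notMem hr]
      by_cases hr' : r ∈ Ioc s 0
      · rw [indicator_of_mem hr', hκ, indicator_of_notMem]
        intro h
        exact hr ⟨hr'.1, h⟩
      · rw [indicator_of_notMem hr']
  rw [e2]
  have e3 : ∀ r : ℝ, ((m - r : ℝ) : ℂ) ^ n / n.factorial
      = (((m - r) ^ n / n.factorial : ℝ) : ℂ) := fun r => by push_cast; rfl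
  simp_rw [e3]
  rw [intervalIntegral.integral_ofReal, intervalIntegral.integral_div,
    intervalIntegral.integral_comp_sub_left (fun x => x ^ n), sub_self, integral_pow,
    Nat.factorial_succ]
  push_cast
  rw [zero_pow (Nat.succ_ne_zero n), sub_zero, div_div]

end RepeatedIntegrals

namespace DelaySystem

variable {𝓗 X : Type*} [NormedAddCommGroup 𝓗] [InnerProductSpace ℂ 𝓗] [CompleteSpace 𝓗]

/-- The exponentials of successive steps combine, e^{z(s-r)} e^{z(r-m)} = e^{z(s-m)}, and what
remains is repeated integration. -/
theorem iterate_shiftRes {f : ℝ → 𝓗} {τ : ℝ} (hf : IntegrableOn f (Icc (-τ) 0)) (z : ℂ) (n : ℕ) :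
    ∀ s ∈ Icc (-τ) 0, (shiftRes z)^[n + 1] f s =
      ∫ m in Ioc s 0, (((m - s : ℝ) : ℂ) ^ n / n.factorial) •
        (Complex.exp (z * ((s : ℂ) - m)) • f m) := by
  have hstep : ∀ (h : ℝ → 𝓗) (s : ℝ), s ≤ 0 →
      shiftRes z h s = ∫ m in Ioc s 0, Complex.exp (z * ((s : ℂ) - m)) • h m := by
    intro h s hs
    rw [shiftRes, intervalIntegral.integral_of_ge hs, neg_neg]
  induction n with
  | zero =>
    intro s hs
    rw [Function.iterate_one, hstep f s hs.2]
    simp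
  | succ n ih =>
    intro s hs
    rw [Function.iterate_succ_apply', hstep _ s hs.2]
    set F : ℝ → 𝓗 := fun m => Complex.exp (z * ((s : ℂ) - m)) • f m with hFdef
    have hsub : Ioc s 0 ⊆ Icc (-τ) 0 := fun m hm => ⟨hs.1.trans hm.1.le, hm.2⟩
    have hF : IntegrableOn F (Ioc s 0) := by
      have h1 : IntegrableOn F (Icc (-τ) 0) :=
        hf.continuousOn_smul (by fun_prop) isCompact_Icc
      exact h1.mono_set hsub
    rw [← integral_integral_pow_smul hF n]
    refine setIntegral_congr_fun measurableSet_Ioc fun r hr => ?_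
    rw [ih r (hsub hr), ← integral_smul]
    refine setIntegral_congr_fun measurableSet_Ioc fun m hm => ?_
    simp only [hFdef, smul_smul]
    congr 1
    rw [mul_left_comm, ← Complex.exp_add]
    congr 2
    ring

section History

variable [AddCommGroup X] [Module ℂ X] [TopologicalSpace X] {S : DelaySystem 𝓗 X}

theorem delayRes_eq (hS : S.Standing) {f : ℝ → 𝓗}
    (hf : MemLp f 2 (volume.restrict (Icc (-S.τ) 0))) (z : ℂ) (n : ℕ) :
    S.delayRes z (n + 1) f = ∫ s in Icc (-S.τ) 0,
      (Complex.exp (-z * (S.τ + s)) * ((S.τ + s : ℂ) ^ n / n.factorial)) • S.K (f s) := by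
  have hτ := hS.tau_pos
  have hfi : IntegrableOn f (Icc (-S.τ) 0) := hf.integrable (by norm_num)
  rw [delayRes, iterate_shiftRes hfi z n _ ⟨le_rfl, by linarith⟩, ← integral_Icc_eq_integral_Ioc]
  rw [← S.K.integral_comp_comm]
  · refine setIntegral_congr_fun measurableSet_Icc fun m hm => ?_
    simp only [map_smul, smul_smul]
    congr 1
    rw [mul_comm]
    congr 2
    · push_cast
      ring
    · push_cast
      ring
  · have h1 : IntegrableOn (fun m : ℝ => ((((m - -S.τ : ℝ) : ℂ) ^ n / n.factorial) *
        Complex.exp (z * (((-S.τ : ℝ) : ℂ) - m))) • f m) (Icc (-S.τ) 0) :=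
      hfi.continuousOn_smul (by fun_prop) isCompact_Icc
    simp only [smul_smul]
    exact h1

/-- Derivatives of the transform of an integrable function on the history interval. -/
theorem hasDerivAt_moment {τ : ℝ} {c : ℝ → ℂ} (hc : IntegrableOn c (Icc (-τ) 0)) (n : ℕ) (z : ℂ) :
    HasDerivAt (fun z : ℂ => ∫ s in Icc (-τ) 0,
        (Complex.exp (-z * (τ + s)) * (-(τ + s : ℂ)) ^ n) * c s)
      (∫ s in Icc (-τ) 0, (Complex.exp (-z * (τ + s)) * (-(τ + s : ℂ)) ^ (n + 1)) * c s) z := by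
  have hcont : Continuous fun p : ℂ × ℝ =>
      Complex.exp (-p.1 * (τ + p.2)) * (-(τ + p.2 : ℂ)) ^ (n + 1) := by fun_prop
  obtain ⟨M, hM⟩ := (((isCompact_closedBall z 1).prod
    (isCompact_Icc (a := -τ) (b := 0))).image hcont).isBounded.exists_norm_le
  have hi : ∀ (k : ℕ) (w : ℂ), IntegrableOn (fun s : ℝ =>
      (Complex.exp (-w * (τ + s)) * (-(τ + s : ℂ)) ^ k) * c s) (Icc (-τ) 0) := fun k w =>
    hc.continuousOn_mul (by fun_prop) isCompact_Icc
  refine (hasDerivAt_integral_of_dominated_loc_of_deriv_le (μ := volume.restrict (Icc (-τ) 0))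
    (F := fun (w : ℂ) (s : ℝ) => (Complex.exp (-w * (τ + s)) * (-(τ + s : ℂ)) ^ n) * c s)
    (F' := fun (w : ℂ) (s : ℝ) => (Complex.exp (-w * (τ + s)) * (-(τ + s : ℂ)) ^ (n + 1)) * c s)
    (bound := fun s => M * ‖c s‖) (Metric.ball_mem_nhds z one_pos)
    (Eventually.of_forall fun w => (hi n w).aestronglyMeasurable) (hi n z)
    (hi (n + 1) z).aestronglyMeasurable ?_ (hc.norm.const_mul M) ?_).2
  · filter_upwards [ae_restrict_mem measurableSet_Icc] with s hs w hw
    rw [norm_mul]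
    gcongr
    exact hM _ ⟨(w, s), ⟨Metric.ball_subset_closedBall hw, hs⟩, rfl⟩
  · refine Eventually.of_forall fun s w _ => ?_
    have h1 : HasDerivAt (fun w : ℂ => -w * (τ + s : ℂ)) (-1 * (τ + s : ℂ)) w :=
      (hasDerivAt_id w).neg.mul_const _
    have h2 := (h1.cexp.mul_const ((-(τ + s : ℂ)) ^ n)).mul_const (c s)
    convert! h2 using 1
    ring

end History

section Moments

variable [AddCommGroup X] [Module ℂ X] [UniformSpace X] [IsUniformAddGroup X] [ContinuousSMul ℂ X]
  {S : DelaySystem 𝓗 X}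

/-- `g z m` is the weak integral `∫ e^{-z(τ+s)} (τ+s)^m / m! k(s) ds`. -/
structure IsMoments (S : DelaySystem 𝓗 X) (f : ℝ → 𝓗) (k : ℝ → X) (g : ℂ → ℕ → X) : Prop where
  ae_eq : ∀ᵐ s ∂(volume.restrict (Icc (-S.τ) 0)), S.ι (k s) = S.K (f s)
  integrable : ∀ l : X →L[ℂ] ℂ, IntegrableOn (fun s => l (k s)) (Icc (-S.τ) 0)
  eq : ∀ (l : X →L[ℂ] ℂ) z m, l (g z m) = ∫ s in Icc (-S.τ) 0,
    (Complex.exp (-z * (S.τ + s)) * ((S.τ + s : ℂ) ^ m / m.factorial)) * l (k s)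

/-- Only the integrals without powers of τ + s are assumed to lie in X. The others are, up to sign
and factorials, their derivatives in z, which exist in X by `exists_weak_deriv`. -/
theorem IsHistory.exists_moments [T2Space X] [LocallyConvexSpace ℝ X] [QuasiCompleteSpace ℂ X]
    {f : ℝ → 𝓗} (hf : S.IsHistory f) : ∃ k g, S.IsMoments f k g := by
  obtain ⟨k, hk, hy⟩ := hf.values
  choose y hy using hy
  have hki : ∀ l : X →L[ℂ] ℂ, IntegrableOn (fun s => l (k s)) (Icc (-S.τ) 0) := fun l => by
    simpa using (hy 0 l).1
  have hY : ∀ m : ℕ, ∃ Y : ℂ → X, ∀ (l : X →L[ℂ] ℂ) z, l (Y z) = ∫ s in Icc (-S.τ) 0,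
      (Complex.exp (-z * (S.τ + s)) * (-(S.τ + s : ℂ)) ^ m) * l (k s) := by
    intro m
    induction m with
    | zero =>
      refine ⟨y, fun l z => ?_⟩
      rw [(hy z l).2]
      simp
    | succ m ih =>
      obtain ⟨Y, hY⟩ := ih
      obtain ⟨Y', hY'⟩ := exists_weak_deriv Y fun l z => by
        simp only [hY]
        exact (hasDerivAt_moment (hki l) m z).differentiableAt
      refine ⟨Y', fun l z => ?_⟩
      have h1 := hY' l z
      simp only [hY] at h1
      exact h1.unique (hasDerivAt_moment (hki l) m z)
  choose Y hY using hY
  refine ⟨k, fun z m => ((-1 : ℂ) ^ m / m.factorial) • Y m z, hk, hki, fun l z m => ?_⟩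
  rw [map_smul, hY, smul_eq_mul, ← integral_const_mul]
  refine integral_congr_ae (Eventually.of_forall fun s => ?_)
  simp only
  rw [neg_pow (S.τ + s : ℂ) m]
  have : ((-1 : ℂ) ^ m) * (-1) ^ m = 1 := by rw [← mul_pow]; simp
  linear_combination (Complex.exp (-z * (S.τ + s)) * ((S.τ + s : ℂ) ^ m / m.factorial) * l (k s)) *
    this

namespace IsMoments

variable {f : ℝ → 𝓗} {k : ℝ → X} {g : ℂ → ℕ → X} (hg : S.IsMoments f k g)
include hg

theorem ι_eq (hS : S.Standing) (hf : MemLp f 2 (volume.restrict (Icc (-S.τ) 0))) (z : ℂ) (m : ℕ) :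
    S.ι (g z m) = S.delayRes z (m + 1) f := by
  have hfi : IntegrableOn f (Icc (-S.τ) 0) := hf.integrable (by norm_num)
  refine ext_inner_left ℂ fun h => ?_
  have h1 := hg.eq ((innerSL ℂ h).comp S.ι) z m
  have h2 : inner ℂ h (S.ι (g z m)) = _ := h1
  rw [h2, delayRes_eq hS hf, ← integral_inner]
  · refine integral_congr_ae ?_
    filter_upwards [hg.ae_eq] with s hs
    rw [inner_smul_right, ← hs]
    rfl
  · exact IntegrableOn.continuousOn_smul (S.K.integrable_comp hfi) (by fun_prop) isCompact_Icc

theorem ι_zero (hS : S.Standing) (hf : MemLp f 2 (volume.restrict (Icc (-S.τ) 0))) (z : ℂ) :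
    S.ι (g z 0) = S.historyTransform f z := by
  rw [hg.ι_eq hS hf, delayRes_eq hS hf, historyTransform]
  simp

theorem differentiable (l : X →L[ℂ] ℂ) : Differentiable ℂ fun z => l (g z 0) := fun z => by
  have := (hasDerivAt_moment (hg.integrable l) 0 z).differentiableAt
  simp only [hg.eq]
  simpa using this

/-- The Taylor expansion of the history transform, in the weak sense. -/
theorem hasSum (l : X →L[ℂ] ℂ) (z w : ℂ) :
    HasSum (fun m : ℕ => (z - w) ^ m * l (g z m)) (l (g w 0)) := by
  have hi := hg.integrable l
  rw [hg.eq l w 0]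
  have e : ∀ m : ℕ, (z - w) ^ m * l (g z m) = ∫ s in Icc (-S.τ) 0,
      ((z - w) * (S.τ + s : ℂ)) ^ m / m.factorial * (Complex.exp (-z * (S.τ + s)) * l (k s)) := by
    intro m
    rw [hg.eq, ← integral_const_mul]
    refine integral_congr_ae (Eventually.of_forall fun s => ?_)
    simp only
    rw [mul_pow]
    ring
  simp only [e]
  have hbd : ∀ s ∈ Icc (-S.τ) 0, ‖(z - w) * (S.τ + s : ℂ)‖ ≤ ‖z - w‖ * S.τ := fun s hs => by
    rw [norm_mul]
    gcongr
    rw [← Complex.ofReal_add, Complex.norm_real, Real.norm_of_nonneg (by linarith [hs.1])]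
    linarith [hs.2]
  have hci : IntegrableOn (fun s : ℝ => Complex.exp (-z * (S.τ + s)) * l (k s)) (Icc (-S.τ) 0) :=
    hi.continuousOn_mul (by fun_prop) isCompact_Icc
  refine hasSum_integral_of_dominated_convergence
    (fun (m : ℕ) (s : ℝ) => (‖z - w‖ * S.τ) ^ m / m.factorial *
      ‖Complex.exp (-z * (S.τ + s)) * l (k s)‖) ?_ ?_ ?_ ?_ ?_
  · exact fun m => (Continuous.aestronglyMeasurable (by fun_prop)).mul hci.aestronglyMeasurable
  · intro m
    filter_upwards [ae_restrict_mem measurableSet_Icc] with s hs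
    rw [norm_mul, norm_div, norm_pow, Complex.norm_natCast]
    gcongr
    exact hbd s hs
  · exact Eventually.of_forall fun s => (Real.summable_pow_div_factorial _).mul_right _
  · have : ∀ s : ℝ, ∑' m : ℕ, (‖z - w‖ * S.τ) ^ m / m.factorial *
        ‖Complex.exp (-z * (S.τ + s)) * l (k s)‖
        = (∑' m : ℕ, (‖z - w‖ * S.τ) ^ m / m.factorial) *
          ‖Complex.exp (-z * (S.τ + s)) * l (k s)‖ := fun s => tsum_mul_right
    simp_rw [this]
    exact hci.norm.const_mul _
  · refine Eventually.of_forall fun s => ?_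
    have h1 := (NormedSpace.expSeries_div_hasSum_exp ((z - w) * (S.τ + s : ℂ))).mul_right
      (Complex.exp (-z * (S.τ + s)) * l (k s))
    rw [← Complex.exp_eq_exp_ℂ, ← mul_assoc, ← Complex.exp_add] at h1
    convert! h1 using 1
    simp only [pow_zero, Nat.factorial_zero, Nat.cast_one, div_one, mul_one]
    congr 2
    ring

/-- The weak Taylor series converges everywhere, in particular at z - ρ⁻¹, so its terms there are
bounded for every functional. Weakly bounded families are bounded in each continuous seminorm. -/
theorem exists_seminorm_le (z : ℂ) {ρ : ℝ} (hρ : 0 < ρ) (p : Seminorm ℂ X)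
    (hp : Continuous p) : ∃ M, ∀ m, p (g z m) ≤ M * ρ ^ m := by
  have hweak : ∀ l : X →L[ℂ] ℂ, ∃ M, ∀ m : ℕ, ‖l ((((ρ : ℂ) ^ m)⁻¹) • g z m)‖ ≤ M := by
    intro l
    have hsum := (hg.hasSum l z (z - (ρ : ℂ)⁻¹)).summable.tendsto_atTop_zero
    obtain ⟨M, hM⟩ := (Metric.isBounded_range_of_tendsto _ hsum).exists_norm_le
    refine ⟨M, fun m => ?_⟩
    have := hM _ ⟨m, rfl⟩
    simp only [sub_sub_cancel, inv_pow] at this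
    rwa [map_smul, smul_eq_mul]
  obtain ⟨M, hM⟩ := Seminorm.bounded_of_weakly_bounded _ hweak p hp
  refine ⟨M, fun m => ?_⟩
  have := hM m
  rw [map_smul_eq_mul, norm_inv, norm_pow, Complex.norm_real, Real.norm_of_nonneg hρ.le] at this
  rwa [inv_mul_le_iff₀ (by positivity), mul_comm] at this

theorem exists_seminorm_le_of_compact {D : Set ℂ} (hD : IsCompact D) (p : Seminorm ℂ X)
    (hp : Continuous p) : ∃ M, ∀ z ∈ D, p (g z 0) ≤ M := by
  obtain ⟨M, hM⟩ := Seminorm.bounded_of_weakly_bounded (fun z : D => g z 0) (fun l => by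
    obtain ⟨M, hM⟩ := (hD.image (hg.differentiable l).continuous).isBounded.exists_norm_le
    exact ⟨M, fun z => hM _ ⟨z, z.2, rfl⟩⟩) p hp
  exact ⟨M, fun z hz => hM ⟨z, hz⟩⟩

end IsMoments

end Moments

end DelaySystem

/-! ### Residues at the eigenvalues and the deformed integral -/

namespace DelaySystem

variable {𝓗 X : Type*} [NormedAddCommGroup 𝓗] [InnerProductSpace ℂ 𝓗] [CompleteSpace 𝓗]
  [AddCommGroup X] [Module ℂ X] [UniformSpace X] [IsUniformAddGroup X] [ContinuousSMul ℂ X]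
  [T2Space X] [LocallyConvexSpace ℝ X] [QuasiCompleteSpace ℂ X] [BarrelledSpace ℂ X]
  {S : DelaySystem 𝓗 X} (hS : S.Standing) (hC : S.UniformlyCompact)

namespace Standing

include hS hC

theorem continuous_R_left {z : ℂ} (hz : z ∈ S.dom \ S.poles) (φ : X) :
    Continuous fun y => S.R z y φ := by
  have hD : ({z} : Set ℂ) ⊆ S.dom := singleton_subset_iff.2 hz.1
  obtain ⟨M⟩ := hS.exists_compactModel hC isCompact_singleton hD
  have hu : IsUnit (1 - M.T z) := (M.isCompactOperator_T z).isUnit_one_sub_of_injective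
    ((M.injective_oneSub_iff hS hD (mem_singleton z)).1 (hS.bijective_oneSub hC hz).1)
  have h1 : (fun y => S.R z y φ) = fun y => S.A z (y + M.j (Ring.inverse (1 - M.T z)
      (Complex.exp (-z * S.τ) • M.Chat z y))) φ := by
    funext y
    exact hS.R_eq_of_oneSub hC hz (M.oneSub_inverse hS hD (mem_singleton z) hu y) φ
  rw [h1]
  refine (hS.continuous_A_left hz.1 φ).comp (continuous_id.add (M.j.continuous.comp
    ((ContinuousLinearMap.continuous _).comp ((M.Chat z).continuous.const_smul _))))

/-- The resolvent as a continuous linear functional of its first argument. -/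
def RL {z : ℂ} (hz : z ∈ S.dom \ S.poles) (φ : X) : X →L[ℂ] ℂ :=
  ⟨{ toFun := fun y => S.R z y φ
     map_add' := fun y y' => hS.R_add_left hC hz y y' φ
     map_smul' := fun c y => hS.R_smul_left hC hz c y φ }, hS.continuous_R_left hC hz φ⟩

theorem RL_apply {z : ℂ} (hz : z ∈ S.dom \ S.poles) (y φ : X) :
    hS.RL hC hz φ y = S.R z y φ := rfl

/-- Local equicontinuity of the resolvent in its first argument. -/
theorem exists_seminorm_R_left_le {D : Set ℂ} (hD : IsCompact D) (hDd : D ⊆ S.dom \ S.poles)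
    (φ : X) : ∃ q : Seminorm ℂ X, Continuous q ∧ ∀ z ∈ D, ∀ y, ‖S.R z y φ‖ ≤ q y := by
  obtain ⟨q, hq, hpq⟩ := exists_continuous_seminorm_bound
    (fun z : D => (normSeminorm ℂ ℂ).comp (hS.RL hC (hDd z.2) φ).toLinearMap)
    (fun z => (hS.continuous_R_left hC (hDd z.2) φ).norm) (fun y => by
    obtain ⟨c, hc⟩ := (hD.image_of_continuousOn
      ((hS.differentiableOn_R hC y φ).continuousOn.mono hDd)).isBounded.exists_norm_le
    exact ⟨c, fun z => hc _ ⟨z, z.2, rfl⟩⟩)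
  exact ⟨q, hq, fun z hz y => hpq ⟨z, hz⟩ y⟩

/-- The resolvent applied to a weakly entire function is holomorphic. -/
theorem differentiableOn_R_moments {f : ℝ → 𝓗} {k : ℝ → X} {g : ℂ → ℕ → X}
    (hg : S.IsMoments f k g) (φ : X) :
    DifferentiableOn ℂ (fun z => S.R z (g z 0) φ) (S.dom \ S.poles) := by
  intro z₀ hz₀
  refine DifferentiableAt.differentiableWithinAt ?_
  obtain ⟨r, hr, hrd⟩ := Metric.nhds_basis_closedBall.mem_iff.1
    ((hS.isOpen_dom_diff_poles hC).mem_nhds hz₀)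
  have hcpt := isCompact_closedBall z₀ r
  obtain ⟨q, hq, hqR⟩ := hS.exists_seminorm_R_left_le hC hcpt hrd φ
  obtain ⟨M, hM⟩ := hg.exists_seminorm_le_of_compact hcpt q hq
  have hsub := Metric.ball_subset_closedBall (x := z₀) (ε := r)
  refine differentiableAt_diag (G := fun z v => S.R z (g v 0) φ) hr (M := M) ?_ ?_ ?_
  · intro v _
    exact (hS.differentiableOn_R hC _ φ).mono (hsub.trans hrd)
  · intro z hz
    exact (hg.differentiable (hS.RL hC (hrd (hsub hz)) φ)).differentiableOn
  · intro z hz v hv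
    exact (hqR z (hsub hz) _).trans (hM v (hsub hv))

end Standing

/-- The expansion of `λ ↦ e^{λt} R(λ) G(λ)` at an eigenvalue, for `G(λ) = ∑ (z - λ)^m G_m`, and
its residue. -/
theorem IsExpansion.summable_and_residue {z : ℂ} {r : ℝ} {E : ℤ → X →ₗ[ℂ] AntiDual X}
    (hS : S.Standing) (hC : S.UniformlyCompact) (hE : S.IsExpansion z r E) {ρ : ℝ} (hρ : 0 < ρ)
    (hρr : ρ < r) {G : ℕ → X} {Φ : ℂ → ℂ} {ψ : X} (t : ℝ)
    (hG : ∀ p : Seminorm ℂ X, Continuous p → ∃ M, ∀ m, p (G m) ≤ M * ((2 * ρ)⁻¹) ^ m)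
    (hΦ : ∀ w ∈ Metric.sphere z ρ, HasSum (fun m : ℕ => (z - w) ^ m * S.R w (G m) ψ) (Φ w)) :
    Summable (fun j : ℕ => ∑ m ∈ Finset.range (j + 1), (-(t : ℂ)) ^ (j - m) /
      ((j - m).factorial : ℂ) * Complex.exp (z * t) * E (j + 1) (G m) ψ) ∧
    (2 * Real.pi * Complex.I)⁻¹ * (∮ w in C(z, ρ), Complex.exp (w * t) * Φ w) =
      -∑' j : ℕ, ∑ m ∈ Finset.range (j + 1), (-(t : ℂ)) ^ (j - m) /
        ((j - m).factorial : ℂ) * Complex.exp (z * t) * E (j + 1) (G m) ψ := by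
  have hsph : Metric.sphere z ρ ⊆ S.dom \ S.poles :=
    (sphere_subset_punctured_ball hρ hρr).trans hE.subset
  obtain ⟨q, hq, hqR⟩ := hS.exists_seminorm_R_left_le hC (isCompact_sphere z ρ) hsph ψ
  obtain ⟨M, hM⟩ := hG q hq
  set c : ℂ → ℕ → ℂ := fun w m => (z - w) ^ m * S.R w (G m) ψ with hc
  set α : ℂ → ℕ → ℂ := fun w n => ((-t : ℂ) * (z - w)) ^ n / n.factorial with hα
  -- On the circle the factor ρ^m meets the decay (2ρ)^{-m} of the coefficients; this is the source
  -- of the ratio 1/2.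
  set c' : ℕ → ℝ := fun m => M * (1 / 2) ^ m with hc'
  set α' : ℕ → ℝ := fun n => (|t| * ρ) ^ n / n.factorial with hα'
  have hnorm : ∀ w ∈ Metric.sphere z ρ, ‖z - w‖ = ρ := fun w hw => by
    rw [norm_sub_rev, ← mem_sphere_iff_norm]; exact hw
  have hM0 : 0 ≤ M := by simpa using (apply_nonneg q (G 0)).trans (hM 0)
  have hcb : ∀ w ∈ Metric.sphere z ρ, ∀ m, ‖c w m‖ ≤ c' m := fun w hw m => by
    rw [hc, hc']
    simp only [norm_mul, norm_pow, hnorm w hw]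
    calc ρ ^ m * ‖S.R w (G m) ψ‖ ≤ ρ ^ m * (M * ((2 * ρ)⁻¹) ^ m) := by
          gcongr
          exact (hqR w hw _).trans (hM m)
      _ = M * (1 / 2) ^ m := by
          rw [mul_left_comm, ← mul_pow]
          congr 2
          field_simp
  have hαb : ∀ w ∈ Metric.sphere z ρ, ∀ n, ‖α w n‖ = α' n := fun w hw n => by
    rw [hα, hα']
    simp [hnorm w hw]
  have hc's : Summable c' := (summable_geometric_of_lt_one (by norm_num) (by norm_num)).mul_left M
  have hα's : Summable α' := Real.summable_pow_div_factorial _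
  have hc'0 : ∀ m, 0 ≤ c' m := fun m => by positivity
  have hα'0 : ∀ m, 0 ≤ α' m := fun m => by positivity
  set B : ℕ → ℝ := fun j => ∑ m ∈ Finset.range (j + 1), c' m * α' (j - m) with hB
  have hBs : Summable B := by
    have h1 := summable_norm_sum_mul_range_of_summable_norm (f := c') (g := α') hc's.norm hα's.norm
    exact h1.of_norm
  -- The Cauchy product of the resolvent-weighted Taylor series with that of e^{wt} = e^{zt}
  -- e^{-t(z-w)}, grouped by the total power of z - w.
  set b : ℂ → ℕ → ℂ := fun w j => Complex.exp (z * t) *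
    ∑ m ∈ Finset.range (j + 1), c w m * α w (j - m) with hb
  have hbB : ∀ w ∈ Metric.sphere z ρ, ∀ j, ‖b w j‖ ≤ ‖Complex.exp (z * t)‖ * B j := fun w hw j => by
    rw [hb, hB]
    simp only [norm_mul]
    gcongr
    refine (norm_sum_le _ _).trans (Finset.sum_le_sum fun m _ => ?_)
    rw [norm_mul, hαb w hw]
    exact mul_le_mul_of_nonneg_right (hcb w hw m) (hα'0 _)
  have hbsum : ∀ w ∈ Metric.sphere z ρ, HasSum (b w) (Complex.exp (w * t) * Φ w) := fun w hw => by
    have hcn : Summable fun m => ‖c w m‖ := hc's.of_nonneg_of_le (fun _ => norm_nonneg _) (hcb w hw)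
    have hαn : Summable fun m => ‖α w m‖ := by simpa only [hαb w hw] using hα's
    have h1 := (summable_norm_sum_mul_range_of_summable_norm hcn hαn).of_norm.hasSum
    rw [← tsum_mul_tsum_eq_tsum_sum_range_of_summable_norm hcn hαn, (hΦ w hw).tsum_eq,
      (NormedSpace.expSeries_div_hasSum_exp ((-t : ℂ) * (z - w))).tsum_eq,
      ← Complex.exp_eq_exp_ℂ] at h1
    have h2 := h1.mul_left (Complex.exp (z * t))
    have e : Complex.exp (z * t) * (Φ w * Complex.exp ((-t : ℂ) * (z - w))) =
        Complex.exp (w * t) * Φ w := by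
      rw [mul_left_comm, ← Complex.exp_add, mul_comm]
      congr 2
      ring
    rw [e] at h2
    exact h2
  set h : ℕ → X := fun j => ∑ m ∈ Finset.range (j + 1), ((-(t : ℂ)) ^ (j - m) /
      ((j - m).factorial : ℂ) * Complex.exp (z * t)) • G m with hh
  have hbR : ∀ w ∈ Metric.sphere z ρ, ∀ j, b w j = (z - w) ^ (((j : ℤ) + 1) - 1) * S.R w (h j) ψ := by
    intro w hw j
    rw [← hS.RL_apply hC (hsph hw), hh, map_sum, add_sub_cancel_right, zpow_natCast, hb]
    simp only
    rw [Finset.mul_sum, Finset.mul_sum]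
    refine Finset.sum_congr rfl fun m hm => ?_
    have hmj : m ≤ j := Nat.lt_succ_iff.1 (Finset.mem_range.1 hm)
    rw [map_smul, smul_eq_mul, hS.RL_apply hC, hc, hα]
    simp only
    have : (z - w) ^ j = (z - w) ^ m * (z - w) ^ (j - m) := by
      rw [← pow_add, Nat.add_sub_cancel' hmj]
    rw [this, mul_pow]
    ring
  -- The power (z - w)^j picks out the Laurent coefficient of index j + 1. The minus sign is that of
  -- the expansion in powers of z - w instead of w - z.
  have hEt : ∀ j : ℕ, ∑ m ∈ Finset.range (j + 1), (-(t : ℂ)) ^ (j - m) /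
      ((j - m).factorial : ℂ) * Complex.exp (z * t) * E (j + 1) (G m) ψ
      = -((2 * Real.pi * Complex.I)⁻¹ * ∮ w in C(z, ρ), b w j) := by
    intro j
    have h1 : E (j + 1) (h j) ψ = ∑ m ∈ Finset.range (j + 1), (-(t : ℂ)) ^ (j - m) /
        ((j - m).factorial : ℂ) * Complex.exp (z * t) * E (j + 1) (G m) ψ := by
      rw [hh, map_sum, _root_.sum_apply]
      refine Finset.sum_congr rfl fun m _ => ?_
      rw [map_smul, _root_.smul_apply, smul_eq_mul]
    rw [← h1, hE.coeff ρ hρ hρr, laurentCoeff]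
    congr 2
    exact circleIntegral.integral_congr hρ.le fun w hw => (hbR w hw j).symm
  have hcircle : HasSum (fun j => ∮ w in C(z, ρ), b w j)
      (∮ w in C(z, ρ), Complex.exp (w * t) * Φ w) := by
    have hcm : ∀ θ, circleMap z ρ θ ∈ Metric.sphere z ρ := circleMap_mem_sphere z hρ.le
    refine intervalIntegral.hasSum_integral_of_dominated_convergence
      (fun j _ => ρ * (‖Complex.exp (z * t)‖ * B j)) (fun j => ?_)
      (fun j => Eventually.of_forall fun θ _ => ?_)
      (Eventually.of_forall fun θ _ => (hBs.mul_left _).mul_left _) intervalIntegrable_const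
      (Eventually.of_forall fun θ _ =>
        (hbsum _ (hcm θ)).const_smul (deriv (circleMap z ρ) θ))
    · have hcont : ContinuousOn (fun w => b w j) (Metric.sphere z ρ) := by
        refine ContinuousOn.congr ?_ fun w hw => hbR w hw j
        simp only [add_sub_cancel_right, zpow_natCast]
        exact ContinuousOn.mul (by fun_prop)
          ((hS.differentiableOn_R hC _ ψ).continuousOn.mono hsph)
      refine Continuous.aestronglyMeasurable ?_
      have h1 : Continuous fun θ => deriv (circleMap z ρ) θ := by
        simp only [deriv_circleMap]
        fun_prop
      exact h1.smul (hcont.comp_continuous (continuous_circleMap z ρ) hcm)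
    · rw [norm_smul, deriv_circleMap, norm_mul, norm_circleMap_zero, Complex.norm_I, mul_one,
        abs_of_pos hρ]
      exact mul_le_mul_of_nonneg_left (hbB _ (hcm θ) j) hρ.le
  have hfin := (hcircle.mul_left ((2 * Real.pi * Complex.I : ℂ)⁻¹)).neg
  simp only [← hEt] at hfin
  refine ⟨hfin.summable, ?_⟩
  rw [hfin.tsum_eq, neg_neg]

end DelaySystem

namespace DelaySystem

variable {𝓗 X : Type*} [NormedAddCommGroup 𝓗] [InnerProductSpace ℂ 𝓗] [CompleteSpace 𝓗]
  [AddCommGroup X] [Module ℂ X] [UniformSpace X] [IsUniformAddGroup X] [ContinuousSMul ℂ X]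
  [T2Space X] [LocallyConvexSpace ℝ X] [QuasiCompleteSpace ℂ X] [BarrelledSpace ℂ X]
  {S : DelaySystem 𝓗 X} (hS : S.Standing) (hC : S.UniformlyCompact)

namespace IsExpansion

variable {E : ℂ → ℤ → X →ₗ[ℂ] AntiDual X} {z : ℂ} {r : ℝ} (hE : S.IsExpansion z r (E z))
include hS hC hE

theorem summable_and_residue_termF {f : ℝ → 𝓗} {k : ℝ → X} {g : ℂ → ℕ → X}
    (hg : S.IsMoments f k g) {ρ : ℝ} (hρ : 0 < ρ) (hρr : ρ < r) (t : ℝ) (ψ : X) :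
    Summable (termF E g ψ t z) ∧
    (2 * Real.pi * Complex.I)⁻¹ * (∮ w in C(z, ρ), Complex.exp (w * t) * S.R w (g w 0) ψ) =
      -∑' j, termF E g ψ t z j := by
  have hsph : Metric.sphere z ρ ⊆ S.dom \ S.poles :=
    (sphere_subset_punctured_ball hρ hρr).trans hE.subset
  exact hE.summable_and_residue hS hC hρ hρr t
    (fun p hp => hg.exists_seminorm_le z (by positivity) p hp)
    (fun w hw => hg.hasSum (hS.RL hC (hsph hw) ψ) z w)

theorem summable_and_residue_termX (x : X) {ρ : ℝ} (hρ : 0 < ρ) (hρr : ρ < r) (t : ℝ) (ψ : X) :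
    Summable (termX E x ψ t z) ∧
    (2 * Real.pi * Complex.I)⁻¹ * (∮ w in C(z, ρ), Complex.exp (w * t) * S.R w x ψ) =
      -∑' j, termX E x ψ t z j := by
  have hsph : Metric.sphere z ρ ⊆ S.dom \ S.poles :=
    (sphere_subset_punctured_ball hρ hρr).trans hE.subset
  -- The initial value is the case of a constant function, whose Taylor coefficients vanish beyond
  -- index 0.
  have h := hE.summable_and_residue hS hC hρ hρr t (G := Pi.single 0 x) (ψ := ψ)
    (Φ := fun w => S.R w x ψ)
    (fun p _ => ⟨p x, fun m => by
      rcases Nat.eq_zero_or_pos m with rfl | hm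
      · simp
      · rw [Pi.single_eq_of_ne hm.ne', map_zero]
        have := apply_nonneg p x
        positivity⟩)
    (fun w hw => by
      have h0 := hasSum_single (f := fun m : ℕ => (z - w) ^ m *
        S.R w ((Pi.single 0 x : ℕ → X) m) ψ) 0 fun m hm => by
          rw [Pi.single_eq_of_ne hm, ← hS.RL_apply hC (hsph hw), map_zero, mul_zero]
      simpa using h0)
  have e : (fun j : ℕ => ∑ m ∈ Finset.range (j + 1), (-(t : ℂ)) ^ (j - m) /
      ((j - m).factorial : ℂ) * Complex.exp (z * t) *
      E z (j + 1) ((Pi.single 0 x : ℕ → X) m) ψ) = termX E x ψ t z := by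
    funext j
    rw [Finset.sum_eq_single_of_mem 0 (by simp)]
    · simp [termX]
    · intro m _ hm
      rw [Pi.single_eq_of_ne hm, map_zero]
      simp
  rw [e] at h
  exact ⟨h.1, by rw [h.2]⟩

theorem residue_add {f : ℝ → 𝓗} {k : ℝ → X} {g : ℂ → ℕ → X} (hg : S.IsMoments f k g) (x : X)
    {ρ : ℝ} (hρ : 0 < ρ) (hρr : ρ < r) (t : ℝ) (ψ : X) :
    (2 * Real.pi * Complex.I)⁻¹ *
        (∮ w in C(z, ρ), Complex.exp (w * t) * S.R w (x + g w 0) ψ) =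
      -(∑' j, termF E g ψ t z j + ∑' j, termX E x ψ t z j) := by
  have hsph : Metric.sphere z ρ ⊆ S.dom \ S.poles :=
    (sphere_subset_punctured_ball hρ hρr).trans hE.subset
  have hexp : ContinuousOn (fun w : ℂ => Complex.exp (w * t)) (Metric.sphere z ρ) := by fun_prop
  have hx : CircleIntegrable (fun w => Complex.exp (w * t) * S.R w x ψ) z ρ :=
    ContinuousOn.circleIntegrable hρ.le
      (hexp.mul ((hS.differentiableOn_R hC x ψ).continuousOn.mono hsph))
  have hf : CircleIntegrable (fun w => Complex.exp (w * t) * S.R w (g w 0) ψ) z ρ :=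
    ContinuousOn.circleIntegrable hρ.le
      (hexp.mul ((hS.differentiableOn_R_moments hC hg ψ).continuousOn.mono hsph))
  rw [circleIntegral.integral_congr hρ.le (g := fun w => Complex.exp (w * t) * S.R w (g w 0) ψ +
      Complex.exp (w * t) * S.R w x ψ), circleIntegral.integral_add hf hx, mul_add,
    (hE.summable_and_residue_termF hS hC hg hρ hρr t ψ).2,
    (hE.summable_and_residue_termX hS hC x hρ hρr t ψ).2]
  · ring
  · intro w hw
    simp only
    rw [hS.R_add_left hC (hsph hw)]
    ring

end IsExpansion

/-- If the line `Re λ = a > 0` can be deformed inside the sheet, then `I` is nonempty. -/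
theorem nonempty_I_of_isDeformation {c : Contour} {a : ℝ} {Q : Set ℂ} (ha : 0 < a)
    (h : c.IsDeformation a S.dom Q) : S.I.Nonempty := by
  have hcont : ContinuousOn (fun s => (c.lower 0 s).re) (Icc 0 1) :=
    Complex.continuous_re.comp_continuousOn (h.lower_smooth 0).1
  obtain ⟨s, hs, h0⟩ := intermediate_value_Icc' zero_le_one hcont
    (show (0 : ℝ) ∈ Icc _ _ from ⟨by
      simp only [h.lower_end]
      exact (h.left _).le, by
      simp only [h.lower_start, vline_re]
      exact ha.le⟩)
  rcases (h.lower_mem 0 s hs).1 with h1 | h1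
  · exact absurd h0 h1
  · exact ⟨_, h1⟩

/-- Deformation of the contour in the inverse Laplace integral. -/
theorem exists_residue_sum {E : ℂ → ℤ → X →ₗ[ℂ] AntiDual X}
    (hE : ∀ z ∈ S.dom, ∃ r, S.IsExpansion z r (E z)) {c : Contour} {a : ℝ} (ha : ‖S.K‖ < a)
    (hS : S.Standing) (hC : S.UniformlyCompact)
    (h : c.IsDeformation a S.dom S.poles) {f : ℝ → 𝓗} {k : ℝ → X} {g : ℂ → ℕ → X}
    (hg : S.IsMoments f k g) (x : X) (t : ℝ) (ψ : X) (n : ℕ) :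
    ∃ Λ : Finset ℂ, (Λ : Set ℂ) = c.enclosed a S.poles n ∧
      (∀ F : ℂ → ℂ, F = (fun z => Complex.exp (z * t) * S.R z (x + g z 0) ψ) →
        (2 * Real.pi * Complex.I)⁻¹ * lineInt F (vline a) (-c.b n) (c.b n) =
          (2 * Real.pi * Complex.I)⁻¹ * (c.mainInt F n + c.arcInt F n) -
          ∑ z ∈ Λ, (∑' j, termF E g ψ t z j + ∑' j, termX E x ψ t z j)) ∧
      (∀ F : ℂ → ℂ, F = (fun z => Complex.exp (z * t) * S.R z x ψ) →
        (2 * Real.pi * Complex.I)⁻¹ * lineInt F (vline a) (-c.b n) (c.b n) =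
          (2 * Real.pi * Complex.I)⁻¹ * (c.mainInt F n + c.arcInt F n) -
          ∑ z ∈ Λ, ∑' j, termX E x ψ t z j) := by
  have ha0 : 0 < a := (norm_nonneg _).trans_lt ha
  obtain ⟨ω₀, hω₀⟩ := nonempty_I_of_isDeformation ha0 h
  -- Any point iω₀ of the cut is a star centre of the sheet; one exists because the connecting arc
  -- must cross the imaginary axis inside iI.
  obtain ⟨Λ, hΛ, hres⟩ := h.residue_theorem n (o := ω₀ * Complex.I) hS.isOpen_dom
    (fun w hw t ht => hS.star_dom hω₀ hw ht)
    (fun s => hS.mem_dom_diff_poles (by simpa using ha)) (fun D => hS.finite_inter_poles hC)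
  have hexp : DifferentiableOn ℂ (fun w : ℂ => Complex.exp (w * t)) (S.dom \ S.poles) := by
    fun_prop
  refine ⟨Λ, hΛ, ?_, ?_⟩
  · rintro F rfl
    rw [hres _ (fun z => -(∑' j, termF E g ψ t z j + ∑' j, termX E x ψ t z j)),
      Finset.sum_neg_distrib, sub_eq_add_neg]
    · refine hexp.mul (((hS.differentiableOn_R hC x ψ).add
        (hS.differentiableOn_R_moments hC hg ψ)).congr fun z hz => ?_)
      exact hS.R_add_left hC hz _ _ _
    · intro z hz
      obtain ⟨r, hr⟩ := hE z hz.1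
      exact ⟨r / 2, r, half_pos hr.pos, half_lt_self hr.pos, hr.subset,
        (hr.residue_add hS hC hg x (half_pos hr.pos) (half_lt_self hr.pos) t ψ).symm⟩
  · rintro F rfl
    rw [hres _ (fun z => -∑' j, termX E x ψ t z j), Finset.sum_neg_distrib, sub_eq_add_neg]
    · exact hexp.mul (hS.differentiableOn_R hC x ψ)
    · intro z hz
      obtain ⟨r, hr⟩ := hE z hz.1
      exact ⟨r / 2, r, half_pos hr.pos, half_lt_self hr.pos, hr.subset,
        (hr.summable_and_residue_termX hS hC x (half_pos hr.pos) (half_lt_self hr.pos) t ψ).2.symm⟩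

end DelaySystem

end

/-! ### The theorem -/

theorem corollary3 {𝓗 X : Type*} [NormedAddCommGroup 𝓗] [InnerProductSpace ℂ 𝓗] [CompleteSpace 𝓗]
    [AddCommGroup X] [Module ℂ X] [UniformSpace X] [IsUniformAddGroup X] [ContinuousSMul ℂ X]
    [T2Space X] [LocallyConvexSpace ℝ X] [QuasiCompleteSpace ℂ X] [BarrelledSpace ℂ X]
    (S : DelaySystem 𝓗 X) (hS : S.Standing) (hC : S.UniformlyCompact) :
    -- off the generalized eigenvalues the resolvent exists and is holomorphic
    (∀ z ∈ S.dom \ S.poles, Function.Bijective (S.oneSub z)) ∧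
    (∀ y φ : X, DifferentiableOn ℂ (fun z => S.R z y φ) (S.dom \ S.poles)) ∧
    -- the generalized eigenvalues are isolated
    (∀ D : Set ℂ, IsCompact D → D ⊆ S.dom → (D ∩ S.poles).Finite) ∧
    -- the Laurent coefficients of the resolvent at the generalized eigenvalues
    ∃ E : ℂ → ℤ → X →ₗ[ℂ] AntiDual X, (∀ z ∈ S.poles, S.IsLaurent z (E z)) ∧
    ∃ a₀ : ℝ, (∀ z ∈ S.poles, z.re ≤ a₀) ∧
    ∀ (a : ℝ), a₀ < a → 0 < a →
    ∀ (x : X) (f u : ℝ → 𝓗), S.IsHistory f → S.IsMildSolution (S.ι x) f u →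
    ∃ g : ℂ → ℕ → X, (∀ z m, S.ι (g z m) = S.delayRes z (m + 1) f) ∧
    ∀ (t : ℝ), 0 < t → ∀ ψ : X,
    ∀ F Fx : ℂ → ℂ, F = (fun z => Complex.exp (z * t) * S.R z (x + g z 0) ψ) →
      Fx = (fun z => Complex.exp (z * t) * S.R z x ψ) →
    (∀ z ∈ S.poles, Summable (DelaySystem.termF E g ψ t z) ∧
      Summable (DelaySystem.termX E x ψ t z)) ∧
    -- inverse Laplace formula
    Tendsto (fun b : ℝ => (2 * Real.pi * Complex.I)⁻¹ * lineInt F (vline a) (-b) b) atTop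
      (𝓝 (inner ℂ (S.ι ψ) (u t))) ∧
    ∀ c : Contour, c.IsDeformation a S.dom S.poles →
    ∃ Λ : ℕ → Finset ℂ, (∀ n, (Λ n : Set ℂ) = c.enclosed a S.poles n) ∧
    -- the deformed integrals, connecting arcs included
    (∀ n, (2 * Real.pi * Complex.I)⁻¹ * lineInt F (vline a) (-c.b n) (c.b n) =
      (2 * Real.pi * Complex.I)⁻¹ * (c.mainInt F n + c.arcInt F n)
        - ∑ z ∈ Λ n, ∑' j, DelaySystem.termF E g ψ t z j
        - ∑ z ∈ Λ n, ∑' j, DelaySystem.termX E x ψ t z j) ∧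
    -- the expansion, when the connecting arcs contribute nothing in the limit
    ∀ J : ℂ, Tendsto (c.arcInt F) atTop (𝓝 0) → Tendsto (c.mainInt F) atTop (𝓝 J) →
    (∃ σ : ℂ, Tendsto (fun n => ∑ z ∈ Λ n, (∑' j, DelaySystem.termF E g ψ t z j
        + ∑' j, DelaySystem.termX E x ψ t z j)) atTop (𝓝 σ) ∧
      inner ℂ (S.ι ψ) (u t) = (2 * Real.pi * Complex.I)⁻¹ * J - σ) ∧
    ∀ Jx : ℂ, Tendsto (c.arcInt Fx) atTop (𝓝 0) → Tendsto (c.mainInt Fx) atTop (𝓝 Jx) →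
    ∃ σf σx : ℂ,
      Tendsto (fun n => ∑ z ∈ Λ n, ∑' j, DelaySystem.termF E g ψ t z j) atTop (𝓝 σf) ∧
      Tendsto (fun n => ∑ z ∈ Λ n, ∑' j, DelaySystem.termX E x ψ t z j) atTop (𝓝 σx) ∧
      inner ℂ (S.ι ψ) (u t) = (2 * Real.pi * Complex.I)⁻¹ * J - σf - σx := by
  classical
  choose! r E₀ hE₀ using fun z (hz : z ∈ S.dom) => hS.exists_isExpansion hC hz
  refine ⟨fun z hz => hS.bijective_oneSub hC hz, hS.differentiableOn_R hC,
    fun D => hS.finite_inter_poles hC, E₀, fun z hz => (hE₀ z hz.1).isLaurent hS hC,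
    -- ‖K‖ serves as the abscissa for both purposes: it bounds the real parts of the eigenvalues and
    -- the growth rate of the solution.
    ‖S.K‖, fun z hz => hS.re_le_of_mem_poles hz, ?_⟩
  intro a ha _ x f u hf hu
  obtain ⟨k, g, hg⟩ := hf.exists_moments
  refine ⟨g, hg.ι_eq hS hf.memLp, ?_⟩
  intro t ht ψ F Fx hF hFx
  have hlim : Tendsto (fun b : ℝ => (2 * Real.pi * Complex.I)⁻¹ * lineInt F (vline a) (-b) b)
      atTop (𝓝 (inner ℂ (S.ι ψ) (u t))) := by
    rw [hF]
    exact hu.tendsto_lineInt hS hC hf.memLp ha (hg.ι_zero hS hf.memLp) ht ψ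
  obtain ⟨L, hL⟩ := hS.exists_tendsto_lineInt hC ha ht x ψ
  rw [← hFx] at hL
  refine ⟨fun z hz => ?_, hlim, fun c hc => ?_⟩
  · have hz := hE₀ z hz.1
    exact ⟨(hz.summable_and_residue_termF hS hC hg (half_pos hz.pos) (half_lt_self hz.pos) t ψ).1,
      (hz.summable_and_residue_termX hS hC x (half_pos hz.pos) (half_lt_self hz.pos) t ψ).1⟩
  choose Λ hΛ h1 h2 using DelaySystem.exists_residue_sum (fun z hz => ⟨r z, hE₀ z hz⟩) ha hS hC hc hg
    x t ψ
  have hFs : ∀ n, ∑ z ∈ Λ n, (∑' j, DelaySystem.termF E₀ g ψ t z j +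
      ∑' j, DelaySystem.termX E₀ x ψ t z j) =
      (2 * Real.pi * Complex.I)⁻¹ * (c.mainInt F n + c.arcInt F n) -
        (2 * Real.pi * Complex.I)⁻¹ * lineInt F (vline a) (-c.b n) (c.b n) := fun n => by
    rw [h1 n F hF]
    ring
  have hXs : ∀ n, ∑ z ∈ Λ n, ∑' j, DelaySystem.termX E₀ x ψ t z j =
      (2 * Real.pi * Complex.I)⁻¹ * (c.mainInt Fx n + c.arcInt Fx n) -
        (2 * Real.pi * Complex.I)⁻¹ * lineInt Fx (vline a) (-c.b n) (c.b n) := fun n => by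
    rw [h2 n Fx hFx]
    ring
  refine ⟨Λ, hΛ, fun n => ?_, fun J harc hmain => ?_⟩
  · rw [h1 n F hF, Finset.sum_add_distrib]
    ring
  have hσ : Tendsto (fun n => ∑ z ∈ Λ n, (∑' j, DelaySystem.termF E₀ g ψ t z j +
      ∑' j, DelaySystem.termX E₀ x ψ t z j)) atTop
      (𝓝 ((2 * Real.pi * Complex.I)⁻¹ * J - inner ℂ (S.ι ψ) (u t))) := by
    simp only [hFs]
    have := ((hmain.add harc).const_mul (2 * Real.pi * Complex.I : ℂ)⁻¹).sub (hlim.comp hc.b_lim)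
    rwa [add_zero] at this
  refine ⟨⟨_, hσ, by ring⟩, fun Jx harcx hmainx => ?_⟩
  -- The integral with the initial value alone has some limit `L` on the vertical line. Its value is
  -- irrelevant, since the history sums are obtained by subtraction.
  have hσx : Tendsto (fun n => ∑ z ∈ Λ n, ∑' j, DelaySystem.termX E₀ x ψ t z j) atTop
      (𝓝 ((2 * Real.pi * Complex.I)⁻¹ * Jx - L)) := by
    simp only [hXs]
    have := ((hmainx.add harcx).const_mul (2 * Real.pi * Complex.I : ℂ)⁻¹).sub (hL.comp hc.b_lim)
    rwa [add_zero] at this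
  have hσf := hσ.sub hσx
  simp only [← Finset.sum_sub_distrib, add_sub_cancel_right] at hσf
  exact ⟨_, _, hσf, hσx, by ring⟩
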